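/- Let $f,g\colon[0,1]\to\mathbb{R}_{\ge 0}$ be piecewise $C^1$ functions (finitely many pieces, on each of which the function extends to a $C^1$ function on the closed piece; jumps are allowed) with $f(s)>0$ and $g(s)\ge 0$ for all $s$, and let $c\ge 0$. For $n,k\ge1$ put $x_i=f(i/n)$ $(1\le i\le n)$, $y_j=g(j/k)$ $(1\le j\le k)$, and for half-integers $m,m'\in\mathbb{Z}+\frac12$ let $$\mathcal{K}(m,m')=\oint\oint_{|w|<|z|}\frac{dz}{2\pi \mathrm{i} z}\frac{dw}{2\pi \mathrm{i} w}\,\frac{K(z)}{K(w)}\,z^{-m}w^{m'}\frac{\sqrt{zw}}{z-w},\qquad K(z)=\prod_{i=1}^n\frac1{1-x_iz}\prod_{j=1}^k\frac1{1+y_j/z},$$ where the $w$-contour encircles $0$ and the $z$-contour encircles the $w$-contour and all $-y_j$, but no $x_i^{-1}$; this is the correlation kernel of the probability measure on Young diagrams $\lambda\subseteq k^n$ proportional to $s_\lambda(x)s_{\lambda'}(y)$. Suppose that the roots in $\mathbb{R}\sqcup\{\infty\}$ of $$\int_0^1\frac{f(s)}{(1-f(s)z)^2}\,ds-c\int_0^1\frac{g(s)}{(z+g(s))^2}\,ds=0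 \tag{1}$$ are $z^{(1)},\dots,z^{(m)}$. (A real number is a root only if both integrals exist; where $g(s)=0$ the second integrand is read as $0$. The point $\infty$ is a root if the coefficient of $z^{-2}$ at infinity vanishes, i.e. $\int_0^1 ds/f(s)=c\int_0^1 g(s)\,ds$.) Put $$t^{(i)}=\int_0^1\frac{f(s)z^{(i)}}{1-f(s)z^{(i)}}\,ds+c\int_0^1\frac{g(s)}{z^{(i)}+g(s)}\,ds$$ (which is $-1$ for $z^{(i)}=\infty$), label the roots so that $t^{(1)}\le\dots\le t^{(m)}$, and put $t^{(0)}=-1$, $t^{(m+1)}=c$. Then $t^{(0)}\le t^{(1)}\le\dots\le t^{(m+1)}$, and for every $a=0,\dots,m$ the equation $$\int_0^1\frac{f(s)z}{1-f(s)z}\,ds+c\int_0^1\frac{g(s)}{z+g(s)}\,ds-t=0 \tag{2}$$ either has, for all $t\in(t^{(a)},t^{(a+1)})$, exactly one pair of nonreal roots $z_1(t)$, $\overline{z_1(t)}$, $\operatorname{Im}z_1(t)>0$, or has no nonreal roots for all $t\in(t^{(a)},t^{(a+1)})$. Suppose that $t^{(a)}<t^{(a+1)}$ and that the first alternative holds (a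 support interval). Then $z_1(t)$ is continuous on $(t^{(a)},t^{(a+1)})$ and extends continuously to $[t^{(a)},t^{(a+1)}]$ with values in $\mathbb{C}\sqcup\{\infty\}$, its value at an endpoint $t$ being a root $z^{(i)}$ of (1) with $t^{(i)}=t$. For every $t\in[t^{(a)},t^{(a+1)}]$ with $z_1(t)\ne0,\infty$ (this holds for all interior $t$) and all integers $l,l'$, as $n,k\to\infty$ with $k/n\to c$, $$\lim\ |z_1(t)|^{\,l-l'}\,\mathcal{K}(nt+l,nt+l')=\begin{cases}\dfrac{\sin\bigl(\pi\rho(t)(l-l')\bigr)}{\pi(l-l')}& l\ne l',\\[2mm] \rho(t)& l=l',\end{cases}\qquad \rho(t)=\frac1\pi\arg z_1(t),$$ where $nt$ stands for the half-integer $\lfloor nt\rfloor+\frac12$. -/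

import Mathlib

open Set Filter Topology MeasureTheory

namespace SkewHowe

noncomputable section

/-- `f` is piecewise continuously differentiable on `[0, 1]`: there is a finite partition of
`[0, 1]` such that on each open piece `f` coincides with a function that is `C¹` on the closed
piece. Jumps at the partition points, with arbitrary values there, are allowed. -/
def PiecewiseC1 (f : ℝ → ℝ) : Prop :=
  ∃ (N : ℕ) (s : Fin (N + 1) → ℝ), StrictMono s ∧ s 0 = 0 ∧ s (Fin.last N) = 1 ∧
    ∀ i : Fin N, ∃ φ : ℝ → ℝ,
      ContDiffOn ℝ 1 φ (Icc (s i.castSucc) (s i.succ)) ∧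
      EqOn f φ (Ioo (s i.castSucc) (s i.succ))

/-- The finite real roots `w` of
`∫₀¹ f / (1 - f w)² ds - c ∫₀¹ g / (w + g)² ds = 0`, where both integrals have to exist: the
denominators do not vanish on a set of positive measure and the integrands are integrable.
Where `g` vanishes, the second integrand is identically zero as a function of `w`, and it is
taken to be zero also at `w = 0`. -/
def IsRealDoubleRoot (f g : ℝ → ℝ) (c w : ℝ) : Prop :=
  (∀ᵐ s ∂(volume.restrict (Icc (0 : ℝ) 1)),
    1 - f s * w ≠ 0 ∧ (g s = 0 ∨ w + g s ≠ 0)) ∧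
  IntegrableOn (fun s => f s / (1 - f s * w) ^ 2) (Icc 0 1) ∧
  IntegrableOn (fun s => g s / (w + g s) ^ 2) (Icc 0 1) ∧
  (∫ s in (0 : ℝ)..1, f s / (1 - f s * w) ^ 2) -
    c * (∫ s in (0 : ℝ)..1, g s / (w + g s) ^ 2) = 0

/-- The point `∞` is a root of the same equation: the coefficient of `w⁻²` in the expansion of
its left-hand side at infinity vanishes. -/
def IsInftyDoubleRoot (f g : ℝ → ℝ) (c : ℝ) : Prop :=
  IntegrableOn (fun s => (f s)⁻¹) (Icc 0 1) ∧
  (∫ s in (0 : ℝ)..1, (f s)⁻¹) - c * (∫ s in (0 : ℝ)..1, g s) = 0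

/-- The roots in `ℝ ⊔ {∞}`. -/
def IsDoubleRoot (f g : ℝ → ℝ) (c : ℝ) (w : OnePoint ℝ) : Prop :=
  w.elim (IsInftyDoubleRoot f g c) (IsRealDoubleRoot f g c)

/-- The critical value `t = ∫₀¹ f w / (1 - f w) ds + c ∫₀¹ g / (w + g) ds` of a root `w`; at
`w = ∞` it is the limiting value `-1`. -/
def criticalValue (f g : ℝ → ℝ) (c : ℝ) (w : OnePoint ℝ) : ℝ :=
  w.elim (-1) fun w =>
    (∫ s in (0 : ℝ)..1, f s * w / (1 - f s * w)) + c * (∫ s in (0 : ℝ)..1, g s / (w + g s))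

/-- The critical point equation
`∫₀¹ f z / (1 - f z) ds + c ∫₀¹ g / (z + g) ds - t = 0` for a complex number `z`. -/
def CriticalPointEq (f g : ℝ → ℝ) (c t : ℝ) (z : ℂ) : Prop :=
  (∫ s in (0 : ℝ)..1, (f s : ℂ) * z / (1 - (f s : ℂ) * z)) +
    (c : ℂ) * (∫ s in (0 : ℝ)..1, (g s : ℂ) / (z + (g s : ℂ))) - (t : ℂ) = 0

/-- The nonreal roots of the critical point equation are exactly `z₁` and its conjugate, for
some `z₁` in the open upper half-plane. -/
def HasConjugatePair (f g : ℝ → ℝ) (c t : ℝ) : Prop :=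
  ∃ z₁ : ℂ, 0 < z₁.im ∧ ∀ z : ℂ, z.im ≠ 0 →
    (CriticalPointEq f g c t z ↔ z = z₁ ∨ z = (starRingEnd ℂ) z₁)

/-- The critical point equation has no nonreal root. -/
def HasOnlyRealRoots (f g : ℝ → ℝ) (c t : ℝ) : Prop :=
  ∀ z : ℂ, CriticalPointEq f g c t z → z.im = 0

/-- `K(z) = ∏ᵢ 1 / (1 - xᵢ z) ∏ⱼ 1 / (1 + yⱼ / z)`. -/
def genFun {n k : ℕ} (x : Fin n → ℝ) (y : Fin k → ℝ) (z : ℂ) : ℂ :=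
  (∏ i, (1 - (x i : ℂ) * z)⁻¹) * ∏ j, (1 + (y j : ℂ) / z)⁻¹

/-- Integration contours for the correlation kernel: `w` runs through the circle of radius `r`
about `0`, and `z` through a circle that encircles the `w`-contour and all `-yⱼ` but no `xᵢ⁻¹`,
with `|w| < |z|` on the contours. -/
structure Contours {n k : ℕ} (x : Fin n → ℝ) (y : Fin k → ℝ) where
  center : ℂ
  radius : ℝ
  r : ℝ
  r_pos : 0 < r
  zero_mem : (0 : ℂ) ∈ Metric.ball center radius
  lt_norm : ∀ z ∈ Metric.sphere center radius, r < ‖z‖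
  neg_y_mem : ∀ j, (-(y j : ℂ)) ∈ Metric.ball center radius
  inv_x_notMem : ∀ i, ((x i : ℂ))⁻¹ ∉ Metric.closedBall center radius

/-- The correlation kernel `𝒦(m, m')` at the half-integers `m = p + 1/2`, `m' = p' + 1/2`,
`𝒦(m, m') = ∮∮ dz/(2πi z) dw/(2πi w) K(z)/K(w) z^(-m) w^(m') √(zw)/(z-w)`;
for half-integers `√(zw) z^(-m) w^(m') / (z w) = z^(-p-1) w^(p')`. -/
def corrKernel {n k : ℕ} (x : Fin n → ℝ) (y : Fin k → ℝ) (Γ : Contours x y) (p p' : ℤ) : ℂ :=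
  ((2 * (Real.pi : ℂ) * Complex.I) ^ 2)⁻¹ *
    ∮ z in C(Γ.center, Γ.radius), ∮ w in C(0, Γ.r),
      genFun x y z / genFun x y w * z ^ (-p - 1) * w ^ p' / (z - w)

/-- Admissible contours exist for all positive `xᵢ` and nonnegative `yⱼ`. -/
theorem nonempty_contours {n k : ℕ} (x : Fin n → ℝ) (y : Fin k → ℝ)
    (hx : ∀ i, 0 < x i) (hy : ∀ j, 0 ≤ y j) : Nonempty (Contours x y) := by
  have hX : 0 ≤ ∑ i, x i := Finset.sum_nonneg fun i _ => (hx i).le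
  have hY : 0 ≤ ∑ j, y j := Finset.sum_nonneg fun j _ => hy j
  obtain ⟨d, hd0, hd⟩ : ∃ d : ℝ, 0 < d ∧ ∀ i, d < (x i)⁻¹ := by
    refine ⟨(1 + ∑ i, x i)⁻¹, by positivity, fun i => ?_⟩
    have h : x i ≤ ∑ i, x i := Finset.single_le_sum (fun i _ => (hx i).le) (Finset.mem_univ i)
    exact (inv_lt_inv₀ (by linarith) (hx i)).2 (by linarith)
  obtain ⟨R, hR0, hR⟩ : ∃ R : ℝ, 0 ≤ R ∧ ∀ j, y j ≤ R :=
    ⟨∑ j, y j, hY, fun j => Finset.single_le_sum (fun j _ => hy j) (Finset.mem_univ j)⟩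
  have hn : ∀ a : ℝ, ‖((a : ℝ) : ℂ) - ((-R : ℝ) : ℂ)‖ = |a + R| := fun a => by
    rw [← Complex.ofReal_sub, Complex.norm_real, Real.norm_eq_abs, sub_neg_eq_add]
  refine ⟨⟨((-R : ℝ) : ℂ), R + d, d / 2, by linarith, ?_, ?_, ?_, ?_⟩⟩
  · have := hn 0
    rw [mem_ball_iff_norm, ← Complex.ofReal_zero, this, zero_add, abs_of_nonneg hR0]
    linarith
  · intro z hz
    rw [mem_sphere_iff_norm] at hz
    have h1 : ‖z - ((-R : ℝ) : ℂ)‖ ≤ ‖z‖ + ‖((-R : ℝ) : ℂ)‖ := norm_sub_le _ _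
    rw [Complex.norm_real, Real.norm_eq_abs, abs_neg, abs_of_nonneg hR0] at h1
    linarith
  · intro j
    have := hn (-(y j))
    rw [Complex.ofReal_neg] at this
    rw [mem_ball_iff_norm, this, abs_of_nonneg (by linarith [hR j])]
    linarith [hy j]
  · intro i
    have := hn (x i)⁻¹
    rw [Complex.ofReal_inv] at this
    have hi := hd i
    rw [mem_closedBall_iff_norm, this, abs_of_nonneg (by linarith)]
    linarith

/-- The parameters `xᵢ = f(i/n)`, `i = 1, …, n`. -/
def specialize (f : ℝ → ℝ) (n : ℕ) (i : Fin n) : ℝ := f (((i : ℝ) + 1) / n)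

/-- The discrete sine kernel of density `ρ`. -/
def discreteSine (ρ : ℝ) (l l' : ℤ) : ℝ :=
  if l = l' then ρ else Real.sin (Real.pi * ρ * ((l : ℝ) - l')) / (Real.pi * ((l : ℝ) - l'))

/-- For all `n, k → ∞` with `k / n → c`, all contours and all integers `l, l'`,
`|ζ|^(l - l') 𝒦(nt + l, nt + l')` converges to the discrete sine kernel of density
`arg ζ / π`. Here `nt` stands for the half-integer `⌊nt⌋ + 1/2`. -/
def KernelConverges (f g : ℝ → ℝ) (c t : ℝ) (ζ : ℂ) : Prop :=
  ∀ n k : ℕ → ℕ, Tendsto n atTop atTop → Tendsto k atTop atTop →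
    Tendsto (fun j => (k j : ℝ) / (n j : ℝ)) atTop (𝓝 c) →
    ∀ (Γ : ∀ j, Contours (specialize f (n j)) (specialize g (k j))) (l l' : ℤ),
      Tendsto
        (fun j => ((‖ζ‖ ^ (l - l') : ℝ) : ℂ) *
          corrKernel (specialize f (n j)) (specialize g (k j)) (Γ j)
            (⌊(n j : ℝ) * t⌋ + l) (⌊(n j : ℝ) * t⌋ + l'))
        atTop (𝓝 ((discreteSine (ζ.arg / Real.pi) l l' : ℝ) : ℂ))

end

end SkewHowe

namespace SkewHowe

noncomputable section

open scoped Real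
open Real (add_one_le_exp arccos arccos_le_pi arccos_nonneg cos cos_le_cos_of_nonneg_of_le_pi
  cos_two_pi_sub dist_eq exp exp_add exp_injective exp_le_exp exp_le_one_iff exp_log exp_lt_exp
  exp_mul exp_nat_mul exp_neg exp_pos exp_sub le_sqrt_of_sq_le log log_le_log log_mul log_pow
  norm_eq_abs one_le_exp pi_pos rpow_intCast sin sin_le_sin_of_le_of_le_pi_div_two
  sin_pos_of_mem_Ioo sin_pos_of_pos_of_lt_pi sin_sq_add_cos_sq sq_sqrt sqrt sqrt_eq_rpow
  sqrt_le_sqrt sqrt_mul sqrt_nonneg sqrt_pos sqrt_sq volume_Icc)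
open Complex (I I_im I_re I_sq add_im add_re
  circleIntegral_eq_zero_of_differentiable_on_off_countable conj_im conj_re continuous_exp
  continuous_im continuous_normSq continuous_ofReal continuous_re differentiableAt_exp exp_im
  exp_ne_zero exp_periodic exp_pi_mul_I exp_re inv_re isOpen_slitPlane mul_im mul_re neg_re
  normSq normSq_apply normSq_eq_zero norm_I norm_exp norm_real ofReal_exp ofReal_im
  ofReal_mem_slitPlane ofReal_ne_zero ofReal_neg ofReal_re ofReal_sub re_add_im slitPlane sq_norm
  sub_im sub_re zero_im zero_re)
open Finset (card_univ mem_filter mul_sum prod_const prod_inv_distrib prod_mul_distrib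
  prod_ne_zero_iff single_le_sum sum_add_distrib sum_add_sum_compl sum_congr sum_const sum_div
  sum_filter sum_le_sum sum_mul sum_neg_distrib sum_nonneg sum_range_succ sum_sub_distrib)
open Metric (ball ball_subset_closedBall closedBall continuousAt_iff mem_ball mem_sphere
  pos_of_mem_ball sphere sphere_subset_closedBall)
open Fintype (card card_fin card_sum)

section

/-- The squared distance `|X - z|²` between a real number `X` and `z = r (a + i √(1 - a²))`. -/
def sqDist (X r a : ℝ) : ℝ := X ^ 2 - 2 * X * r * a + r ^ 2

/-- `∑ Re (Xᵢ / (Xᵢ - z))` at `z = r (a + i √(1 - a²))`. -/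
def sumRe {ι : Type*} [Fintype ι] (X : ι → ℝ) (r a : ℝ) : ℝ :=
  ∑ i, X i * (X i - r * a) / sqDist (X i) r a

/-- `∑ Xᵢ / |Xᵢ - z|²` at `z = r (a + i √(1 - a²))`. -/
def sumSlope {ι : Type*} [Fintype ι] (X : ι → ℝ) (r a : ℝ) : ℝ :=
  ∑ i, X i / sqDist (X i) r a

/-- The logarithmic potential `s log |z| - ∑ log |Xᵢ - z|` at `z = e^ξ (a + i √(1 - a²))`. -/
def logPot {ι : Type*} [Fintype ι] (s : ℝ) (X : ι → ℝ) (ξ a : ℝ) : ℝ :=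
  s * ξ - (∑ i, log (sqDist (X i) (exp ξ) a)) / 2

theorem sqDist_eq (X r a : ℝ) : sqDist X r a = (X - r * a) ^ 2 + r ^ 2 * (1 - a ^ 2) := by
  unfold sqDist; ring

theorem sqDist_pos {X r a : ℝ} (hr : 0 < r) (ha : |a| < 1) : 0 < sqDist X r a := by
  have h1 : a ^ 2 < 1 := (sq_lt_one_iff_abs_lt_one a).2 ha
  rw [sqDist_eq]
  have : 0 < r ^ 2 * (1 - a ^ 2) := by have := sub_pos.2 h1; positivity
  positivity

theorem sqDist_le {X r a : ℝ} (hr : 0 ≤ r) (ha : |a| ≤ 1) : sqDist X r a ≤ (|X| + r) ^ 2 := by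
  have h : -(X * a) ≤ |X| := by
    calc -(X * a) ≤ |X * a| := neg_le_abs _
      _ = |X| * |a| := abs_mul _ _
      _ ≤ |X| * 1 := by gcongr
      _ = |X| := mul_one _
  unfold sqDist
  nlinarith [sq_abs X, mul_le_mul_of_nonneg_left h hr]

/-- The identity behind the uniqueness of nonreal critical points, in terms of `x = Re z`,
`ρ = |z|²`, `x' = Re w`, `ρ' = |w|²`. -/
theorem two_point_identity (X x ρ x' ρ' : ℝ) (h : X ^ 2 - 2 * X * x + ρ ≠ 0)
    (h' : X ^ 2 - 2 * X * x' + ρ' ≠ 0) :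
    X ^ 2 * (4 * (ρ' * x ^ 2 + ρ * x' ^ 2) - 4 * (ρ + ρ') * (x * x') + (ρ - ρ') ^ 2) /
      ((X ^ 2 - 2 * X * x + ρ) * (X ^ 2 - 2 * X * x' + ρ')) =
    (X * (X - x') / (X ^ 2 - 2 * X * x' + ρ') - X * (X - x) / (X ^ 2 - 2 * X * x + ρ)) *
      (ρ - ρ') + X / (X ^ 2 - 2 * X * x + ρ) * (x * (ρ + ρ') - 2 * ρ * x') +
      X / (X ^ 2 - 2 * X * x' + ρ') * (x' * (ρ + ρ') - 2 * ρ' * x) := by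
  obtain ⟨d, hd⟩ : ∃ d, d = X ^ 2 - 2 * X * x + ρ := ⟨_, rfl⟩
  obtain ⟨d', hd'⟩ : ∃ d', d' = X ^ 2 - 2 * X * x' + ρ' := ⟨_, rfl⟩
  rw [← hd] at h ⊢
  rw [← hd'] at h' ⊢
  obtain rfl : ρ = d - X ^ 2 + 2 * X * x := by linarith
  obtain rfl : ρ' = d' - X ^ 2 + 2 * X * x' := by linarith
  clear hd hd'
  field_simp
  ring

theorem pow_four_le_two_point {r r' a a' : ℝ} (hr : 0 ≤ r) (hr' : 0 ≤ r') (ha : |a| ≤ 1)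
    (ha' : |a'| ≤ 1) :
    (r - r') ^ 4 ≤ 4 * (r' ^ 2 * (r * a) ^ 2 + r ^ 2 * (r' * a') ^ 2) -
      4 * (r ^ 2 + r' ^ 2) * ((r * a) * (r' * a')) + (r ^ 2 - r' ^ 2) ^ 2 := by
  have h1 : a * a' ≤ 1 := by
    calc a * a' ≤ |a * a'| := le_abs_self _
      _ = |a| * |a'| := abs_mul _ _
      _ ≤ 1 := mul_le_one₀ ha (abs_nonneg _) ha'
  have h2 : 0 ≤ r * r' * (r - r') ^ 2 * (1 - a * a') := by
    have := sub_nonneg.2 h1; positivity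
  nlinarith [sq_nonneg (r * r' * (a - a'))]

variable {ι : Type*} [Fintype ι]

/-- Monotonicity of `sumRe` along points satisfying the variational inequality for `sumSlope`. -/
theorem two_point_inequality (X : ι → ℝ) {r r' a a' : ℝ} (hr : 0 < r) (hr' : 0 < r')
    (ha : |a| < 1) (ha' : |a'| < 1)
    (h1 : a * sumSlope X r a ≤ 0) (h2 : 0 ≤ sumSlope X r a * (a' - a))
    (h1' : a' * sumSlope X r' a' ≤ 0) (h2' : 0 ≤ sumSlope X r' a' * (a - a')) :
    (r - r') ^ 4 * ∑ i, X i ^ 2 / ((|X i| + r) ^ 2 * (|X i| + r') ^ 2) ≤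
      (sumRe X r' a' - sumRe X r a) * (r ^ 2 - r' ^ 2) := by
  set E : ℝ := 4 * (r' ^ 2 * (r * a) ^ 2 + r ^ 2 * (r' * a') ^ 2) -
      4 * (r ^ 2 + r' ^ 2) * ((r * a) * (r' * a')) + (r ^ 2 - r' ^ 2) ^ 2 with hE
  have hE4 : (r - r') ^ 4 ≤ E := pow_four_le_two_point hr.le hr'.le ha.le ha'.le
  have hsum : ∑ i, X i ^ 2 * E / (sqDist (X i) r a * sqDist (X i) r' a') =
      (sumRe X r' a' - sumRe X r a) * (r ^ 2 - r' ^ 2) +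
      sumSlope X r a * ((r * a) * (r ^ 2 + r' ^ 2) - 2 * r ^ 2 * (r' * a')) +
      sumSlope X r' a' * ((r' * a') * (r ^ 2 + r' ^ 2) - 2 * r' ^ 2 * (r * a)) := by
    unfold sumRe sumSlope
    rw [← sum_sub_distrib, sum_mul, sum_mul, sum_mul,
      ← sum_add_distrib, ← sum_add_distrib]
    refine sum_congr rfl fun i _ => ?_
    have p1 := (sqDist_pos (X := X i) hr ha).ne'
    have p2 := (sqDist_pos (X := X i) hr' ha').ne'
    have := two_point_identity (X i) (r * a) (r ^ 2) (r' * a') (r' ^ 2)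
      (by simpa [sqDist, mul_assoc] using p1) (by simpa [sqDist, mul_assoc] using p2)
    rw [hE]
    simpa [sqDist, mul_assoc] using this
  have hB : sumSlope X r a * ((r * a) * (r ^ 2 + r' ^ 2) - 2 * r ^ 2 * (r' * a')) ≤ 0 := by
    have e : sumSlope X r a * ((r * a) * (r ^ 2 + r' ^ 2) - 2 * r ^ 2 * (r' * a')) =
      r * (r - r') ^ 2 * (a * sumSlope X r a) - 2 * r ^ 2 * r' * (sumSlope X r a * (a' - a)) := by
      ring
    rw [e]
    have : r * (r - r') ^ 2 * (a * sumSlope X r a) ≤ 0 :=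
      mul_nonpos_of_nonneg_of_nonpos (by positivity) h1
    have : 0 ≤ 2 * r ^ 2 * r' * (sumSlope X r a * (a' - a)) := by positivity
    linarith
  have hB' : sumSlope X r' a' * ((r' * a') * (r ^ 2 + r' ^ 2) - 2 * r' ^ 2 * (r * a)) ≤ 0 := by
    have e : sumSlope X r' a' * ((r' * a') * (r ^ 2 + r' ^ 2) - 2 * r' ^ 2 * (r * a)) =
      r' * (r - r') ^ 2 * (a' * sumSlope X r' a') -
        2 * r' ^ 2 * r * (sumSlope X r' a' * (a - a')) := by ring
    rw [e]
    have : r' * (r - r') ^ 2 * (a' * sumSlope X r' a') ≤ 0 :=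
      mul_nonpos_of_nonneg_of_nonpos (by positivity) h1'
    have : 0 ≤ 2 * r' ^ 2 * r * (sumSlope X r' a' * (a - a')) := by positivity
    linarith
  have hle : (r - r') ^ 4 * ∑ i, X i ^ 2 / ((|X i| + r) ^ 2 * (|X i| + r') ^ 2) ≤
      ∑ i, X i ^ 2 * E / (sqDist (X i) r a * sqDist (X i) r' a') := by
    rw [mul_sum]
    refine sum_le_sum fun i _ => ?_
    have p1 := (sqDist_pos (X := X i) hr ha)
    have p2 := (sqDist_pos (X := X i) hr' ha')
    have q1 := sqDist_le (X := X i) hr.le ha.le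
    have q2 := sqDist_le (X := X i) hr'.le ha'.le
    rw [← mul_div_assoc, mul_comm]
    have : 0 ≤ E := le_trans (by positivity) hE4
    gcongr
  linarith

theorem sqDist_sub (X r a b : ℝ) : sqDist X r a - sqDist X r b = 2 * X * r * (b - a) := by
  unfold sqDist; ring

/-- `sumSlope` increases in `a` at a definite rate. -/
theorem sumSlope_sub_ge (X : ι → ℝ) {r a b : ℝ} (hr : 0 < r) (ha : |a| < 1) (hb : |b| < 1)
    (hab : b ≤ a) :
    2 * r * (∑ i, X i ^ 2 / (|X i| + r) ^ 4) * (a - b) ≤ sumSlope X r a - sumSlope X r b := by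
  unfold sumSlope
  rw [← sum_sub_distrib, mul_sum, sum_mul]
  refine sum_le_sum fun i _ => ?_
  have p1 := (sqDist_pos (X := X i) hr ha)
  have p2 := (sqDist_pos (X := X i) hr hb)
  have q1 := sqDist_le (X := X i) hr.le ha.le
  have q2 := sqDist_le (X := X i) hr.le hb.le
  have e : X i / sqDist (X i) r a - X i / sqDist (X i) r b =
      2 * r * (X i ^ 2 / (sqDist (X i) r a * sqDist (X i) r b)) * (a - b) := by
    rw [div_sub_div _ _ p1.ne' p2.ne', mul_comm (sqDist (X i) r a) (X i), ← mul_sub, sqDist_sub]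
    field_simp
  rw [e]
  have : 0 ≤ a - b := by linarith
  have h4 : (|X i| + r) ^ 4 = (|X i| + r) ^ 2 * (|X i| + r) ^ 2 := by ring
  rw [h4]
  gcongr

theorem continuousOn_sumSlope (X : ι → ℝ) {r : ℝ} (hr : 0 < r) :
    ContinuousOn (sumSlope X r) (Ioo (-1) 1) := by
  unfold sumSlope
  refine continuousOn_finsetSum _ fun i _ => ?_
  refine ContinuousOn.div continuousOn_const ?_ fun a ha =>
    (sqDist_pos hr (abs_lt.2 ha)).ne'
  unfold sqDist
  fun_prop

/-- `log A ≤ log B + (A - B) / B - (A - B)² / (2 m²)` for `A, B ∈ (0, m]`. -/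
theorem log_le_tangent_sub_sq {A B m : ℝ} (hA : 0 < A) (hB : 0 < B) (hAm : A ≤ m)
    (hBm : B ≤ m) :
    log A ≤ log B + (A - B) / B - (A - B) ^ 2 / (2 * m ^ 2) := by
  have hm : 0 < m := hA.trans_le hAm
  -- the function `φ x = log x + (x - B)² / (2 m²) - (x - B) / B` is maximal at `B`
  let φ : ℝ → ℝ := fun x => log x + (x - B) ^ 2 / (2 * m ^ 2) - (x - B) / B
  have hd : ∀ x, 0 < x → HasDerivAt φ ((x - B) * (1 / m ^ 2 - 1 / (x * B))) x := by
    intro x hx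
    have h1 := (Real.hasDerivAt_log hx.ne').add
      ((((hasDerivAt_id x).sub_const B).pow 2).div_const (2 * m ^ 2))
    have h2 := h1.sub (((hasDerivAt_id x).sub_const B).div_const B)
    refine h2.congr_deriv ?_
    simp only [id]
    field_simp
    ring
  have key : φ A ≤ φ B := by
    rcases le_total A B with h | h
    · have : MonotoneOn φ (Icc A B) := by
        refine monotoneOn_of_deriv_nonneg (convex_Icc _ _)
          (fun x hx => (hd x (hA.trans_le hx.1)).continuousAt.continuousWithinAt)
          (fun x hx => ?_) (fun x hx => ?_)
        · rw [interior_Icc] at hx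
          exact (hd x (hA.trans hx.1)).differentiableAt.differentiableWithinAt
        · rw [interior_Icc] at hx
          have hx0 := hA.trans hx.1
          rw [(hd x hx0).deriv]
          refine mul_nonneg_of_nonpos_of_nonpos (by linarith [hx.2]) ?_
          have : 1 / m ^ 2 ≤ 1 / (x * B) := by
            apply one_div_le_one_div_of_le (by positivity)
            rw [sq]; have := hx.2; gcongr; linarith
          linarith
      exact this (left_mem_Icc.2 h) (right_mem_Icc.2 h) h
    · have : AntitoneOn φ (Icc B A) := by
        refine antitoneOn_of_deriv_nonpos (convex_Icc _ _)
          (fun x hx => (hd x (hB.trans_le hx.1)).continuousAt.continuousWithinAt)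
          (fun x hx => ?_) (fun x hx => ?_)
        · rw [interior_Icc] at hx
          exact (hd x (hB.trans hx.1)).differentiableAt.differentiableWithinAt
        · rw [interior_Icc] at hx
          have hx0 := hB.trans hx.1
          rw [(hd x hx0).deriv]
          refine mul_nonpos_of_nonneg_of_nonpos (by linarith [hx.1]) ?_
          have : 1 / m ^ 2 ≤ 1 / (x * B) := by
            apply one_div_le_one_div_of_le (by positivity)
            rw [sq]; have := hx.2; gcongr; linarith
          linarith
      exact this (left_mem_Icc.2 h) (right_mem_Icc.2 h) h
  simp only [φ, sub_self] at key
  simp at key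
  linarith

/-- Strong convexity of the logarithmic potential in `a`. -/
theorem logPot_ge (s : ℝ) (X : ι → ℝ) (ξ : ℝ) {a b : ℝ} (ha : |a| < 1) (hb : |b| < 1) :
    logPot s X ξ b + exp ξ * sumSlope X (exp ξ) b * (a - b) +
      exp ξ ^ 2 * (∑ i, X i ^ 2 / (|X i| + exp ξ) ^ 4) * (a - b) ^ 2 ≤
      logPot s X ξ a := by
  set r := exp ξ with hr'
  have hr : 0 < r := exp_pos ξ
  have key : ∑ i, log (sqDist (X i) r a) ≤ ∑ i, (log (sqDist (X i) r b) -
      2 * r * (X i / sqDist (X i) r b) * (a - b) -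
      2 * r ^ 2 * (X i ^ 2 / (|X i| + r) ^ 4) * (a - b) ^ 2) := by
    refine sum_le_sum fun i _ => ?_
    have p1 := (sqDist_pos (X := X i) hr ha)
    have p2 := (sqDist_pos (X := X i) hr hb)
    have q1 := sqDist_le (X := X i) hr.le ha.le
    have q2 := sqDist_le (X := X i) hr.le hb.le
    refine (log_le_tangent_sub_sq p1 p2 q1 q2).trans (le_of_eq ?_)
    rw [sqDist_sub]
    have : 0 < |X i| + r := by positivity
    field_simp
    ring
  rw [sum_sub_distrib, sum_sub_distrib, ← sum_mul, ← sum_mul,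
    ← mul_sum, ← mul_sum] at key
  unfold logPot
  rw [← hr']
  change _ + r * (∑ i, X i / sqDist (X i) r b) * (a - b) + _ ≤ _
  linarith

theorem sum_sq_div_nonneg (X : ι → ℝ) (r : ℝ) : 0 ≤ ∑ i, X i ^ 2 / (|X i| + r) ^ 4 :=
  sum_nonneg fun i _ => by positivity

theorem logPot_ge_tangent (s : ℝ) (X : ι → ℝ) (ξ : ℝ) {a b : ℝ} (ha : |a| < 1) (hb : |b| < 1) :
    logPot s X ξ b + exp ξ * sumSlope X (exp ξ) b * (a - b) ≤ logPot s X ξ a := by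
  have := logPot_ge s X ξ ha hb
  have h0 : 0 ≤ exp ξ ^ 2 * (∑ i, X i ^ 2 / (|X i| + exp ξ) ^ 4) * (a - b) ^ 2 :=
    mul_nonneg (mul_nonneg (sq_nonneg _) (sum_sq_div_nonneg X _)) (sq_nonneg _)
  linarith

/-- On an arc the potential is at most the larger of its values at the two ends. -/
theorem logPot_le_max (s : ℝ) (X : ι → ℝ) (ξ : ℝ) {a b d : ℝ} (ha : |a| < 1) (hb : |b| < 1)
    (h1 : a ≤ d) (h2 : d ≤ b) : logPot s X ξ d ≤ max (logPot s X ξ a) (logPot s X ξ b) := by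
  have hd : |d| < 1 := by rw [abs_lt] at *; constructor <;> linarith
  have e1 := logPot_ge_tangent s X ξ ha hd
  have e2 := logPot_ge_tangent s X ξ hb hd
  rcases le_total 0 (sumSlope X (exp ξ) d) with h | h
  · refine le_max_of_le_right (le_trans ?_ e2)
    have : 0 ≤ exp ξ * sumSlope X (exp ξ) d * (b - d) :=
      mul_nonneg (mul_nonneg (exp_pos _).le h) (by linarith)
    linarith
  · refine le_max_of_le_left (le_trans ?_ e1)
    have : 0 ≤ exp ξ * sumSlope X (exp ξ) d * (a - d) :=
      mul_nonneg_of_nonpos_of_nonpos (mul_nonpos_of_nonneg_of_nonpos (exp_pos _).le h)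
        (by linarith)
    linarith

theorem hasDerivAt_sqDist_exp (X a ξ : ℝ) : HasDerivAt (fun ξ => sqDist X (exp ξ) a)
    (2 * exp ξ ^ 2 - 2 * X * exp ξ * a) ξ := by
  unfold sqDist
  have h := Real.hasDerivAt_exp ξ
  have := (((h.const_mul (2 * X)).mul_const a).const_sub (X ^ 2)).add (h.pow 2)
  refine this.congr_deriv ?_
  simp; ring

/-- The radial derivative of the potential. -/
theorem hasDerivAt_logPot (s : ℝ) (X : ι → ℝ) {a : ℝ} (ha : |a| < 1) (ξ : ℝ) :
    HasDerivAt (fun ξ => logPot s X ξ a)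
      (sumRe X (exp ξ) a - (card ι - s)) ξ := by
  unfold logPot
  have hr := exp_pos ξ
  have h1 : HasDerivAt (fun ξ => ∑ i, log (sqDist (X i) (exp ξ) a))
      (∑ i, (2 * exp ξ ^ 2 - 2 * X i * exp ξ * a) / sqDist (X i) (exp ξ) a) ξ := by
    refine HasDerivAt.fun_sum fun i _ => ?_
    exact (hasDerivAt_sqDist_exp (X i) a ξ).log (sqDist_pos hr ha).ne'
  have h2 := ((hasDerivAt_id ξ).const_mul s).sub (h1.div_const 2)
  refine h2.congr_deriv ?_
  have : ∑ i, (2 * exp ξ ^ 2 - 2 * X i * exp ξ * a) / sqDist (X i) (exp ξ) a =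
      ∑ i, (2 - 2 * (X i * (X i - exp ξ * a) / sqDist (X i) (exp ξ) a)) := by
    refine sum_congr rfl fun i _ => ?_
    have p1 := (sqDist_pos (X := X i) hr ha)
    rw [eq_sub_iff_add_eq, ← mul_div_assoc, ← add_div, div_eq_iff p1.ne']
    unfold sqDist; ring
  rw [this, sum_sub_distrib, ← mul_sum]
  unfold sumRe
  simp
  ring

/-- The radial derivative of one term of `sumRe`. -/
theorem hasDerivAt_re_term (X : ℝ) {a : ℝ} (ha : |a| < 1) (ξ : ℝ) :
    HasDerivAt (fun ξ => X * (X - exp ξ * a) / sqDist X (exp ξ) a)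
      (exp ξ * a * (X / sqDist X (exp ξ) a) -
        2 * X ^ 2 * exp ξ ^ 2 * (1 - a ^ 2) / sqDist X (exp ξ) a ^ 2) ξ := by
  have p1 := (sqDist_pos (X := X) (exp_pos ξ) ha)
  have h1 := (((Real.hasDerivAt_exp ξ).mul_const a).const_sub X).const_mul X
  refine (h1.div (hasDerivAt_sqDist_exp X a ξ) p1.ne').congr_deriv ?_
  rw [div_eq_iff (by positivity), sub_mul, div_mul_cancel₀ _ (by positivity)]
  have : exp ξ * a * (X / sqDist X (exp ξ) a) * sqDist X (exp ξ) a ^ 2 =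
    exp ξ * a * X * sqDist X (exp ξ) a := by field_simp
  rw [this]
  unfold sqDist
  ring

/-- Existence of the minimiser of the potential on an arc, through its variational inequality. -/
theorem exists_slope_variational (X : ι → ℝ) {r α : ℝ} (hr : 0 < r) (hα0 : 0 ≤ α) (hα : α < 1) :
    ∃ a ∈ Icc (-α) α, ∀ b ∈ Icc (-α) α, 0 ≤ sumSlope X r a * (b - a) := by
  have hc : ContinuousOn (sumSlope X r) (Icc (-α) α) :=
    (continuousOn_sumSlope X hr).mono fun a ha => ⟨by linarith [ha.1], by linarith [ha.2]⟩
  rcases le_total 0 (sumSlope X r (-α)) with h1 | h1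
  · exact ⟨-α, ⟨le_rfl, by linarith⟩, fun b hb => mul_nonneg h1 (by linarith [hb.1])⟩
  rcases le_total (sumSlope X r α) 0 with h2 | h2
  · exact ⟨α, ⟨by linarith, le_rfl⟩, fun b hb =>
      mul_nonneg_of_nonpos_of_nonpos h2 (by linarith [hb.2])⟩
  obtain ⟨a, ha, h⟩ := intermediate_value_Icc (by linarith) hc ⟨h1, h2⟩
  exact ⟨a, ha, fun b hb => by rw [h, zero_mul]⟩

theorem sumSlope_lower (X : ι → ℝ) {r a : ℝ} (hr : 0 < r) (ha0 : 0 ≤ a) (ha : a < 1) :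
    -(card ι / 2 : ℝ) ≤ r * sumSlope X r a := by
  unfold sumSlope
  have : -(card ι / 2 : ℝ) = ∑ _i : ι, (-(1 / 2) : ℝ) := by simp; ring
  rw [this, mul_sum]
  refine sum_le_sum fun i _ => ?_
  have p1 := (sqDist_pos (X := X i) hr (abs_lt.2 ⟨by linarith, ha⟩))
  rw [← mul_div_assoc, le_div_iff₀ p1]
  unfold sqDist
  rcases le_total 0 (X i) with h | h
  · have : 0 ≤ r * X i := by positivity
    have : 0 ≤ (r * X i) * (1 - a) := mul_nonneg this (by linarith)
    nlinarith [sq_nonneg (X i - r)]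
  · have : 0 ≤ -(r * X i * a) := by
      have := mul_nonneg (mul_nonneg hr.le (neg_nonneg.2 h)) ha0; linarith
    nlinarith [sq_nonneg (X i + r)]

theorem sumSlope_neg (X : ι → ℝ) (r a : ℝ) :
    sumSlope X r (-a) = -sumSlope (fun i => -X i) r a := by
  unfold sumSlope
  rw [← sum_neg_distrib]
  refine sum_congr rfl fun i _ => ?_
  rw [neg_div, neg_neg]
  congr 1
  unfold sqDist; ring

theorem sumSlope_upper (X : ι → ℝ) {r a : ℝ} (hr : 0 < r) (ha0 : a ≤ 0) (ha : -1 < a) :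
    r * sumSlope X r a ≤ (card ι / 2 : ℝ) := by
  have := sumSlope_lower (fun i => -X i) hr (a := -a) (by linarith) (by linarith)
  rw [← neg_neg a, sumSlope_neg]
  linarith

end

section

variable {ι : Type*} [Fintype ι]

/-- `a ξ` minimises the logarithmic potential on the part `|a| ≤ α` of the circle of radius `e^ξ`,
expressed by the variational inequality. -/
structure IsArcMin (X : ι → ℝ) (α : ℝ) (a : ℝ → ℝ) : Prop where
  nonneg : 0 ≤ α
  lt_one : α < 1
  mem : ∀ ξ, a ξ ∈ Icc (-α) α
  var : ∀ ξ, ∀ b ∈ Icc (-α) α, 0 ≤ sumSlope X (exp ξ) (a ξ) * (b - a ξ)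

theorem exists_isArcMin (X : ι → ℝ) {α : ℝ} (hα0 : 0 ≤ α) (hα : α < 1) :
    ∃ a, IsArcMin X α a := by
  choose a ha h using fun ξ => exists_slope_variational X (exp_pos ξ) hα0 hα
  exact ⟨a, hα0, hα, ha, h⟩

namespace IsArcMin

variable {X : ι → ℝ} {α : ℝ} {a : ℝ → ℝ} (h : IsArcMin X α a)
include h

theorem abs_le (ξ : ℝ) : |a ξ| ≤ α := _root_.abs_le.2 (h.mem ξ)

theorem abs_lt_one (ξ : ℝ) : |a ξ| < 1 := (h.abs_le ξ).trans_lt h.lt_one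

theorem mul_slope_nonpos (ξ : ℝ) : a ξ * sumSlope X (exp ξ) (a ξ) ≤ 0 := by
  have := h.var ξ 0 ⟨by linarith [h.nonneg], h.nonneg⟩
  linarith

theorem logPot_le (s ξ : ℝ) {b : ℝ} (hb : |b| ≤ α) : logPot s X ξ (a ξ) ≤ logPot s X ξ b := by
  have h1 := logPot_ge_tangent s X ξ (hb.trans_lt h.lt_one) (h.abs_lt_one ξ)
  have h2 := mul_nonneg (exp_pos ξ).le (h.var ξ b (_root_.abs_le.1 hb))
  nlinarith

/-- Quadratic growth of the potential away from the minimiser, on the whole circle. -/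
theorem logPot_ge_sq (s ξ : ℝ) {b : ℝ} (hb : |b| < 1) :
    logPot s X ξ (a ξ) + exp ξ ^ 2 * (∑ i, X i ^ 2 / (|X i| + exp ξ) ^ 4) *
      (b - a ξ) ^ 2 - card ι / 2 * (1 - α) ≤ logPot s X ξ b := by
  have h1 := logPot_ge s X ξ hb (h.abs_lt_one ξ)
  suffices -(card ι / 2 * (1 - α)) ≤
      exp ξ * sumSlope X (exp ξ) (a ξ) * (b - a ξ) by linarith
  have hcard : (0 : ℝ) ≤ card ι / 2 := by positivity
  have hα1 := h.lt_one
  rw [_root_.abs_lt] at hb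
  rcases le_or_gt |b| α with h2 | h2
  · have := mul_nonneg (exp_pos ξ).le (h.var ξ b (_root_.abs_le.1 h2))
    have : 0 ≤ card ι / 2 * (1 - α) := mul_nonneg hcard (by linarith)
    nlinarith
  · rcases le_total 0 b with h3 | h3
    · rw [abs_of_nonneg h3] at h2
      have v := h.var ξ α ⟨by linarith [h.nonneg], le_rfl⟩
      rcases (h.mem ξ).2.eq_or_lt with e | e
      · have lo := sumSlope_lower X (exp_pos ξ) (e ▸ h.nonneg) (by linarith)
        have : -(card ι / 2 : ℝ) * (b - a ξ) ≤
          exp ξ * sumSlope X (exp ξ) (a ξ) * (b - a ξ) :=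
          mul_le_mul_of_nonneg_right lo (by linarith)
        refine le_trans ?_ this
        rw [neg_mul, neg_le_neg_iff]
        exact mul_le_mul_of_nonneg_left (by linarith) hcard
      · have : 0 ≤ sumSlope X (exp ξ) (a ξ) := by
          by_contra hn; push Not at hn; nlinarith
        have : 0 ≤ exp ξ * sumSlope X (exp ξ) (a ξ) * (b - a ξ) :=
          mul_nonneg (mul_nonneg (exp_pos ξ).le this) (by linarith)
        have : 0 ≤ card ι / 2 * (1 - α) := mul_nonneg hcard (by linarith)
        linarith
    · rw [abs_of_nonpos h3] at h2
      have v := h.var ξ (-α) ⟨le_rfl, by linarith [h.nonneg]⟩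
      rcases (h.mem ξ).1.eq_or_lt with e | e
      · have lo := sumSlope_upper X (exp_pos ξ) (a := a ξ) (by linarith [h.nonneg])
          (by linarith)
        have : (card ι / 2 : ℝ) * (b - a ξ) ≤
          exp ξ * sumSlope X (exp ξ) (a ξ) * (b - a ξ) :=
          mul_le_mul_of_nonpos_right lo (by linarith)
        refine le_trans ?_ this
        rw [← mul_neg]
        exact mul_le_mul_of_nonneg_left (by linarith) hcard
      · have : sumSlope X (exp ξ) (a ξ) ≤ 0 := by
          by_contra hn; push Not at hn; nlinarith
        have : 0 ≤ exp ξ * sumSlope X (exp ξ) (a ξ) * (b - a ξ) :=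
          mul_nonneg_of_nonpos_of_nonpos
            (mul_nonpos_of_nonneg_of_nonpos (exp_pos ξ).le this) (by linarith)
        have : 0 ≤ card ι / 2 * (1 - α) := mul_nonneg hcard (by linarith)
        linarith

theorem two_point (ξ ξ' : ℝ) :
    (exp ξ - exp ξ') ^ 4 *
      ∑ i, X i ^ 2 / ((|X i| + exp ξ) ^ 2 * (|X i| + exp ξ') ^ 2) ≤
      (sumRe X (exp ξ') (a ξ') - sumRe X (exp ξ) (a ξ)) *
        (exp ξ ^ 2 - exp ξ' ^ 2) :=
  two_point_inequality X (exp_pos _) (exp_pos _) (h.abs_lt_one _) (h.abs_lt_one _)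
    (h.mul_slope_nonpos _) (h.var _ _ (h.mem _)) (h.mul_slope_nonpos _) (h.var _ _ (h.mem _))

theorem antitone_sumRe : Antitone fun ξ => sumRe X (exp ξ) (a ξ) := by
  intro ξ' ξ hle
  rcases hle.eq_or_lt with rfl | hlt
  · exact le_rfl
  have h1 := h.two_point ξ ξ'
  have h2 : 0 < exp ξ ^ 2 - exp ξ' ^ 2 := by
    have := exp_lt_exp.2 hlt
    have := exp_pos ξ'
    nlinarith
  have h3 : 0 ≤ (exp ξ - exp ξ') ^ 4 *
      ∑ i, X i ^ 2 / ((|X i| + exp ξ) ^ 2 * (|X i| + exp ξ') ^ 2) :=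
    mul_nonneg (by positivity) (sum_nonneg fun i _ => by positivity)
  have := nonneg_of_mul_nonneg_left (h3.trans h1) h2
  exact sub_nonneg.1 this

/-- Quantitative decrease of `sumRe` along the curve of minimisers. -/
theorem sumRe_sub_ge {ξ ξ' R c : ℝ} (hlt : ξ' < ξ) (hR : exp ξ ≤ R)
    (hc : c ≤ ∑ i, X i ^ 2 / (|X i| + R) ^ 4) :
    c * (exp ξ - exp ξ') ^ 3 / (2 * R) ≤
      sumRe X (exp ξ') (a ξ') - sumRe X (exp ξ) (a ξ) := by
  have h1 := h.two_point ξ ξ'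
  have hr := exp_lt_exp.2 hlt
  have hr0 := exp_pos ξ'
  set r := exp ξ
  set r' := exp ξ'
  have hS : c ≤ ∑ i, X i ^ 2 / ((|X i| + r) ^ 2 * (|X i| + r') ^ 2) := by
    refine hc.trans (sum_le_sum fun i _ => ?_)
    have e : (|X i| + R) ^ 4 = (|X i| + R) ^ 2 * (|X i| + R) ^ 2 := by ring
    rw [e]
    have : 0 < (|X i| + r) ^ 2 * (|X i| + r') ^ 2 := by positivity
    gcongr
    linarith
  have h2 : c * (r - r') ^ 4 ≤ (sumRe X r' (a ξ') - sumRe X r (a ξ)) * ((r + r') * (r - r')) := by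
    calc c * (r - r') ^ 4 ≤ (∑ i, X i ^ 2 / ((|X i| + r) ^ 2 * (|X i| + r') ^ 2)) * (r - r') ^ 4 := by
          gcongr
      _ ≤ _ := by rw [mul_comm]; refine h1.trans (le_of_eq ?_); ring
  have h3 : c * (r - r') ^ 3 ≤ (sumRe X r' (a ξ') - sumRe X r (a ξ)) * (r + r') := by
    have hd : 0 < r - r' := by linarith
    refine le_of_mul_le_mul_right ?_ hd
    calc c * (r - r') ^ 3 * (r - r') = c * (r - r') ^ 4 := by ring
      _ ≤ _ := h2
      _ = _ := by ring
  have hT : 0 ≤ sumRe X r' (a ξ') - sumRe X r (a ξ) := sub_nonneg.2 (h.antitone_sumRe hlt.le)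
  rw [div_le_iff₀ (by linarith)]
  refine h3.trans ?_
  gcongr
  linarith

end IsArcMin

/-- A bound for the potential along a ray, from a one-sided bound on the derivative of `sumRe`. -/
theorem logPot_ray_le (s : ℝ) (X : ι → ℝ) {a B ξ ξ' : ℝ} (ha : |a| < 1) (hB : 0 ≤ B)
    (hd : ∀ m ∈ uIcc ξ ξ', ∑ i, (exp m * a * (X i / sqDist (X i) (exp m) a) -
        2 * X i ^ 2 * exp m ^ 2 * (1 - a ^ 2) / sqDist (X i) (exp m) a ^ 2) ≤ B) :
    logPot s X ξ' a ≤ logPot s X ξ a +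
      (sumRe X (exp ξ) a - (card ι - s)) * (ξ' - ξ) + B * (ξ' - ξ) ^ 2 := by
  have hT : ∀ m, HasDerivAt (fun ξ => sumRe X (exp ξ) a)
      (∑ i, (exp m * a * (X i / sqDist (X i) (exp m) a) -
        2 * X i ^ 2 * exp m ^ 2 * (1 - a ^ 2) / sqDist (X i) (exp m) a ^ 2)) m := by
    intro m
    unfold sumRe
    exact HasDerivAt.fun_sum fun i _ => hasDerivAt_re_term (X i) ha m
  have hU := hasDerivAt_logPot s X ha
  -- along the ray, parametrised by `u ∈ [0, 1]`
  let φ : ℝ → ℝ := fun u => logPot s X (ξ + u * (ξ' - ξ)) a -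
    (sumRe X (exp ξ) a - (card ι - s)) * (u * (ξ' - ξ)) - B * (ξ' - ξ) ^ 2 * u ^ 2 / 2
  have hmem : ∀ u ∈ Icc (0 : ℝ) 1, ξ + u * (ξ' - ξ) ∈ uIcc ξ ξ' := by
    intro u hu
    have : ξ + u * (ξ' - ξ) = (1 - u) • ξ + u • ξ' := by simp; ring
    rw [this, ← segment_eq_uIcc]
    exact ⟨1 - u, u, by linarith [hu.2], hu.1, by ring, rfl⟩
  have hlin : ∀ u, HasDerivAt (fun u : ℝ => ξ + u * (ξ' - ξ)) (ξ' - ξ) u := by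
    intro u; simpa using ((hasDerivAt_id u).mul_const (ξ' - ξ)).const_add ξ
  have hTle : ∀ u ∈ Icc (0 : ℝ) 1,
      (sumRe X (exp (ξ + u * (ξ' - ξ))) a - sumRe X (exp ξ) a) * (ξ' - ξ) ≤
        B * (ξ' - ξ) ^ 2 * u := by
    intro u hu
    let ψ : ℝ → ℝ := fun u => sumRe X (exp (ξ + u * (ξ' - ξ))) a * (ξ' - ξ) -
      B * (ξ' - ξ) ^ 2 * u
    have hψ : ∀ v, HasDerivAt ψ ((∑ i, (exp (ξ + v * (ξ' - ξ)) * a *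
        (X i / sqDist (X i) (exp (ξ + v * (ξ' - ξ))) a) -
        2 * X i ^ 2 * exp (ξ + v * (ξ' - ξ)) ^ 2 * (1 - a ^ 2) /
          sqDist (X i) (exp (ξ + v * (ξ' - ξ))) a ^ 2)) * (ξ' - ξ) * (ξ' - ξ) -
        B * (ξ' - ξ) ^ 2) v := by
      intro v
      have := (((hT (ξ + v * (ξ' - ξ))).comp v (hlin v)).mul_const (ξ' - ξ)).sub
        ((hasDerivAt_id v).const_mul (B * (ξ' - ξ) ^ 2))
      refine this.congr_deriv ?_
      rw [mul_one]
    have : AntitoneOn ψ (Icc 0 1) := by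
      refine antitoneOn_of_deriv_nonpos (convex_Icc _ _)
        (fun x _ => (hψ x).continuousAt.continuousWithinAt)
        (fun x _ => (hψ x).differentiableAt.differentiableWithinAt) (fun v hv => ?_)
      rw [interior_Icc] at hv
      rw [(hψ v).deriv]
      have := hd _ (hmem v ⟨hv.1.le, hv.2.le⟩)
      nlinarith [mul_le_mul_of_nonneg_right this (sq_nonneg (ξ' - ξ))]
    have := this (left_mem_Icc.2 zero_le_one) hu hu.1
    simp only [ψ, zero_mul, add_zero, mul_zero, sub_zero] at this
    linarith
  have hφ : ∀ u, HasDerivAt φ ((sumRe X (exp (ξ + u * (ξ' - ξ))) a -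
      (card ι - s)) * (ξ' - ξ) -
      (sumRe X (exp ξ) a - (card ι - s)) * (ξ' - ξ) - B * (ξ' - ξ) ^ 2 * u) u := by
    intro u
    have h1 := (hU (ξ + u * (ξ' - ξ))).comp u (hlin u)
    have h2 := ((hasDerivAt_id u).mul_const (ξ' - ξ)).const_mul
      (sumRe X (exp ξ) a - (card ι - s))
    have h3 := (((hasDerivAt_id u).pow 2).const_mul (B * (ξ' - ξ) ^ 2)).div_const 2
    refine ((h1.sub h2).sub h3).congr_deriv ?_
    simp
    ring
  have : AntitoneOn φ (Icc 0 1) := by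
    refine antitoneOn_of_deriv_nonpos (convex_Icc _ _)
      (fun x _ => (hφ x).continuousAt.continuousWithinAt)
      (fun x _ => (hφ x).differentiableAt.differentiableWithinAt) (fun v hv => ?_)
    rw [interior_Icc] at hv
    rw [(hφ v).deriv]
    have := hTle v ⟨hv.1.le, hv.2.le⟩
    linarith
  have := this (left_mem_Icc.2 zero_le_one) (right_mem_Icc.2 zero_le_one) zero_le_one
  simp only [φ, zero_mul, add_zero, mul_zero, sub_zero, one_mul, one_pow, mul_one] at this
  have e : ξ + (ξ' - ξ) = ξ' := by ring
  rw [e] at this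
  have : 0 ≤ B * (ξ' - ξ) ^ 2 := by positivity
  norm_num at *
  linarith

theorem two_mul_abs_mul_le_sqDist {X r a : ℝ} (hr : 0 ≤ r) :
    2 * |X| * r * (1 - |a|) ≤ sqDist X r a := by
  have h : X * a ≤ |X| * |a| := by rw [← abs_mul]; exact le_abs_self _
  unfold sqDist
  nlinarith [sq_nonneg (|X| - r), sq_abs X, mul_le_mul_of_nonneg_left h hr]

theorem exp_mul_div_sqDist_le {X r a α : ℝ} (hr : 0 < r) (ha : |a| ≤ α) (hα : α < 1) :
    r * |X| / sqDist X r a ≤ 1 / (2 * (1 - α)) := by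
  have h1 := two_mul_abs_mul_le_sqDist (X := X) (a := a) hr.le
  have h2 := sqDist_pos (X := X) hr (ha.trans_lt hα)
  rw [div_le_div_iff₀ h2 (by linarith)]
  have : 0 ≤ |X| * r := by positivity
  nlinarith

theorem sum_deriv_re_le (X : ι → ℝ) {ξ a α : ℝ} (ha : |a| ≤ α) (hα : α < 1) :
    ∑ i, (exp ξ * a * (X i / sqDist (X i) (exp ξ) a) -
        2 * X i ^ 2 * exp ξ ^ 2 * (1 - a ^ 2) / sqDist (X i) (exp ξ) a ^ 2) ≤
      card ι / (2 * (1 - α)) := by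
  have : (card ι / (2 * (1 - α)) : ℝ) = ∑ _i : ι, 1 / (2 * (1 - α)) := by
    rw [sum_const, card_univ, nsmul_eq_mul, mul_one_div]
  rw [this]
  refine sum_le_sum fun i _ => ?_
  have hp := sqDist_pos (X := X i) (exp_pos ξ) (ha.trans_lt hα)
  have h2 : 0 ≤ 2 * X i ^ 2 * exp ξ ^ 2 * (1 - a ^ 2) / sqDist (X i) (exp ξ) a ^ 2 := by
    have : 0 ≤ 1 - a ^ 2 := by
      have := (sq_lt_one_iff_abs_lt_one a).2 (ha.trans_lt hα); linarith
    positivity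
  have h3 : exp ξ * a * (X i / sqDist (X i) (exp ξ) a) ≤
      exp ξ * |X i| / sqDist (X i) (exp ξ) a := by
    rw [← mul_div_assoc]
    refine div_le_div_of_nonneg_right ?_ hp.le
    have : a * X i ≤ 1 * |X i| := by
      calc a * X i ≤ |a * X i| := le_abs_self _
        _ = |a| * |X i| := abs_mul _ _
        _ ≤ _ := by gcongr; linarith
    have := mul_le_mul_of_nonneg_left this (exp_pos ξ).le
    linarith
  have := exp_mul_div_sqDist_le (X := X i) (exp_pos ξ) ha hα
  linarith

/-- A function with approximate supergradients along an antitone function has exact ones. -/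
theorem le_of_approx_supergradient {φ A : ℝ → ℝ} {Λ : ℝ} (hA : Antitone A)
    (h : ∀ p q, φ q ≤ φ p + A p * (q - p) + Λ * (q - p) ^ 2) (p q : ℝ) :
    φ q ≤ φ p + A p * (q - p) := by
  have key : ∀ N : ℕ, 0 < N → φ q ≤ φ p + A p * (q - p) + Λ * (q - p) ^ 2 / N := by
    intro N hN
    have hN' : (0 : ℝ) < N := by exact_mod_cast hN
    set δ := (q - p) / N with hδ
    have ind : ∀ j : ℕ, φ (p + j * δ) ≤ φ p + j * (A p * δ + Λ * δ ^ 2) := by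
      intro j
      induction j with
      | zero => simp
      | succ j ih =>
        have h1 := h (p + j * δ) (p + (j + 1 : ℕ) * δ)
        have e : p + ((j + 1 : ℕ) : ℝ) * δ - (p + j * δ) = δ := by push_cast; ring
        rw [e] at h1
        have h2 : A (p + j * δ) * δ ≤ A p * δ := by
          rcases le_total 0 δ with hd | hd
          · exact mul_le_mul_of_nonneg_right (hA (by nlinarith [Nat.cast_nonneg (α := ℝ) j])) hd
          · exact mul_le_mul_of_nonpos_right (hA (by nlinarith [Nat.cast_nonneg (α := ℝ) j])) hd
        push_cast at *
        linarith
    have h3 := ind N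
    have e1 : p + N * δ = q := by rw [hδ]; field_simp; ring
    have e2 : (N : ℝ) * (A p * δ + Λ * δ ^ 2) = A p * (q - p) + Λ * (q - p) ^ 2 / N := by
      rw [hδ]; field_simp
    rw [e1, e2] at h3
    linarith
  have lim : Tendsto (fun N : ℕ => φ p + A p * (q - p) + Λ * (q - p) ^ 2 / N) atTop
      (𝓝 (φ p + A p * (q - p) + 0)) :=
    tendsto_const_nhds.add (tendsto_const_div_atTop_nhds_zero_nat _)
  rw [add_zero] at lim
  exact ge_of_tendsto lim (eventually_atTop.2 ⟨1, fun N hN => key N hN⟩)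

/-- The minimal potential on circles is a concave function of the logarithm of the radius. -/
theorem IsArcMin.logPot_concave {X : ι → ℝ} {α : ℝ} {a : ℝ → ℝ} (h : IsArcMin X α a)
    (s p q : ℝ) :
    logPot s X q (a q) ≤ logPot s X p (a p) +
      (sumRe X (exp p) (a p) - (card ι - s)) * (q - p) := by
  refine le_of_approx_supergradient (φ := fun ξ => logPot s X ξ (a ξ))
    (A := fun ξ => sumRe X (exp ξ) (a ξ) - (card ι - s))
    (Λ := card ι / (2 * (1 - α))) (fun x y hxy => ?_) (fun p q => ?_) p q
  · exact sub_le_sub_right (h.antitone_sumRe hxy) _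
  · refine (h.logPot_le s q (h.abs_le p)).trans ?_
    have : 0 < 1 - α := by linarith [h.lt_one]
    exact logPot_ray_le s X (h.abs_lt_one p) (by positivity)
      fun m _ => sum_deriv_re_le X (h.abs_le p) h.lt_one

end

section

variable {ι : Type*} [Fintype ι]

theorem sqDist_ge_sq_sub {X r a : ℝ} (hr : 0 ≤ r) (ha : |a| ≤ 1) :
    (|X| - r) ^ 2 ≤ sqDist X r a := by
  have h : X * a ≤ |X| := by
    calc X * a ≤ |X * a| := le_abs_self _
      _ = |X| * |a| := abs_mul _ _
      _ ≤ |X| * 1 := by gcongr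
      _ = |X| := mul_one _
  unfold sqDist
  nlinarith [sq_abs X, mul_le_mul_of_nonneg_left h hr]

set_option maxHeartbeats 400000 in
/-- Comparison of two values of the slope, the key to the Lipschitz continuity of minimisers. -/
theorem sumSlope_lt_of_lipschitz [Nonempty ι] {X : ι → ℝ} {R r1 X0 c0 L r r' a a' : ℝ}
    (hr1 : 0 < r1) (hX0 : 0 < X0) (hX : ∀ i, X i ≤ 0 ∨ X0 ≤ X i)
    (hc : c0 * card ι ≤ ∑ i, (max (X i) 0) ^ 2 / (|X i| + R) ^ 4)
    (hL1 : 2 + 2 * (R / X0) ≤ L * r1) (hL2 : 2 * R ≤ r1 * (r1 * L - 1))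
    (hL3 : 16 * R < r1 ^ 4 * c0 * L)
    (hr : r1 ≤ r) (hrR : r ≤ R) (hr' : r1 ≤ r') (hrR' : r' ≤ R) (ha : |a| < 1) (ha' : |a'| < 1)
    (hne : r ≠ r') (hlt : a + L * |r - r'| ≤ a') : sumSlope X r a < sumSlope X r' a' := by
  have hΔ : 0 < |r - r'| := abs_pos.2 (sub_ne_zero.2 hne)
  set Δ := |r - r'| with hΔdef
  have hR : 0 < R := by linarith
  have hrr : |r' - r| = Δ := by rw [abs_sub_comm]
  have hL0 : 1 ≤ L * r1 := by
    have : 0 ≤ R / X0 := by positivity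
    linarith
  have hLpos : 0 < L := by
    by_contra h; push Not at h; nlinarith
  have ha1 := abs_lt.1 ha
  have habs : ∀ x : ℝ, |x * (r' - r)| = |x| * Δ := fun x => by rw [abs_mul, hrr]
  have hDΔ : ∀ x, sqDist x r' a' - sqDist x r a =
      -(2 * x * r' * (a' - a)) - 2 * x * (a * (r' - r)) + (r' - r) * (r' + r) := by
    intro x; unfold sqDist; ring
  have haΔ : |a * (r' - r)| ≤ Δ := by
    rw [habs]; nlinarith
  have haΔ' := abs_le.1 haΔ
  have hsΔ : |(r' - r) * (r' + r)| ≤ 2 * R * Δ := by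
    rw [abs_mul, hrr, abs_of_pos (by linarith : 0 < r' + r)]; nlinarith
  have hsΔ' := abs_le.1 hsΔ
  have hstep : r1 * (L * Δ) ≤ r' * (a' - a) := by
    have : 0 ≤ L * Δ := by positivity
    exact mul_le_mul hr' (by linarith) this (by linarith)
  -- termwise comparison
  have hterm : ∀ i, r1 * L * Δ * ((max (X i) 0) ^ 2 / (|X i| + R) ^ 4) - 16 * R * Δ / r1 ^ 3 ≤
      X i / sqDist (X i) r' a' - X i / sqDist (X i) r a := by
    intro i
    have p1 := (sqDist_pos (X := X i) (hr1.trans_le hr) ha)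
    have p2 := (sqDist_pos (X := X i) (hr1.trans_le hr') ha')
    have q1 := (sqDist_le (X := X i) (hr1.trans_le hr).le ha.le)
    have q2 := (sqDist_le (X := X i) (hr1.trans_le hr').le ha'.le)
    have e : X i / sqDist (X i) r' a' - X i / sqDist (X i) r a =
        X i * (sqDist (X i) r a - sqDist (X i) r' a') / (sqDist (X i) r' a' * sqDist (X i) r a) := by
      rw [div_sub_div _ _ p2.ne' p1.ne']; ring
    have hd := hDΔ (X i)
    have hloss : 0 ≤ 16 * R * Δ / r1 ^ 3 := by positivity
    rcases hX i with hneg | hpos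
    · rw [max_eq_right hneg]
      have z : r1 * L * Δ * ((0 : ℝ) ^ 2 / (|X i| + R) ^ 4) = 0 := by simp
      rw [z, zero_sub, e]
      rcases le_total (r1 / 2) (-X i) with hY | hY
      · refine le_trans (neg_nonpos.2 hloss) (div_nonneg ?_ (by positivity))
        refine mul_nonneg_of_nonpos_of_nonpos hneg ?_
        have h1 : -X i * (r1 * (L * Δ)) ≤ -X i * (r' * (a' - a)) :=
          mul_le_mul_of_nonneg_left hstep (by linarith)
        have h2 : -X i * (a * (r' - r)) ≥ -X i * (-Δ) :=
          mul_le_mul_of_nonneg_left haΔ'.1 (by linarith)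
        have h3 : r1 / 2 * ((r1 * L - 1) * Δ) ≤ -X i * ((r1 * L - 1) * Δ) :=
          mul_le_mul_of_nonneg_right hY (mul_nonneg (by linarith) hΔ.le)
        have h4 := mul_le_mul_of_nonneg_right hL2 hΔ.le
        linarith [hsΔ'.1]
      · have h1 : -X i * (r1 * (L * Δ)) ≤ -X i * (r' * (a' - a)) :=
          mul_le_mul_of_nonneg_left hstep (by linarith)
        have h2 : -X i * (a * (r' - r)) ≥ -X i * (-Δ) :=
          mul_le_mul_of_nonneg_left haΔ'.1 (by linarith)
        have h3 : 0 ≤ -X i * ((L * r1 - 1) * Δ) :=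
          mul_nonneg (by linarith) (mul_nonneg (by linarith) hΔ.le)
        have h4 : sqDist (X i) r a - sqDist (X i) r' a' ≤ 2 * R * Δ := by linarith [hsΔ'.1]
        have hlow : ∀ x b, r1 ≤ x → |b| < 1 → (r1 / 2) ^ 2 ≤ sqDist (X i) x b := by
          intro x b hx hb
          refine le_trans ?_ (sqDist_ge_sq_sub (by linarith) hb.le)
          rw [abs_of_nonpos hneg, ← neg_sub, neg_sq]
          exact pow_le_pow_left₀ (by positivity) (by linarith) 2
        have d1 := hlow r a hr ha
        have d2 := hlow r' a' hr' ha'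
        have h5 : -(r1 / 2 * (2 * R * Δ)) ≤ X i * (sqDist (X i) r a - sqDist (X i) r' a') := by
          have t1 : -X i * (sqDist (X i) r a - sqDist (X i) r' a') ≤ -X i * (2 * R * Δ) :=
            mul_le_mul_of_nonneg_left h4 (by linarith)
          have t2 : -X i * (2 * R * Δ) ≤ r1 / 2 * (2 * R * Δ) :=
            mul_le_mul_of_nonneg_right hY (by positivity)
          linarith
        rw [le_div_iff₀ (by positivity)]
        refine le_trans ?_ h5
        rw [neg_mul, neg_le_neg_iff]
        have : (r1 / 2) ^ 2 * (r1 / 2) ^ 2 ≤ sqDist (X i) r' a' * sqDist (X i) r a :=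
          mul_le_mul d2 d1 (by positivity) p2.le
        calc r1 / 2 * (2 * R * Δ) = 16 * R * Δ / r1 ^ 3 * ((r1 / 2) ^ 2 * (r1 / 2) ^ 2) := by
              field_simp; ring
          _ ≤ _ := mul_le_mul_of_nonneg_left this hloss
    · have hp : 0 < X i := hX0.trans_le hpos
      rw [max_eq_left hp.le, e]
      have h1 : X i * (r1 * (L * Δ)) ≤ X i * (r' * (a' - a)) :=
        mul_le_mul_of_nonneg_left hstep hp.le
      have h2 : X i * (-Δ) ≤ X i * (a * (r' - r)) := mul_le_mul_of_nonneg_left haΔ'.1 hp.le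
      have h3 : 2 * X i + 2 * R ≤ X i * (L * r1) := by
        have : R ≤ X i * (R / X0) := by
          rw [mul_div_assoc', le_div_iff₀ hX0, mul_comm]
          exact mul_le_mul_of_nonneg_right hpos hR.le
        have := mul_le_mul_of_nonneg_left hL1 hp.le
        linarith
      have h4 : X i * r1 * L * Δ ≤ sqDist (X i) r a - sqDist (X i) r' a' := by
        have := mul_le_mul_of_nonneg_right h3 hΔ.le
        linarith [hsΔ'.2]
      have hn4 : (|X i| + R) ^ 4 = (|X i| + R) ^ 2 * (|X i| + R) ^ 2 := by ring
      have hR2 : ∀ x, 0 < x → x ≤ R → (|X i| + x) ^ 2 ≤ (|X i| + R) ^ 2 := by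
        intro x hx hx'; gcongr
      calc r1 * L * Δ * (X i ^ 2 / (|X i| + R) ^ 4) - 16 * R * Δ / r1 ^ 3
          ≤ X i * (X i * r1 * L * Δ) / ((|X i| + R) ^ 2 * (|X i| + R) ^ 2) := by
            rw [hn4]
            refine (sub_le_self _ hloss).trans (le_of_eq ?_)
            ring
        _ ≤ _ := by
            have := q2.trans (hR2 r' (by linarith) hrR')
            have := q1.trans (hR2 r (by linarith) hrR)
            have : 0 ≤ X i * (sqDist (X i) r a - sqDist (X i) r' a') :=
              mul_nonneg hp.le (le_trans (by positivity) h4)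
            gcongr
  have hsum := sum_le_sum fun i (_ : i ∈ Finset.univ) => hterm i
  rw [sum_sub_distrib, sum_sub_distrib, ← mul_sum, sum_const,
    card_univ, nsmul_eq_mul] at hsum
  change _ ≤ sumSlope X r' a' - sumSlope X r a at hsum
  have hcard : (0 : ℝ) < card ι := by exact_mod_cast Fintype.card_pos
  have h6 : r1 * L * Δ * (c0 * card ι) ≤
      r1 * L * Δ * ∑ i, (max (X i) 0) ^ 2 / (|X i| + R) ^ 4 :=
    mul_le_mul_of_nonneg_left hc (by positivity)
  have h7 : (card ι : ℝ) * (16 * R * Δ / r1 ^ 3) < r1 * L * Δ * (c0 * card ι) := by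
    rw [mul_div_assoc', div_lt_iff₀ (by positivity)]
    have := mul_lt_mul_of_pos_right hL3 (mul_pos hΔ hcard)
    linarith
  linarith

/-- The minimisers depend Lipschitz continuously on the radius. -/
theorem IsArcMin.lipschitz [Nonempty ι] {X : ι → ℝ} {α : ℝ} {a : ℝ → ℝ} (h : IsArcMin X α a)
    {R r1 X0 c0 L ξ ξ' : ℝ}
    (hr1 : 0 < r1) (hX0 : 0 < X0) (hX : ∀ i, X i ≤ 0 ∨ X0 ≤ X i)
    (hc : c0 * card ι ≤ ∑ i, (max (X i) 0) ^ 2 / (|X i| + R) ^ 4)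
    (hL1 : 2 + 2 * (R / X0) ≤ L * r1) (hL2 : 2 * R ≤ r1 * (r1 * L - 1))
    (hL3 : 16 * R < r1 ^ 4 * c0 * L)
    (hr : r1 ≤ exp ξ) (hrR : exp ξ ≤ R) (hr' : r1 ≤ exp ξ')
    (hrR' : exp ξ' ≤ R) : |a ξ - a ξ'| ≤ L * |exp ξ - exp ξ'| := by
  have key : ∀ p q, r1 ≤ exp p → exp p ≤ R → r1 ≤ exp q → exp q ≤ R →
      a q - a p ≤ L * |exp p - exp q| := by
    intro p q hp hpR hq hqR
    by_contra hcon
    push Not at hcon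
    rcases eq_or_ne p q with rfl | hpq
    · simp at hcon
    have hne : exp p ≠ exp q := fun e => hpq (exp_injective e)
    have hlt := sumSlope_lt_of_lipschitz hr1 hX0 hX hc hL1 hL2 hL3 hp hpR hq hqR
      (h.abs_lt_one p) (h.abs_lt_one q) hne (by linarith)
    have hRp : 0 < R := (hr1.trans_le hp).trans_le hpR
    have hL0 : 0 < L := by
      have : 0 ≤ R / X0 := by positivity
      by_contra h; push Not at h; nlinarith
    have hpos : 0 < a q - a p := lt_of_le_of_lt (by positivity) hcon
    have v1 := h.var p (a q) (h.mem q)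
    have v2 := h.var q (a p) (h.mem p)
    nlinarith
  rw [_root_.abs_le]
  constructor
  · have := key ξ ξ' hr hrR hr' hrR'; linarith
  · have := key ξ' ξ hr' hrR' hr hrR; rw [abs_sub_comm] at this; linarith

theorem abs_div_sqDist_sub_le {X r r1 a ε R : ℝ} (hε : 0 < ε) (hr : 0 < r) (hrR : r ≤ R)
    (hr1 : 0 < r1) (hr1R : r1 ≤ R) (ha : |a| ≤ 1) (h : ε ^ 2 ≤ sqDist X r a)
    (h1 : ε ^ 2 ≤ sqDist X r1 a) :
    |X / sqDist X r a - X / sqDist X r1 a| ≤ 2 * (1 + 2 * R / ε) ^ 2 / ε ^ 2 * |r - r1| := by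
  have p : 0 < sqDist X r a := lt_of_lt_of_le (by positivity) h
  have p1 : 0 < sqDist X r1 a := lt_of_lt_of_le (by positivity) h1
  have hR : 0 < R := hr.trans_le hrR
  have hbd : ∀ x, 0 < x → x ≤ R → ε ^ 2 ≤ sqDist X x a →
      (|X| + R) ^ 2 ≤ (1 + 2 * R / ε) ^ 2 * sqDist X x a := by
    intro x hx hxR hD
    have hpos : 0 < sqDist X x a := lt_of_lt_of_le (by positivity) hD
    set e := sqrt (sqDist X x a) with he
    have he2 : e ^ 2 = sqDist X x a := sq_sqrt hpos.le
    have heε : ε ≤ e := le_sqrt_of_sq_le hD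
    have hXe : |X| - x ≤ e := by
      refine (le_abs_self _).trans ?_
      rw [← Real.sqrt_sq_eq_abs]
      exact sqrt_le_sqrt (sqDist_ge_sq_sub hx.le ha)
    rw [← he2, ← mul_pow]
    have : R ≤ R / ε * e := by
      rw [div_mul_eq_mul_div, le_div_iff₀ hε]; gcongr
    have h2 : |X| + R ≤ (1 + 2 * R / ε) * e := by
      have e2 : (1 + 2 * R / ε) * e = e + 2 * (R / ε * e) := by ring
      rw [e2]; linarith
    exact pow_le_pow_left₀ (by positivity) h2 2
  have b := hbd r hr hrR h
  have b1 := hbd r1 hr1 hr1R h1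
  have e : X / sqDist X r a - X / sqDist X r1 a =
      X * (r1 + r - 2 * X * a) / (sqDist X r a * sqDist X r1 a) * (r1 - r) := by
    rw [div_sub_div _ _ p.ne' p1.ne', div_mul_eq_mul_div]
    congr 1
    unfold sqDist; ring
  rw [e, abs_mul, abs_sub_comm r1 r]
  refine mul_le_mul_of_nonneg_right ?_ (abs_nonneg _)
  rw [abs_div, abs_of_pos (mul_pos p p1), div_le_div_iff₀ (mul_pos p p1) (by positivity), abs_mul]
  have hXa : |r1 + r - 2 * X * a| ≤ 2 * (|X| + R) := by
    have t1 : |2 * X * a| ≤ 2 * |X| := by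
      rw [abs_mul, abs_mul, abs_two]; nlinarith [abs_nonneg X]
    have t2 : |r1 + r| ≤ 2 * R := by rw [abs_of_pos (by linarith)]; linarith
    have := abs_sub (r1 + r) (2 * X * a)
    linarith
  have hXR : |X| ≤ |X| + R := by linarith
  have s1 : |X| * |r1 + r - 2 * X * a| ≤ 2 * (|X| + R) ^ 2 := by
    have := mul_le_mul hXR hXa (abs_nonneg _) (by positivity)
    nlinarith
  calc |X| * |r1 + r - 2 * X * a| * ε ^ 2 ≤ 2 * (|X| + R) ^ 2 * ε ^ 2 := by gcongr
    _ ≤ 2 * ((1 + 2 * R / ε) ^ 2 * sqDist X r a) * sqDist X r1 a := by gcongr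
    _ = _ := by ring

/-- Control of the derivative of `sumRe` along a ray issuing from the curve of minimisers, in the
presence of a few points at `Z` that may lie close to the ray. -/
theorem sum_deriv_re_near_le [DecidableEq ι] {X : ι → ℝ} {A : Finset ι} {Z a ε δ R ξ ξ1 : ℝ}
    {κ : ℕ} (hε : 0 < ε) (hδ : 0 < δ) (hR : exp ξ ≤ R) (hR1 : exp ξ1 ≤ R) (ha : |a| < 1)
    (hslope : a * sumSlope X (exp ξ1) a ≤ 0)
    (hA : ∀ i ∈ A, X i = Z) (hAcard : A.card ≤ κ) (haZ : 0 ≤ a * Z)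
    (hAδ : A.Nonempty → δ ^ 2 ≤ sqDist Z (exp ξ) a)
    (hfar : ∀ i ∉ A, ε ^ 2 ≤ sqDist (X i) (exp ξ) a ∧ ε ^ 2 ≤ sqDist (X i) (exp ξ1) a) :
    ∑ i, (exp ξ * a * (X i / sqDist (X i) (exp ξ) a) -
        2 * X i ^ 2 * exp ξ ^ 2 * (1 - a ^ 2) / sqDist (X i) (exp ξ) a ^ 2) ≤
      R * (card ι * (2 * (1 + 2 * R / ε) ^ 2 / ε ^ 2 * |exp ξ - exp ξ1|)) +
        κ * (R * |Z| / δ ^ 2) := by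
  set r := exp ξ
  set r1 := exp ξ1
  have hr : 0 < r := exp_pos _
  have hr1 : 0 < r1 := exp_pos _
  set K := 2 * (1 + 2 * R / ε) ^ 2 / ε ^ 2 * |r - r1| with hK
  have hK0 : 0 ≤ K := by positivity
  have hRpos : 0 < R := hr.trans_le hR
  have step1 : ∑ i, (r * a * (X i / sqDist (X i) r a) -
        2 * X i ^ 2 * r ^ 2 * (1 - a ^ 2) / sqDist (X i) r a ^ 2) ≤
      ∑ i, r * (a * (X i / sqDist (X i) r a)) := by
    refine sum_le_sum fun i _ => ?_
    have : 0 ≤ 2 * X i ^ 2 * r ^ 2 * (1 - a ^ 2) / sqDist (X i) r a ^ 2 := by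
      have : 0 ≤ 1 - a ^ 2 := by
        have := (sq_lt_one_iff_abs_lt_one a).2 ha; linarith
      positivity
    linarith
  refine step1.trans ?_
  rw [← sum_add_sum_compl A]
  have hatoms : ∑ i ∈ A, r * (a * (X i / sqDist (X i) r a)) ≤ κ * (R * |Z| / δ ^ 2) := by
    have hb : ∀ i ∈ A, r * (a * (X i / sqDist (X i) r a)) ≤ R * |Z| / δ ^ 2 := by
      intro i hi
      have hD := hAδ ⟨i, hi⟩
      rw [hA i hi]
      have h1 : a * Z ≤ |Z| := by
        calc a * Z ≤ |a * Z| := le_abs_self _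
          _ = |a| * |Z| := abs_mul _ _
          _ ≤ 1 * |Z| := by gcongr
          _ = _ := one_mul _
      have : 0 < sqDist Z r a := lt_of_lt_of_le (by positivity) hD
      rw [← mul_div_assoc, ← mul_div_assoc]
      gcongr
    calc _ ≤ ∑ i ∈ A, R * |Z| / δ ^ 2 := sum_le_sum hb
      _ = A.card * (R * |Z| / δ ^ 2) := by rw [sum_const, nsmul_eq_mul]
      _ ≤ _ := by
        have : (A.card : ℝ) ≤ κ := by exact_mod_cast hAcard
        gcongr
  have hrest : ∑ i ∈ Aᶜ, r * (a * (X i / sqDist (X i) r a)) ≤ R * (card ι * K) := by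
    have h1 : ∑ i ∈ Aᶜ, a * (X i / sqDist (X i) r a) ≤
        ∑ i ∈ Aᶜ, (a * (X i / sqDist (X i) r1 a) + K) := by
      refine sum_le_sum fun i hi => ?_
      obtain ⟨f1, f2⟩ := hfar i (Finset.mem_compl.1 hi)
      have hle := abs_div_sqDist_sub_le (X := X i) hε hr hR hr1 hR1 ha.le f1 f2
      have : a * (X i / sqDist (X i) r a) - a * (X i / sqDist (X i) r1 a) ≤ K := by
        rw [← mul_sub]
        calc _ ≤ |a * (X i / sqDist (X i) r a - X i / sqDist (X i) r1 a)| := le_abs_self _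
          _ = |a| * |X i / sqDist (X i) r a - X i / sqDist (X i) r1 a| := abs_mul _ _
          _ ≤ 1 * K := by gcongr
          _ = K := one_mul _
      linarith
    have h2 : ∑ i ∈ Aᶜ, a * (X i / sqDist (X i) r1 a) ≤ 0 := by
      have hs : a * sumSlope X r1 a = ∑ i ∈ A, a * (X i / sqDist (X i) r1 a) +
          ∑ i ∈ Aᶜ, a * (X i / sqDist (X i) r1 a) := by
        rw [sum_add_sum_compl, ← mul_sum]; rfl
      have h3 : 0 ≤ ∑ i ∈ A, a * (X i / sqDist (X i) r1 a) := by
        refine sum_nonneg fun i hi => ?_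
        rw [hA i hi, ← mul_div_assoc]
        exact div_nonneg haZ (sqDist_pos hr1 ha).le
      linarith
    have h4 : ∑ i ∈ Aᶜ, (a * (X i / sqDist (X i) r1 a) + K) ≤ card ι * K := by
      rw [sum_add_distrib, sum_const, nsmul_eq_mul]
      have : ((Aᶜ).card : ℝ) ≤ card ι := by exact_mod_cast Finset.card_le_univ _
      nlinarith
    rw [← mul_sum]
    have hc0 : 0 ≤ card ι * K := by positivity
    calc r * ∑ i ∈ Aᶜ, a * (X i / sqDist (X i) r a) ≤ r * (card ι * K) := by
          gcongr; linarith
      _ ≤ _ := by gcongr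
  linarith

theorem sq_sub_le_abs_cos_sub_cos {θ φ : ℝ} (hθ : θ ∈ Icc 0 π) (hφ : φ ∈ Icc 0 π) :
    2 / π ^ 2 * (θ - φ) ^ 2 ≤ |cos θ - cos φ| := by
  wlog h : φ ≤ θ generalizing θ φ
  · have := this hφ hθ (le_of_not_ge h)
    rw [abs_sub_comm]; convert this using 2; ring
  have hpi := pi_pos
  have h1 : (θ - φ) / π ≤ sin ((θ - φ) / 2) := by
    have := Real.mul_le_sin (x := (θ - φ) / 2) (by linarith) (by linarith [hθ.2, hφ.1])
    refine le_trans (le_of_eq ?_) this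
    field_simp
  have h2 : sin ((θ - φ) / 2) ≤ sin ((θ + φ) / 2) := by
    rcases le_total ((θ + φ) / 2) (π / 2) with hh | hh
    · exact sin_le_sin_of_le_of_le_pi_div_two (by linarith [hθ.2, hφ.1]) hh (by linarith [hφ.1])
    · rw [← Real.sin_pi_sub ((θ + φ) / 2)]
      exact sin_le_sin_of_le_of_le_pi_div_two (by linarith [hθ.2, hφ.1]) (by linarith)
        (by linarith [hθ.2])
  have h0 : 0 ≤ (θ - φ) / π := div_nonneg (by linarith) hpi.le
  rw [Real.cos_sub_cos, abs_mul, abs_mul, abs_of_nonneg (h0.trans h1),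
    abs_of_nonneg (h0.trans (h1.trans h2))]
  calc 2 / π ^ 2 * (θ - φ) ^ 2 = 2 * ((θ - φ) / π) * ((θ - φ) / π) := by
        field_simp
    _ ≤ |(-2 : ℝ)| * sin ((θ + φ) / 2) * sin ((θ - φ) / 2) := by
        rw [abs_neg, abs_two]
        have := h1.trans h2
        have := h0.trans this
        gcongr

theorem abs_arccos_sub_le {a b : ℝ} (ha : |a| ≤ 1) (hb : |b| ≤ 1) :
    |arccos a - arccos b| ≤ π * sqrt |a - b| := by
  have hpi := pi_pos
  have h := sq_sub_le_abs_cos_sub_cos ⟨arccos_nonneg a, arccos_le_pi a⟩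
    ⟨arccos_nonneg b, arccos_le_pi b⟩
  rw [Real.cos_arccos (abs_le.1 ha).1 (abs_le.1 ha).2,
    Real.cos_arccos (abs_le.1 hb).1 (abs_le.1 hb).2] at h
  refine abs_le_of_sq_le_sq ?_ (by positivity)
  rw [mul_pow, sq_sqrt (abs_nonneg _)]
  rw [div_mul_eq_mul_div, div_le_iff₀ (by positivity)] at h
  nlinarith [sq_nonneg (arccos a - arccos b)]

end

section

open Complex in
theorem rect_cauchy {g : ℂ → ℂ} {p q u v : ℝ}
    (hg : DifferentiableOn ℂ g (uIcc p q ×ℂ uIcc u v)) :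
    (∫ s in p..q, g (s + v * I)) - (∫ s in p..q, g (s + u * I)) =
      (∫ y in u..v, g (q + y * I) * I) - ∫ y in u..v, g (p + y * I) * I := by
  have h := integral_boundary_rect_eq_zero_of_differentiableOn g (p + u * I) (q + v * I)
    (by simpa using hg)
  simp only [add_re, ofReal_re, mul_re, I_re, mul_zero, ofReal_im, I_im, mul_one, sub_self,
    add_zero, add_im, mul_im, zero_add, smul_eq_mul] at h
  rw [intervalIntegral.integral_mul_const, intervalIntegral.integral_mul_const]
  linear_combination -h

/-- The integral of `g(ζ) dζ` along the vertical segment from `ξ - i c` to `ξ + i c`. -/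
def arcInt (g : ℂ → ℂ) (ξ c : ℝ) : ℂ := ∫ y in (-c)..c, g (ξ + y * I) * I

/-- The integral of `g(ζ) dζ` along the vertical segment from `ξ + i c` to `ξ + i (2π - c)`. -/
def coarcInt (g : ℂ → ℂ) (ξ c : ℝ) : ℂ :=
  ∫ y in c..(2 * π - c), g (ξ + y * I) * I

/-- The integral of `g(ζ) dζ` along a horizontal segment at height `c`, minus the one at height
`-c`. -/
def horizInt (g : ℂ → ℂ) (p q c : ℝ) : ℂ :=
  ∫ s in p..q, (g (s + c * I) - g (s - c * I))

/-- The integral of `g(ζ) dζ` along the vertical segment at `ξ` from height `c` to height `c'` and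
along the mirror image of that segment. -/
def jumpInt (g : ℂ → ℂ) (ξ c c' : ℝ) : ℂ :=
  ∫ y in c..c', (g (ξ + y * I) + g (ξ - y * I)) * I

/-- The integral along a staircase with `N + 1` horizontal steps and along its mirror image. -/
def stairInt (g : ℂ → ℂ) (ξ c : ℕ → ℝ) (N : ℕ) : ℂ :=
  (∑ k ∈ Finset.range (N + 1), horizInt g (ξ k) (ξ (k + 1)) (c k)) +
    ∑ k ∈ Finset.range N, jumpInt g (ξ (k + 1)) (c k) (c (k + 1))

theorem stairInt_zero (g : ℂ → ℂ) (ξ c : ℕ → ℝ) :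
    stairInt g ξ c 0 = horizInt g (ξ 0) (ξ 1) (c 0) := by
  simp [stairInt]

theorem stairInt_succ (g : ℂ → ℂ) (ξ c : ℕ → ℝ) (N : ℕ) :
    stairInt g ξ c (N + 1) = stairInt g ξ c N + jumpInt g (ξ (N + 1)) (c N) (c (N + 1)) +
      horizInt g (ξ (N + 1)) (ξ (N + 2)) (c (N + 1)) := by
  unfold stairInt
  rw [sum_range_succ _ (N + 1),
    sum_range_succ (fun k => jumpInt g (ξ (k + 1)) (c k) (c (k + 1))) N]
  ring

theorem continuous_vert (ξ : ℝ) : Continuous fun y : ℝ => (ξ + y * I : ℂ) := by fun_prop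

theorem continuous_horiz (c : ℝ) : Continuous fun y : ℝ => (y + c * I : ℂ) := by fun_prop

section strip

variable {g : ℂ → ℂ} {a b : ℝ}

theorem intervalIntegrable_vert (hg : DifferentiableOn ℂ g {z | z.im ∈ Ioo a b}) (ξ : ℝ) {u v : ℝ}
    (hu : u ∈ Ioo a b) (hv : v ∈ Ioo a b) :
    IntervalIntegrable (fun y : ℝ => g (ξ + y * I) * I) volume u v := by
  refine ContinuousOn.intervalIntegrable ?_
  refine ContinuousOn.mul ?_ continuousOn_const
  refine hg.continuousOn.comp (continuous_vert ξ).continuousOn fun y hy => ?_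
  have : y ∈ Ioo a b := (Set.ordConnected_Ioo.uIcc_subset hu hv) hy
  simpa using this

theorem intervalIntegrable_horiz (hg : DifferentiableOn ℂ g {z | z.im ∈ Ioo a b}) {c : ℝ}
    (hc : c ∈ Ioo a b) (p q : ℝ) :
    IntervalIntegrable (fun y : ℝ => g (y + c * I)) volume p q := by
  refine ContinuousOn.intervalIntegrable ?_
  refine hg.continuousOn.comp (continuous_horiz c).continuousOn fun y hy => ?_
  simpa using hc

theorem horizInt_eq_arcInt (hg : DifferentiableOn ℂ g {z | z.im ∈ Ioo (-π) π})
    (p q : ℝ) {c : ℝ} (hc : c ∈ Ioo 0 π) :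
    horizInt g p q c = arcInt g q c - arcInt g p c := by
  have h1 : c ∈ Ioo (-π) π := ⟨by linarith [hc.1, hc.2], hc.2⟩
  have h2 : -c ∈ Ioo (-π) π := ⟨by linarith [hc.1, hc.2], by linarith [hc.1, hc.2]⟩
  unfold horizInt arcInt
  have hi := intervalIntegrable_horiz hg h2 p q
  simp only [ofReal_neg, neg_mul, ← sub_eq_add_neg] at hi
  rw [intervalIntegral.integral_sub (intervalIntegrable_horiz hg h1 p q) hi]
  have := rect_cauchy (g := g) (p := p) (q := q) (u := -c) (v := c) (hg.mono ?_)
  · simpa only [ofReal_neg, neg_mul, ← sub_eq_add_neg] using this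
  · intro z hz
    exact (Set.ordConnected_Ioo.uIcc_subset h2 h1) hz.2

theorem jumpInt_eq_arcInt (hg : DifferentiableOn ℂ g {z | z.im ∈ Ioo (-π) π})
    (ξ : ℝ) {c c' : ℝ} (hc : c ∈ Ioo 0 π) (hc' : c' ∈ Ioo 0 π) :
    jumpInt g ξ c c' = arcInt g ξ c' - arcInt g ξ c := by
  have mem : ∀ {x}, x ∈ Ioo 0 π →
      x ∈ Ioo (-π) π ∧ -x ∈ Ioo (-π) π := fun hx =>
    ⟨⟨by linarith [hx.1, hx.2], hx.2⟩, ⟨by linarith [hx.1, hx.2], by linarith [hx.1, hx.2]⟩⟩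
  have i1 : ∀ {u v}, u ∈ Ioo (-π) π → v ∈ Ioo (-π) π →
    IntervalIntegrable (fun y : ℝ => g (ξ + y * I) * I) volume u v :=
    fun hu hv => intervalIntegrable_vert hg ξ hu hv
  obtain ⟨m1, m2⟩ := mem hc
  obtain ⟨m1', m2'⟩ := mem hc'
  have h1 : (∫ y in c..c', g (ξ - y * I) * I) =
      ∫ y in (-c')..(-c), g (ξ + y * I) * I := by
    have := intervalIntegral.integral_comp_neg (a := c) (b := c')
      (fun y : ℝ => g (ξ + y * I) * I)
    rw [← this]
    simp only [ofReal_neg, neg_mul, ← sub_eq_add_neg]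
  have i2 : IntervalIntegrable (fun y : ℝ => g (ξ - y * I) * I) volume c c' := by
    have := (IntervalIntegrable.iff_comp_neg (f := fun y : ℝ => g (ξ + y * I) * I)
      (a := -c) (b := -c')).1 (i1 m2 m2')
    simpa only [ofReal_neg, neg_mul, ← sub_eq_add_neg, neg_neg] using this
  unfold jumpInt arcInt
  simp only [add_mul]
  rw [intervalIntegral.integral_add (i1 m1 m1') i2, h1,
    ← intervalIntegral.integral_add_adjacent_intervals (i1 m2' m2) (i1 m2 m1'),
    ← intervalIntegral.integral_add_adjacent_intervals (i1 m2 m1) (i1 m1 m1')]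
  ring

/-- Cauchy's theorem for a staircase in a strip. -/
theorem stairInt_eq_arcInt (hg : DifferentiableOn ℂ g {z | z.im ∈ Ioo (-π) π})
    (ξ : ℕ → ℝ) {c : ℕ → ℝ} (hc : ∀ k, c k ∈ Ioo 0 π) (N : ℕ) :
    stairInt g ξ c N = arcInt g (ξ (N + 1)) (c N) - arcInt g (ξ 0) (c 0) := by
  induction N with
  | zero => rw [stairInt_zero, horizInt_eq_arcInt hg _ _ (hc 0)]
  | succ N ih =>
    rw [stairInt_succ, ih, horizInt_eq_arcInt hg _ _ (hc _), jumpInt_eq_arcInt hg _ (hc _) (hc _)]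
    ring

theorem horizInt_eq_coarcInt (hg : DifferentiableOn ℂ g {z | z.im ∈ Ioo 0 (2 * π)})
    (hper : ∀ z, g (z + 2 * π * I) = g z) (p q : ℝ) {c : ℝ} (hc : c ∈ Ioo 0 π) :
    horizInt g p q c = coarcInt g p c - coarcInt g q c := by
  have h1 : c ∈ Ioo 0 (2 * π) := ⟨hc.1, by linarith [hc.1, hc.2]⟩
  have h2 : 2 * π - c ∈ Ioo 0 (2 * π) :=
    ⟨by linarith [hc.1, hc.2], by linarith [hc.1, hc.2]⟩
  have e : ∀ s : ℝ, g (s - c * I) = g (s + (2 * π - c : ℝ) * I) := by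
    intro s
    rw [← hper]
    congr 1
    push_cast
    ring
  unfold horizInt coarcInt
  simp only [e]
  rw [intervalIntegral.integral_sub (intervalIntegrable_horiz hg h1 p q)
    (intervalIntegrable_horiz hg h2 p q)]
  have := rect_cauchy (g := g) (p := p) (q := q) (u := c) (v := 2 * π - c) (hg.mono ?_)
  · linear_combination -this
  · intro z hz
    exact (Set.ordConnected_Ioo.uIcc_subset h1 h2) hz.2

theorem jumpInt_eq_coarcInt (hg : DifferentiableOn ℂ g {z | z.im ∈ Ioo 0 (2 * π)})
    (hper : ∀ z, g (z + 2 * π * I) = g z) (ξ : ℝ) {c c' : ℝ}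
    (hc : c ∈ Ioo 0 π) (hc' : c' ∈ Ioo 0 π) :
    jumpInt g ξ c c' = coarcInt g ξ c - coarcInt g ξ c' := by
  have mem : ∀ {x}, x ∈ Ioo 0 π →
      x ∈ Ioo 0 (2 * π) ∧ 2 * π - x ∈ Ioo 0 (2 * π) := fun hx =>
    ⟨⟨hx.1, by linarith [hx.1, hx.2]⟩, ⟨by linarith [hx.1, hx.2], by linarith [hx.1, hx.2]⟩⟩
  have i1 : ∀ {u v}, u ∈ Ioo 0 (2 * π) → v ∈ Ioo 0 (2 * π) →
    IntervalIntegrable (fun y : ℝ => g (ξ + y * I) * I) volume u v :=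
    fun hu hv => intervalIntegrable_vert hg ξ hu hv
  obtain ⟨m1, m2⟩ := mem hc
  obtain ⟨m1', m2'⟩ := mem hc'
  have e : ∀ y : ℝ, g (ξ - y * I) = g (ξ + (2 * π - y : ℝ) * I) := by
    intro s
    rw [← hper]
    congr 1
    push_cast
    ring
  have h1 : (∫ y in c..c', g (ξ + (2 * π - y : ℝ) * I) * I) =
      ∫ y in (2 * π - c')..(2 * π - c), g (ξ + y * I) * I :=
    intervalIntegral.integral_comp_sub_left (fun y : ℝ => g (ξ + y * I) * I) _
  have i2 : IntervalIntegrable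
      (fun y : ℝ => g (ξ + (2 * π - y : ℝ) * I) * I) volume c c' := by
    have := (i1 m2 m2').comp_sub_left (2 * π)
    simpa using this
  unfold jumpInt coarcInt
  simp only [e, add_mul]
  rw [intervalIntegral.integral_add (i1 m1 m1') i2, h1,
    ← intervalIntegral.integral_add_adjacent_intervals (i1 m1 m2') (i1 m2' m2),
    ← intervalIntegral.integral_add_adjacent_intervals (i1 m1 m1') (i1 m1' m2')]
  ring

theorem stairInt_eq_coarcInt (hg : DifferentiableOn ℂ g {z | z.im ∈ Ioo 0 (2 * π)})
    (hper : ∀ z, g (z + 2 * π * I) = g z)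
    (ξ : ℕ → ℝ) {c : ℕ → ℝ} (hc : ∀ k, c k ∈ Ioo 0 π) (N : ℕ) :
    stairInt g ξ c N = coarcInt g (ξ 0) (c 0) - coarcInt g (ξ (N + 1)) (c N) := by
  induction N with
  | zero => rw [stairInt_zero, horizInt_eq_coarcInt hg hper _ _ (hc 0)]
  | succ N ih =>
    rw [stairInt_succ, ih, horizInt_eq_coarcInt hg hper _ _ (hc _),
      jumpInt_eq_coarcInt hg hper _ (hc _) (hc _)]
    ring

end strip

/-- The closed contour made of an arc through the positive axis at `ξ_(N+1)`, two half-staircases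
issuing from a common point, and an arc through the negative axis at `η_(N+1)`. -/
def contourInt (g : ℂ → ℂ) (ξ c η d : ℕ → ℝ) (N : ℕ) : ℂ :=
  arcInt g (ξ (N + 1)) (c N) - stairInt g ξ c N + stairInt g η d N + coarcInt g (η (N + 1)) (d N)

/-- The pullback of the differential `R(z) dz` under the exponential map. -/
def expPull (R : ℂ → ℂ) (ζ : ℂ) : ℂ := R (Complex.exp ζ) * Complex.exp ζ

theorem expPull_periodic (R : ℂ → ℂ) (z : ℂ) :
    expPull R (z + 2 * π * I) = expPull R z := by
  unfold expPull
  rw [exp_periodic z]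

theorem arcInt_add_coarcInt {R : ℂ → ℂ} {ξ : ℝ}
    (hR : ContinuousOn R (sphere 0 (exp ξ))) (c : ℝ) :
    arcInt (expPull R) ξ c + coarcInt (expPull R) ξ c = ∮ z in C(0, exp ξ), R z := by
  set G : ℝ → ℂ := fun y => expPull R (ξ + y * I) * I with hG
  have hcont : Continuous G := by
    refine Continuous.mul ?_ continuous_const
    unfold expPull
    refine Continuous.mul ?_ (by fun_prop)
    refine hR.comp_continuous (by fun_prop) fun y => ?_
    simp [norm_exp]
  have hper : Function.Periodic G (2 * π) := by
    intro y
    simp only [hG]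
    rw [← expPull_periodic R (ξ + y * I)]
    congr 2
    push_cast
    ring
  unfold arcInt coarcInt
  rw [intervalIntegral.integral_add_adjacent_intervals (hcont.intervalIntegrable _ _)
    (hcont.intervalIntegrable _ _)]
  have h1 := hper.intervalIntegral_add_eq (-c) 0
  have e : -c + 2 * π = 2 * π - c := by ring
  rw [e, zero_add] at h1
  refine h1.trans ?_
  unfold circleIntegral
  refine intervalIntegral.integral_congr fun y _ => ?_
  simp only [hG, expPull, deriv_circleMap, circleMap, zero_add, smul_eq_mul]
  rw [Complex.exp_add, ← ofReal_exp]
  ring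

theorem exp_mem_slitPlane_of_im {z : ℂ} (hz : z.im ∈ Ioo (-π) π) :
    Complex.exp z ∈ slitPlane := by
  rw [Complex.exp_mem_slitPlane]
  rw [(toIocMod_eq_self _).2 ⟨hz.1, by linarith [hz.2]⟩]
  exact hz.2.ne

theorem differentiableOn_expPull {R : ℂ → ℂ} {s : Set ℂ} {t : Set ℂ} (hs : IsOpen s)
    (hR : DifferentiableOn ℂ R s) (ht : ∀ z ∈ t, Complex.exp z ∈ s) :
    DifferentiableOn ℂ (expPull R) t := by
  intro z hz
  refine DifferentiableAt.differentiableWithinAt ?_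
  have h1 : DifferentiableAt ℂ R (Complex.exp z) := (hR _ (ht z hz)).differentiableAt
    (hs.mem_nhds (ht z hz))
  exact (h1.comp z differentiableAt_exp).mul differentiableAt_exp

theorem contourInt_eq_outer {R : ℂ → ℂ} {ξ c η d : ℕ → ℝ} {N : ℕ}
    (hR : DifferentiableOn ℂ R slitPlane)
    (hRc : ContinuousOn R (sphere 0 (exp (η (N + 1)))))
    (hc : ∀ k, c k ∈ Ioo 0 π) (hd : ∀ k, d k ∈ Ioo 0 π) (h0 : ξ 0 = η 0)
    (h0' : c 0 = d 0) :
    contourInt (expPull R) ξ c η d N = ∮ z in C(0, exp (η (N + 1))), R z := by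
  have hg : DifferentiableOn ℂ (expPull R) {z | z.im ∈ Ioo (-π) π} :=
    differentiableOn_expPull isOpen_slitPlane hR fun z hz => exp_mem_slitPlane_of_im hz
  unfold contourInt
  rw [stairInt_eq_arcInt hg ξ hc, stairInt_eq_arcInt hg η hd, ← arcInt_add_coarcInt hRc (d N), h0,
    h0']
  ring

theorem contourInt_eq_inner {R : ℂ → ℂ} {ξ c η d : ℕ → ℝ} {N : ℕ}
    (hR : DifferentiableOn ℂ R {z | -z ∈ slitPlane})
    (hRc : ContinuousOn R (sphere 0 (exp (ξ (N + 1)))))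
    (hc : ∀ k, c k ∈ Ioo 0 π) (hd : ∀ k, d k ∈ Ioo 0 π) (h0 : ξ 0 = η 0)
    (h0' : c 0 = d 0) :
    contourInt (expPull R) ξ c η d N = ∮ z in C(0, exp (ξ (N + 1))), R z := by
  have hg : DifferentiableOn ℂ (expPull R) {z | z.im ∈ Ioo 0 (2 * π)} := by
    refine differentiableOn_expPull (isOpen_slitPlane.preimage continuous_neg) hR ?_
    intro z hz
    have : -Complex.exp z = Complex.exp (z - π * I) := by
      rw [Complex.exp_sub, exp_pi_mul_I, div_neg, div_one]
    change -Complex.exp z ∈ slitPlane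
    rw [this]
    apply exp_mem_slitPlane_of_im
    simp only [sub_im, mul_im, ofReal_re, I_im, mul_one,
      ofReal_im, I_re, mul_zero, add_zero]
    exact ⟨by linarith [hz.1], by linarith [hz.2]⟩
  unfold contourInt
  rw [stairInt_eq_coarcInt hg (expPull_periodic R) ξ hc,
    stairInt_eq_coarcInt hg (expPull_periodic R) η hd, ← arcInt_add_coarcInt hRc (c N), h0, h0']
  ring

end

section

open Polynomial in
theorem circleIntegral_inv_prod {s : Multiset ℂ} (hs : 2 ≤ s.card) {c : ℂ} {R : ℝ}
    (hR : ∀ a ∈ s, a ∈ ball c R) : ∮ z in C(c, R), ((s.map fun a => z - a).prod)⁻¹ = 0 := by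
  obtain ⟨a0, ha0⟩ : ∃ a, a ∈ s := Multiset.card_pos_iff_exists_mem.1 (by omega)
  have hR0 : 0 < R := pos_of_mem_ball (hR a0 ha0)
  have hlow : ∀ z a, R ≤ ‖z - c‖ → a ∈ s → 0 < ‖z - a‖ := by
    intro z a hz ha
    have h1 := mem_ball_iff_norm.1 (hR a ha)
    have h2 : ‖z - c‖ ≤ ‖z - a‖ + ‖a - c‖ := norm_sub_le_norm_sub_add_norm_sub z a c
    linarith
  have hne : ∀ z, R ≤ ‖z - c‖ → (s.map fun a => z - a).prod ≠ 0 := by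
    intro z hz h0
    rw [Multiset.prod_eq_zero_iff, Multiset.mem_map] at h0
    obtain ⟨a, ha, h⟩ := h0
    have := hlow z a hz ha
    rw [h, norm_zero] at this
    exact lt_irrefl _ this
  have hdiff : Differentiable ℂ fun z => (s.map fun a => z - a).prod := by
    have : (fun z => (s.map fun a => z - a).prod) =
        fun z => ((s.map fun a => X - C a).prod : ℂ[X]).eval z := by
      funext z
      rw [Polynomial.eval_multiset_prod, Multiset.map_map]
      simp
    rw [this]
    exact Polynomial.differentiable _
  have hconst : ∀ R', R ≤ R' → ∮ z in C(c, R'), ((s.map fun a => z - a).prod)⁻¹ =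
      ∮ z in C(c, R), ((s.map fun a => z - a).prod)⁻¹ := by
    intro R' hR'
    refine Complex.circleIntegral_eq_of_differentiable_on_annulus_off_countable hR0 hR'
      countable_empty ?_ ?_
    · intro z hz
      have : R ≤ ‖z - c‖ := by simpa [dist_eq_norm] using hz.2
      exact (hdiff.continuous.continuousAt.inv₀ (hne z this)).continuousWithinAt
    · intro z hz
      have : R < ‖z - c‖ := by simpa [dist_eq_norm] using hz.1.2
      exact (hdiff z).inv (hne z this.le)
  have hbound : ∀ T : ℝ, 1 ≤ T → ‖∮ z in C(c, R), ((s.map fun a => z - a).prod)⁻¹‖ ≤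
      2 * π * (R + 1) / T := by
    intro T hT
    rw [← hconst (R + T) (by linarith)]
    have h1 : ∀ z ∈ sphere c (R + T), ‖((s.map fun a => z - a).prod)⁻¹‖ ≤ (T ^ 2)⁻¹ := by
      intro z hz
      rw [mem_sphere_iff_norm] at hz
      rw [norm_inv]
      refine inv_anti₀ (by positivity) ?_
      have h3 : ∀ t : Multiset ℂ, (∀ a ∈ t, a ∈ s) → T ^ t.card ≤ ‖(t.map fun a => z - a).prod‖ := by
        intro t
        induction t using Multiset.induction_on with
        | empty => simp
        | cons a t ih =>
          intro h
          rw [Multiset.map_cons, Multiset.prod_cons, norm_mul, Multiset.card_cons, pow_succ']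
          have h4 := ih fun b hb => h b (Multiset.mem_cons_of_mem hb)
          have h5 := mem_ball_iff_norm.1 (hR a (h a (Multiset.mem_cons_self a t)))
          have h6 : ‖z - c‖ ≤ ‖z - a‖ + ‖a - c‖ := norm_sub_le_norm_sub_add_norm_sub z a c
          exact mul_le_mul (by linarith) h4 (by positivity) (norm_nonneg _)
      exact (pow_le_pow_right₀ hT hs).trans (h3 s fun _ h => h)
    refine (circleIntegral.norm_integral_le_of_norm_le_const (by linarith) h1).trans ?_
    rw [← div_eq_mul_inv, div_le_div_iff₀ (by positivity) (by positivity)]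
    have : R + T ≤ (R + 1) * T := by nlinarith
    have := mul_le_mul_of_nonneg_left this (by positivity : 0 ≤ 2 * π * T)
    linarith
  have hlim : Tendsto (fun T : ℝ => 2 * π * (R + 1) / T) atTop (𝓝 0) :=
    tendsto_const_nhds.div_atTop tendsto_id
  have := ge_of_tendsto hlim (eventually_atTop.2 ⟨1, fun T hT => hbound T hT⟩)
  exact norm_le_zero_iff.1 this

/-- The integral of a rational function does not depend on the circle, as long as the circle
surrounds all poles. -/
theorem circleIntegral_rational_eq (s : Multiset ℂ) (U : Polynomial ℂ) :
    ∃ v : ℂ, ∀ (c : ℂ) (R : ℝ), 0 < R → (∀ a ∈ s, a ∈ ball c R) →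
      ∮ z in C(c, R), U.eval z * ((s.map fun a => z - a).prod)⁻¹ = v := by
  have base : ∀ t : Multiset ℂ, ∃ v : ℂ, ∀ (c : ℂ) (R : ℝ), 0 < R →
      (∀ a ∈ t, a ∈ ball c R) → ∮ z in C(c, R), ((t.map fun a => z - a).prod)⁻¹ = v := by
    intro t
    rcases Nat.lt_or_ge t.card 2 with h | h
    · rcases Nat.lt_succ_iff.1 h |>.eq_or_lt with h1 | h1
      · obtain ⟨a, rfl⟩ := Multiset.card_eq_one.1 h1
        refine ⟨2 * π * I, fun c R _ hR => ?_⟩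
        simpa using circleIntegral.integral_sub_inv_of_mem_ball (hR a (by simp))
      · have : t = 0 := Multiset.card_eq_zero.1 (by omega)
        subst this
        refine ⟨0, fun c R hR _ => ?_⟩
        simpa using circleIntegral_eq_zero_of_differentiable_on_off_countable
          (f := fun _ => (1 : ℂ)) hR.le (c := c) countable_empty continuousOn_const
            fun z _ => differentiableAt_const _
    · exact ⟨0, fun c R _ hR => circleIntegral_inv_prod h hR⟩
  induction s using Multiset.induction_on generalizing U with
  | empty =>
    refine ⟨0, fun c R hR _ => ?_⟩
    simp only [Multiset.map_zero, Multiset.prod_zero, inv_one, mul_one]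
    exact circleIntegral_eq_zero_of_differentiable_on_off_countable hR.le
      countable_empty U.continuous.continuousOn fun z _ => U.differentiable z
  | cons a s ih =>
    obtain ⟨q, hq⟩ := Polynomial.X_sub_C_dvd_sub_C_eval (p := U) (a := a)
    obtain ⟨v0, hv0⟩ := base (a ::ₘ s)
    obtain ⟨v1, hv1⟩ := ih q
    refine ⟨U.eval a * v0 + v1, fun c R hR h => ?_⟩
    have hs : ∀ b ∈ s, b ∈ ball c R := fun b hb => h b (Multiset.mem_cons_of_mem hb)
    rw [← hv0 c R hR h, ← hv1 c R hR hs, ← circleIntegral.integral_const_mul]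
    have hne : ∀ t : Multiset ℂ, (∀ b ∈ t, b ∈ ball c R) → ∀ z ∈ sphere c R,
        (t.map fun a => z - a).prod ≠ 0 := by
      intro t ht z hz h0
      rw [Multiset.prod_eq_zero_iff, Multiset.mem_map] at h0
      obtain ⟨b, hb, e⟩ := h0
      rw [sub_eq_zero] at e
      subst e
      have h1 := mem_ball.1 (ht z hb)
      rw [mem_sphere.1 hz] at h1
      exact lt_irrefl _ h1
    have hcont : ∀ t : Multiset ℂ, Continuous fun z => (t.map fun a => z - a).prod := by
      intro t
      exact continuous_multiset_prod _ fun b _ => by fun_prop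
    rw [← circleIntegral.integral_add]
    · refine circleIntegral.integral_congr hR.le fun z hz => ?_
      have h1 := congrArg (Polynomial.eval z) hq
      simp only [Polynomial.eval_sub, Polynomial.eval_C, Polynomial.eval_mul,
        Polynomial.eval_X] at h1
      have h2 := hne (a ::ₘ s) h z hz
      have h3 := hne s hs z hz
      simp only [Multiset.map_cons, Multiset.prod_cons] at h2 ⊢
      have h4 : z - a ≠ 0 := left_ne_zero_of_mul h2
      have h5 : U.eval z = U.eval a + (z - a) * q.eval z := by linear_combination h1
      rw [h5]
      field_simp
    · refine ContinuousOn.circleIntegrable hR.le ?_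
      exact continuousOn_const.mul ((hcont _).continuousOn.inv₀ (hne _ h))
    · refine ContinuousOn.circleIntegrable hR.le ?_
      exact q.continuous.continuousOn.mul ((hcont _).continuousOn.inv₀ (hne _ hs))

theorem circleIntegral_zpow_div_sub_of_lt {r : ℝ} (hr : 0 < r) {z : ℂ} (hz : r < ‖z‖) (e : ℤ) :
    ∮ w in C(0, r), w ^ e / (z - w) = if e < 0 then 2 * π * I * z ^ e else 0 := by
  have hz0 : z ≠ 0 := norm_pos_iff.1 (hr.trans hz)
  have hw0 : ∀ w ∈ sphere (0 : ℂ) r, w ≠ 0 := by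
    intro w hw h; rw [h] at hw; simp at hw; linarith
  have hzw : ∀ w ∈ closedBall (0 : ℂ) r, z - w ≠ 0 := by
    intro w hw h
    rw [sub_eq_zero] at h; subst h
    rw [mem_closedBall_zero_iff] at hw; linarith
  have nonneg : ∀ n : ℕ, ∮ w in C(0, r), w ^ (n : ℤ) / (z - w) = 0 := by
    intro n
    refine circleIntegral_eq_zero_of_differentiable_on_off_countable hr.le
      countable_empty ?_ ?_
    · simp only [zpow_natCast]
      exact ContinuousOn.div (by fun_prop) (by fun_prop) hzw
    · intro w hw
      simp only [zpow_natCast]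
      exact DifferentiableAt.div (by fun_prop) (by fun_prop)
        (hzw w (ball_subset_closedBall hw.1))
  rcases le_or_gt 0 e with he | he
  · rw [if_neg (not_lt.2 he)]
    obtain ⟨n, rfl⟩ := Int.eq_ofNat_of_zero_le he
    exact nonneg n
  · rw [if_pos he]
    obtain ⟨n, hn⟩ : ∃ n : ℕ, e = -((n : ℤ) + 1) := ⟨(-e - 1).toNat, by omega⟩
    subst hn
    clear he
    induction n with
    | zero =>
      have h1 : ∮ w in C(0, r), w ^ (-((0 : ℕ) + 1 : ℤ)) / (z - w) =
          ∮ w in C(0, r), (z⁻¹ * (w - 0)⁻¹ + z⁻¹ * (w ^ ((0 : ℕ) : ℤ) / (z - w))) := by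
        refine circleIntegral.integral_congr hr.le fun w hw => ?_
        have := hw0 w hw
        have := hzw w (sphere_subset_closedBall hw)
        simp
        field_simp
        ring
      rw [h1, circleIntegral.integral_add, circleIntegral.integral_const_mul,
        circleIntegral.integral_const_mul, nonneg 0,
        circleIntegral.integral_sub_inv_of_mem_ball (by simpa using hr)]
      · simp; ring
      · refine ContinuousOn.circleIntegrable hr.le ?_
        refine continuousOn_const.mul (ContinuousOn.inv₀ (by fun_prop) fun w hw => ?_)
        simpa using hw0 w hw
      · refine ContinuousOn.circleIntegrable hr.le ?_
        simp only [zpow_natCast]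
        exact continuousOn_const.mul (ContinuousOn.div (by fun_prop) (by fun_prop)
          fun w hw => hzw w (sphere_subset_closedBall hw))
    | succ n ih =>
      have h1 : ∮ w in C(0, r), w ^ (-((n + 1 : ℕ) + 1 : ℤ)) / (z - w) =
          ∮ w in C(0, r), (z⁻¹ * (w - 0) ^ (-((n + 1 : ℕ) + 1 : ℤ)) +
            z⁻¹ * (w ^ (-((n : ℕ) + 1 : ℤ)) / (z - w))) := by
        refine circleIntegral.integral_congr hr.le fun w hw => ?_
        have hw := hw0 w hw
        have := hzw w (sphere_subset_closedBall ‹_›)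
        have e1 : w ^ (-((n : ℕ) + 1 : ℤ)) = w ^ (-((n + 1 : ℕ) + 1 : ℤ)) * w := by
          rw [← zpow_add_one₀ hw]; congr 1
        simp only [sub_zero]
        rw [e1]
        field_simp
        ring
      rw [h1, circleIntegral.integral_add, circleIntegral.integral_const_mul,
        circleIntegral.integral_const_mul, ih,
        circleIntegral.integral_sub_zpow_of_ne (by push_cast; omega)]
      · have e1 : z ^ (-((n : ℕ) + 1 : ℤ)) = z ^ (-((n + 1 : ℕ) + 1 : ℤ)) * z := by
          rw [← zpow_add_one₀ hz0]; congr 1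
        rw [e1]
        field_simp
        ring
      · refine ContinuousOn.circleIntegrable hr.le ?_
        refine continuousOn_const.mul (ContinuousOn.zpow₀ (by fun_prop) _ fun w hw => Or.inl ?_)
        simpa using hw0 w hw
      · refine ContinuousOn.circleIntegrable hr.le ?_
        exact continuousOn_const.mul (ContinuousOn.div (ContinuousOn.zpow₀ (by fun_prop) _
          fun w hw => Or.inl (hw0 w hw)) (by fun_prop)
          fun w hw => hzw w (sphere_subset_closedBall hw))

theorem circleIntegral_zpow_div_sub_of_gt {r : ℝ} {z : ℂ} (hz0 : z ≠ 0) (hz : ‖z‖ < r) (e : ℤ) :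
    ∮ w in C(0, r), w ^ e / (z - w) =
      (if e < 0 then 2 * π * I * z ^ e else 0) - 2 * π * I * z ^ e := by
  have hr : 0 < r := (norm_nonneg z).trans_lt hz
  have hw0 : ∀ w ∈ sphere (0 : ℂ) r, w ≠ 0 := by
    intro w hw h; rw [h] at hw; simp at hw; linarith
  have hzw : ∀ w ∈ sphere (0 : ℂ) r, z - w ≠ 0 := by
    intro w hw h
    rw [sub_eq_zero] at h; subst h
    rw [mem_sphere_zero_iff_norm] at hw; linarith
  have hball : z ∈ ball (0 : ℂ) r := by simpa using hz
  have nonneg : ∀ n : ℕ, ∮ w in C(0, r), w ^ (n : ℤ) / (z - w) =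
      -(2 * π * I * z ^ (n : ℤ)) := by
    intro n
    have h1 := DiffContOnCl.circleIntegral_sub_inv_smul (f := fun w : ℂ => w ^ n)
      (c := 0) (R := r) (w := z) (by
        apply Differentiable.diffContOnCl; fun_prop) hball
    simp only [smul_eq_mul] at h1
    rw [zpow_natCast, ← h1, neg_eq_neg_one_mul, ← circleIntegral.integral_const_mul]
    refine circleIntegral.integral_congr hr.le fun w hw => ?_
    have := hzw w hw
    have h2 : w - z ≠ 0 := by rw [← neg_sub]; exact neg_ne_zero.2 this
    simp only [zpow_natCast]
    field_simp
    ring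
  rcases le_or_gt 0 e with he | he
  · rw [if_neg (not_lt.2 he)]
    obtain ⟨n, rfl⟩ := Int.eq_ofNat_of_zero_le he
    rw [nonneg n]; ring
  · rw [if_pos he, sub_self]
    obtain ⟨n, hn⟩ : ∃ n : ℕ, e = -((n : ℤ) + 1) := ⟨(-e - 1).toNat, by omega⟩
    subst hn
    clear he
    induction n with
    | zero =>
      have h1 : ∮ w in C(0, r), w ^ (-((0 : ℕ) + 1 : ℤ)) / (z - w) =
          ∮ w in C(0, r), (z⁻¹ * (w - 0)⁻¹ + z⁻¹ * (w ^ ((0 : ℕ) : ℤ) / (z - w))) := by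
        refine circleIntegral.integral_congr hr.le fun w hw => ?_
        have := hw0 w hw
        have := hzw w ‹_›
        simp
        field_simp
        ring
      rw [h1, circleIntegral.integral_add, circleIntegral.integral_const_mul,
        circleIntegral.integral_const_mul, nonneg 0,
        circleIntegral.integral_sub_inv_of_mem_ball (by simpa using hr)]
      · simp
      · refine ContinuousOn.circleIntegrable hr.le ?_
        refine continuousOn_const.mul (ContinuousOn.inv₀ (by fun_prop) fun w hw => ?_)
        simpa using hw0 w hw
      · refine ContinuousOn.circleIntegrable hr.le ?_
        simp only [zpow_natCast]
        exact continuousOn_const.mul (ContinuousOn.div (by fun_prop) (by fun_prop)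
          fun w hw => hzw w hw)
    | succ n ih =>
      have h1 : ∮ w in C(0, r), w ^ (-((n + 1 : ℕ) + 1 : ℤ)) / (z - w) =
          ∮ w in C(0, r), (z⁻¹ * (w - 0) ^ (-((n + 1 : ℕ) + 1 : ℤ)) +
            z⁻¹ * (w ^ (-((n : ℕ) + 1 : ℤ)) / (z - w))) := by
        refine circleIntegral.integral_congr hr.le fun w hw => ?_
        have hw := hw0 w hw
        have := hzw w ‹_›
        have e1 : w ^ (-((n : ℕ) + 1 : ℤ)) = w ^ (-((n + 1 : ℕ) + 1 : ℤ)) * w := by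
          rw [← zpow_add_one₀ hw]; congr 1
        simp only [sub_zero]
        rw [e1]
        field_simp
        ring
      rw [h1, circleIntegral.integral_add, circleIntegral.integral_const_mul,
        circleIntegral.integral_const_mul, ih,
        circleIntegral.integral_sub_zpow_of_ne (by push_cast; omega)]
      · simp
      · refine ContinuousOn.circleIntegrable hr.le ?_
        refine continuousOn_const.mul (ContinuousOn.zpow₀ (by fun_prop) _ fun w hw => Or.inl ?_)
        simpa using hw0 w hw
      · refine ContinuousOn.circleIntegrable hr.le ?_
        exact continuousOn_const.mul (ContinuousOn.div (ContinuousOn.zpow₀ (by fun_prop) _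
          fun w hw => Or.inl (hw0 w hw)) (by fun_prop)
          fun w hw => hzw w hw)

end

section

/-- The points at which `contourInt` may evaluate its integrand. -/
def contourDomain (p q : ℝ) : Set ℂ :=
  {ζ | sin ζ.im ≠ 0} ∪ {ζ | ζ.re = p ∧ ζ.im ∈ Ioo (-π) π} ∪
    {ζ | ζ.re = q ∧ ζ.im ∈ Ioo 0 (2 * π)}

section add

variable {g₁ g₂ g : ℂ → ℂ} {ξ c η d : ℕ → ℝ} {N : ℕ}

theorem horiz_mem_contourDomain {p q b : ℝ} (hb : b ∈ Ioo 0 π) (s : ℝ) :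
    (s + b * I : ℂ) ∈ contourDomain p q ∧ (s - b * I : ℂ) ∈ contourDomain p q := by
  have := (sin_pos_of_mem_Ioo hb).ne'
  constructor
  · left; left; simpa using this
  · left; left; simpa using this

theorem intervalIntegrable_horizInt {p q : ℝ} (h : ContinuousOn g (contourDomain p q)) {b : ℝ}
    (hb : b ∈ Ioo 0 π) (u v : ℝ) :
    IntervalIntegrable (fun s : ℝ => g (s + b * I) - g (s - b * I)) volume u v := by
  refine ContinuousOn.intervalIntegrable ?_
  refine ContinuousOn.sub ?_ ?_
  · exact h.comp (Continuous.continuousOn (by fun_prop)) fun s _ => (horiz_mem_contourDomain hb s).1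
  · exact h.comp (Continuous.continuousOn (by fun_prop)) fun s _ => (horiz_mem_contourDomain hb s).2

theorem intervalIntegrable_jumpInt {p q : ℝ} (h : ContinuousOn g (contourDomain p q)) {b b' : ℝ}
    (hb : b ∈ Ioo 0 π) (hb' : b' ∈ Ioo 0 π) (s : ℝ) :
    IntervalIntegrable (fun y : ℝ => (g (s + y * I) + g (s - y * I)) * I)
      volume b b' := by
  refine ContinuousOn.intervalIntegrable ?_
  have hm : ∀ y ∈ uIcc b b', y ∈ Ioo 0 π := fun y hy =>
    (Set.ordConnected_Ioo.uIcc_subset hb hb') hy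
  refine ContinuousOn.mul (ContinuousOn.add ?_ ?_) continuousOn_const
  · exact h.comp (Continuous.continuousOn (by fun_prop))
      fun y hy => (horiz_mem_contourDomain (hm y hy) s).1
  · exact h.comp (Continuous.continuousOn (by fun_prop))
      fun y hy => (horiz_mem_contourDomain (hm y hy) s).2

theorem intervalIntegrable_arcInt {p q b : ℝ} (h : ContinuousOn g (contourDomain p q))
    (hb : b ∈ Ioo 0 π) :
    IntervalIntegrable (fun y : ℝ => g (p + y * I) * I) volume (-b) b := by
  refine ContinuousOn.intervalIntegrable ?_
  refine ContinuousOn.mul ?_ continuousOn_const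
  refine h.comp (Continuous.continuousOn (by fun_prop)) fun y hy => ?_
  rw [uIcc_of_le (by linarith [hb.1])] at hy
  left; right
  simp only [mem_ofPred_eq, add_re, ofReal_re, mul_re, I_re,
    mul_zero, ofReal_im, I_im, mul_one, sub_self, add_zero, add_im,
    mul_im, zero_add, true_and]
  exact ⟨by linarith [hb.2, hy.1], by linarith [hb.2, hy.2]⟩

theorem intervalIntegrable_coarcInt {p q b : ℝ} (h : ContinuousOn g (contourDomain p q))
    (hb : b ∈ Ioo 0 π) :
    IntervalIntegrable (fun y : ℝ => g (q + y * I) * I) volume b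
      (2 * π - b) := by
  refine ContinuousOn.intervalIntegrable ?_
  refine ContinuousOn.mul ?_ continuousOn_const
  refine h.comp (Continuous.continuousOn (by fun_prop)) fun y hy => ?_
  rw [uIcc_of_le (by linarith [hb.2])] at hy
  right
  simp only [mem_ofPred_eq, add_re, ofReal_re, mul_re, I_re,
    mul_zero, ofReal_im, I_im, mul_one, sub_self, add_zero, add_im,
    mul_im, zero_add, true_and]
  exact ⟨by linarith [hb.1, hy.1], by linarith [hb.1, hy.2]⟩

theorem stairInt_add {p q : ℝ} (h₁ : ContinuousOn g₁ (contourDomain p q))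
    (h₂ : ContinuousOn g₂ (contourDomain p q)) (hc : ∀ k, c k ∈ Ioo 0 π) :
    stairInt (fun ζ => g₁ ζ + g₂ ζ) ξ c N = stairInt g₁ ξ c N + stairInt g₂ ξ c N := by
  have e1 : ∀ k, horizInt (fun ζ => g₁ ζ + g₂ ζ) (ξ k) (ξ (k + 1)) (c k) =
      horizInt g₁ (ξ k) (ξ (k + 1)) (c k) + horizInt g₂ (ξ k) (ξ (k + 1)) (c k) := by
    intro k
    unfold horizInt
    rw [← intervalIntegral.integral_add (intervalIntegrable_horizInt h₁ (hc k) _ _)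
      (intervalIntegrable_horizInt h₂ (hc k) _ _)]
    congr 1; funext s; ring
  have e2 : ∀ k, jumpInt (fun ζ => g₁ ζ + g₂ ζ) (ξ (k + 1)) (c k) (c (k + 1)) =
      jumpInt g₁ (ξ (k + 1)) (c k) (c (k + 1)) + jumpInt g₂ (ξ (k + 1)) (c k) (c (k + 1)) := by
    intro k
    unfold jumpInt
    rw [← intervalIntegral.integral_add (intervalIntegrable_jumpInt h₁ (hc k) (hc _) _)
      (intervalIntegrable_jumpInt h₂ (hc k) (hc _) _)]
    congr 1; funext s; ring
  unfold stairInt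
  simp only [e1, e2, sum_add_distrib]
  ring

theorem contourInt_add (h₁ : ContinuousOn g₁ (contourDomain (ξ (N + 1)) (η (N + 1))))
    (h₂ : ContinuousOn g₂ (contourDomain (ξ (N + 1)) (η (N + 1))))
    (hc : ∀ k, c k ∈ Ioo 0 π) (hd : ∀ k, d k ∈ Ioo 0 π) :
    contourInt (fun ζ => g₁ ζ + g₂ ζ) ξ c η d N =
      contourInt g₁ ξ c η d N + contourInt g₂ ξ c η d N := by
  have e3 : arcInt (fun ζ => g₁ ζ + g₂ ζ) (ξ (N + 1)) (c N) =
      arcInt g₁ (ξ (N + 1)) (c N) + arcInt g₂ (ξ (N + 1)) (c N) := by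
    unfold arcInt
    rw [← intervalIntegral.integral_add (intervalIntegrable_arcInt h₁ (hc _))
      (intervalIntegrable_arcInt h₂ (hc _))]
    congr 1; funext s; ring
  have e4 : coarcInt (fun ζ => g₁ ζ + g₂ ζ) (η (N + 1)) (d N) =
      coarcInt g₁ (η (N + 1)) (d N) + coarcInt g₂ (η (N + 1)) (d N) := by
    unfold coarcInt
    rw [← intervalIntegral.integral_add (intervalIntegrable_coarcInt h₁ (hd _))
      (intervalIntegrable_coarcInt h₂ (hd _))]
    congr 1; funext s; ring
  unfold contourInt
  rw [stairInt_add h₁ h₂ hc, stairInt_add h₁ h₂ hd, e3, e4]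
  ring

theorem stairInt_congr {p q : ℝ} (h : EqOn g₁ g₂ (contourDomain p q))
    (hc : ∀ k, c k ∈ Ioo 0 π) : stairInt g₁ ξ c N = stairInt g₂ ξ c N := by
  unfold stairInt horizInt jumpInt
  congr 1
  · refine sum_congr rfl fun k _ => intervalIntegral.integral_congr fun s _ => ?_
    have := horiz_mem_contourDomain (p := p) (q := q) (hc k) s
    simp only [h this.1, h this.2]
  · refine sum_congr rfl fun k _ => intervalIntegral.integral_congr fun y hy => ?_
    have hm : y ∈ Ioo 0 π := (Set.ordConnected_Ioo.uIcc_subset (hc k) (hc (k + 1))) hy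
    have := horiz_mem_contourDomain (p := p) (q := q) hm (ξ (k + 1))
    simp only [h this.1, h this.2]

theorem contourInt_congr (h : EqOn g₁ g₂ (contourDomain (ξ (N + 1)) (η (N + 1))))
    (hc : ∀ k, c k ∈ Ioo 0 π) (hd : ∀ k, d k ∈ Ioo 0 π) :
    contourInt g₁ ξ c η d N = contourInt g₂ ξ c η d N := by
  unfold contourInt
  rw [stairInt_congr h hc, stairInt_congr h hd]
  congr 1
  · congr 2
    unfold arcInt
    refine intervalIntegral.integral_congr fun y hy => ?_
    have := hc N
    rw [uIcc_of_le (by linarith [this.1])] at hy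
    have hm : (ξ (N + 1) + y * I : ℂ) ∈ contourDomain (ξ (N + 1)) (η (N + 1)) := by
      left; right
      simp only [mem_ofPred_eq, add_re, ofReal_re, mul_re, I_re,
        mul_zero, ofReal_im, I_im, mul_one, sub_self, add_zero, add_im,
        mul_im, zero_add, true_and]
      exact ⟨by linarith [this.2, hy.1], by linarith [this.2, hy.2]⟩
    simp only [h hm]
  · unfold coarcInt
    refine intervalIntegral.integral_congr fun y hy => ?_
    have := hd N
    rw [uIcc_of_le (by linarith [this.2])] at hy
    have hm : (η (N + 1) + y * I : ℂ) ∈ contourDomain (ξ (N + 1)) (η (N + 1)) := by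
      right
      simp only [mem_ofPred_eq, add_re, ofReal_re, mul_re, I_re,
        mul_zero, ofReal_im, I_im, mul_one, sub_self, add_zero, add_im,
        mul_im, zero_add, true_and]
      exact ⟨by linarith [this.1, hy.1], by linarith [this.1, hy.2]⟩
    simp only [h hm]

end add

/-- On the contour one stays away from the nonpositive numbers, apart from the circle of radius
`e^q`, and from the nonnegative ones, apart from the circle of radius `e^p`. -/
theorem exp_of_mem_contourDomain {p q : ℝ} {ζ : ℂ} (hζ : ζ ∈ contourDomain p q) :
    (Complex.exp ζ ∈ slitPlane ∨ ‖Complex.exp ζ‖ = exp q) ∧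
      (-Complex.exp ζ ∈ slitPlane ∨ ‖Complex.exp ζ‖ = exp p) := by
  rcases hζ with (h | h) | h
  · have him : (Complex.exp ζ).im ≠ 0 := by
      rw [exp_im]
      exact mul_ne_zero (exp_pos _).ne' h
    exact ⟨Or.inl (Or.inr him), Or.inl (Or.inr (by simpa using him))⟩
  · refine ⟨Or.inl (exp_mem_slitPlane_of_im h.2), Or.inr ?_⟩
    rw [norm_exp, h.1]
  · refine ⟨Or.inr (by rw [norm_exp, h.1]), Or.inl ?_⟩
    have : -Complex.exp ζ = Complex.exp (ζ - π * I) := by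
      rw [Complex.exp_sub, exp_pi_mul_I, div_neg, div_one]
    rw [this]
    apply exp_mem_slitPlane_of_im
    simp only [sub_im, mul_im, ofReal_re, I_im, mul_one,
      ofReal_im, I_re, mul_zero, add_zero]
    exact ⟨by linarith [h.2.1], by linarith [h.2.2]⟩

theorem not_mem_slitPlane_of_nonpos {z : ℂ} (h : z.im = 0) (h' : z.re ≤ 0) :
    z ∉ slitPlane := by
  rintro (h1 | h1)
  · linarith
  · exact h1 h

open Polynomial in
/-- A rational function may be integrated along a staircase contour instead of a circle that
separates its poles in the same way. -/
theorem circleIntegral_eq_contourInt {s : Multiset ℂ} {B U : ℂ[X]}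
    (hs : ∀ a ∈ s, a.im = 0 ∧ a.re ≤ 0) (hB : ∀ z, B.eval z = 0 → z.im = 0 ∧ 0 < z.re)
    {z₀ : ℂ} {R : ℝ} (hR : 0 < R) (hsR : ∀ a ∈ s, a ∈ ball z₀ R)
    (hBR : ∀ z ∈ closedBall z₀ R, B.eval z ≠ 0)
    {ξ c η d : ℕ → ℝ} {N : ℕ} (hsη : ∀ a ∈ s, ‖a‖ < exp (η (N + 1)))
    (hBξ : ∀ z, B.eval z = 0 → exp (ξ (N + 1)) < ‖z‖)
    (hc : ∀ k, c k ∈ Ioo 0 π) (hd : ∀ k, d k ∈ Ioo 0 π) (h0 : ξ 0 = η 0)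
    (h0' : c 0 = d 0) :
    ∮ z in C(z₀, R), U.eval z * ((s.map fun a => z - a).prod)⁻¹ * (B.eval z)⁻¹ =
      contourInt (expPull fun z => U.eval z * ((s.map fun a => z - a).prod)⁻¹ * (B.eval z)⁻¹)
        ξ c η d N := by
  set A : ℂ[X] := (s.map fun a => X - C a).prod with hA
  have hAe : ∀ z, (s.map fun a => z - a).prod = A.eval z := by
    intro z
    rw [hA, Polynomial.eval_multiset_prod, Multiset.map_map]
    simp
  have hA0 : ∀ z, A.eval z = 0 → z ∈ s := by
    intro z hz
    rw [← hAe, Multiset.prod_eq_zero_iff, Multiset.mem_map] at hz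
    obtain ⟨a, ha, h⟩ := hz
    rw [sub_eq_zero] at h
    exact h ▸ ha
  have hcop : IsCoprime A B := by
    rw [hA]
    refine IsCoprime.symm ?_
    suffices ∀ t : Multiset ℂ, (∀ a ∈ t, a ∈ s) →
        IsCoprime B (t.map fun a => X - C a).prod from this s fun _ h => h
    intro t
    induction t using Multiset.induction_on with
    | empty => intro _; simpa using isCoprime_one_right
    | cons a t ih =>
      intro h
      rw [Multiset.map_cons, Multiset.prod_cons]
      refine IsCoprime.mul_right ?_ (ih fun b hb => h b (Multiset.mem_cons_of_mem hb))
      refine IsCoprime.symm ((Irreducible.coprime_iff_not_dvd (irreducible_X_sub_C a)).2 ?_)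
      rw [dvd_iff_isRoot]
      intro hr
      have h1 := hB a hr
      have h2 := hs a (h a (Multiset.mem_cons_self a t))
      linarith [h1.2, h2.2]
  obtain ⟨u, v, huv⟩ := hcop
  have hsplit : ∀ z, A.eval z ≠ 0 → B.eval z ≠ 0 →
      U.eval z * (A.eval z)⁻¹ * (B.eval z)⁻¹ =
        (U * v).eval z * (A.eval z)⁻¹ + (U * u).eval z * (B.eval z)⁻¹ := by
    intro z h1 h2
    have h3 := congrArg (Polynomial.eval z) huv
    simp only [eval_add, eval_mul, eval_one] at h3 ⊢
    field_simp
    linear_combination -(U.eval z) * h3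
  have hAne : ∀ z, z ∈ slitPlane ∨ ‖z‖ = exp (η (N + 1)) → A.eval z ≠ 0 := by
    rintro z (hz | hz) h
    · exact not_mem_slitPlane_of_nonpos (hs z (hA0 z h)).1 (hs z (hA0 z h)).2 hz
    · exact (hsη z (hA0 z h)).ne hz
  have hBne : ∀ z, -z ∈ slitPlane ∨ ‖z‖ = exp (ξ (N + 1)) → B.eval z ≠ 0 := by
    rintro z (hz | hz) h
    · exact not_mem_slitPlane_of_nonpos (by simp [(hB z h).1])
        (by simpa using (hB z h).2.le) hz
    · exact (hBξ z h).ne' hz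
  have hAsph : ∀ z ∈ sphere z₀ R, A.eval z ≠ 0 := by
    intro z hz h
    have h1 := mem_ball.1 (hsR z (hA0 z h))
    rw [mem_sphere.1 hz] at h1
    exact lt_irrefl _ h1
  have hBsph : ∀ z ∈ sphere z₀ R, B.eval z ≠ 0 := fun z hz =>
    hBR z (sphere_subset_closedBall hz)
  -- the two parts of the contour integral
  have hdA : ∀ z, A.eval z ≠ 0 → DifferentiableAt ℂ (fun z => (U * v).eval z * (A.eval z)⁻¹) z :=
    fun z hz => (Polynomial.differentiable _ z).mul ((Polynomial.differentiable _ z).inv hz)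
  have hdB : ∀ z, B.eval z ≠ 0 → DifferentiableAt ℂ (fun z => (U * u).eval z * (B.eval z)⁻¹) z :=
    fun z hz => (Polynomial.differentiable _ z).mul ((Polynomial.differentiable _ z).inv hz)
  have hcontA : ContinuousOn (expPull fun z => (U * v).eval z * (A.eval z)⁻¹)
      (contourDomain (ξ (N + 1)) (η (N + 1))) := by
    intro ζ hζ
    have := hdA _ (hAne _ (exp_of_mem_contourDomain hζ).1)
    exact ((this.continuousAt.comp (f := Complex.exp) continuous_exp.continuousAt).mul
      continuous_exp.continuousAt).continuousWithinAt
  have hcontB : ContinuousOn (expPull fun z => (U * u).eval z * (B.eval z)⁻¹)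
      (contourDomain (ξ (N + 1)) (η (N + 1))) := by
    intro ζ hζ
    have := hdB _ (hBne _ (exp_of_mem_contourDomain hζ).2)
    exact ((this.continuousAt.comp (f := Complex.exp) continuous_exp.continuousAt).mul
      continuous_exp.continuousAt).continuousWithinAt
  simp only [hAe]
  have hR1 : contourInt (expPull fun z => U.eval z * (A.eval z)⁻¹ * (B.eval z)⁻¹) ξ c η d N =
      contourInt (expPull fun z => (U * v).eval z * (A.eval z)⁻¹) ξ c η d N +
        contourInt (expPull fun z => (U * u).eval z * (B.eval z)⁻¹) ξ c η d N := by
    rw [← contourInt_add hcontA hcontB hc hd]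
    refine contourInt_congr (fun ζ hζ => ?_) hc hd
    have h1 := exp_of_mem_contourDomain hζ
    dsimp only [expPull]
    rw [hsplit _ (hAne _ h1.1) (hBne _ h1.2)]
    ring
  rw [hR1, contourInt_eq_outer (fun z hz => (hdA z (hAne z (Or.inl hz))).differentiableWithinAt)
      (fun z hz => (hdA z (hAne z (Or.inr (by simpa using hz)))).continuousAt.continuousWithinAt)
      hc hd h0 h0',
    contourInt_eq_inner (fun z hz => (hdB z (hBne z (Or.inl hz))).differentiableWithinAt)
      (fun z hz => (hdB z (hBne z (Or.inr (by simpa using hz)))).continuousAt.continuousWithinAt)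
      hc hd h0 h0']
  have hL : ∮ z in C(z₀, R), U.eval z * (A.eval z)⁻¹ * (B.eval z)⁻¹ =
      (∮ z in C(z₀, R), (U * v).eval z * (A.eval z)⁻¹) +
        ∮ z in C(z₀, R), (U * u).eval z * (B.eval z)⁻¹ := by
    rw [← circleIntegral.integral_add]
    · exact circleIntegral.integral_congr hR.le fun z hz => hsplit z (hAsph z hz) (hBsph z hz)
    · exact ContinuousOn.circleIntegrable hR.le fun z hz =>
        (hdA z (hAsph z hz)).continuousAt.continuousWithinAt
    · exact ContinuousOn.circleIntegrable hR.le fun z hz =>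
        (hdB z (hBsph z hz)).continuousAt.continuousWithinAt
  rw [hL]
  have hB0 : ∀ (w : ℂ) (T : ℝ), 0 < T → (∀ z ∈ closedBall w T, B.eval z ≠ 0) →
      ∮ z in C(w, T), (U * u).eval z * (B.eval z)⁻¹ = 0 := by
    intro w T hT h
    exact circleIntegral_eq_zero_of_differentiable_on_off_countable hT.le countable_empty
      (fun z hz => (hdB z (h z hz)).continuousAt.continuousWithinAt)
      fun z hz => hdB z (h z (ball_subset_closedBall hz.1))
  rw [hB0 z₀ R hR hBR, hB0 0 _ (exp_pos _)]
  · obtain ⟨val, hval⟩ := circleIntegral_rational_eq s (U * v)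
    simp only [hAe] at hval
    rw [hval _ _ hR hsR, hval _ _ (exp_pos _) fun a ha => by simpa using hsη a ha]
  · intro z hz h
    have := hBξ z h
    rw [mem_closedBall_zero_iff] at hz
    linarith

end

section

variable {n k : ℕ} (x : Fin n → ℝ) (y : Fin k → ℝ)

theorem prod_one_add_div {z : ℂ} (hz : z ≠ 0) :
    ∏ j, (1 + (y j : ℂ) / z) = (∏ j, (z + y j)) * z ^ (-(k : ℤ)) := by
  have h : ∀ j, (1 + (y j : ℂ) / z) = (z + y j) * z⁻¹ := fun j => by field_simp
  simp only [h]
  rw [prod_mul_distrib, prod_const, card_univ, card_fin, zpow_neg,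
    zpow_natCast, inv_pow]

theorem inv_genFun (z : ℂ) :
    (genFun x y z)⁻¹ = (∏ i, (1 - (x i : ℂ) * z)) * ∏ j, (1 + (y j : ℂ) / z) := by
  unfold genFun
  rw [mul_inv, prod_inv_distrib, prod_inv_distrib, inv_inv, inv_inv]

open Polynomial in
theorem exists_laurent (p' : ℤ) : ∃ (P : ℂ[X]) (M : ℕ), ∀ w : ℂ, w ≠ 0 →
    w ^ p' / genFun x y w = P.eval w * w ^ (-(M : ℤ)) := by
  refine ⟨X ^ (p'.natAbs + p').toNat * (∏ i, (1 - C (x i : ℂ) * X)) * ∏ j, (X + C (y j : ℂ)),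
    k + p'.natAbs, fun w hw => ?_⟩
  rw [div_eq_mul_inv, inv_genFun, prod_one_add_div y hw]
  simp only [eval_mul, eval_pow, eval_X, eval_prod, eval_sub, eval_one, eval_C, eval_add]
  have h : w ^ p' * w ^ (-(k : ℤ)) =
      w ^ (p'.natAbs + p').toNat * w ^ (-((k + p'.natAbs : ℕ) : ℤ)) := by
    rw [← zpow_natCast w (p'.natAbs + p').toNat, ← zpow_add₀ hw, ← zpow_add₀ hw]
    congr 1
    have : ((p'.natAbs + p').toNat : ℤ) = p'.natAbs + p' := Int.toNat_of_nonneg (by omega)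
    rw [this]
    push_cast
    ring
  linear_combination (∏ i, (1 - (x i : ℂ) * w)) * (∏ j, (w + (y j : ℂ))) * h

/-- The `w`-integral of the correlation kernel, for a contour of small radius. -/
def outerInt (p' : ℤ) (z : ℂ) : ℂ :=
  ∮ w in C(0, ‖z‖ / 2), w ^ p' / genFun x y w / (z - w)

open Polynomial in
theorem exists_outer (p' : ℤ) : ∃ (Q : ℂ[X]) (M : ℕ), ∀ z : ℂ, z ≠ 0 →
    (∀ r, 0 < r → r < ‖z‖ →
      ∮ w in C(0, r), w ^ p' / genFun x y w / (z - w) = Q.eval z * z ^ (-(M : ℤ))) ∧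
    ∀ r, ‖z‖ < r → ∮ w in C(0, r), w ^ p' / genFun x y w / (z - w) =
      Q.eval z * z ^ (-(M : ℤ)) - 2 * π * I * (z ^ p' / genFun x y z) := by
  obtain ⟨P, M, hP⟩ := exists_laurent x y p'
  have hexp : ∀ w : ℂ, w ≠ 0 → w ^ p' / genFun x y w =
      ∑ d ∈ Finset.range (P.natDegree + 1), P.coeff d * w ^ ((d : ℤ) - M) := by
    intro w hw
    rw [hP w hw, eval_eq_sum_range, sum_mul]
    refine sum_congr rfl fun d _ => ?_
    rw [mul_assoc, sub_eq_add_neg, zpow_add₀ hw, zpow_natCast]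
  have hIntegr : ∀ z : ℂ, ∀ r, 0 < r → r ≠ ‖z‖ →
      ∮ w in C(0, r), w ^ p' / genFun x y w / (z - w) =
      ∑ d ∈ Finset.range (P.natDegree + 1), P.coeff d *
        ∮ w in C(0, r), w ^ ((d : ℤ) - M) / (z - w) := by
    intro z r hr hrz
    have hw0 : ∀ w ∈ sphere (0 : ℂ) r, w ≠ 0 := by
      intro w hw h; rw [h] at hw; simp at hw; linarith
    have hzw : ∀ w ∈ sphere (0 : ℂ) r, z - w ≠ 0 := by
      intro w hw h
      rw [sub_eq_zero] at h; subst h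
      rw [mem_sphere_zero_iff_norm] at hw; exact hrz hw.symm
    simp only [← circleIntegral.integral_const_mul]
    rw [← circleIntegral.integral_fun_sum]
    · refine circleIntegral.integral_congr hr.le fun w hw => ?_
      rw [hexp w (hw0 w hw), sum_div]
      refine sum_congr rfl fun d _ => ?_
      rw [mul_div_assoc]
    · intro d _
      refine ContinuousOn.circleIntegrable hr.le ?_
      exact continuousOn_const.mul (ContinuousOn.div (ContinuousOn.zpow₀ (by fun_prop) _
          fun w hw => Or.inl (hw0 w hw)) (by fun_prop) hzw)
  let Q : ℂ[X] := ∑ d ∈ Finset.range (P.natDegree + 1),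
    if d < M then C (2 * π * I * P.coeff d) * X ^ d else 0
  have hQ : ∀ z : ℂ, z ≠ 0 → Q.eval z * z ^ (-(M : ℤ)) =
      ∑ d ∈ Finset.range (P.natDegree + 1), P.coeff d *
        if (d : ℤ) - M < 0 then 2 * π * I * z ^ ((d : ℤ) - M) else 0 := by
    intro z hz
    simp only [Q, eval_finsetSum, sum_mul]
    refine sum_congr rfl fun d _ => ?_
    by_cases h : d < M
    · rw [if_pos h, if_pos (by omega), sub_eq_add_neg, zpow_add₀ hz, zpow_natCast]
      simp only [eval_mul, eval_C, eval_pow, eval_X]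
      ring
    · rw [if_neg h, if_neg (by omega)]
      simp
  refine ⟨Q, M, fun z hz => ⟨fun r hr hrz => ?_, fun r hr => ?_⟩⟩
  · rw [hIntegr z r hr hrz.ne, hQ z hz]
    refine sum_congr rfl fun d _ => ?_
    rw [circleIntegral_zpow_div_sub_of_lt hr hrz]
  · rw [hIntegr z r ((norm_nonneg z).trans_lt hr) hr.ne', hQ z hz, hexp z hz, mul_sum,
      ← sum_sub_distrib]
    refine sum_congr rfl fun d _ => ?_
    rw [circleIntegral_zpow_div_sub_of_gt hz hr]
    ring

theorem circleIntegral_eq_outerInt (p' : ℤ) {z : ℂ} {r : ℝ} (hr : 0 < r) (hz : r < ‖z‖) :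
    ∮ w in C(0, r), w ^ p' / genFun x y w / (z - w) = outerInt x y p' z := by
  obtain ⟨Q, M, h⟩ := exists_outer x y p'
  have hz0 : z ≠ 0 := norm_pos_iff.1 (hr.trans hz)
  have hn : 0 < ‖z‖ := hr.trans hz
  unfold outerInt
  rw [(h z hz0).1 r hr hz, (h z hz0).1 _ (by positivity) (by linarith)]

theorem circleIntegral_eq_outerInt_sub (p' : ℤ) {z : ℂ} {r : ℝ} (hz0 : z ≠ 0) (hz : ‖z‖ < r) :
    ∮ w in C(0, r), w ^ p' / genFun x y w / (z - w) =
      outerInt x y p' z - 2 * π * I * (z ^ p' / genFun x y z) := by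
  obtain ⟨Q, M, h⟩ := exists_outer x y p'
  have hn : 0 < ‖z‖ := norm_pos_iff.2 hz0
  unfold outerInt
  rw [(h z hz0).2 r hz, (h z hz0).1 _ (by positivity) (by linarith)]

variable {x y}

open Polynomial in
/-- The correlation kernel as an integral over a staircase contour. -/
theorem corrKernel_eq_contourInt (hx : ∀ i, 0 < x i) (hy : ∀ j, 0 ≤ y j) (Γ : Contours x y)
    (p p' : ℤ) {ξ c η d : ℕ → ℝ} {N : ℕ} (hxξ : ∀ i, exp (ξ (N + 1)) * x i < 1)
    (hyη : ∀ j, y j < exp (η (N + 1)))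
    (hc : ∀ k, c k ∈ Ioo 0 π) (hd : ∀ k, d k ∈ Ioo 0 π) (h0 : ξ 0 = η 0)
    (h0' : c 0 = d 0) :
    corrKernel x y Γ p p' = ((2 * (π : ℂ) * I) ^ 2)⁻¹ *
      contourInt (expPull fun z => genFun x y z * z ^ (-p - 1) * outerInt x y p' z) ξ c η d N := by
  obtain ⟨Q, M, hQ⟩ := exists_outer x y p'
  have houter : ∀ z : ℂ, z ≠ 0 → outerInt x y p' z = Q.eval z * z ^ (-(M : ℤ)) := by
    intro z hz
    have hn : 0 < ‖z‖ := norm_pos_iff.2 hz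
    exact (hQ z hz).1 _ (by positivity) (by linarith)
  set e : ℤ := k - p - 1 - M with he
  set s : Multiset ℂ := Multiset.replicate (-e).toNat 0 +
    (Finset.univ.val.map fun j : Fin k => -(y j : ℂ)) with hs
  have hsmem : ∀ a ∈ s, a = 0 ∨ ∃ j, a = -(y j : ℂ) := by
    intro a ha
    rw [hs, Multiset.mem_add, Multiset.mem_map] at ha
    rcases ha with ha | ⟨j, _, rfl⟩
    · exact Or.inl (Multiset.eq_of_mem_replicate ha)
    · exact Or.inr ⟨j, rfl⟩
  set B : ℂ[X] := ∏ i, (1 - C (x i : ℂ) * X) with hBdef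
  have hBe : ∀ z, B.eval z = ∏ i, (1 - (x i : ℂ) * z) := by
    intro z; rw [hBdef, eval_prod]; simp
  have hB0 : ∀ z, B.eval z = 0 → ∃ i, z = (x i : ℂ)⁻¹ := by
    intro z hz
    rw [hBe, Finset.prod_eq_zero_iff] at hz
    obtain ⟨i, _, h⟩ := hz
    refine ⟨i, ?_⟩
    have : (x i : ℂ) ≠ 0 := ofReal_ne_zero.2 (hx i).ne'
    rw [← one_div, eq_div_iff this]
    linear_combination -h
  have hrat : ∀ z : ℂ, z ≠ 0 → genFun x y z * z ^ (-p - 1) * outerInt x y p' z =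
      (Q * X ^ e.toNat).eval z * ((s.map fun a => z - a).prod)⁻¹ * (B.eval z)⁻¹ := by
    intro z hz
    have hsprod : (s.map fun a => z - a).prod = z ^ (-e).toNat * ∏ j, (z + (y j : ℂ)) := by
      rw [hs, Multiset.map_add, Multiset.prod_add, Multiset.map_replicate, Multiset.prod_replicate,
        sub_zero, Multiset.map_map]
      congr 1
      simp only [Function.comp_def, sub_neg_eq_add]
      rfl
    have hg : genFun x y z = z ^ (k : ℤ) * (B.eval z)⁻¹ * (∏ j, (z + (y j : ℂ)))⁻¹ := by
      rw [← inv_inv (genFun x y z), inv_genFun, prod_one_add_div y hz, hBe, mul_inv, mul_inv,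
        zpow_neg, inv_inv]
      ring
    have hze : z ^ e.toNat * (z ^ (-e).toNat)⁻¹ = z ^ e := by
      rw [← zpow_natCast, ← zpow_natCast, ← zpow_neg, ← zpow_add₀ hz]
      congr 1
      omega
    have hz2 : z ^ (k : ℤ) * z ^ (-p - 1) * z ^ (-(M : ℤ)) = z ^ e := by
      rw [← zpow_add₀ hz, ← zpow_add₀ hz]; congr 1; rw [he]; ring
    rw [houter z hz, hg, hsprod, mul_inv, eval_mul, eval_pow, eval_X]
    linear_combination (B.eval z)⁻¹ * (∏ j, (z + (y j : ℂ)))⁻¹ * Q.eval z * (hz2 - hze)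
  have hΓR : 0 < Γ.radius := pos_of_mem_ball Γ.zero_mem
  have hΓ0 : ∀ z ∈ sphere Γ.center Γ.radius, z ≠ 0 := fun z hz h => by
    have := Γ.lt_norm z hz
    rw [h, norm_zero] at this
    exact absurd Γ.r_pos (not_lt.2 this.le)
  have hmain := circleIntegral_eq_contourInt (s := s) (B := B) (U := Q * X ^ e.toNat)
    (z₀ := Γ.center) (R := Γ.radius) (ξ := ξ) (c := c) (η := η) (d := d) (N := N)
    (by
      intro a ha
      rcases hsmem a ha with rfl | ⟨j, rfl⟩
      · simp
      · simpa using hy j)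
    (by
      intro z hz
      obtain ⟨i, rfl⟩ := hB0 z hz
      rw [← Complex.ofReal_inv]
      simpa using hx i)
    hΓR
    (by
      intro a ha
      rcases hsmem a ha with rfl | ⟨j, rfl⟩
      · exact Γ.zero_mem
      · exact Γ.neg_y_mem j)
    (by
      intro z hz h
      obtain ⟨i, rfl⟩ := hB0 z h
      exact Γ.inv_x_notMem i hz)
    (by
      intro a ha
      rcases hsmem a ha with rfl | ⟨j, rfl⟩
      · simpa using exp_pos _
      · rw [norm_neg, norm_real, norm_eq_abs, abs_of_nonneg (hy j)]
        exact hyη j)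
    (by
      intro z hz
      obtain ⟨i, rfl⟩ := hB0 z hz
      rw [norm_inv, norm_real, norm_eq_abs, abs_of_pos (hx i)]
      rw [← one_div, lt_div_iff₀ (hx i)]
      exact hxξ i)
    hc hd h0 h0'
  unfold corrKernel
  congr 1
  trans ∮ z in C(Γ.center, Γ.radius), genFun x y z * z ^ (-p - 1) * outerInt x y p' z
  · refine circleIntegral.integral_congr hΓR.le fun z hz => ?_
    rw [← circleIntegral_eq_outerInt x y p' Γ.r_pos (Γ.lt_norm z hz),
      ← circleIntegral.integral_const_mul]
    congr 1
    funext w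
    ring
  · trans ∮ z in C(Γ.center, Γ.radius),
      (Q * X ^ e.toNat).eval z * ((s.map fun a => z - a).prod)⁻¹ * (B.eval z)⁻¹
    · exact circleIntegral.integral_congr hΓR.le fun z hz => hrat z (hΓ0 z hz)
    · rw [hmain]
      refine contourInt_congr (fun ζ _ => ?_) hc hd
      dsimp only [expPull]
      rw [hrat _ (exp_ne_zero ζ)]

end

theorem integral_lorentz_le {b θ₀ u v : ℝ} (hb : 0 < b) :
    ∫ θ in u..v, (1 + (b * (θ - θ₀)) ^ 2)⁻¹ ≤ π / b := by
  have h : ∀ θ ∈ uIcc u v, HasDerivAt (fun θ => Real.arctan (b * (θ - θ₀)) / b)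
      ((1 + (b * (θ - θ₀)) ^ 2)⁻¹) θ := by
    intro θ _
    have h1 : HasDerivAt (fun θ => b * (θ - θ₀)) b θ := by
      simpa using ((hasDerivAt_id θ).sub_const θ₀).const_mul b
    refine (h1.arctan.div_const b).congr_deriv ?_
    field_simp
  have hc : Continuous fun θ : ℝ => (1 + (b * (θ - θ₀)) ^ 2)⁻¹ :=
    Continuous.inv₀ (by fun_prop) fun θ => by positivity
  rw [intervalIntegral.integral_eq_sub_of_hasDerivAt h (hc.intervalIntegrable _ _), ← sub_div]
  refine div_le_div_of_nonneg_right ?_ hb.le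
  have := Real.arctan_lt_pi_div_two (b * (v - θ₀))
  have := Real.neg_pi_div_two_lt_arctan (b * (u - θ₀))
  linarith

theorem exp_neg_sq_le (t : ℝ) (ht : 0 ≤ t) : exp (-t ^ 2) ≤ 2 * (1 + t)⁻¹ := by
  rw [exp_neg, ← div_eq_mul_inv, inv_eq_one_div, div_le_div_iff₀ (exp_pos _) (by linarith)]
  have := add_one_le_exp (t ^ 2)
  nlinarith [sq_nonneg (t - 1)]

theorem integral_exp_cos_half_le {β a₀ : ℝ} (hβ : 0 < β) (ha : |a₀| ≤ 1) :
    ∫ θ in (0 : ℝ)..Real.pi, exp (-(β ^ 2 * |cos θ - a₀|) ^ 2) ≤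
      2 * (π / (β / π)) := by
  have hpi := pi_pos
  rw [abs_le] at ha
  have hle : ∀ θ ∈ Icc (0 : ℝ) π, exp (-(β ^ 2 * |cos θ - a₀|) ^ 2) ≤
      2 * (1 + (β / π * (θ - arccos a₀)) ^ 2)⁻¹ := by
    intro θ hθ
    refine (exp_neg_sq_le _ (by positivity)).trans ?_
    have h1 := sq_sub_le_abs_cos_sub_cos hθ ⟨arccos_nonneg a₀, arccos_le_pi a₀⟩
    rw [Real.cos_arccos ha.1 ha.2] at h1
    refine mul_le_mul_of_nonneg_left (inv_anti₀ (by positivity) ?_) zero_le_two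
    have h2 : (β / π * (θ - arccos a₀)) ^ 2 ≤
        β ^ 2 * (2 / π ^ 2 * (θ - arccos a₀) ^ 2) := by
      have : 0 ≤ (β / π * (θ - arccos a₀)) ^ 2 := sq_nonneg _
      calc _ ≤ 2 * (β / π * (θ - arccos a₀)) ^ 2 := by linarith
        _ = _ := by field_simp
    have h3 := mul_le_mul_of_nonneg_left h1 (sq_nonneg β)
    linarith
  calc _ ≤ ∫ θ in (0 : ℝ)..Real.pi, 2 * (1 + (β / π * (θ - arccos a₀)) ^ 2)⁻¹ := by
        refine intervalIntegral.integral_mono_on hpi.le ?_ ?_ hle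
        · exact Continuous.intervalIntegrable (by fun_prop) _ _
        · refine Continuous.intervalIntegrable ?_ _ _
          exact continuous_const.mul (Continuous.inv₀ (by fun_prop) fun θ => by positivity)
    _ ≤ _ := by
        rw [intervalIntegral.integral_const_mul]
        exact mul_le_mul_of_nonneg_left (integral_lorentz_le (by positivity)) zero_le_two

theorem integral_exp_cos_le {β a₀ : ℝ} (hβ : 0 < β) (ha : |a₀| ≤ 1) :
    ∫ θ in (0 : ℝ)..(2 * π), exp (-(β ^ 2 * |cos θ - a₀|) ^ 2) ≤
      4 * π ^ 2 / β := by
  have hpi := pi_pos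
  have hIntegr : ∀ u v, IntervalIntegrable
      (fun θ => exp (-(β ^ 2 * |cos θ - a₀|) ^ 2)) volume u v :=
    fun u v => Continuous.intervalIntegrable (by fun_prop) _ _
  have h2 : ∫ θ in π..(2 * π), exp (-(β ^ 2 * |cos θ - a₀|) ^ 2) =
      ∫ θ in (0 : ℝ)..Real.pi, exp (-(β ^ 2 * |cos θ - a₀|) ^ 2) := by
    have := intervalIntegral.integral_comp_sub_left (a := 0) (b := π)
      (fun θ => exp (-(β ^ 2 * |cos θ - a₀|) ^ 2)) (2 * π)
    simp only [cos_two_pi_sub] at this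
    rw [this]
    congr 1 <;> ring
  rw [← intervalIntegral.integral_add_adjacent_intervals (hIntegr 0 π) (hIntegr _ _), h2]
  have h := integral_exp_cos_half_le hβ ha
  have e : 4 * π ^ 2 / β = 2 * (π / (β / π)) + 2 * (π / (β / π)) := by
    field_simp; ring
  linarith

theorem sq_norm_sub_exp (z : ℂ) (ξ θ : ℝ) :
    ‖z - Complex.exp (ξ + θ * I)‖ ^ 2 = (‖z‖ - exp ξ) ^ 2 +
      2 * (‖z‖ * exp ξ) * (1 - cos (θ - z.arg)) := by
  have hz : z = ‖z‖ * Complex.exp (z.arg * I) := (Complex.norm_mul_exp_arg_mul_I z).symm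
  have h1 : (z.re) = ‖z‖ * cos z.arg := by rw [Complex.norm_mul_cos_arg]
  have h2 : (z.im) = ‖z‖ * sin z.arg := by rw [Complex.norm_mul_sin_arg]
  rw [sq_norm, normSq_apply]
  simp only [sub_re, sub_im, exp_re, exp_im, add_re,
    ofReal_re, mul_re, I_re, mul_zero, ofReal_im, I_im,
    mul_one, sub_self, add_zero, add_im, mul_im, zero_add]
  rw [Real.cos_sub]
  generalize exp ξ = r at *
  generalize hρ : ‖z‖ = ρ at *
  rw [h1, h2]
  have c1 := sin_sq_add_cos_sq z.arg
  have c2 := sin_sq_add_cos_sq θ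
  linear_combination ρ ^ 2 * c1 + r ^ 2 * c2

theorem abs_sub_le_norm_sub_exp (z : ℂ) (ξ θ : ℝ) :
    |‖z‖ - exp ξ| ≤ ‖z - Complex.exp (ξ + θ * I)‖ := by
  have := abs_norm_sub_norm_le z (Complex.exp (ξ + θ * I))
  rwa [norm_exp, show (ξ + θ * I : ℂ).re = ξ by simp] at this

theorem continuous_inv_norm_sub {z : ℂ} {ξ : ℝ} (hz : ‖z‖ ≠ exp ξ) :
    Continuous fun θ : ℝ => ‖z - Complex.exp (ξ + θ * I)‖⁻¹ := by
  refine Continuous.inv₀ (by fun_prop) fun θ => ?_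
  have := abs_sub_le_norm_sub_exp z ξ θ
  have h2 : 0 < |‖z‖ - exp ξ| := abs_pos.2 (sub_ne_zero.2 hz)
  linarith

theorem integral_inv_sq_norm_le {z : ℂ} {ξ r₁ : ℝ} (hr₁ : 0 < r₁) (hz : r₁ ≤ ‖z‖)
    (hξ : r₁ ≤ exp ξ) (hne : ‖z‖ ≠ exp ξ) :
    ∫ θ in (0 : ℝ)..(2 * π), (‖z - Complex.exp (ξ + θ * I)‖⁻¹) ^ 2 ≤
      π ^ 2 / (2 * r₁ * |‖z‖ - exp ξ|) := by
  have hpi := pi_pos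
  set d := |‖z‖ - exp ξ| with hd
  have hd0 : 0 < d := abs_pos.2 (sub_ne_zero.2 hne)
  have hcont : Continuous fun θ : ℝ => (‖z - Complex.exp (ξ + θ * I)‖⁻¹) ^ 2 :=
    (continuous_inv_norm_sub hne).pow 2
  have hper : Function.Periodic (fun θ : ℝ => (‖z - Complex.exp (ξ + θ * I)‖⁻¹) ^ 2)
      (2 * π) := by
    intro θ
    have : Complex.exp (ξ + (θ + 2 * π : ℝ) * I) =
        Complex.exp (ξ + θ * I) := by
      rw [← exp_periodic (ξ + θ * I)]
      congr 1; push_cast; ring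
    simp only [this]
  have h1 := hper.intervalIntegral_add_eq 0 (z.arg - π)
  rw [zero_add] at h1
  rw [h1]
  set b := 2 * r₁ / (π * d) with hb
  have hb0 : 0 < b := by positivity
  have hle : ∀ θ ∈ Icc (z.arg - π) (z.arg - π + 2 * π),
      (‖z - Complex.exp (ξ + θ * I)‖⁻¹) ^ 2 ≤
        (d ^ 2)⁻¹ * (1 + (b * (θ - z.arg)) ^ 2)⁻¹ := by
    intro θ hθ
    rw [inv_pow, ← mul_inv]
    refine inv_anti₀ (by positivity) ?_
    rw [sq_norm_sub_exp]
    have h2 : cos (θ - z.arg) ≤ 1 - 2 / π ^ 2 * (θ - z.arg) ^ 2 :=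
      Real.cos_le_one_sub_mul_cos_sq (abs_le.2 ⟨by linarith [hθ.1], by linarith [hθ.2]⟩)
    have h3 : r₁ * r₁ ≤ ‖z‖ * exp ξ := mul_le_mul hz hξ hr₁.le (norm_nonneg _)
    have h4 : r₁ * r₁ * (2 / π ^ 2 * (θ - z.arg) ^ 2) ≤
        ‖z‖ * exp ξ * (1 - cos (θ - z.arg)) :=
      mul_le_mul h3 (by linarith) (by positivity) (by positivity)
    have h5 : d ^ 2 * (1 + (b * (θ - z.arg)) ^ 2) =
        d ^ 2 + 2 * (r₁ * r₁ * (2 / π ^ 2 * (θ - z.arg) ^ 2)) := by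
      rw [hb]; field_simp
    rw [h5, hd, sq_abs]
    linarith
  calc _ ≤ ∫ θ in (z.arg - π)..(z.arg - π + 2 * π),
        (d ^ 2)⁻¹ * (1 + (b * (θ - z.arg)) ^ 2)⁻¹ := by
        refine intervalIntegral.integral_mono_on (by linarith) (hcont.intervalIntegrable _ _) ?_ hle
        refine Continuous.intervalIntegrable ?_ _ _
        exact continuous_const.mul (Continuous.inv₀ (by fun_prop) fun θ => by positivity)
    _ ≤ (d ^ 2)⁻¹ * (π / b) := by
        rw [intervalIntegral.integral_const_mul]
        exact mul_le_mul_of_nonneg_left (integral_lorentz_le hb0) (by positivity)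
    _ = _ := by rw [hb]; field_simp

/-- Bounds for the Cauchy transform of a function on a circle that is concentrated near two
conjugate points. -/
theorem norm_cauchy_le {ψ : ℂ → ℂ} {z : ℂ} {ξ r₁ K β a₀ : ℝ} (hr₁ : 0 < r₁) (hz : r₁ ≤ ‖z‖)
    (hξ : r₁ ≤ exp ξ) (hne : ‖z‖ ≠ exp ξ) (hK : 0 ≤ K) (hβ : 0 < β) (ha : |a₀| ≤ 1)
    (hψ : ∀ θ : ℝ, sin θ ≠ 0 → ‖ψ (Complex.exp (ξ + θ * I))‖ ≤
      K * exp (-(β ^ 2 * |cos θ - a₀|) ^ 2)) :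
    ‖∮ w in C(0, exp ξ), ψ w / (z - w)‖ ≤
        exp ξ * K * (4 * π ^ 2 / (β * |‖z‖ - exp ξ|)) ∧
      ‖∮ w in C(0, exp ξ), ψ w / (z - w)‖ ≤
        exp ξ * K * (π ^ 2 * (2 + (4 * r₁)⁻¹) /
          (sqrt β * sqrt |‖z‖ - exp ξ|)) := by
  have hpi := pi_pos
  set d := |‖z‖ - exp ξ| with hd
  have hd0 : 0 < d := abs_pos.2 (sub_ne_zero.2 hne)
  set E : ℝ → ℝ := fun θ => exp (-(β ^ 2 * |cos θ - a₀|) ^ 2) with hE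
  set J : ℝ → ℝ := fun θ => ‖z - Complex.exp (ξ + θ * I)‖⁻¹ with hI
  have hEc : Continuous E := by fun_prop
  have hIc : Continuous J := continuous_inv_norm_sub hne
  have hr := exp_pos ξ
  have main : ‖∮ w in C(0, exp ξ), ψ w / (z - w)‖ ≤
      ∫ θ in (0 : ℝ)..(2 * π), exp ξ * K * (E θ * J θ) := by
    unfold circleIntegral
    refine intervalIntegral.norm_integral_le_of_norm_le (by positivity) ?_
      (Continuous.intervalIntegrable (by fun_prop) _ _)
    have hae : ∀ᵐ θ : ℝ, sin θ ≠ 0 := by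
      have : {θ : ℝ | sin θ = 0}.Countable := by
        have : {θ : ℝ | sin θ = 0} = Set.range fun m : ℤ => (m : ℝ) * π := by
          ext θ; simp [Real.sin_eq_zero_iff]
        rw [this]; exact countable_range _
      have h0 := this.measure_zero volume
      rw [ae_iff]
      simpa using h0
    filter_upwards [hae] with θ hθ _
    have e : circleMap 0 (exp ξ) θ = Complex.exp (ξ + θ * I) := by
      rw [circleMap, zero_add, Complex.exp_add, ofReal_exp]
    rw [norm_smul, deriv_circleMap, norm_mul, norm_I, mul_one, norm_circleMap_zero,
      abs_of_pos hr, norm_div, e, mul_assoc, div_eq_mul_inv]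
    have := hψ θ hθ
    have hI0 : 0 ≤ J θ := by positivity
    calc exp ξ * (‖ψ (Complex.exp (ξ + θ * I))‖ * J θ) ≤
        exp ξ * (K * E θ * J θ) := by gcongr
      _ = _ := by ring
  rw [intervalIntegral.integral_const_mul] at main
  have hEint := integral_exp_cos_le hβ ha
  have hIint := integral_inv_sq_norm_le hr₁ hz hξ hne
  constructor
  · refine main.trans (mul_le_mul_of_nonneg_left ?_ (by positivity))
    calc ∫ θ in (0 : ℝ)..(2 * π), E θ * J θ ≤ ∫ θ in (0 : ℝ)..(2 * π), E θ * d⁻¹ := by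
          refine intervalIntegral.integral_mono_on (by positivity)
            (Continuous.intervalIntegrable (by fun_prop) _ _)
            (Continuous.intervalIntegrable (by fun_prop) _ _) fun θ _ => ?_
          refine mul_le_mul_of_nonneg_left ?_ (exp_pos _).le
          exact inv_anti₀ hd0 (abs_sub_le_norm_sub_exp z ξ θ)
      _ ≤ 4 * π ^ 2 / β * d⁻¹ := by
          rw [intervalIntegral.integral_mul_const]
          exact mul_le_mul_of_nonneg_right hEint (by positivity)
      _ = _ := by field_simp
  · refine main.trans (mul_le_mul_of_nonneg_left ?_ (by positivity))
    obtain ⟨sβ, hsβ, hsβ0⟩ : ∃ t, sqrt β = t ∧ 0 < t := ⟨_, rfl, sqrt_pos.2 hβ⟩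
    obtain ⟨sd, hsd, hsd0⟩ : ∃ t, sqrt d = t ∧ 0 < t := ⟨_, rfl, sqrt_pos.2 hd0⟩
    have eβ : β = sβ ^ 2 := by rw [← hsβ, sq_sqrt hβ.le]
    have ed : d = sd ^ 2 := by rw [← hsd, sq_sqrt hd0.le]
    set lam := sβ / sd with hlam
    have hl0 : 0 < lam := by positivity
    calc ∫ θ in (0 : ℝ)..(2 * π), E θ * J θ ≤
        ∫ θ in (0 : ℝ)..(2 * π), (lam / 2 * E θ + (2 * lam)⁻¹ * J θ ^ 2) := by
          refine intervalIntegral.integral_mono_on (by positivity)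
            (Continuous.intervalIntegrable (by fun_prop) _ _)
            (Continuous.intervalIntegrable (by fun_prop) _ _) fun θ _ => ?_
          have hE0 : 0 < E θ := exp_pos _
          have hE1 : E θ ≤ 1 := exp_le_one_iff.2 (neg_nonpos.2 (sq_nonneg _))
          have h1 : lam / 2 * E θ ^ 2 ≤ lam / 2 * E θ := by
            refine mul_le_mul_of_nonneg_left ?_ (by positivity)
            nlinarith
          have h2 : 0 ≤ (lam * E θ - J θ) ^ 2 / (2 * lam) := by positivity
          have h3 : (lam * E θ - J θ) ^ 2 / (2 * lam) =
              lam / 2 * E θ ^ 2 + (2 * lam)⁻¹ * J θ ^ 2 - E θ * J θ := by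
            field_simp; ring
          linarith
      _ ≤ lam / 2 * (4 * π ^ 2 / β) + (2 * lam)⁻¹ * (π ^ 2 / (2 * r₁ * d)) := by
          rw [intervalIntegral.integral_add (Continuous.intervalIntegrable (by fun_prop) _ _)
            (Continuous.intervalIntegrable (by fun_prop) _ _),
            intervalIntegral.integral_const_mul, intervalIntegral.integral_const_mul]
          gcongr
      _ = _ := by
          rw [hsβ, hsd, eβ, ed, hlam]
          field_simp
          ring

section

theorem abs_cos_lt_one {θ : ℝ} (h : sin θ ≠ 0) : |cos θ| < 1 := by
  rw [← sq_lt_one_iff_abs_lt_one]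
  have := sin_sq_add_cos_sq θ
  have : 0 < sin θ ^ 2 := by positivity
  linarith

theorem sq_norm_ofReal_sub_exp (X ξ θ : ℝ) :
    ‖(X : ℂ) - Complex.exp (ξ + θ * I)‖ ^ 2 = sqDist X (exp ξ) (cos θ) := by
  rw [sq_norm, normSq_apply]
  simp only [sub_re, sub_im, exp_re, exp_im, add_re,
    ofReal_re, mul_re, I_re, mul_zero, ofReal_im, I_im,
    mul_one, sub_self, add_zero, add_im, mul_im, zero_add, zero_sub]
  unfold sqDist
  have c2 := sin_sq_add_cos_sq θ
  linear_combination (exp ξ) ^ 2 * c2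

variable {n k : ℕ}

/-- The singularities `1 / xᵢ` and `-yⱼ` of the generating function. -/
def sites (x : Fin n → ℝ) (y : Fin k → ℝ) : Fin n ⊕ Fin k → ℝ :=
  Sum.elim (fun i => (x i)⁻¹) fun j => -y j

variable {x : Fin n → ℝ} {y : Fin k → ℝ}

/-- The modulus of `K(z) z^(-q)` in terms of the logarithmic potential. -/
theorem norm_genFun_eq (hx : ∀ i, 0 < x i) (q : ℤ) (ξ : ℝ) {θ : ℝ} (hθ : sin θ ≠ 0) :
    ‖genFun x y (Complex.exp (ξ + θ * I))‖ * exp (-(q * ξ)) =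
      (∏ i, (x i)⁻¹) * exp (logPot (k - q) (sites x y) ξ (cos θ)) := by
  set z := Complex.exp (ξ + θ * I) with hz
  have hzn : ‖z‖ = exp ξ := by rw [hz, norm_exp]; simp
  have hz0 : z ≠ 0 := exp_ne_zero _
  have hpos : ∀ X : ℝ, 0 < sqDist X (exp ξ) (cos θ) := fun X =>
    sqDist_pos (exp_pos ξ) (abs_cos_lt_one hθ)
  have hterm : ∀ X : ℝ, exp (-(log (sqDist X (exp ξ) (cos θ)) / 2)) =
      ‖(X : ℂ) - z‖⁻¹ := by
    intro X
    have h1 := sq_norm_ofReal_sub_exp X ξ θ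
    rw [← hz] at h1
    have h2 : 0 < ‖(X : ℂ) - z‖ := by
      have := hpos X
      rw [← h1] at this
      exact lt_of_le_of_ne (norm_nonneg _) fun h => by rw [← h] at this; simp at this
    rw [← h1, log_pow, Nat.cast_ofNat, mul_div_cancel_left₀ _ two_ne_zero, exp_neg,
      exp_log h2]
  have hU : exp (logPot (k - q) (sites x y) ξ (cos θ)) =
      exp ((k - q) * ξ) * ((∏ i, ‖((x i)⁻¹ : ℝ) - z‖⁻¹) * ∏ j, ‖((-y j : ℝ) : ℂ) - z‖⁻¹) := by
    unfold logPot
    rw [sub_eq_add_neg, exp_add, sum_div, ← sum_neg_distrib, Real.exp_sum,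
      Fintype.prod_sum_type]
    simp only [sites, Sum.elim_inl, Sum.elim_inr, hterm]
  have hgx : ∀ i, ‖(1 - (x i : ℂ) * z)⁻¹‖ = (x i)⁻¹ * ‖((x i)⁻¹ : ℝ) - z‖⁻¹ := by
    intro i
    have : (1 - (x i : ℂ) * z) = (x i : ℂ) * (((x i)⁻¹ : ℝ) - z) := by
      have : (x i : ℂ) ≠ 0 := ofReal_ne_zero.2 (hx i).ne'
      push_cast
      field_simp
    rw [this, norm_inv, norm_mul, mul_inv, norm_real, norm_eq_abs, abs_of_pos (hx i)]
  have hgy : ∀ j, ‖(1 + (y j : ℂ) / z)⁻¹‖ = exp ξ * ‖((-y j : ℝ) : ℂ) - z‖⁻¹ := by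
    intro j
    have : (1 + (y j : ℂ) / z) = -(((-y j : ℝ) : ℂ) - z) / z := by
      push_cast
      field_simp
      ring
    rw [this, norm_inv, norm_div, norm_neg, hzn, inv_div, div_eq_mul_inv]
  unfold genFun
  rw [norm_mul, norm_prod, norm_prod, hU]
  simp only [hgx, hgy]
  rw [prod_mul_distrib, prod_mul_distrib, prod_const, card_univ,
    card_fin, sub_mul, exp_sub, ← exp_nat_mul, exp_neg]
  field_simp

/-- The `w`-integral of the correlation kernel over the circle of radius `e^ξ`. -/
def cauchyInt (x : Fin n → ℝ) (y : Fin k → ℝ) (p' : ℤ) (ξ : ℝ) (z : ℂ) : ℂ :=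
  ∮ w in C(0, exp ξ), w ^ p' / genFun x y w / (z - w)

theorem norm_exp_zpow (ζ : ℂ) (e : ℤ) : ‖Complex.exp ζ ^ e‖ = exp (e * ζ.re) := by
  rw [norm_zpow, norm_exp, mul_comm, exp_mul, rpow_intCast]

theorem exp_sub_exp_ge {T ξ ξ₀ : ℝ} (h : |ξ| ≤ T) (h₀ : |ξ₀| ≤ T) :
    exp (-T) * |ξ - ξ₀| ≤ |exp ξ - exp ξ₀| := by
  have key : ∀ u v : ℝ, |u| ≤ T → v ≤ u → |v| ≤ T →
      exp (-T) * (u - v) ≤ exp u - exp v := by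
    intro u v _ huv hv
    have h1 := add_one_le_exp (u - v)
    have h2 : exp u = exp v * exp (u - v) := by rw [← exp_add]; congr 1; ring
    have h3 : exp (-T) ≤ exp v := exp_le_exp.2 (abs_le.1 hv).1
    have h4 : exp (-T) * (u - v) ≤ exp v * (u - v) :=
      mul_le_mul_of_nonneg_right h3 (by linarith)
    have h5 := mul_le_mul_of_nonneg_left h1 (exp_pos v).le
    rw [h2]; linarith
  rcases le_total ξ₀ ξ with hle | hle
  · rw [abs_of_nonneg (by linarith), abs_of_nonneg (sub_nonneg.2 (exp_le_exp.2 hle))]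
    exact key ξ ξ₀ h hle h₀
  · rw [abs_sub_comm, abs_sub_comm (exp ξ), abs_of_nonneg (by linarith),
      abs_of_nonneg (sub_nonneg.2 (exp_le_exp.2 hle))]
    exact key ξ₀ ξ h₀ hle h

/-- The constant in the bound for the integrand of the correlation kernel. -/
def kernelConst (l l' : ℤ) (T : ℝ) : ℝ :=
  4 * π ^ 2 * exp (((|l| + |l'| : ℤ) + 3) * T + 1)

theorem norm_integrand_le (hx : ∀ i, 0 < x i) {q l l' : ℤ} {α β T ξ₀ ξ θ : ℝ} {a : ℝ → ℝ}
    (ha : IsArcMin (sites x y) α a)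
    (hα : card (Fin n ⊕ Fin k) / 2 * (1 - α) ≤ 1) (hβ : 0 < β)
    (hβS : (β ^ 2) ^ 2 ≤
      exp ξ₀ ^ 2 * ∑ i, sites x y i ^ 2 / (|sites x y i| + exp ξ₀) ^ 4)
    (hξ₀ : |ξ₀| ≤ T) (hξ : |ξ| ≤ T) (hne : ξ ≠ ξ₀) (hθ : sin θ ≠ 0) :
    ‖expPull (fun z => genFun x y z * z ^ (-(q + l) - 1) * cauchyInt x y (q + l') ξ₀ z)
        (ξ + θ * I)‖ ≤
      kernelConst l l' T * exp (logPot (k - q) (sites x y) ξ (cos θ) -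
        logPot (k - q) (sites x y) ξ₀ (a ξ₀)) *
          min (1 / (β * |ξ - ξ₀|)) (1 / (sqrt β * sqrt |ξ - ξ₀|)) := by
  set X := sites x y with hX
  set U := logPot (k - q) X ξ (cos θ) with hU
  set M := logPot (k - q) X ξ₀ (a ξ₀) with hM
  set P := ∏ i, (x i)⁻¹ with hP
  have hP0 : 0 < P := Finset.prod_pos fun i _ => inv_pos.2 (hx i)
  have hT : 0 ≤ T := (abs_nonneg _).trans hξ
  have hψ : ∀ φ : ℝ, sin φ ≠ 0 →
      ‖(fun w => w ^ (q + l') / genFun x y w) (Complex.exp (ξ₀ + φ * I))‖ ≤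
      (exp (l' * ξ₀) * (P⁻¹ * exp (-M + 1))) *
        exp (-(β ^ 2 * |cos φ - a ξ₀|) ^ 2) := by
    intro φ hφ
    have h1 := norm_genFun_eq (x := x) (y := y) hx q ξ₀ hφ
    have h2 := ha.logPot_ge_sq (k - q) ξ₀ (abs_cos_lt_one hφ)
    have h3 : (β ^ 2 * |cos φ - a ξ₀|) ^ 2 ≤
        exp ξ₀ ^ 2 * (∑ i, X i ^ 2 / (|X i| + exp ξ₀) ^ 4) *
          (cos φ - a ξ₀) ^ 2 := by
      rw [mul_pow, sq_abs]
      exact mul_le_mul_of_nonneg_right hβS (sq_nonneg _)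
    have hU0 : M - 1 + (β ^ 2 * |cos φ - a ξ₀|) ^ 2 ≤
        logPot (k - q) X ξ₀ (cos φ) := by linarith
    have hg0 : ‖genFun x y (Complex.exp (ξ₀ + φ * I))‖ =
        P * exp (logPot (k - q) X ξ₀ (cos φ)) * exp (q * ξ₀) := by
      rw [← h1, mul_assoc, ← exp_add]; simp
    simp only [norm_div, norm_exp_zpow]
    rw [hg0]
    have hre : (ξ₀ + φ * I : ℂ).re = ξ₀ := by simp
    rw [hre, div_eq_mul_inv, mul_inv, mul_inv, ← exp_neg, ← exp_neg]
    have e1 : ((q + l' : ℤ) : ℝ) * ξ₀ = q * ξ₀ + l' * ξ₀ := by push_cast; ring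
    rw [e1, exp_add]
    have e2 : exp (q * ξ₀) * exp (l' * ξ₀) *
        (P⁻¹ * exp (-logPot (k - q) X ξ₀ (cos φ)) * exp (-(q * ξ₀))) =
        exp (l' * ξ₀) * (P⁻¹ * exp (-logPot (k - q) X ξ₀ (cos φ))) := by
      rw [exp_neg (q * ξ₀)]
      field_simp
    rw [e2, mul_assoc, mul_assoc, ← exp_add]
    gcongr
    linarith
  have hzn : ‖Complex.exp (ξ + θ * I)‖ = exp ξ := by rw [norm_exp]; simp
  have hexpne : exp ξ ≠ exp ξ₀ := fun h => hne (exp_injective h)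
  have hlow : ∀ u, |u| ≤ T → exp (-T) ≤ exp u := fun u hu =>
    exp_le_exp.2 (abs_le.1 hu).1
  have hC := norm_cauchy_le (ψ := fun w => w ^ (q + l') / genFun x y w)
    (z := Complex.exp (ξ + θ * I)) (ξ := ξ₀) (r₁ := exp (-T)) (exp_pos _)
    (by rw [hzn]; exact hlow ξ hξ) (hlow ξ₀ hξ₀) (by rw [hzn]; exact hexpne) (by positivity) hβ
    (ha.abs_lt_one ξ₀).le hψ
  rw [hzn] at hC
  have hdpos : 0 < |ξ - ξ₀| := abs_pos.2 (sub_ne_zero.2 hne)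
  have hdist := exp_sub_exp_ge hξ hξ₀
  have hcauchy : ‖cauchyInt x y (q + l') ξ₀ (Complex.exp (ξ + θ * I))‖ ≤
      exp ξ₀ * (exp (l' * ξ₀) * (P⁻¹ * exp (-M + 1))) *
        (4 * π ^ 2 * exp (2 * T) *
          min (1 / (β * |ξ - ξ₀|)) (1 / (sqrt β * sqrt |ξ - ξ₀|))) := by
    rw [mul_min_of_nonneg _ _ (by positivity), mul_min_of_nonneg _ _ (by positivity)]
    refine le_min (hC.1.trans ?_) (hC.2.trans ?_)
    · refine mul_le_mul_of_nonneg_left ?_ (by positivity)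
      have h2 : exp (2 * T) = exp T * exp T := by rw [← exp_add]; ring_nf
      have h1T : 1 ≤ exp T := one_le_exp hT
      calc 4 * π ^ 2 / (β * |exp ξ - exp ξ₀|) ≤
          4 * π ^ 2 / (β * (exp (-T) * |ξ - ξ₀|)) := by gcongr
        _ = 4 * π ^ 2 * (exp T * 1) * (1 / (β * |ξ - ξ₀|)) := by
            rw [exp_neg]; field_simp
        _ ≤ _ := by rw [h2]; gcongr
    · refine mul_le_mul_of_nonneg_left ?_ (by positivity)
      have h2 : exp (2 * T) = exp T * exp T := by rw [← exp_add]; ring_nf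
      have h1T : 1 ≤ exp T := one_le_exp hT
      have hs : sqrt (exp (-T)) * sqrt |ξ - ξ₀| ≤
          sqrt |exp ξ - exp ξ₀| := by
        rw [← sqrt_mul (exp_pos _).le]; exact sqrt_le_sqrt hdist
      have hs2 : exp (-T) ≤ sqrt (exp (-T)) := by
        refine le_sqrt_of_sq_le ?_
        have h3 : exp (-T) ≤ 1 := exp_le_one_iff.2 (by linarith)
        have h4 := exp_pos (-T)
        nlinarith
      have hs3 : exp (-T) * sqrt |ξ - ξ₀| ≤ sqrt |exp ξ - exp ξ₀| :=
        le_trans (mul_le_mul_of_nonneg_right hs2 (sqrt_nonneg _)) hs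
      have hsp : 0 < sqrt |ξ - ξ₀| := sqrt_pos.2 hdpos
      have hsβ : 0 < sqrt β := sqrt_pos.2 hβ
      have h5 : 2 + (4 * exp (-T))⁻¹ ≤ 4 * exp T := by
        rw [mul_inv, ← exp_neg, neg_neg]; linarith
      calc π ^ 2 * (2 + (4 * exp (-T))⁻¹) /
            (sqrt β * sqrt |exp ξ - exp ξ₀|) ≤
          π ^ 2 * (4 * exp T) / (sqrt β * (exp (-T) * sqrt |ξ - ξ₀|)) := by
            gcongr
        _ = _ := by rw [exp_neg, h2]; field_simp
  set mn := min (1 / (β * |ξ - ξ₀|)) (1 / (sqrt β * sqrt |ξ - ξ₀|)) with hmn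
  have hmn0 : 0 ≤ mn := le_min (by positivity) (by positivity)
  have hgen := norm_genFun_eq (x := x) (y := y) hx q ξ hθ
  have hg0 : ‖genFun x y (Complex.exp (ξ + θ * I))‖ =
      P * exp U * exp (q * ξ) := by
    rw [← hgen, mul_assoc, ← exp_add]; simp
  have hre : (ξ + θ * I : ℂ).re = ξ := by simp
  unfold expPull
  rw [norm_mul, norm_mul, norm_mul, norm_exp_zpow, hzn, hre, hg0]
  calc P * exp U * exp (q * ξ) * exp ((-(q + l) - 1 : ℤ) * ξ) *
        ‖cauchyInt x y (q + l') ξ₀ (Complex.exp (ξ + θ * I))‖ * exp ξ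
      ≤ P * exp U * exp (q * ξ) * exp ((-(q + l) - 1 : ℤ) * ξ) *
        (exp ξ₀ * (exp (l' * ξ₀) * (P⁻¹ * exp (-M + 1))) *
        (4 * π ^ 2 * exp (2 * T) * mn)) * exp ξ := by gcongr
    _ = 4 * π ^ 2 * exp (U - M) * mn *
        exp (-(l * ξ) + l' * ξ₀ + ξ₀ + 2 * T + 1) := by
        have e1 : exp ((-(q + l) - 1 : ℤ) * ξ) =
            exp (-(q * ξ)) * exp (-(l * ξ)) * exp (-ξ) := by
          rw [← exp_add, ← exp_add]; congr 1; push_cast; ring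
        rw [e1, sub_eq_add_neg, exp_add U, exp_add (-M), exp_add (_ + 2 * T),
          exp_add _ (2 * T), exp_add _ ξ₀, exp_add (-(l * ξ)),
          exp_neg (q * ξ), exp_neg ξ]
        field_simp
    _ ≤ 4 * π ^ 2 * exp (U - M) * mn *
        exp (((|l| + |l'| : ℤ) + 3) * T + 1) := by
        gcongr
        have b1 : -(l * ξ) ≤ |(l : ℝ)| * T := by
          calc -(l * ξ) ≤ |l * ξ| := neg_le_abs _
            _ = |(l : ℝ)| * |ξ| := abs_mul _ _
            _ ≤ _ := by gcongr
        have b2 : l' * ξ₀ ≤ |(l' : ℝ)| * T := by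
          calc l' * ξ₀ ≤ |l' * ξ₀| := le_abs_self _
            _ = |(l' : ℝ)| * |ξ₀| := abs_mul _ _
            _ ≤ _ := by gcongr
        have b3 : ξ₀ ≤ T := (le_abs_self _).trans hξ₀
        push_cast
        linarith
    _ = _ := by unfold kernelConst; ring

end

section

theorem sum_dvd_inv_le {m : ℕ} (hm : 0 < m) (N : ℕ) :
    ∑ k ∈ (Finset.range N).filter (fun k => m ∣ k + 1), (1 : ℝ) / (k + 1) ≤
      (1 + log N) / m := by
  have hm' : (0 : ℝ) < m := by exact_mod_cast hm
  have hsub : (Finset.range N).filter (fun k => m ∣ k + 1) ⊆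
      (Finset.range N).image fun j => m * (j + 1) - 1 := by
    intro k hk
    rw [mem_filter, Finset.mem_range] at hk
    obtain ⟨hkN, j, hj⟩ := hk
    have hj0 : 0 < j := by
      rcases Nat.eq_zero_or_pos j with rfl | h
      · simp at hj
      · exact h
    rw [Finset.mem_image]
    refine ⟨j - 1, Finset.mem_range.2 ?_, ?_⟩
    · have : j ≤ m * j := Nat.le_mul_of_pos_left j hm
      omega
    · rw [Nat.sub_add_cancel hj0, ← hj]; omega
  have hinj : Set.InjOn (fun j => m * (j + 1) - 1) (Finset.range N : Set ℕ) := by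
    intro i _ j _ hij
    have h1 : 0 < m * (i + 1) := Nat.mul_pos hm (by omega)
    have h2 : 0 < m * (j + 1) := Nat.mul_pos hm (by omega)
    have h3 : m * (i + 1) = m * (j + 1) := by
      simp only at hij; omega
    have := Nat.eq_of_mul_eq_mul_left hm h3
    omega
  calc ∑ k ∈ (Finset.range N).filter (fun k => m ∣ k + 1), (1 : ℝ) / (k + 1)
      ≤ ∑ k ∈ (Finset.range N).image fun j => m * (j + 1) - 1, (1 : ℝ) / (k + 1) :=
        Finset.sum_le_sum_of_subset_of_nonneg hsub fun k _ _ => by positivity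
    _ = ∑ j ∈ Finset.range N, (1 / m) * (((j : ℝ) + 1)⁻¹) := by
        rw [Finset.sum_image hinj]
        refine sum_congr rfl fun j _ => ?_
        have h1 : 0 < m * (j + 1) := Nat.mul_pos hm (by omega)
        have h2 : ((m * (j + 1) - 1 : ℕ) : ℝ) + 1 = m * (j + 1) := by
          have : ((m * (j + 1) - 1 : ℕ) : ℝ) = ((m * (j + 1) : ℕ) : ℝ) - 1 := by
            rw [Nat.cast_sub h1]; simp
          rw [this]; push_cast; ring
        rw [h2]
        field_simp
    _ ≤ _ := by
        rw [← mul_sum, one_div, div_eq_inv_mul]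
        refine mul_le_mul_of_nonneg_left ?_ (by positivity)
        have := harmonic_le_one_add_log N
        refine le_trans (le_of_eq ?_) this
        unfold harmonic
        push_cast
        rfl

/-- The singular weight in the bounds for the integrand. -/
def weight (β u : ℝ) : ℝ := min (1 / (β * u)) (1 / (sqrt β * sqrt u))

/-- `g` is bounded by the exponential of `W`, times a weight that is singular at `ξ₀`. -/
structure StairBound (g : ℂ → ℂ) (W : ℝ → ℝ → ℝ) (ξ₀ K β H : ℝ) : Prop where
  K_nonneg : 0 ≤ K
  β_pos : 0 < β
  bound : ∀ s θ : ℝ, s ≠ ξ₀ → |s - ξ₀| ≤ H → sin θ ≠ 0 →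
    ‖g (s + θ * I)‖ ≤ K * exp (W s (cos θ)) * weight β |s - ξ₀|

section

variable {g : ℂ → ℂ} {W : ℝ → ℝ → ℝ} {ξ₀ K β H : ℝ}

theorem weight_nonneg {u : ℝ} (hβ : 0 < β) (hu : 0 ≤ u) : 0 ≤ weight β u :=
  le_min (by positivity) (by positivity)

theorem StairBound.bound_neg (h : StairBound g W ξ₀ K β H) {s θ : ℝ} (hs : s ≠ ξ₀)
    (hs' : |s - ξ₀| ≤ H) (hθ : sin θ ≠ 0) :
    ‖g (s - θ * I)‖ ≤ K * exp (W s (cos θ)) * weight β |s - ξ₀| := by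
  have := h.bound s (-θ) hs hs' (by simpa using hθ)
  rw [Real.cos_neg, ofReal_neg, neg_mul, ← sub_eq_add_neg] at this
  exact this

theorem StairBound.norm_horizInt_le (h : StairBound g W ξ₀ K β H) {σ u v c C : ℝ}
    (hσ : |σ| = 1) (hu : 0 ≤ u) (huv : u ≤ v) (hv : v ≤ H) (hc : c ∈ Ioo 0 π)
    (hW : ∀ t ∈ Icc u v, W (ξ₀ + σ * t) (cos c) ≤ C) :
    ‖horizInt g (ξ₀ + σ * u) (ξ₀ + σ * v) c‖ ≤
      4 * K * exp C / sqrt β * (sqrt v - sqrt u) := by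
  have hsβ : 0 < sqrt β := sqrt_pos.2 h.β_pos
  have hK := h.K_nonneg
  unfold horizInt
  rw [← intervalIntegral.smul_integral_comp_add_mul
    (fun s : ℝ => g (s + c * I) - g (s - c * I)) σ ξ₀, norm_smul, norm_eq_abs,
    hσ, one_mul]
  have hsin : sin c ≠ 0 := (sin_pos_of_mem_Ioo hc).ne'
  have hIntegr : IntervalIntegrable (fun t : ℝ => 2 * K * exp C / sqrt β * t ^ (-(1 / 2) : ℝ))
      volume u v := (intervalIntegral.intervalIntegrable_rpow' (by norm_num)).const_mul _
  refine (intervalIntegral.norm_integral_le_of_norm_le huv ?_ hIntegr).trans ?_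
  · refine Eventually.of_forall fun t ht => ?_
    have ht0 : 0 < t := hu.trans_lt ht.1
    have e : |ξ₀ + σ * t - ξ₀| = t := by
      rw [add_sub_cancel_left, abs_mul, hσ, one_mul, abs_of_pos ht0]
    have hne : ξ₀ + σ * t ≠ ξ₀ := by
      intro h0
      rw [h0, sub_self, abs_zero] at e
      exact ht0.ne e
    have hH : |ξ₀ + σ * t - ξ₀| ≤ H := by rw [e]; exact ht.2.trans hv
    have b1 := h.bound _ _ hne hH hsin
    have b2 := h.bound_neg hne hH hsin
    rw [e] at b1 b2
    have hw : weight β t ≤ 1 / sqrt β * t ^ (-(1 / 2) : ℝ) := by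
      refine (min_le_right _ _).trans (le_of_eq ?_)
      rw [Real.rpow_neg ht0.le, ← sqrt_eq_rpow]
      field_simp
    have hw0 := weight_nonneg h.β_pos ht0.le
    have hexp : exp (W (ξ₀ + σ * t) (cos c)) ≤ exp C :=
      exp_le_exp.2 (hW t ⟨ht.1.le, ht.2⟩)
    have b3 : K * exp (W (ξ₀ + σ * t) (cos c)) * weight β t ≤
        K * exp C * (1 / sqrt β * t ^ (-(1 / 2) : ℝ)) := by gcongr
    calc _ ≤ K * exp C * (1 / sqrt β * t ^ (-(1 / 2) : ℝ)) +
          K * exp C * (1 / sqrt β * t ^ (-(1 / 2) : ℝ)) :=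
          (norm_sub_le _ _).trans (add_le_add (b1.trans b3) (b2.trans b3))
      _ = _ := by ring
  · rw [intervalIntegral.integral_const_mul, integral_rpow (Or.inl (by norm_num))]
    refine le_of_eq ?_
    rw [sqrt_eq_rpow, sqrt_eq_rpow v, sqrt_eq_rpow u]
    norm_num
    ring

theorem StairBound.norm_jumpInt_le (h : StairBound g W ξ₀ K β H) {σ u c c' C : ℝ}
    (hσ : |σ| = 1) (hu : 0 < u) (hH : u ≤ H) (hc : c ∈ Ioo 0 π) (hc' : c' ∈ Ioo 0 π)
    (hconv : ∀ s a b d : ℝ, |a| < 1 → |b| < 1 → a ≤ d → d ≤ b → W s d ≤ max (W s a) (W s b))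
    (hW : W (ξ₀ + σ * u) (cos c) ≤ C) (hW' : W (ξ₀ + σ * u) (cos c') ≤ C) :
    ‖jumpInt g (ξ₀ + σ * u) c c'‖ ≤ 2 * K * exp C * weight β u * |c' - c| := by
  have hK := h.K_nonneg
  have e : |ξ₀ + σ * u - ξ₀| = u := by
    rw [add_sub_cancel_left, abs_mul, hσ, one_mul, abs_of_pos hu]
  have hne : ξ₀ + σ * u ≠ ξ₀ := by
    intro h0
    rw [h0, sub_self, abs_zero] at e
    exact hu.ne e
  have hw0 := weight_nonneg h.β_pos hu.le
  unfold jumpInt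
  refine intervalIntegral.norm_integral_le_of_norm_le_const fun y hy => ?_
  have hy' : y ∈ uIcc c c' := uIoc_subset_uIcc hy
  have hyI : y ∈ Ioo 0 π := (Set.ordConnected_Ioo.uIcc_subset hc hc') hy'
  have hsin : ∀ {t}, t ∈ Ioo 0 π → sin t ≠ 0 := fun ht =>
    (sin_pos_of_mem_Ioo ht).ne'
  have b1 := h.bound (ξ₀ + σ * u) y hne (by rw [e]; exact hH) (hsin hyI)
  have b2 := h.bound_neg (s := ξ₀ + σ * u) (θ := y) hne (by rw [e]; exact hH) (hsin hyI)
  rw [e] at b1 b2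
  have hWy : W (ξ₀ + σ * u) (cos y) ≤ C := by
    have anti : ∀ {s t}, s ∈ Ioo 0 π → t ∈ Ioo 0 π → s ≤ t →
        cos t ≤ cos s := fun hs ht hst =>
      cos_le_cos_of_nonneg_of_le_pi hs.1.le ht.2.le hst
    rcases le_total c c' with hcc | hcc
    · rw [uIcc_of_le hcc] at hy'
      exact (hconv _ _ _ _ (abs_cos_lt_one (hsin hc')) (abs_cos_lt_one (hsin hc))
        (anti hyI hc' hy'.2) (anti hc hyI hy'.1)).trans (max_le hW' hW)
    · rw [uIcc_of_ge hcc] at hy'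
      exact (hconv _ _ _ _ (abs_cos_lt_one (hsin hc)) (abs_cos_lt_one (hsin hc'))
        (anti hyI hc hy'.2) (anti hc' hyI hy'.1)).trans (max_le hW hW')
  have hexp : exp (W (ξ₀ + σ * u) (cos y)) ≤ exp C := exp_le_exp.2 hWy
  have b3 : K * exp (W (ξ₀ + σ * u) (cos y)) * weight β u ≤
      K * exp C * weight β u := by gcongr
  rw [norm_mul, norm_I, mul_one]
  push_cast at b1 b2 ⊢
  calc _ ≤ K * exp C * weight β u + K * exp C * weight β u :=
        (norm_add_le _ _).trans (add_le_add (b1.trans b3) (b2.trans b3))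
    _ = _ := by ring

/-- The estimate for the integral along a staircase. Each vertical step is trivial, or far from
`ξ₀`, or at a multiple of `m`, or in an exceptional set `E`. -/
theorem StairBound.norm_stairInt_le (h : StairBound g W ξ₀ K β H) {σ δ C D J : ℝ} {c : ℕ → ℝ}
    {N m : ℕ} {E : Finset ℕ} (hσ : |σ| = 1) (hδ : 0 < δ) (hN : (N + 1) * δ ≤ H) (hm : 0 < m)
    (hJ : 0 ≤ J) (hc : ∀ k, c k ∈ Ioo 0 π)
    (hconv : ∀ s a b d : ℝ, |a| < 1 → |b| < 1 → a ≤ d → d ≤ b → W s d ≤ max (W s a) (W s b))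
    (hW : ∀ k ≤ N, ∀ t ∈ Icc (k * δ) ((k + 1) * δ), W (ξ₀ + σ * t) (cos (c k)) ≤ C)
    (hjump : ∀ k < N, c (k + 1) = c k ∨
      (W (ξ₀ + σ * ((k + 1) * δ)) (cos (c k)) ≤ -D ∧
        W (ξ₀ + σ * ((k + 1) * δ)) (cos (c (k + 1))) ≤ -D) ∨
      ((m ∣ k + 1 ∨ k ∈ E) ∧ |c (k + 1) - c k| ≤ J)) :
    ‖stairInt g (fun k => ξ₀ + σ * (k * δ)) c N‖ ≤
      4 * K * exp C / sqrt β * sqrt H +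
      (N * (2 * K * exp (-D) * (1 / (sqrt β * sqrt δ)) * π) +
        2 * K * exp C * J * ((1 + log N) / (β * (m * δ)) +
          E.card * (1 / (sqrt β * sqrt δ)))) := by
  have hK := h.K_nonneg
  have hβ := h.β_pos
  have hsβ : 0 < sqrt β := sqrt_pos.2 hβ
  have hsδ : 0 < sqrt δ := sqrt_pos.2 hδ
  have hHle : ∀ k : ℕ, k ≤ N → ((k : ℝ) + 1) * δ ≤ H := by
    intro k hk
    have : (k : ℝ) ≤ N := by exact_mod_cast hk
    refine le_trans ?_ hN
    gcongr
  unfold stairInt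
  refine (norm_add_le _ _).trans (add_le_add ?_ ?_)
  · calc ‖∑ k ∈ Finset.range (N + 1), horizInt g (ξ₀ + σ * (k * δ)) (ξ₀ + σ * ((k + 1 : ℕ) * δ))
          (c k)‖ ≤ ∑ k ∈ Finset.range (N + 1), 4 * K * exp C / sqrt β *
          (sqrt ((k + 1 : ℕ) * δ) - sqrt (k * δ)) := by
          refine norm_sum_le_of_le _ fun k hk => ?_
          have hk' : k ≤ N := by rw [Finset.mem_range] at hk; omega
          push_cast
          exact h.norm_horizInt_le hσ (by positivity) (by gcongr; linarith) (hHle k hk') (hc k)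
            (hW k hk')
      _ = 4 * K * exp C / sqrt β * sqrt ((N + 1 : ℕ) * δ) := by
          rw [← mul_sum, Finset.sum_range_sub (fun k : ℕ => sqrt (k * δ))]
          simp
      _ ≤ _ := by
          push_cast
          gcongr
  · set A : ℝ := 2 * K * exp (-D) * (1 / (sqrt β * sqrt δ)) * π with hA
    set B : ℕ → ℝ := fun k => if m ∣ k + 1 then 2 * K * exp C * J / (β * δ) * (1 / ((k : ℝ) + 1))
      else 0 with hB
    set B' : ℝ := 2 * K * exp C * J * (1 / (sqrt β * sqrt δ)) with hB'
    have hA0 : 0 ≤ A := by positivity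
    have hB0 : ∀ k, 0 ≤ B k := by intro k; simp only [hB]; split_ifs <;> positivity
    have hB'0 : 0 ≤ B' := by positivity
    have hwt : ∀ k : ℕ, weight β (((k : ℝ) + 1) * δ) ≤ 1 / (sqrt β * sqrt δ) := by
      intro k
      refine (min_le_right _ _).trans ?_
      have : δ ≤ ((k : ℝ) + 1) * δ := by nlinarith [Nat.cast_nonneg (α := ℝ) k]
      have := sqrt_le_sqrt this
      gcongr
    have hterm : ∀ k ∈ Finset.range N,
        ‖jumpInt g (ξ₀ + σ * ((k + 1 : ℕ) * δ)) (c k) (c (k + 1))‖ ≤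
        A + B k + if k ∈ E then B' else 0 := by
      intro k hk
      rw [Finset.mem_range] at hk
      push_cast
      have hif : 0 ≤ if k ∈ E then B' else 0 := by split_ifs <;> positivity
      have hu : 0 < ((k : ℝ) + 1) * δ := by positivity
      have hw0 := weight_nonneg hβ hu.le
      have hWk : W (ξ₀ + σ * ((k + 1) * δ)) (cos (c k)) ≤ C :=
        hW k hk.le _ ⟨by gcongr; linarith, le_rfl⟩
      have hWk' : W (ξ₀ + σ * ((k + 1) * δ)) (cos (c (k + 1))) ≤ C := by
        have := hW (k + 1) hk (((k + 1 : ℕ) : ℝ) * δ) ⟨le_rfl, by gcongr; linarith⟩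
        push_cast at this
        exact this
      rcases hjump k hk with h1 | ⟨h1, h2⟩ | ⟨h1, h2⟩
      · have : jumpInt g (ξ₀ + σ * (((k : ℝ) + 1) * δ)) (c k) (c (k + 1)) = 0 := by
          rw [h1]; unfold jumpInt; exact intervalIntegral.integral_same
        rw [this, norm_zero]
        have := hB0 k
        linarith
      · have hj := h.norm_jumpInt_le hσ hu (hHle k hk.le) (hc k) (hc (k + 1)) hconv h1 h2
        have hpi : |c (k + 1) - c k| ≤ π := by
          rw [abs_le]
          constructor <;> linarith [(hc k).1, (hc k).2, (hc (k + 1)).1, (hc (k + 1)).2]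
        have : 2 * K * exp (-D) * weight β (((k : ℝ) + 1) * δ) * |c (k + 1) - c k| ≤ A := by
          rw [hA]
          have := hwt k
          gcongr
        have := hB0 k
        linarith
      · have hj := h.norm_jumpInt_le hσ hu (hHle k hk.le) (hc k) (hc (k + 1)) hconv hWk hWk'
        rcases h1 with h1 | h1
        · have : 2 * K * exp C * weight β (((k : ℝ) + 1) * δ) * |c (k + 1) - c k| ≤ B k := by
            simp only [hB, if_pos h1]
            calc _ ≤ 2 * K * exp C * (1 / (β * (((k : ℝ) + 1) * δ))) * J := by
                  have : weight β (((k : ℝ) + 1) * δ) ≤ 1 / (β * (((k : ℝ) + 1) * δ)) :=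
                    min_le_left _ _
                  gcongr
              _ = _ := by field_simp
          linarith
        · have : 2 * K * exp C * weight β (((k : ℝ) + 1) * δ) * |c (k + 1) - c k| ≤ B' := by
            have := hwt k
            calc _ ≤ 2 * K * exp C * (1 / (sqrt β * sqrt δ)) * J := by gcongr
              _ = _ := by rw [hB']; ring
          rw [if_pos h1]
          have := hB0 k
          linarith
    refine (norm_sum_le_of_le _ hterm).trans ?_
    rw [sum_add_distrib, sum_add_distrib, sum_const, Finset.card_range,
      nsmul_eq_mul, mul_add, add_assoc]
    refine add_le_add le_rfl (add_le_add ?_ ?_)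
    · simp only [hB]
      rw [← sum_filter, ← mul_sum]
      have := sum_dvd_inv_le hm N
      have h2 : 0 ≤ 2 * K * exp C * J / (β * δ) := by positivity
      refine (mul_le_mul_of_nonneg_left this h2).trans (le_of_eq ?_)
      have : (0 : ℝ) < m := by exact_mod_cast hm
      field_simp
    · rw [← sum_filter, sum_const, nsmul_eq_mul]
      have hcard : (((Finset.range N).filter (· ∈ E)).card : ℝ) ≤ E.card := by
        have : (Finset.range N).filter (· ∈ E) ⊆ E := fun k hk => (mem_filter.1 hk).2
        exact_mod_cast Finset.card_le_card this
      calc _ ≤ (E.card : ℝ) * B' := by gcongr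
        _ = _ := by rw [hB']; ring

end

end

section

variable {ι : Type*} [Fintype ι]

/-- A finite configuration `X` with a saddle point at `e^ξ₀ (a(ξ₀) + i √(1 - a(ξ₀)²))`, with
uniform control near the saddle point: up to at most `κ` points, all equal to `Z`, the points of the
configuration are at distance `≥ ε` from the curve of minimisers. -/
structure NearSaddle (X : ι → ℝ) (s : ℝ) (a : ℝ → ℝ) (ξ₀ : ℝ) (A : Finset ι)
    (Z r₁ R c₀ L ε ε₀ : ℝ) (κ : ℕ) : Prop where
  arc : IsArcMin X (1 - 1 / card ι) a
  saddle : sumRe X (exp ξ₀) (a ξ₀) = card ι - s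
  r₁_pos : 0 < r₁
  c₀_pos : 0 < c₀
  ε_pos : 0 < ε
  ε₀_pos : 0 < ε₀
  mem : ∀ ξ, |ξ - ξ₀| ≤ ε₀ → r₁ ≤ exp ξ ∧ exp ξ ≤ R
  lip : ∀ ξ ξ', |ξ - ξ₀| ≤ ε₀ → |ξ' - ξ₀| ≤ ε₀ → |a ξ - a ξ'| ≤ L * |ξ - ξ'|
  curv : c₀ * card ι ≤ ∑ i, X i ^ 2 / (|X i| + R) ^ 4
  far : ∀ u v, |u - ξ₀| ≤ ε₀ → |v - ξ₀| ≤ ε₀ → ∀ i ∉ A, ε ^ 2 ≤ sqDist (X i) (exp u) (a v)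
  atom : ∀ i ∈ A, X i = Z
  atom_card : A.card ≤ κ
  atom_sign : ∀ ξ, |ξ - ξ₀| ≤ ε₀ → 0 ≤ a ξ * Z
  atom_mem : A.Nonempty → r₁ ≤ |Z| ∧ |Z| ≤ R

/-- The exponential rate of decay away from the saddle point. -/
def decayRate (r₁ R c₀ ε₀ : ℝ) : ℝ := c₀ * (r₁ * (ε₀ / 8)) ^ 3 / (2 * R) * (ε₀ / 8)

/-- The excess of the potential on the cells of the staircase near the saddle point. -/
def cellConst (r₁ R ε : ℝ) (κ : ℕ) (ν δ Δ : ℝ) : ℝ :=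
  R * (ν * (2 * (1 + 2 * R / ε) ^ 2 / ε ^ 2 * (R * Δ))) * Δ ^ 2 +
    κ * (R * ν / (2 * r₁)) * δ ^ 2 + κ * (R ^ 2 / r₁ ^ 2)

theorem exp_sub_exp_le {R u v : ℝ} (hu : exp u ≤ R) (hv : exp v ≤ R) :
    |exp u - exp v| ≤ R * |u - v| := by
  have key : ∀ u v : ℝ, exp u ≤ R → v ≤ u → exp u - exp v ≤ R * (u - v) := by
    intro u v hu huv
    have h1 := add_one_le_exp (v - u)
    have h2 : exp v = exp u * exp (v - u) := by rw [← exp_add]; congr 1; ring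
    have h3 := mul_le_mul_of_nonneg_left h1 (exp_pos u).le
    have h4 := mul_le_mul_of_nonneg_right hu (sub_nonneg.2 huv)
    rw [h2]; linarith
  rcases le_total v u with h | h
  · rw [abs_of_nonneg (sub_nonneg.2 (exp_le_exp.2 h)), abs_of_nonneg (sub_nonneg.2 h)]
    exact key u v hu h
  · rw [abs_sub_comm, abs_sub_comm u, abs_of_nonneg (sub_nonneg.2 (exp_le_exp.2 h)),
      abs_of_nonneg (sub_nonneg.2 h)]
    exact key v u hv h

namespace NearSaddle

variable {X : ι → ℝ} {s : ℝ} {a : ℝ → ℝ} {ξ₀ : ℝ} {A : Finset ι} {Z r₁ R c₀ L ε ε₀ : ℝ} {κ : ℕ}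
  (h : NearSaddle X s a ξ₀ A Z r₁ R c₀ L ε ε₀ κ)
include h

theorem card_pos : (0 : ℝ) < card ι := by
  have := h.arc.lt_one
  rcases Nat.eq_zero_or_pos (card ι) with h0 | h0
  · rw [h0] at this; simp at this
  · exact_mod_cast h0

theorem R_pos : 0 < R := by
  have := h.mem ξ₀ (by simpa using h.ε₀_pos.le)
  linarith [h.r₁_pos]

theorem logPot_le_saddle (u : ℝ) : logPot s X u (a u) ≤ logPot s X ξ₀ (a ξ₀) := by
  have := h.arc.logPot_concave s ξ₀ u
  rw [h.saddle] at this
  linarith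

theorem decayRate_pos : 0 < decayRate r₁ R c₀ ε₀ := by
  have := h.R_pos
  have := h.r₁_pos
  have := h.c₀_pos
  have := h.ε₀_pos
  unfold decayRate
  positivity

theorem logPot_le_far {u : ℝ} (hu : ε₀ / 4 ≤ |u - ξ₀|) :
    logPot s X u (a u) ≤ logPot s X ξ₀ (a ξ₀) - decayRate r₁ R c₀ ε₀ * card ι := by
  have hε := h.ε₀_pos
  have hR := h.R_pos
  have hr := h.r₁_pos
  have hc := h.c₀_pos
  have hν := h.card_pos
  have h0 : exp ξ₀ ≤ R := (h.mem ξ₀ (by simpa using hε.le)).2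
  have hr0 : r₁ ≤ exp ξ₀ := (h.mem ξ₀ (by simpa using hε.le)).1
  set τ := c₀ * (r₁ * (ε₀ / 8)) ^ 3 / (2 * R) with hτ
  have hτ0 : 0 < τ := by positivity
  have hgap : ∀ p q : ℝ, q = p + ε₀ / 8 → r₁ ≤ exp p → exp q ≤ R →
      τ * card ι ≤ sumRe X (exp p) (a p) - sumRe X (exp q) (a q) := by
    intro p q hpq hp hq
    have h1 := h.arc.sumRe_sub_ge (ξ := q) (ξ' := p) (R := R) (c := c₀ * card ι)
      (by linarith) hq h.curv
    refine le_trans ?_ h1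
    have h2 : r₁ * (ε₀ / 8) ≤ exp q - exp p := by
      have e : exp q = exp p * exp (ε₀ / 8) := by rw [← exp_add, hpq]
      have := add_one_le_exp (ε₀ / 8)
      have h3 := mul_le_mul_of_nonneg_left this (exp_pos p).le
      have h4 := mul_le_mul_of_nonneg_right hp (by linarith : 0 ≤ ε₀ / 8)
      rw [e]; linarith
    have h3 : (r₁ * (ε₀ / 8)) ^ 3 ≤ (exp q - exp p) ^ 3 :=
      pow_le_pow_left₀ (by positivity) h2 3
    calc τ * card ι = c₀ * card ι * (r₁ * (ε₀ / 8)) ^ 3 / (2 * R) := by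
          rw [hτ]; ring
      _ ≤ _ := by gcongr
  have hfin : ∀ p, (sumRe X (exp p) (a p) - (card ι - s)) * (u - p) ≤
      -(τ * card ι * (ε₀ / 8)) →
      logPot s X u (a u) ≤ logPot s X ξ₀ (a ξ₀) - decayRate r₁ R c₀ ε₀ * card ι := by
    intro p hp
    have h1 := h.arc.logPot_concave s p u
    have h2 := h.logPot_le_saddle p
    have e : decayRate r₁ R c₀ ε₀ * card ι = τ * card ι * (ε₀ / 8) := by
      unfold decayRate; rw [hτ]; ring
    rw [e]; linarith
  rcases le_total ξ₀ u with hle | hle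
  · rw [abs_of_nonneg (by linarith)] at hu
    have hg := hgap ξ₀ (ξ₀ + ε₀ / 8) rfl hr0
      (h.mem _ (by rw [add_sub_cancel_left, abs_of_pos (by linarith)]; linarith)).2
    rw [h.saddle] at hg
    refine hfin (ξ₀ + ε₀ / 8) ?_
    have h1 : τ * card ι * (ε₀ / 8) ≤ τ * card ι * (u - (ξ₀ + ε₀ / 8)) := by
      gcongr; linarith
    have h2 : (τ * card ι) * (u - (ξ₀ + ε₀ / 8)) ≤
        ((card ι - s) - sumRe X (exp (ξ₀ + ε₀ / 8)) (a (ξ₀ + ε₀ / 8))) *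
          (u - (ξ₀ + ε₀ / 8)) := mul_le_mul_of_nonneg_right hg (by linarith)
    linarith
  · rw [abs_of_nonpos (by linarith)] at hu
    have hg := hgap (ξ₀ - ε₀ / 8) ξ₀ (by ring)
      (h.mem _ (by rw [sub_sub_cancel_left, abs_neg, abs_of_pos (by linarith)]; linarith)).1 h0
    rw [h.saddle] at hg
    refine hfin (ξ₀ - ε₀ / 8) ?_
    have h1 : τ * card ι * (ε₀ / 8) ≤ τ * card ι * ((ξ₀ - ε₀ / 8) - u) := by
      gcongr; linarith
    have h2 : (τ * card ι) * ((ξ₀ - ε₀ / 8) - u) ≤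
        (sumRe X (exp (ξ₀ - ε₀ / 8)) (a (ξ₀ - ε₀ / 8)) - (card ι - s)) *
          ((ξ₀ - ε₀ / 8) - u) := mul_le_mul_of_nonneg_right hg (by linarith)
    linarith

/-- Moving outwards, the linear term in the expansion of the potential is nonpositive. -/
theorem linear_nonpos {σ t t' : ℝ} (hσ : |σ| = 1) (ht : 0 ≤ t) (htt : t ≤ t') :
    (sumRe X (exp (ξ₀ + σ * t)) (a (ξ₀ + σ * t)) - (card ι - s)) *
      (ξ₀ + σ * t' - (ξ₀ + σ * t)) ≤ 0 := by
  have e : ξ₀ + σ * t' - (ξ₀ + σ * t) = σ * (t' - t) := by ring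
  rw [e]
  rcases (abs_eq zero_le_one).1 hσ with rfl | rfl
  · have := h.arc.antitone_sumRe (show ξ₀ ≤ ξ₀ + 1 * t by linarith)
    simp only at this
    rw [h.saddle] at this
    exact mul_nonpos_of_nonpos_of_nonneg (by linarith) (by linarith)
  · have := h.arc.antitone_sumRe (show ξ₀ + -1 * t ≤ ξ₀ by linarith)
    simp only at this
    rw [h.saddle] at this
    exact mul_nonpos_of_nonneg_of_nonpos (by linarith) (by linarith)

omit h [Fintype ι] in
theorem abs_outward {σ t : ℝ} (hσ : |σ| = 1) (ht : 0 ≤ t) : |ξ₀ + σ * t - ξ₀| = t := by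
  rw [add_sub_cancel_left, abs_mul, hσ, one_mul, abs_of_nonneg ht]

omit h [Fintype ι] in
theorem uIcc_outward {σ t t' m : ℝ} (hσ : |σ| = 1) (htt : t ≤ t')
    (hm : m ∈ uIcc (ξ₀ + σ * t) (ξ₀ + σ * t')) : ∃ v ∈ Icc t t', m = ξ₀ + σ * v := by
  rcases (abs_eq zero_le_one).1 hσ with rfl | rfl
  · rw [uIcc_of_le (by linarith)] at hm
    exact ⟨m - ξ₀, ⟨by linarith [hm.1], by linarith [hm.2]⟩, by ring⟩
  · rw [uIcc_of_ge (by linarith)] at hm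
    exact ⟨ξ₀ - m, ⟨by linarith [hm.2], by linarith [hm.1]⟩, by ring⟩

/-- The potential on a cell far from the saddle point. -/
theorem logPot_cell_far {σ t t' : ℝ} (hσ : |σ| = 1) (ht : 0 ≤ t) (htt : t ≤ t') :
    logPot s X (ξ₀ + σ * t') (a (ξ₀ + σ * t)) ≤
      logPot s X (ξ₀ + σ * t) (a (ξ₀ + σ * t)) + card ι ^ 2 * (t' - t) ^ 2 := by
  have hν := h.card_pos
  have h1 := logPot_ray_le s X (ξ := ξ₀ + σ * t) (ξ' := ξ₀ + σ * t')
    (a := a (ξ₀ + σ * t)) (h.arc.abs_lt_one _)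
    (B := card ι / (2 * (1 - (1 - 1 / card ι))))
    (by
      have : 0 < 1 - (1 - 1 / (card ι : ℝ)) := by ring_nf; positivity
      positivity)
    fun m _ => sum_deriv_re_le X (h.arc.abs_le _) h.arc.lt_one
  have h2 := h.linear_nonpos hσ ht htt
  have e1 : (card ι : ℝ) / (2 * (1 - (1 - 1 / card ι))) =
      card ι ^ 2 / 2 := by
    rw [sub_sub_cancel]; field_simp
  have e2 : (ξ₀ + σ * t' - (ξ₀ + σ * t)) ^ 2 = (t' - t) ^ 2 := by
    have : σ ^ 2 = 1 := by rw [← sq_abs, hσ, one_pow]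
    linear_combination (t' - t) ^ 2 * this
  rw [e1, e2] at h1
  have : 0 ≤ (card ι : ℝ) ^ 2 * (t' - t) ^ 2 := by positivity
  linarith

/-- The potential on a cell near the saddle point. -/
theorem logPot_cell_near [DecidableEq ι] {σ t t' d δ : ℝ} (hσ : |σ| = 1) (ht : 0 ≤ t)
    (htt : t ≤ t') (ht' : t' ≤ ε₀) (hd : t' - t ≤ d) (hδ : 0 < δ)
    (hatom : A.Nonempty → ∀ v ∈ Icc t t',
      δ ^ 2 ≤ sqDist Z (exp (ξ₀ + σ * v)) (a (ξ₀ + σ * t))) :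
    logPot s X (ξ₀ + σ * t') (a (ξ₀ + σ * t)) ≤ logPot s X (ξ₀ + σ * t) (a (ξ₀ + σ * t)) +
      (R * (card ι * (2 * (1 + 2 * R / ε) ^ 2 / ε ^ 2 * (R * d))) +
        κ * (R * |Z| / δ ^ 2)) * d ^ 2 := by
  have hν := h.card_pos
  have hR := h.R_pos
  have hε := h.ε_pos
  have hd0 : 0 ≤ d := by linarith
  have hnear : ∀ v ∈ Icc t t', |ξ₀ + σ * v - ξ₀| ≤ ε₀ := by
    intro v hv
    rw [abs_outward hσ (ht.trans hv.1)]
    exact hv.2.trans ht'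
  have ht_mem : t ∈ Icc t t' := ⟨le_rfl, htt⟩
  have hv0 := hnear t ht_mem
  set B := R * (card ι * (2 * (1 + 2 * R / ε) ^ 2 / ε ^ 2 * (R * d))) +
        κ * (R * |Z| / δ ^ 2) with hB
  have hB0 : 0 ≤ B := by positivity
  have h1 := logPot_ray_le s X (ξ := ξ₀ + σ * t) (ξ' := ξ₀ + σ * t')
    (a := a (ξ₀ + σ * t)) (h.arc.abs_lt_one _)
    (B := B) hB0 (fun m hm => by
      obtain ⟨v, hv, rfl⟩ := uIcc_outward hσ htt hm
      have hvn := hnear v hv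
      have h3 := sum_deriv_re_near_le (X := X) (A := A) (Z := Z) (a := a (ξ₀ + σ * t)) (ε := ε)
        (δ := δ) (R := R) (ξ := ξ₀ + σ * v) (ξ1 := ξ₀ + σ * t) (κ := κ) hε hδ
        (h.mem _ hvn).2 (h.mem _ hv0).2 (h.arc.abs_lt_one _) (h.arc.mul_slope_nonpos _)
        h.atom h.atom_card (h.atom_sign _ hv0) (fun hA => hatom hA v hv)
        (fun i hi => ⟨h.far _ _ hvn hv0 i hi, h.far _ _ hv0 hv0 i hi⟩)
      refine h3.trans ?_
      rw [hB]
      have h4 := exp_sub_exp_le (h.mem _ hvn).2 (h.mem _ hv0).2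
      have h5 : |ξ₀ + σ * v - (ξ₀ + σ * t)| ≤ d := by
        rw [add_sub_add_left_eq_sub, ← mul_sub, abs_mul, hσ, one_mul,
          abs_of_nonneg (by linarith [hv.1])]
        linarith [hv.2]
      have h6 : |exp (ξ₀ + σ * v) - exp (ξ₀ + σ * t)| ≤ R * d :=
        h4.trans (by gcongr)
      gcongr)
  have h2 := h.linear_nonpos hσ ht htt
  have e2 : (ξ₀ + σ * t' - (ξ₀ + σ * t)) ^ 2 = (t' - t) ^ 2 := by
    have : σ ^ 2 = 1 := by rw [← sq_abs, hσ, one_pow]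
    linear_combination (t' - t) ^ 2 * this
  rw [e2] at h1
  have h3 : B * (t' - t) ^ 2 ≤ B * d ^ 2 := by
    have : 0 ≤ t' - t := by linarith
    gcongr
  linarith

/-- A cell of the fine subdivision. -/
theorem logPot_cell_fine [DecidableEq ι] {σ t t' δ Δ : ℝ} (hσ : |σ| = 1) (ht : 0 ≤ t)
    (htt : t ≤ t') (ht' : t' ≤ ε₀) (hd : t' - t ≤ δ) (hδΔ : δ ≤ Δ) :
    logPot s X (ξ₀ + σ * t') (a (ξ₀ + σ * t)) ≤ logPot s X (ξ₀ + σ * t) (a (ξ₀ + σ * t)) +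
      cellConst r₁ R ε κ (card ι) δ Δ := by
  have hν := h.card_pos
  have hR := h.R_pos
  have hε := h.ε_pos
  have hr := h.r₁_pos
  have hδ0 : 0 ≤ δ := by linarith
  have hΔ0 : 0 ≤ Δ := by linarith
  have hmain : ∀ hA : A.Nonempty, ∀ v ∈ Icc t t', (sqrt (2 * |Z| * r₁ / card ι)) ^ 2 ≤
      sqDist Z (exp (ξ₀ + σ * v)) (a (ξ₀ + σ * t)) := by
    intro hA v hv
    rw [sq_sqrt (by positivity)]
    refine le_trans ?_ (two_mul_abs_mul_le_sqDist (exp_pos _).le)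
    have hvn : |ξ₀ + σ * v - ξ₀| ≤ ε₀ := by
      rw [abs_outward hσ (ht.trans hv.1)]; exact hv.2.trans ht'
    have h1 := (h.mem _ hvn).1
    have h2 := h.arc.abs_le (ξ₀ + σ * t)
    have h3 : 1 / (card ι : ℝ) ≤ 1 - |a (ξ₀ + σ * t)| := by linarith
    calc 2 * |Z| * r₁ / card ι = 2 * |Z| * r₁ * (1 / card ι) := by ring
      _ ≤ _ := by gcongr
  have hcc : R * (card ι * (2 * (1 + 2 * R / ε) ^ 2 / ε ^ 2 * (R * δ))) * δ ^ 2 ≤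
      R * (card ι * (2 * (1 + 2 * R / ε) ^ 2 / ε ^ 2 * (R * Δ))) * Δ ^ 2 := by
    gcongr
  have hlast : 0 ≤ κ * (R ^ 2 / r₁ ^ 2) := by positivity
  unfold cellConst
  rcases A.eq_empty_or_nonempty with hA | hA
  · have h1 := h.logPot_cell_near hσ ht htt ht' hd (δ := 1) one_pos (fun hA' => by
      rw [hA] at hA'; exact absurd hA' (by simp))
    have h0 : NearSaddle X s a ξ₀ A 0 r₁ R c₀ L ε ε₀ 0 := by
      refine { h with
        atom := fun i hi => by simp [hA] at hi
        atom_card := by simp [hA]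
        atom_sign := fun ξ _ => by simp
        atom_mem := fun hA' => by rw [hA] at hA'; exact absurd hA' (by simp) }
    have h2 := h0.logPot_cell_near hσ ht htt ht' hd (δ := 1) one_pos (fun hA' => by
      rw [hA] at hA'; exact absurd hA' (by simp))
    simp only [Nat.cast_zero, zero_mul, add_zero] at h2
    have : 0 ≤ κ * (R * card ι / (2 * r₁)) * δ ^ 2 := by positivity
    linarith
  · obtain ⟨hZ, _⟩ := h.atom_mem hA
    have hZ0 : 0 < |Z| := hr.trans_le hZ
    have h1 := h.logPot_cell_near hσ ht htt ht' hd
      (δ := sqrt (2 * |Z| * r₁ / card ι)) (sqrt_pos.2 (by positivity)) hmain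
    rw [sq_sqrt (by positivity)] at h1
    have e : R * |Z| / (2 * |Z| * r₁ / card ι) = R * card ι / (2 * r₁) := by
      field_simp
    rw [e] at h1
    linarith

/-- A cell of the coarse subdivision, away from the atoms. -/
theorem logPot_cell_coarse [DecidableEq ι] {σ t t' δ Δ : ℝ} (hσ : |σ| = 1) (ht : 0 ≤ t)
    (htt : t ≤ t') (ht' : t' ≤ ε₀) (hd : t' - t ≤ Δ) (hΔ : 0 < Δ)
    (haway : ∀ v ∈ Icc t t', Δ ≤ |ξ₀ + σ * v - log Z|) :
    logPot s X (ξ₀ + σ * t') (a (ξ₀ + σ * t)) ≤ logPot s X (ξ₀ + σ * t) (a (ξ₀ + σ * t)) +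
      cellConst r₁ R ε κ (card ι) δ Δ := by
  have hν := h.card_pos
  have hR := h.R_pos
  have hε := h.ε_pos
  have hr := h.r₁_pos
  have hmid : 0 ≤ κ * (R * card ι / (2 * r₁)) * δ ^ 2 := by positivity
  unfold cellConst
  rcases A.eq_empty_or_nonempty with hA | hA
  · have h0 : NearSaddle X s a ξ₀ A 0 r₁ R c₀ L ε ε₀ 0 := by
      refine { h with
        atom := fun i hi => by simp [hA] at hi
        atom_card := by simp [hA]
        atom_sign := fun ξ _ => by simp
        atom_mem := fun hA' => by rw [hA] at hA'; exact absurd hA' (by simp) }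
    have h2 := h0.logPot_cell_near hσ ht htt ht' hd (δ := 1) one_pos (fun hA' => by
      rw [hA] at hA'; exact absurd hA' (by simp))
    simp only [Nat.cast_zero, zero_mul, add_zero] at h2
    have : 0 ≤ κ * (R ^ 2 / r₁ ^ 2) := by positivity
    linarith
  · obtain ⟨hZ, hZR⟩ := h.atom_mem hA
    have hZ0 : 0 < |Z| := hr.trans_le hZ
    have h1 := h.logPot_cell_near hσ ht htt ht' hd (δ := r₁ * Δ) (by positivity) (by
      intro _ v hv
      refine le_trans ?_ (sqDist_ge_sq_sub (exp_pos _).le (h.arc.abs_lt_one _).le)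
      have hvn : |ξ₀ + σ * v - ξ₀| ≤ ε₀ := by
        rw [abs_outward hσ (ht.trans hv.1)]; exact hv.2.trans ht'
      have h2 := (h.mem _ hvn).1
      have h3 := haway v hv
      rw [← sq_abs (|Z| - _)]
      refine pow_le_pow_left₀ (by positivity) ?_ 2
      have key : ∀ p q : ℝ, r₁ ≤ exp q → r₁ * (p - q) ≤ |exp p - exp q| := by
        intro p q hq
        rcases le_total q p with hqp | hqp
        · rw [abs_of_nonneg (sub_nonneg.2 (exp_le_exp.2 hqp))]
          have e : exp p = exp q * exp (p - q) := by
            rw [← exp_add]; congr 1; ring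
          have h5 := mul_le_mul_of_nonneg_left (add_one_le_exp (p - q)) (exp_pos q).le
          have h6 := mul_le_mul_of_nonneg_right hq (sub_nonneg.2 hqp)
          rw [e]; linarith
        · exact (mul_nonpos_of_nonneg_of_nonpos hr.le (by linarith)).trans (abs_nonneg _)
      have hZe : exp (log Z) = |Z| := Real.exp_log_eq_abs (abs_pos.1 hZ0)
      rcases abs_cases (ξ₀ + σ * v - log Z) with ⟨h4, _⟩ | ⟨h4, _⟩
      · have := key (ξ₀ + σ * v) (log Z) (by rw [hZe]; exact hZ)
        rw [hZe, abs_sub_comm] at this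
        refine le_trans ?_ this
        gcongr; linarith
      · have := key (log Z) (ξ₀ + σ * v) h2
        rw [hZe] at this
        refine le_trans ?_ this
        gcongr; linarith)
    have e : κ * (R * |Z| / (r₁ * Δ) ^ 2) * Δ ^ 2 = κ * (R * |Z| / r₁ ^ 2) := by field_simp
    have h3 : κ * (R * |Z| / r₁ ^ 2) ≤ κ * (R ^ 2 / r₁ ^ 2) := by
      rw [sq R]; gcongr
    linarith

end NearSaddle

end

section

/-- The index of the point that determines the angle of the `k`-th cell of a staircase: the cell
itself near `ζ₀` and far from `ξ₀`, and the preceding multiple of `m` otherwise. -/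
def baseIndex (σ δ ξ₀ ζ₀ ε₀ : ℝ) (m k : ℕ) : ℕ :=
  open Classical in
  if |ξ₀ + σ * (k * δ) - ζ₀| ≤ 2 * (m * δ) ∨ ε₀ / 2 ≤ k * δ then k else m * (k / m)

theorem baseIndex_le (σ δ ξ₀ ζ₀ ε₀ : ℝ) (m k : ℕ) : baseIndex σ δ ξ₀ ζ₀ ε₀ m k ≤ k := by
  unfold baseIndex
  split_ifs
  · exact le_rfl
  · exact Nat.mul_div_le k m

theorem lt_baseIndex_add (σ δ ξ₀ ζ₀ ε₀ : ℝ) {m : ℕ} (hm : 0 < m) (k : ℕ) :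
    k < baseIndex σ δ ξ₀ ζ₀ ε₀ m k + m := by
  unfold baseIndex
  split_ifs
  · omega
  · have := Nat.div_add_mod k m
    have := Nat.mod_lt k hm
    omega

theorem baseIndex_zero (σ δ ξ₀ ζ₀ ε₀ : ℝ) (m : ℕ) : baseIndex σ δ ξ₀ ζ₀ ε₀ m 0 = 0 :=
  Nat.le_zero.1 (baseIndex_le _ _ _ _ _ _ _)

theorem card_window_le {σ δ : ℝ} (hσ : |σ| = 1) (hδ : 0 < δ) (x : ℝ) (m N : ℕ)
    [DecidablePred fun k : ℕ => |x + σ * (k * δ)| ≤ 2 * (m * δ)] :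
    ((Finset.range N).filter fun k : ℕ => |x + σ * (k * δ)| ≤ 2 * (m * δ)).card ≤ 4 * m + 1 := by
  set S := (Finset.range N).filter fun k : ℕ => |x + σ * (k * δ)| ≤ 2 * (m * δ) with hS
  rcases S.eq_empty_or_nonempty with h | h
  · rw [h]; simp
  · have hsub : S ⊆ Finset.Icc (S.min' h) (S.min' h + 4 * m) := by
      intro k hk
      have h1 := S.min'_le k hk
      have h2 := S.min'_mem h
      rw [hS, mem_filter] at hk
      have h3 := (mem_filter.1 h2).2
      rw [Finset.mem_Icc]
      refine ⟨h1, ?_⟩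
      have h4 : |σ * ((k : ℝ) - (S.min' h : ℕ)) * δ| ≤ 4 * m * δ := by
        have e : σ * ((k : ℝ) - (S.min' h : ℕ)) * δ =
            (x + σ * (k * δ)) - (x + σ * ((S.min' h : ℕ) * δ)) := by ring
        rw [e]
        refine (abs_sub _ _).trans ?_
        linarith [hk.2]
      rw [abs_mul, abs_mul, hσ, one_mul, abs_of_pos hδ] at h4
      have h5 := le_of_mul_le_mul_right h4 hδ
      have h6 := (le_abs_self _).trans h5
      have h7 : (k : ℝ) ≤ ((S.min' h + 4 * m : ℕ) : ℝ) := by push_cast; linarith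
      exact_mod_cast h7
    refine (Finset.card_le_card hsub).trans ?_
    rw [Nat.card_Icc]; omega

variable {ι : Type*} [Fintype ι]

namespace NearSaddle

variable {X : ι → ℝ} {s : ℝ} {a : ℝ → ℝ} {ξ₀ : ℝ} {A : Finset ι} {Z r₁ R c₀ L ε ε₀ : ℝ} {κ : ℕ}
  (h : NearSaddle X s a ξ₀ A Z r₁ R c₀ L ε ε₀ κ)
include h

theorem L_nonneg : 0 ≤ L := by
  have hε := h.ε₀_pos
  have h1 := h.lip (ξ₀ + ε₀) ξ₀ (by rw [add_sub_cancel_left, abs_of_pos hε])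
    (by simpa using hε.le)
  rw [add_sub_cancel_left, abs_of_pos hε] at h1
  exact nonneg_of_mul_nonneg_left ((abs_nonneg _).trans h1) hε

theorem cellConst_nonneg {δ Δ : ℝ} (hΔ : 0 ≤ Δ) :
    0 ≤ cellConst r₁ R ε κ (card ι) δ Δ := by
  have := h.R_pos
  have := h.r₁_pos
  have := h.ε_pos
  have := h.card_pos
  unfold cellConst
  positivity

/-- The angles of the cells of the staircase. -/
theorem arccos_mem (ξ : ℝ) : arccos (a ξ) ∈ Ioo 0 π := by
  have h1 := abs_lt.1 (h.arc.abs_lt_one ξ)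
  refine ⟨Real.arccos_pos.2 h1.2, ?_⟩
  have h2 := arccos_le_pi (a ξ)
  refine lt_of_le_of_ne h2 fun h3 => ?_
  rw [Real.arccos_eq_pi] at h3
  linarith

theorem cos_arccos (ξ : ℝ) : cos (arccos (a ξ)) = a ξ := by
  have h1 := abs_lt.1 (h.arc.abs_lt_one ξ)
  exact Real.cos_arccos h1.1.le h1.2.le

variable {σ δ : ℝ} {m : ℕ}

theorem cell_near (hσ : |σ| = 1) (hδ : 0 < δ) (hm : 0 < m) (hΔ : m * δ ≤ ε₀ / 8) {k : ℕ}
    (hk : k * δ < ε₀ / 2) {t : ℝ} (ht : t ∈ Icc (k * δ) ((k + 1) * δ)) :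
    logPot s X (ξ₀ + σ * t) (a (ξ₀ + σ * (baseIndex σ δ ξ₀ (log Z) ε₀ m k * δ))) ≤
      logPot s X (ξ₀ + σ * (baseIndex σ δ ξ₀ (log Z) ε₀ m k * δ))
        (a (ξ₀ + σ * (baseIndex σ δ ξ₀ (log Z) ε₀ m k * δ))) +
      cellConst r₁ R ε κ (card ι) δ (m * δ) := by
  classical
  have hε := h.ε₀_pos
  have hm' : (1 : ℝ) ≤ m := by exact_mod_cast hm
  have hδm : δ ≤ m * δ := by nlinarith
  have hbk : (baseIndex σ δ ξ₀ (log Z) ε₀ m k : ℝ) ≤ k := by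
    exact_mod_cast baseIndex_le _ _ _ _ _ _ _
  have hkb : (k : ℝ) + 1 ≤ baseIndex σ δ ξ₀ (log Z) ε₀ m k + m := by
    exact_mod_cast lt_baseIndex_add σ δ ξ₀ (log Z) ε₀ hm k
  have hkb' := mul_le_mul_of_nonneg_right hkb hδ.le
  have hbk' := mul_le_mul_of_nonneg_right hbk hδ.le
  have htε : t ≤ ε₀ := by linarith [ht.2]
  by_cases hf : |ξ₀ + σ * (k * δ) - log Z| ≤ 2 * (m * δ)
  · have hb : baseIndex σ δ ξ₀ (log Z) ε₀ m k = k := by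
      unfold baseIndex; rw [if_pos (Or.inl hf)]
    rw [hb]
    exact h.logPot_cell_fine hσ (by positivity) ht.1 htε (by linarith [ht.2]) hδm
  · push Not at hf
    refine h.logPot_cell_coarse hσ (by positivity) (by linarith [ht.1]) htε (by linarith [ht.2])
      (by linarith) fun v hv => ?_
    have h1 : |σ * (v - k * δ)| ≤ m * δ := by
      rw [abs_mul, hσ, one_mul, abs_le]
      constructor <;> linarith [hv.1, hv.2, ht.2]
    have e : ξ₀ + σ * (k * δ) - log Z =
        (ξ₀ + σ * v - log Z) - σ * (v - k * δ) := by ring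
    rw [e] at hf
    have := abs_sub (ξ₀ + σ * v - log Z) (σ * (v - k * δ))
    linarith

theorem cell_far (hσ : |σ| = 1) (hδ : 0 < δ)
    (hνδ : card ι * δ ^ 2 ≤ decayRate r₁ R c₀ ε₀ / 2) {k : ℕ}
    (hk : ε₀ / 2 ≤ k * δ) {t : ℝ} (ht : t ∈ Icc (k * δ) ((k + 1) * δ)) :
    logPot s X (ξ₀ + σ * t) (a (ξ₀ + σ * (baseIndex σ δ ξ₀ (log Z) ε₀ m k * δ))) ≤
      logPot s X ξ₀ (a ξ₀) - decayRate r₁ R c₀ ε₀ / 2 * card ι := by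
  have hν := h.card_pos
  have hε := h.ε₀_pos
  have hb : baseIndex σ δ ξ₀ (log Z) ε₀ m k = k := by
    unfold baseIndex; rw [if_pos (Or.inr hk)]
  rw [hb]
  have h1 := h.logPot_cell_far hσ (t := k * δ) (t' := t) (by positivity) ht.1
  have h2 := h.logPot_le_far (u := ξ₀ + σ * (k * δ))
    (by rw [abs_outward hσ (by positivity)]; linarith)
  have h3 : (card ι : ℝ) ^ 2 * (t - k * δ) ^ 2 ≤
      card ι * (decayRate r₁ R c₀ ε₀ / 2) := by
    calc (card ι : ℝ) ^ 2 * (t - k * δ) ^ 2 ≤ (card ι : ℝ) ^ 2 * δ ^ 2 := by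
          have : 0 ≤ t - k * δ := by linarith [ht.1]
          gcongr
          linarith [ht.2]
      _ = card ι * (card ι * δ ^ 2) := by ring
      _ ≤ _ := by gcongr
  linarith

/-- The contribution of a half-staircase. -/
theorem norm_stairInt_le (hσ : |σ| = 1) (hδ : 0 < δ) (hm : 0 < m) (hΔ : m * δ ≤ ε₀ / 8)
    (hνδ : card ι * δ ^ 2 ≤ decayRate r₁ R c₀ ε₀ / 2)
    (hC : cellConst r₁ R ε κ (card ι) δ (m * δ) ≤
      decayRate r₁ R c₀ ε₀ / 2 * card ι)
    {g : ℂ → ℂ} {K β H : ℝ} {N : ℕ} (hN : (N + 1) * δ ≤ H)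
    (hg : StairBound g (fun u b => logPot s X u b - logPot s X ξ₀ (a ξ₀)) ξ₀ K β H) :
    ‖stairInt g (fun k => ξ₀ + σ * (k * δ))
        (fun k => arccos (a (ξ₀ + σ * (baseIndex σ δ ξ₀ (log Z) ε₀ m k * δ)))) N‖ ≤
      4 * K * exp (cellConst r₁ R ε κ (card ι) δ (m * δ)) / sqrt β * sqrt H +
      (N * (2 * K * exp (-(decayRate r₁ R c₀ ε₀ / 2 * card ι)) *
          (1 / (sqrt β * sqrt δ)) * π) +
        2 * K * exp (cellConst r₁ R ε κ (card ι) δ (m * δ)) *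
          (π * sqrt (L * (m * δ))) *
          ((1 + log N) / (β * (m * δ)) +
            (10 * m) * (1 / (sqrt β * sqrt δ)))) := by
  classical
  have hε := h.ε₀_pos
  have hL := h.L_nonneg
  have hν := h.card_pos
  have hK := hg.K_nonneg
  have hβ := hg.β_pos
  have hcr := h.decayRate_pos
  set C := cellConst r₁ R ε κ (card ι) δ (m * δ) with hCdef
  have hm' : (1 : ℝ) ≤ m := by exact_mod_cast hm
  have hδm : δ ≤ m * δ := by nlinarith
  have hC0 : 0 ≤ C := h.cellConst_nonneg (by positivity)
  set b : ℕ → ℕ := baseIndex σ δ ξ₀ (log Z) ε₀ m with hb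
  have hbk : ∀ k : ℕ, (b k : ℝ) * δ ≤ k * δ := fun k => by
    have : (b k : ℝ) ≤ k := by exact_mod_cast baseIndex_le _ _ _ _ _ _ _
    gcongr
  have hkb : ∀ k : ℕ, ((k : ℝ) + 1) * δ ≤ b k * δ + m * δ := fun k => by
    have : (k : ℝ) + 1 ≤ b k + m := by
      exact_mod_cast lt_baseIndex_add σ δ ξ₀ (log Z) ε₀ hm k
    have := mul_le_mul_of_nonneg_right this hδ.le
    linarith
  -- the potential on cell `k`
  have hcell : ∀ k : ℕ, ∀ t ∈ Icc (k * δ) ((k + 1) * δ),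
      logPot s X (ξ₀ + σ * t) (a (ξ₀ + σ * (b k * δ))) - logPot s X ξ₀ (a ξ₀) ≤ C := by
    intro k t ht
    rcases lt_or_ge (k * δ) (ε₀ / 2) with hk | hk
    · have h1 := h.cell_near hσ hδ hm hΔ hk ht
      have h2 := h.logPot_le_saddle (ξ₀ + σ * (b k * δ))
      linarith
    · have h1 := h.cell_far (m := m) hσ hδ hνδ hk ht
      have : 0 ≤ decayRate r₁ R c₀ ε₀ / 2 * card ι := by positivity
      linarith
  have hcellfar : ∀ k : ℕ, ε₀ / 2 ≤ (k + 1) * δ → ∀ t ∈ Icc (k * δ) ((k + 1) * δ),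
      logPot s X (ξ₀ + σ * t) (a (ξ₀ + σ * (b k * δ))) - logPot s X ξ₀ (a ξ₀) ≤
        -(decayRate r₁ R c₀ ε₀ / 2 * card ι) := by
    intro k hk1 t ht
    rcases lt_or_ge (k * δ) (ε₀ / 2) with hk | hk
    · have h1 := h.cell_near hσ hδ hm hΔ hk ht
      have h2 := h.logPot_le_far (u := ξ₀ + σ * (b k * δ))
        (by rw [abs_outward hσ (by positivity)]; linarith [hkb k])
      linarith
    · have h1 := h.cell_far (m := m) hσ hδ hνδ hk ht
      linarith
  set E : Finset ℕ := (Finset.range N).filter (fun k : ℕ =>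
      |(ξ₀ - log Z) + σ * (k * δ)| ≤ 2 * (m * δ)) ∪
    (Finset.range N).filter (fun k : ℕ =>
      |(ξ₀ - log Z + σ * δ) + σ * (k * δ)| ≤ 2 * (m * δ)) with hE
  have hEcard : (E.card : ℝ) ≤ 10 * m := by
    have h1 : E.card ≤ (4 * m + 1) + (4 * m + 1) :=
      (Finset.card_union_le _ _).trans (add_le_add (card_window_le hσ hδ _ m N)
        (card_window_le hσ hδ _ m N))
    have h2 : E.card ≤ 10 * m := by omega
    exact_mod_cast h2
  have hfin := hg.norm_stairInt_le (σ := σ) (δ := δ) (C := C)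
    (D := decayRate r₁ R c₀ ε₀ / 2 * card ι) (J := π * sqrt (L * (m * δ)))
    (c := fun k => arccos (a (ξ₀ + σ * (b k * δ)))) (N := N) (m := m) (E := E) hσ hδ hN hm
    (by positivity) (fun k => h.arccos_mem _)
    (fun u p q d hp hq h1 h2 => by
      have := logPot_le_max s X u hp hq h1 h2
      rcases le_max_iff.1 this with h3 | h3
      · exact le_max_of_le_left (by linarith)
      · exact le_max_of_le_right (by linarith))
    (fun k _ t ht => by
      simp only [h.cos_arccos]
      exact hcell k t ht)
    (fun k hk => by
      simp only [h.cos_arccos]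
      rcases le_or_gt (ε₀ / 2) ((k + 1) * δ) with hfar | hnear
      · refine Or.inr (Or.inl ⟨hcellfar k hfar _ ⟨by gcongr; linarith, le_rfl⟩, ?_⟩)
        have := hcellfar (k + 1) (by push_cast; linarith) (((k + 1 : ℕ) : ℝ) * δ)
          ⟨le_rfl, by gcongr; linarith⟩
        push_cast at this
        exact this
      · by_cases hbb : b (k + 1) = b k
        · exact Or.inl (by rw [hbb])
        · refine Or.inr (Or.inr ⟨?_, ?_⟩)
          · by_contra hcon
            push Not at hcon
            obtain ⟨hdvd, hkE⟩ := hcon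
            apply hbb
            rw [hE, Finset.mem_union, mem_filter, mem_filter, Finset.mem_range] at hkE
            push Not at hkE
            have f1 := hkE.1 hk
            have f2 := hkE.2 hk
            have hk' : k * δ < ε₀ / 2 := by linarith
            have e1 : b k = m * (k / m) := by
              simp only [hb, baseIndex]
              rw [if_neg]
              rw [not_or, not_le, not_le]
              refine ⟨?_, hk'⟩
              rw [show ξ₀ + σ * (k * δ) - log Z = ξ₀ - log Z + σ * (k * δ) by ring]
              exact f1
            have e2 : b (k + 1) = m * ((k + 1) / m) := by
              simp only [hb, baseIndex]
              rw [if_neg]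
              rw [not_or, not_le, not_le]
              refine ⟨?_, by push_cast; exact hnear⟩
              rw [show ξ₀ + σ * ((k + 1 : ℕ) * δ) - log Z =
                ξ₀ - log Z + σ * δ + σ * (k * δ) by push_cast; ring]
              exact f2
            rw [e1, e2, Nat.succ_div, if_neg hdvd, add_zero]
          · have n1 : |ξ₀ + σ * (b (k + 1) * δ) - ξ₀| ≤ ε₀ := by
              rw [abs_outward hσ (by positivity)]
              have := hbk (k + 1)
              push_cast at this
              linarith
            have n2 : |ξ₀ + σ * (b k * δ) - ξ₀| ≤ ε₀ := by
              rw [abs_outward hσ (by positivity)]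
              have := hbk k
              linarith
            have hl := h.lip _ _ n1 n2
            have hd : |ξ₀ + σ * (b (k + 1) * δ) - (ξ₀ + σ * (b k * δ))| ≤ m * δ := by
              rw [add_sub_add_left_eq_sub, ← mul_sub, abs_mul, hσ, one_mul, abs_le]
              have g1 := hbk k
              have g2 := hkb k
              have g3 := hbk (k + 1)
              have g4 := hkb (k + 1)
              push_cast at g3 g4
              constructor <;> linarith
            refine (abs_arccos_sub_le (h.arc.abs_lt_one _).le (h.arc.abs_lt_one _).le).trans ?_
            gcongr
            exact hl.trans (by gcongr))
  refine hfin.trans ?_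
  have : 0 ≤ 2 * K * exp C * (π * sqrt (L * (m * δ))) := by positivity
  gcongr

end NearSaddle

end

section

theorem sqDist_le_exp_mul_sqDist {X r a b ρ : ℝ} (hr : 0 ≤ r) (ha : |a| ≤ 1) (hb : |b| ≤ 1)
    (hρ0 : 0 ≤ ρ) (hρ : ρ ≤ 1 / 2) (h : |X| ≤ ρ * r ∨ r ≤ ρ * |X|) :
    sqDist X r b ≤ exp (2 * (3 * ρ)) * sqDist X r a := by
  have h1 := sqDist_le (X := X) hr hb
  have h2 := sqDist_ge_sq_sub (X := X) hr ha
  have hX := abs_nonneg X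
  have key : ∀ u v : ℝ, 0 ≤ u → 0 ≤ v → u ≤ ρ * v → (u + v) ^ 2 ≤
      exp (2 * (3 * ρ)) * (v - u) ^ 2 := by
    intro u v hu hv huv
    have e1 : 1 + ρ ≤ exp ρ := by linarith [add_one_le_exp ρ]
    have e2 : 1 ≤ exp (2 * ρ) * (1 - ρ) := by
      have := add_one_le_exp (2 * ρ)
      nlinarith
    have e3 : u + v ≤ exp (3 * ρ) * (v - u) := by
      have e4 : exp (3 * ρ) = exp ρ * exp (2 * ρ) := by
        rw [← exp_add]; congr 1; ring
      calc u + v ≤ (1 + ρ) * v * 1 := by linarith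
        _ ≤ exp ρ * v * (exp (2 * ρ) * (1 - ρ)) := by gcongr
        _ = exp (3 * ρ) * ((1 - ρ) * v) := by rw [e4]; ring
        _ ≤ _ := by gcongr; linarith
    calc (u + v) ^ 2 ≤ (exp (3 * ρ) * (v - u)) ^ 2 := by gcongr
      _ = _ := by
        rw [mul_pow, ← exp_nat_mul]; norm_num
  have h3 : (|X| + r) ^ 2 ≤ exp (2 * (3 * ρ)) * (|X| - r) ^ 2 := by
    rcases h with h | h
    · have := key |X| r hX hr h
      rw [sub_sq_comm]; exact this
    · have := key r |X| hr hX h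
      rw [add_comm]; exact this
  calc sqDist X r b ≤ (|X| + r) ^ 2 := h1
    _ ≤ _ := h3
    _ ≤ _ := by gcongr

variable {ι : Type*} [Fintype ι]

theorem logPot_le_of_sqDist_le (s : ℝ) (X : ι → ℝ) (ξ : ℝ) {a b τ : ℝ} (ha : |a| < 1) (hb : |b| < 1)
    (h : ∀ i, sqDist (X i) (exp ξ) b ≤ exp (2 * τ) * sqDist (X i) (exp ξ) a) :
    logPot s X ξ a ≤ logPot s X ξ b + card ι * τ := by
  unfold logPot
  have : ∑ i, log (sqDist (X i) (exp ξ) b) ≤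
      ∑ i, (2 * τ + log (sqDist (X i) (exp ξ) a)) := by
    refine sum_le_sum fun i _ => ?_
    have h1 := sqDist_pos (X := X i) (exp_pos ξ) ha
    have h2 := sqDist_pos (X := X i) (exp_pos ξ) hb
    rw [← Real.log_exp (2 * τ), ← log_mul (exp_pos _).ne' h1.ne']
    exact log_le_log h2 (h i)
  rw [sum_add_distrib, sum_const, card_univ, nsmul_eq_mul] at this
  linarith

/-- On a circle that has all positive points far outside, the potential hardly increases with the
angle decreasing. -/
theorem logPot_le_inner (s : ℝ) (X : ι → ℝ) (ξ : ℝ) {a b ρ X₀ : ℝ} (ha : |a| < 1) (hb : |b| < 1)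
    (hab : b ≤ a) (hρ0 : 0 ≤ ρ) (hρ : ρ ≤ 1 / 2) (hX : ∀ i, X i ≤ 0 ∨ X₀ ≤ X i)
    (hξ : exp ξ ≤ ρ * X₀) :
    logPot s X ξ a ≤ logPot s X ξ b + card ι * (3 * ρ) := by
  refine logPot_le_of_sqDist_le s X ξ ha hb fun i => ?_
  rcases hX i with h | h
  · have h1 := sqDist_sub (X i) (exp ξ) a b
    have h2 : 0 ≤ X i * exp ξ * (b - a) := mul_nonneg_of_nonpos_of_nonpos
      (mul_nonpos_of_nonpos_of_nonneg h (exp_pos ξ).le) (by linarith)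
    have h3 : 1 ≤ exp (2 * (3 * ρ)) := one_le_exp (by positivity)
    have h4 := sqDist_pos (X := X i) (exp_pos ξ) ha
    nlinarith
  · refine sqDist_le_exp_mul_sqDist (exp_pos ξ).le ha.le hb.le hρ0 hρ (Or.inr ?_)
    refine hξ.trans ?_
    gcongr
    exact h.trans (le_abs_self _)

theorem logPot_le_outer (s : ℝ) (X : ι → ℝ) (ξ : ℝ) {a b ρ Y₀ : ℝ} (ha : |a| < 1) (hb : |b| < 1)
    (hab : a ≤ b) (hρ0 : 0 ≤ ρ) (hρ : ρ ≤ 1 / 2) (hX : ∀ i, 0 ≤ X i ∨ |X i| ≤ Y₀)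
    (hξ : Y₀ ≤ ρ * exp ξ) :
    logPot s X ξ a ≤ logPot s X ξ b + card ι * (3 * ρ) := by
  refine logPot_le_of_sqDist_le s X ξ ha hb fun i => ?_
  rcases hX i with h | h
  · have h1 := sqDist_sub (X i) (exp ξ) a b
    have h2 : 0 ≤ X i * exp ξ * (b - a) := mul_nonneg
      (mul_nonneg h (exp_pos ξ).le) (by linarith)
    have h3 : 1 ≤ exp (2 * (3 * ρ)) := one_le_exp (by positivity)
    have h4 := sqDist_pos (X := X i) (exp_pos ξ) ha
    nlinarith
  · exact sqDist_le_exp_mul_sqDist (exp_pos ξ).le ha.le hb.le hρ0 hρ (Or.inl (h.trans hξ))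

section arcs

variable {g : ℂ → ℂ} {W : ℝ → ℝ → ℝ} {ξ₀ K β H : ℝ}

theorem weight_le_of_le {δ u : ℝ} (hβ : 0 < β) (hδ : 0 < δ) (hu : δ ≤ u) :
    weight β u ≤ 1 / (sqrt β * sqrt δ) := by
  have : 0 < sqrt β := sqrt_pos.2 hβ
  have : 0 < sqrt δ := sqrt_pos.2 hδ
  refine (min_le_right _ _).trans ?_
  gcongr

theorem StairBound.norm_vert_le (h : StairBound g W ξ₀ K β H) {s D δ p q e : ℝ} (hδ : 0 < δ)
    (hs : δ ≤ |s - ξ₀|) (hs' : |s - ξ₀| ≤ H) (hpq : p ≤ q)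
    (hsin : ∀ y ∈ Ioc p q, y ≠ e → sin y ≠ 0 ∧ W s (cos y) ≤ -D) :
    ‖∫ y in p..q, g (s + y * I) * I‖ ≤
      K * exp (-D) * (1 / (sqrt β * sqrt δ)) * (q - p) := by
  have hK := h.K_nonneg
  have hβ := h.β_pos
  have hne : s ≠ ξ₀ := fun h0 => by rw [h0, sub_self, abs_zero] at hs; linarith
  refine (intervalIntegral.norm_integral_le_of_norm_le_const_ae ?_).trans_eq
    (by rw [abs_of_nonneg (sub_nonneg.2 hpq)])
  have hae : ∀ᵐ y : ℝ, y ≠ e := by simp [ae_iff]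
  filter_upwards [hae] with y hy hmem
  rw [uIoc_of_le hpq] at hmem
  obtain ⟨h1, h2⟩ := hsin y hmem hy
  rw [norm_mul, norm_I, mul_one]
  refine (h.bound s y hne hs' h1).trans ?_
  gcongr
  · exact weight_nonneg hβ (abs_nonneg _)
  · exact weight_le_of_le hβ hδ hs

end arcs

theorem horizInt_congr {g₁ g₂ : ℂ → ℂ} {p q c : ℝ}
    (h : ∀ s ∈ uIcc p q, ∀ y : ℝ, g₁ (s + y * I) = g₂ (s + y * I)) :
    horizInt g₁ p q c = horizInt g₂ p q c := by
  refine intervalIntegral.integral_congr fun s hs => ?_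
  have h2 := h s hs (-c)
  rw [ofReal_neg, neg_mul, ← sub_eq_add_neg] at h2
  simp only [h s hs c, h2]

theorem stairInt_congr_outward {g₁ g₂ : ℂ → ℂ} {ξ₀ σ δ : ℝ} (hσ : |σ| = 1) (hδ : 0 ≤ δ) {c : ℕ → ℝ}
    {N : ℕ} (h : ∀ t, 0 ≤ t → ∀ y : ℝ,
      g₁ ((ξ₀ + σ * t : ℝ) + y * I) = g₂ ((ξ₀ + σ * t : ℝ) + y * I)) :
    stairInt g₁ (fun k => ξ₀ + σ * (k * δ)) c N = stairInt g₂ (fun k => ξ₀ + σ * (k * δ)) c N := by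
  unfold stairInt
  congr 1
  · refine sum_congr rfl fun k _ => horizInt_congr fun s hs y => ?_
    obtain ⟨v, hv, rfl⟩ := NearSaddle.uIcc_outward hσ
      (by gcongr; simp : (k : ℝ) * δ ≤ ((k + 1 : ℕ) : ℝ) * δ) hs
    exact h v (le_trans (by positivity) hv.1) y
  · refine sum_congr rfl fun k _ => intervalIntegral.integral_congr fun y _ => ?_
    have h1 := h (((k + 1 : ℕ) : ℝ) * δ) (by positivity) y
    have h2 := h (((k + 1 : ℕ) : ℝ) * δ) (by positivity) (-y)
    rw [ofReal_neg, neg_mul, ← sub_eq_add_neg] at h2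
    simp only [h1, h2]

end

section

/-- The bound for the contribution of a half-staircase together with its closing arc. -/
def stairErr (K β H L C D δ : ℝ) (m N : ℕ) : ℝ :=
  4 * K * exp C / sqrt β * sqrt H +
    (N * (2 * K * exp (-D) * (1 / (sqrt β * sqrt δ)) * π) +
      2 * K * exp C * (π * sqrt (L * (m * δ))) *
        ((1 + log N) / (β * (m * δ)) + (10 * m) * (1 / (sqrt β * sqrt δ)))) +
    K * exp (-(D / 2)) * (1 / (sqrt β * sqrt δ)) * (2 * π)

variable {n k : ℕ} {x : Fin n → ℝ} {y : Fin k → ℝ}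

theorem genFun_ne_zero {z : ℂ} (hz : z ≠ 0) (h1 : ∀ i, 1 - (x i : ℂ) * z ≠ 0)
    (h2 : ∀ j, z + (y j : ℂ) ≠ 0) : genFun x y z ≠ 0 := by
  unfold genFun
  refine mul_ne_zero (prod_ne_zero_iff.2 fun i _ => inv_ne_zero (h1 i))
    (prod_ne_zero_iff.2 fun j _ => inv_ne_zero ?_)
  have := h2 j
  intro h
  apply this
  field_simp at h
  rwa [mul_zero] at h

theorem ne_of_im_ne_zero {z : ℂ} (hz : z.im ≠ 0) (hx : ∀ i, 0 < x i) :
    (∀ i, 1 - (x i : ℂ) * z ≠ 0) ∧ ∀ j, z + (y j : ℂ) ≠ 0 := by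
  constructor
  · intro i h
    have := congrArg Complex.im h
    simp at this
    rcases this with h | h
    · exact (hx i).ne' h
    · exact hz h
  · intro j h
    have := congrArg Complex.im h
    simp at this
    exact hz this

theorem ne_of_mem_contourDomain {p q : ℝ} (hx : ∀ i, 0 < x i) (hy : ∀ j, 0 ≤ y j)
    (hp : ∀ i, exp p * x i < 1) (hq : ∀ j, y j < exp q) {ζ : ℂ}
    (hζ : ζ ∈ contourDomain p q) :
    (∀ i, 1 - (x i : ℂ) * Complex.exp ζ ≠ 0) ∧ ∀ j, Complex.exp ζ + (y j : ℂ) ≠ 0 := by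
  obtain ⟨h1, h2⟩ := exp_of_mem_contourDomain hζ
  constructor
  · intro i h
    have hxi : (x i : ℂ) ≠ 0 := ofReal_ne_zero.2 (hx i).ne'
    have e : Complex.exp ζ = ((x i)⁻¹ : ℝ) := by
      push_cast
      field_simp
      linear_combination -h
    rw [e] at h2
    rcases h2 with h2 | h2
    · rw [← ofReal_neg, ofReal_mem_slitPlane] at h2
      have := inv_pos.2 (hx i)
      linarith
    · rw [norm_real, norm_eq_abs, abs_of_pos (inv_pos.2 (hx i))] at h2
      have := hp i
      rw [← h2, inv_mul_cancel₀ (hx i).ne'] at this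
      exact lt_irrefl _ this
  · intro j h
    have e : Complex.exp ζ = ((-y j : ℝ) : ℂ) := by
      push_cast
      linear_combination h
    rw [e] at h1
    rcases h1 with h1 | h1
    · rw [ofReal_mem_slitPlane] at h1
      linarith [hy j]
    · rw [norm_real, norm_eq_abs, abs_neg, abs_of_nonneg (hy j)] at h1
      exact absurd (hq j) (by rw [h1]; exact lt_irrefl _)

theorem continuousOn_integrand {p q : ℝ} (hx : ∀ i, 0 < x i) (hy : ∀ j, 0 ≤ y j)
    (hp : ∀ i, exp p * x i < 1) (hq : ∀ j, y j < exp q) (e e' : ℤ) :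
    ContinuousOn (expPull fun z => genFun x y z * z ^ e * outerInt x y e' z)
      (contourDomain p q) := by
  obtain ⟨Q, M, hQ⟩ := exists_outer x y e'
  have houter : ∀ z : ℂ, z ≠ 0 → outerInt x y e' z = Q.eval z * z ^ (-(M : ℤ)) := by
    intro z hz
    have hn : 0 < ‖z‖ := norm_pos_iff.2 hz
    exact (hQ z hz).1 _ (by positivity) (by linarith)
  have : EqOn (expPull fun z => genFun x y z * z ^ e * outerInt x y e' z)
      (expPull fun z => genFun x y z * z ^ e * (Q.eval z * z ^ (-(M : ℤ)))) (contourDomain p q) := by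
    intro ζ _
    dsimp only [expPull]
    rw [houter _ (exp_ne_zero ζ)]
  refine ContinuousOn.congr ?_ this
  intro ζ hζ
  refine ContinuousAt.continuousWithinAt ?_
  have hz := exp_ne_zero ζ
  obtain ⟨h1, h2⟩ := ne_of_mem_contourDomain hx hy hp hq hζ
  have hgen : ContinuousAt (genFun x y) (Complex.exp ζ) := by
    unfold genFun
    refine ContinuousAt.mul (tendsto_finsetProd _ fun i _ => ?_)
      (tendsto_finsetProd _ fun j _ => ?_)
    · exact ContinuousAt.inv₀ (by fun_prop) (h1 i)
    · refine ContinuousAt.inv₀ (by fun_prop (disch := exact hz)) ?_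
      intro h
      apply h2 j
      field_simp at h
      rwa [mul_zero] at h
  have hpull : ContinuousAt (fun z => genFun x y z * z ^ e * (Q.eval z * z ^ (-(M : ℤ))))
      (Complex.exp ζ) :=
    (hgen.mul (continuousAt_zpow₀ _ _ (Or.inl hz))).mul
      (Q.continuous.continuousAt.mul (continuousAt_zpow₀ _ _ (Or.inl hz)))
  unfold expPull
  exact (ContinuousAt.comp (f := Complex.exp) hpull (by fun_prop)).mul (by fun_prop)

theorem continuous_expPull_zpow (b : ℂ) (e : ℤ) : Continuous (expPull fun z => b * z ^ e) := by
  unfold expPull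
  refine Continuous.mul (Continuous.mul continuous_const ?_) (by fun_prop)
  exact Continuous.zpow₀ (by fun_prop) _ fun ζ => Or.inl (exp_ne_zero ζ)

theorem differentiable_expPull_zpow (b : ℂ) (e : ℤ) :
    Differentiable ℂ (expPull fun z => b * z ^ e) := by
  unfold expPull
  refine Differentiable.mul (Differentiable.mul (differentiable_const _) ?_) (by fun_prop)
  intro ζ
  exact DifferentiableAt.zpow (by fun_prop) (Or.inl (exp_ne_zero ζ))

set_option maxHeartbeats 1000000 in
/-- The kernel at finite size, up to an error, is an arc integral. -/
theorem norm_corrKernel_sub_le (hx : ∀ i, 0 < x i) (hy : ∀ j, 0 ≤ y j) (Γ : Contours x y)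
    {q : ℤ} {a : ℝ → ℝ} {ξ₀ : ℝ} {A : Finset (Fin n ⊕ Fin k)} {Z r₁ R c₀ L ε ε₀ : ℝ} {κ : ℕ}
    (h : NearSaddle (sites x y) (k - q) a ξ₀ A Z r₁ R c₀ L ε ε₀ κ) (l l' : ℤ)
    {δ β T ρ X₀ Y₀ : ℝ} {m N : ℕ} (hδ : 0 < δ) (hm : 0 < m) (hΔ : m * δ ≤ ε₀ / 8)
    (hνδ : card (Fin n ⊕ Fin k) * δ ^ 2 ≤ decayRate r₁ R c₀ ε₀ / 2)
    (hC : cellConst r₁ R ε κ (card (Fin n ⊕ Fin k)) δ (m * δ) ≤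
      decayRate r₁ R c₀ ε₀ / 2 * card (Fin n ⊕ Fin k))
    (hβ : 0 < β) (hβS : (β ^ 2) ^ 2 ≤
      exp ξ₀ ^ 2 * ∑ i, sites x y i ^ 2 / (|sites x y i| + exp ξ₀) ^ 4)
    (hT : |ξ₀| + (N + 1) * δ ≤ T) (hNε : ε₀ / 2 ≤ N * δ)
    (hρ0 : 0 ≤ ρ) (hρ : ρ ≤ 1 / 2) (hρD : 3 * ρ ≤ decayRate r₁ R c₀ ε₀ / 4)
    (hX₀ : 0 < X₀) (hX : ∀ i, sites x y i ≤ 0 ∨ X₀ ≤ sites x y i)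
    (hY : ∀ i, 0 ≤ sites x y i ∨ |sites x y i| ≤ Y₀)
    (hin : exp (ξ₀ - (N + 1) * δ) ≤ ρ * X₀)
    (hout : Y₀ ≤ ρ * exp (ξ₀ + (N + 1) * δ)) :
    ‖corrKernel x y Γ (q + l) (q + l') - (2 * (π : ℂ) * I)⁻¹ *
        arcInt (expPull fun z => z ^ (l' - l - 1)) ξ₀ (arccos (a ξ₀))‖ ≤
      2 * stairErr (kernelConst l l' T) β T L
        (cellConst r₁ R ε κ (card (Fin n ⊕ Fin k)) δ (m * δ))
        (decayRate r₁ R c₀ ε₀ / 2 * card (Fin n ⊕ Fin k)) δ m N := by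
  have hν := h.card_pos
  have hN0 : (0 : ℝ) ≤ N := Nat.cast_nonneg N
  have hNδ : 0 ≤ (N : ℝ) * δ := by positivity
  set D := decayRate r₁ R c₀ ε₀ / 2 * card (Fin n ⊕ Fin k) with hD
  set X := sites x y with hXdef
  set g := expPull fun z => genFun x y z * z ^ (-(q + l) - 1) * outerInt x y (q + l') z with hg
  set Φ := expPull fun z => genFun x y z * z ^ (-(q + l) - 1) * cauchyInt x y (q + l') ξ₀ z
    with hΦ
  set M := expPull fun z => (2 * (π : ℂ) * I) * z ^ (l' - l - 1) with hM
  set K := kernelConst l l' T with hK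
  have hT0 : 0 ≤ T := le_trans (by positivity) hT
  have hK0 : 0 ≤ K := by rw [hK]; unfold kernelConst; positivity
  -- the bound for the integrand
  have hbound : ∀ s θ : ℝ, s ≠ ξ₀ → |s - ξ₀| ≤ (N + 1) * δ → sin θ ≠ 0 →
      ‖Φ (s + θ * I)‖ ≤ K * exp (logPot (k - q) X s (cos θ) -
        logPot (k - q) X ξ₀ (a ξ₀)) * weight β |s - ξ₀| := by
    intro s θ hs hsH hθ
    refine norm_integrand_le hx h.arc ?_ hβ hβS ?_ ?_ hs hθ
    · rw [sub_sub_cancel]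
      field_simp
      norm_num
    · linarith
    · have := abs_add_le (s - ξ₀) ξ₀
      rw [sub_add_cancel] at this
      linarith
  -- comparison of the `w`-integrals
  have hcmp_out : ∀ s θ : ℝ, ξ₀ < s → Φ (s + θ * I) = g (s + θ * I) := by
    intro s θ hs
    have hn : ‖Complex.exp (s + θ * I)‖ = exp s := by rw [norm_exp]; simp
    rw [hΦ, hg]
    dsimp only [expPull, cauchyInt]
    rw [circleIntegral_eq_outerInt x y _ (exp_pos ξ₀)
      (by rw [hn]; exact exp_lt_exp.2 hs)]
  have hcmp_in : ∀ s θ : ℝ, s < ξ₀ → sin θ ≠ 0 →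
      Φ (s + θ * I) = g (s + θ * I) - M (s + θ * I) := by
    intro s θ hs hθ
    set z := Complex.exp (s + θ * I) with hz
    have hn : ‖z‖ = exp s := by rw [hz, norm_exp]; simp
    have hz0 : z ≠ 0 := exp_ne_zero _
    have him : z.im ≠ 0 := by
      rw [hz, exp_im]
      simpa using hθ
    have hne := ne_of_im_ne_zero (x := x) (y := y) him hx
    have hg0 : genFun x y z ≠ 0 := genFun_ne_zero hz0 hne.1 hne.2
    rw [hΦ, hg, hM]
    dsimp only [expPull, cauchyInt]
    rw [← hz, circleIntegral_eq_outerInt_sub x y _ hz0 (by rw [hn]; exact exp_lt_exp.2 hs)]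
    have e1 : z ^ (l' - l - 1) = z ^ (-(q + l) - 1) * z ^ (q + l') := by
      rw [← zpow_add₀ hz0]; congr 1; ring
    rw [e1]
    field_simp
  set Go : ℂ → ℂ := fun ζ => open Classical in if ξ₀ ≤ ζ.re then g ζ else Φ ζ with hGo
  set Gi : ℂ → ℂ := fun ζ => open Classical in if ζ.re ≤ ξ₀ then g ζ - M ζ else Φ ζ with hGi
  have hre : ∀ s y : ℝ, (s + y * I : ℂ).re = s := fun s y => by simp
  have hbo : StairBound Go (fun u b => logPot (k - q) X u b - logPot (k - q) X ξ₀ (a ξ₀)) ξ₀ K β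
      ((N + 1) * δ) := by
    refine ⟨hK0, hβ, fun s θ hs hsH hθ => ?_⟩
    have e : Go (s + θ * I) = Φ (s + θ * I) := by
      simp only [hGo, hre]
      split_ifs with hc
      · exact (hcmp_out s θ (lt_of_le_of_ne hc hs.symm)).symm
      · rfl
    rw [e]
    exact hbound s θ hs hsH hθ
  have hbi : StairBound Gi (fun u b => logPot (k - q) X u b - logPot (k - q) X ξ₀ (a ξ₀)) ξ₀ K β
      ((N + 1) * δ) := by
    refine ⟨hK0, hβ, fun s θ hs hsH hθ => ?_⟩
    have e : Gi (s + θ * I) = Φ (s + θ * I) := by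
      simp only [hGi, hre]
      split_ifs with hc
      · exact (hcmp_in s θ (lt_of_le_of_ne hc hs) hθ).symm
      · rfl
    rw [e]
    exact hbound s θ hs hsH hθ
  set ξ : ℕ → ℝ := fun k => ξ₀ + (-1) * (k * δ) with hξ
  set η : ℕ → ℝ := fun k => ξ₀ + 1 * (k * δ) with hη
  set c : ℕ → ℝ := fun k =>
    arccos (a (ξ₀ + (-1) * (baseIndex (-1) δ ξ₀ (log Z) ε₀ m k * δ))) with hc
  set d : ℕ → ℝ := fun k =>
    arccos (a (ξ₀ + 1 * (baseIndex 1 δ ξ₀ (log Z) ε₀ m k * δ))) with hd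
  have hcm : ∀ k, c k ∈ Ioo 0 π := fun k => h.arccos_mem _
  have hdm : ∀ k, d k ∈ Ioo 0 π := fun k => h.arccos_mem _
  have hc0 : c 0 = arccos (a ξ₀) := by simp only [hc, baseIndex_zero]; simp
  have hd0 : d 0 = arccos (a ξ₀) := by simp only [hd, baseIndex_zero]; simp
  have hξ0 : ξ 0 = ξ₀ := by simp [hξ]
  have hη0 : η 0 = ξ₀ := by simp [hη]
  have hξN : ξ (N + 1) = ξ₀ - (N + 1) * δ := by simp only [hξ]; push_cast; ring
  have hηN : η (N + 1) = ξ₀ + (N + 1) * δ := by simp only [hη]; push_cast; ring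
  have hxp : ∀ i, exp (ξ (N + 1)) * x i < 1 := by
    intro i
    have h1 : X₀ ≤ (x i)⁻¹ := by
      rcases hX (Sum.inl i) with h0 | h0
      · exact absurd h0 (not_le.2 (by simpa [hXdef, sites] using hx i))
      · simpa [hXdef, sites] using h0
    rw [hξN]
    have h2 : exp (ξ₀ - (N + 1) * δ) < (x i)⁻¹ := by
      refine lt_of_le_of_lt hin ?_
      have : ρ * X₀ ≤ 1 / 2 * X₀ := by gcongr
      linarith
    calc _ < (x i)⁻¹ * x i := mul_lt_mul_of_pos_right h2 (hx i)
      _ = 1 := inv_mul_cancel₀ (hx i).ne'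
  have hyq : ∀ j, y j < exp (η (N + 1)) := by
    intro j
    rw [hηN]
    have hE := exp_pos (ξ₀ + (N + 1) * δ)
    rcases hY (Sum.inr j) with h0 | h0
    · have : y j ≤ 0 := by simpa [hXdef, sites] using h0
      linarith
    · have h1 : y j ≤ Y₀ := by simpa [hXdef, sites, abs_of_nonneg (hy j)] using h0
      have : ρ * exp (ξ₀ + (N + 1) * δ) ≤ 1 / 2 * exp (ξ₀ + (N + 1) * δ) := by gcongr
      linarith
  have hker := corrKernel_eq_contourInt hx hy Γ (q + l) (q + l') (ξ := ξ) (c := c) (η := η) (d := d)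
    (N := N) hxp hyq hcm hdm (by rw [hξ0, hη0]) (by rw [hc0, hd0])
  rw [← hg] at hker
  have hgc : ContinuousOn g (contourDomain (ξ (N + 1)) (η (N + 1))) :=
    continuousOn_integrand hx hy hxp hyq _ _
  have hMc : Continuous M := continuous_expPull_zpow _ _
  have hMd : Differentiable ℂ M := differentiable_expPull_zpow _ _
  have hgM : ContinuousOn (fun ζ => g ζ - M ζ) (contourDomain (ξ (N + 1)) (η (N + 1))) :=
    hgc.sub hMc.continuousOn
  -- the inner part
  have hstair_in : stairInt g ξ c N = stairInt (fun ζ => g ζ - M ζ) ξ c N + stairInt M ξ c N := by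
    rw [← stairInt_add hgM hMc.continuousOn hcm]
    simp
  have harc_in : arcInt g (ξ (N + 1)) (c N) =
      arcInt (fun ζ => g ζ - M ζ) (ξ (N + 1)) (c N) + arcInt M (ξ (N + 1)) (c N) := by
    unfold arcInt
    rw [← intervalIntegral.integral_add (intervalIntegrable_arcInt hgM (hcm _))
      (intervalIntegrable_arcInt hMc.continuousOn (hcm _) (q := 0))]
    congr 1; funext s; ring
  have hMmain : arcInt M (ξ (N + 1)) (c N) - stairInt M ξ c N = arcInt M ξ₀ (arccos (a ξ₀)) := by
    rw [stairInt_eq_arcInt hMd.differentiableOn ξ hcm N, hξ0, hc0]; ring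
  have hMarc : arcInt M ξ₀ (arccos (a ξ₀)) = (2 * (π : ℂ) * I) *
      arcInt (expPull fun z => z ^ (l' - l - 1)) ξ₀ (arccos (a ξ₀)) := by
    unfold arcInt
    rw [← intervalIntegral.integral_const_mul]
    congr 1; funext s
    simp only [hM, expPull]; ring
  have hGi_eq : ∀ t, 0 ≤ t → ∀ y : ℝ, (fun ζ => g ζ - M ζ) ((ξ₀ + (-1) * t : ℝ) + y * I) =
      Gi ((ξ₀ + (-1) * t : ℝ) + y * I) := by
    intro t ht y
    simp only [hGi, hre]
    rw [if_pos (by linarith)]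
  have hGo_eq : ∀ t, 0 ≤ t → ∀ y : ℝ, g ((ξ₀ + 1 * t : ℝ) + y * I) =
      Go ((ξ₀ + 1 * t : ℝ) + y * I) := by
    intro t ht y
    simp only [hGo, hre]
    rw [if_pos (by linarith)]
  have hσi : |(-1 : ℝ)| = 1 := by norm_num
  have hσo : |(1 : ℝ)| = 1 := by norm_num
  have hsi : stairInt (fun ζ => g ζ - M ζ) ξ c N = stairInt Gi ξ c N :=
    stairInt_congr_outward hσi hδ.le hGi_eq
  have hso : stairInt g η d N = stairInt Go η d N := stairInt_congr_outward hσo hδ.le hGo_eq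
  have hai : arcInt (fun ζ => g ζ - M ζ) (ξ (N + 1)) (c N) = arcInt Gi (ξ (N + 1)) (c N) := by
    unfold arcInt
    refine intervalIntegral.integral_congr fun y _ => ?_
    have := hGi_eq (((N + 1 : ℕ) : ℝ) * δ) (by positivity) y
    simp only [hξ]
    simp only at this
    rw [this]
  have hao : coarcInt g (η (N + 1)) (d N) = coarcInt Go (η (N + 1)) (d N) := by
    unfold coarcInt
    refine intervalIntegral.integral_congr fun y _ => ?_
    have := hGo_eq (((N + 1 : ℕ) : ℝ) * δ) (by positivity) y
    simp only [hη]
    rw [this]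
  -- the estimates
  have bsi := h.norm_stairInt_le (m := m) hσi hδ hm hΔ hνδ hC le_rfl hbi
  have bso := h.norm_stairInt_le (m := m) hσo hδ hm hΔ hνδ hC le_rfl hbo
  have hH : (N + 1) * δ ≤ T := by linarith [abs_nonneg ξ₀]
  have hδN : δ ≤ (N + 1) * δ := by linarith
  have hcard3 : card (Fin n ⊕ Fin k) * (3 * ρ) ≤ D / 2 := by
    rw [hD]
    calc (card (Fin n ⊕ Fin k) : ℝ) * (3 * ρ) ≤
        card (Fin n ⊕ Fin k) * (decayRate r₁ R c₀ ε₀ / 4) := by gcongr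
      _ = _ := by ring
  have hmemN : ((N + 1 : ℕ) : ℝ) * δ ∈ Icc ((N : ℝ) * δ) ((N + 1) * δ) := by
    push_cast; exact ⟨by linarith, le_rfl⟩
  have hfi := h.cell_far (m := m) hσi hδ hνδ hNε hmemN
  have hfo := h.cell_far (m := m) hσo hδ hνδ hNε hmemN
  have bai : ‖arcInt Gi (ξ (N + 1)) (c N)‖ ≤
      K * exp (-(D / 2)) * (1 / (sqrt β * sqrt δ)) * (2 * π) := by
    have hcN := hcm N
    have hdist : |ξ (N + 1) - ξ₀| = (N + 1) * δ := by
      rw [hξN, sub_sub_cancel_left, abs_neg, abs_of_nonneg (by positivity)]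
    refine (hbi.norm_vert_le (s := ξ (N + 1)) (D := D / 2) (δ := δ) (e := 0) hδ
      (by rw [hdist]; exact hδN) hdist.le (by linarith [hcN.1]) ?_).trans ?_
    · intro y hy hy0
      have hsin : sin y ≠ 0 := by
        rcases lt_or_gt_of_ne hy0 with h0 | h0
        · exact (Real.sin_neg_of_neg_of_neg_pi_lt h0 (by linarith [hy.1, hcN.2])).ne
        · exact (sin_pos_of_pos_of_lt_pi h0 (by linarith [hy.2, hcN.2])).ne'
      refine ⟨hsin, ?_⟩
      have hcos : cos (c N) ≤ cos y := by
        rw [← Real.cos_abs y]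
        exact cos_le_cos_of_nonneg_of_le_pi (abs_nonneg y) hcN.2.le
          (abs_le.2 ⟨hy.1.le, hy.2⟩)
      have h1 := logPot_le_inner (k - q) X (ξ (N + 1)) (abs_cos_lt_one hsin)
        (abs_cos_lt_one (sin_pos_of_mem_Ioo hcN).ne') hcos hρ0 hρ hX (by rw [hξN]; exact hin)
      have h2 : cos (c N) =
          a (ξ₀ + (-1) * (baseIndex (-1) δ ξ₀ (log Z) ε₀ m N * δ)) := h.cos_arccos _
      rw [h2] at h1
      linarith
    · gcongr
      linarith [hcN.2]
  have bao : ‖coarcInt Go (η (N + 1)) (d N)‖ ≤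
      K * exp (-(D / 2)) * (1 / (sqrt β * sqrt δ)) * (2 * π) := by
    have hdN := hdm N
    have hdist : |η (N + 1) - ξ₀| = (N + 1) * δ := by
      rw [hηN, add_sub_cancel_left, abs_of_nonneg (by positivity)]
    refine (hbo.norm_vert_le (s := η (N + 1)) (D := D / 2) (δ := δ) (e := π) hδ
      (by rw [hdist]; exact hδN) hdist.le (by linarith [hdN.2]) ?_).trans ?_
    · intro y hy hy0
      have hsin : sin y ≠ 0 := by
        rcases lt_or_gt_of_ne hy0 with h0 | h0
        · exact (sin_pos_of_pos_of_lt_pi (by linarith [hy.1, hdN.1]) h0).ne'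
        · intro h1
          have := sin_pos_of_pos_of_lt_pi (x := y - π) (by linarith)
            (by linarith [hy.2, hdN.1])
          rw [Real.sin_sub_pi, h1] at this
          simp at this
      refine ⟨hsin, ?_⟩
      have hcos : cos y ≤ cos (d N) := by
        rcases le_total y π with h0 | h0
        · exact cos_le_cos_of_nonneg_of_le_pi hdN.1.le h0 hy.1.le
        · rw [← cos_two_pi_sub y]
          exact cos_le_cos_of_nonneg_of_le_pi hdN.1.le (by linarith) (by linarith [hy.2])
      have h1 := logPot_le_outer (k - q) X (η (N + 1)) (abs_cos_lt_one hsin)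
        (abs_cos_lt_one (sin_pos_of_mem_Ioo hdN).ne') hcos hρ0 hρ hY (by rw [hηN]; exact hout)
      have h2 : cos (d N) =
          a (ξ₀ + 1 * (baseIndex 1 δ ξ₀ (log Z) ε₀ m N * δ)) := h.cos_arccos _
      rw [h2] at h1
      linarith
    · gcongr
      linarith [hdN.1]
  -- conclusion
  have h2pi : (2 * (π : ℂ) * I) ≠ 0 := Complex.two_pi_I_ne_zero
  have hdiff : corrKernel x y Γ (q + l) (q + l') - (2 * (π : ℂ) * I)⁻¹ *
        arcInt (expPull fun z => z ^ (l' - l - 1)) ξ₀ (arccos (a ξ₀)) =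
      ((2 * (π : ℂ) * I) ^ 2)⁻¹ *
        ((arcInt Gi (ξ (N + 1)) (c N) - stairInt Gi ξ c N) +
          (stairInt Go η d N + coarcInt Go (η (N + 1)) (d N))) := by
    rw [hker, contourInt, harc_in, hstair_in, hsi, hso, hai, hao]
    rw [hMarc] at hMmain
    have : (2 * (π : ℂ) * I)⁻¹ *
        arcInt (expPull fun z => z ^ (l' - l - 1)) ξ₀ (arccos (a ξ₀)) =
        ((2 * (π : ℂ) * I) ^ 2)⁻¹ * ((2 * (π : ℂ) * I) *
          arcInt (expPull fun z => z ^ (l' - l - 1)) ξ₀ (arccos (a ξ₀))) := by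
      field_simp
    rw [this, ← hMmain]
    ring
  have hsqrtH : sqrt ((N + 1) * δ) ≤ sqrt T := sqrt_le_sqrt hH
  set C := cellConst r₁ R ε κ (card (Fin n ⊕ Fin k)) δ (m * δ) with hCdef
  have hstep : 4 * K * exp C / sqrt β * sqrt ((N + 1) * δ) ≤
      4 * K * exp C / sqrt β * sqrt T := by gcongr
  rw [hdiff, norm_mul]
  have hcoef : ‖((2 * (π : ℂ) * I) ^ 2)⁻¹‖ ≤ 1 := by
    rw [norm_inv, norm_pow, norm_mul, norm_mul, norm_I, norm_real, norm_eq_abs,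
      abs_of_pos pi_pos, mul_one, Complex.norm_ofNat]
    refine inv_le_one_of_one_le₀ ?_
    have := Real.pi_gt_three
    nlinarith
  refine (mul_le_of_le_one_left (norm_nonneg _) hcoef).trans ?_
  refine (norm_add_le _ _).trans ?_
  have n1 := norm_sub_le (arcInt Gi (ξ (N + 1)) (c N)) (stairInt Gi ξ c N)
  have n2 := norm_add_le (stairInt Go η d N) (coarcInt Go (η (N + 1)) (d N))
  unfold stairErr
  linarith

end

theorem exists_stairErr_le {K T L C₁ b c₁ B : ℝ} (hK : 0 ≤ K) (hL : 0 ≤ L) (hb : 0 < b)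
    (hc₁ : 0 < c₁) (hB : 1 ≤ B) :
    ∃ A : ℝ, ∀ (u C : ℝ) (m N : ℕ), 1 ≤ u → C ≤ C₁ → u ^ 10 ≤ m → m ≤ 2 * u ^ 10 → 0 < N →
      N ≤ 2 * B * u ^ 104 →
      stairErr K (b * u ^ 50) T L C (c₁ * u ^ 200) (u ^ 104)⁻¹ m N ≤ A / u := by
  set sb := sqrt b with hsb
  have hsb0 : 0 < sb := sqrt_pos.2 hb
  set S := sqrt (2 * L) with hS
  have hS0 : 0 ≤ S := sqrt_nonneg _
  refine ⟨4 * K * exp C₁ / sb * sqrt T + 4 * B * K * π / (c₁ * sb) +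
    2 * K * exp C₁ * (π * S) * ((1 + log (2 * B) + 104) / b + 20 / sb) +
    4 * K * π / (c₁ * sb), fun u C m N hu hC hm hm' hN0 hN => ?_⟩
  have hu0 : 0 < u := by linarith
  have hβ : sqrt (b * u ^ 50) = sb * u ^ 25 := by
    rw [sqrt_mul hb.le, show u ^ 50 = (u ^ 25) ^ 2 by ring, sqrt_sq (by positivity)]
  have hδ : sqrt (u ^ 104)⁻¹ = (u ^ 52)⁻¹ := by
    rw [Real.sqrt_inv, show u ^ 104 = (u ^ 52) ^ 2 by ring, sqrt_sq (by positivity)]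
  have hw : 1 / (sb * u ^ 25 * (u ^ 52)⁻¹) = u ^ 27 / sb := by
    field_simp
  have hΔ1 : (u ^ 94)⁻¹ ≤ m * (u ^ 104)⁻¹ := by
    calc (u ^ 94)⁻¹ = u ^ 10 * (u ^ 104)⁻¹ := by field_simp
      _ ≤ _ := by gcongr
  have hΔ2 : m * (u ^ 104)⁻¹ ≤ 2 * (u ^ 94)⁻¹ := by
    calc m * (u ^ 104)⁻¹ ≤ (2 * u ^ 10) * (u ^ 104)⁻¹ := by gcongr
      _ = _ := by field_simp
  have hΔs : sqrt (L * (m * (u ^ 104)⁻¹)) ≤ S * (u ^ 47)⁻¹ := by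
    calc sqrt (L * (m * (u ^ 104)⁻¹)) ≤ sqrt (2 * L * ((u ^ 47)⁻¹) ^ 2) := by
          apply sqrt_le_sqrt
          calc L * (m * (u ^ 104)⁻¹) ≤ L * (2 * (u ^ 94)⁻¹) := by gcongr
            _ = _ := by field_simp
      _ = _ := by rw [sqrt_mul (by positivity), sqrt_sq (by positivity)]
  have hlog : log N ≤ log (2 * B) + 104 * u := by
    have h1 : log N ≤ log (2 * B * u ^ 104) :=
      log_le_log (by exact_mod_cast hN0) hN
    rw [log_mul (by positivity) (by positivity), log_pow] at h1
    have h2 : log u ≤ u := (Real.log_le_sub_one_of_pos hu0).trans (by linarith)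
    push_cast at h1
    linarith
  have hlog0 : 0 ≤ log N := Real.log_natCast_nonneg N
  have hlB : 0 ≤ log (2 * B) := Real.log_nonneg (by linarith)
  have hexp : ∀ x : ℝ, 0 < x → exp (-x) ≤ 1 / x := by
    intro x hx
    rw [exp_neg, ← one_div]
    have := add_one_le_exp x
    exact one_div_le_one_div_of_le hx (by linarith)
  have hup : ∀ k : ℕ, 1 ≤ k → (u ^ k)⁻¹ ≤ u⁻¹ := fun k hk => by
    have : u ≤ u ^ k := le_self_pow₀ hu (by omega)
    gcongr
  have t1 : 4 * K * exp C / (sb * u ^ 25) * sqrt T ≤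
      4 * K * exp C₁ / sb * sqrt T * u⁻¹ := by
    calc 4 * K * exp C / (sb * u ^ 25) * sqrt T =
        4 * K * exp C / sb * sqrt T * (u ^ 25)⁻¹ := by field_simp
      _ ≤ _ := by
        have := hup 25 (by norm_num)
        gcongr
  have t2 : N * (2 * K * exp (-(c₁ * u ^ 200)) * (u ^ 27 / sb) * π) ≤
      4 * B * K * π / (c₁ * sb) * u⁻¹ := by
    calc N * (2 * K * exp (-(c₁ * u ^ 200)) * (u ^ 27 / sb) * π) ≤
        (2 * B * u ^ 104) * (2 * K * (1 / (c₁ * u ^ 200)) * (u ^ 27 / sb) * π) := by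
          have := hexp (c₁ * u ^ 200) (by positivity)
          gcongr
      _ = 4 * B * K * π / (c₁ * sb) * (u ^ 69)⁻¹ := by field_simp; ring
      _ ≤ _ := by
        have := hup 69 (by norm_num)
        gcongr
  have t3a : (1 + log N) / (b * u ^ 50 * (m * (u ^ 104)⁻¹)) ≤
      (1 + log (2 * B) + 104) / b * u ^ 45 := by
    calc (1 + log N) / (b * u ^ 50 * (m * (u ^ 104)⁻¹)) ≤
        ((1 + log (2 * B) + 104) * u) / (b * u ^ 50 * (u ^ 94)⁻¹) := by
          gcongr
          nlinarith
      _ = _ := by field_simp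
  have t3b : (10 * m) * (u ^ 27 / sb) ≤ 20 / sb * u ^ 37 := by
    calc (10 * m) * (u ^ 27 / sb) ≤ (10 * (2 * u ^ 10)) * (u ^ 27 / sb) := by gcongr
      _ = _ := by field_simp; ring
  have t3 : 2 * K * exp C * (π * sqrt (L * (m * (u ^ 104)⁻¹))) *
        ((1 + log N) / (b * u ^ 50 * (m * (u ^ 104)⁻¹)) + (10 * m) * (u ^ 27 / sb)) ≤
      2 * K * exp C₁ * (π * S) * ((1 + log (2 * B) + 104) / b + 20 / sb) * u⁻¹ := by
    calc _ ≤ 2 * K * exp C₁ * (π * (S * (u ^ 47)⁻¹)) *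
          ((1 + log (2 * B) + 104) / b * u ^ 46 + 20 / sb * u ^ 46) := by
          have p1 : u ^ 45 ≤ u ^ 46 := pow_le_pow_right₀ hu (by norm_num)
          have p2 : u ^ 37 ≤ u ^ 46 := pow_le_pow_right₀ hu (by norm_num)
          have q1 : (1 + log (2 * B) + 104) / b * u ^ 45 ≤
            (1 + log (2 * B) + 104) / b * u ^ 46 := by gcongr
          have q2 : 20 / sb * u ^ 37 ≤ 20 / sb * u ^ 46 := by gcongr
          have q3 := add_le_add (t3a.trans q1) (t3b.trans q2)
          gcongr
      _ = _ := by field_simp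
  have t4 : K * exp (-(c₁ * u ^ 200 / 2)) * (u ^ 27 / sb) * (2 * π) ≤
      4 * K * π / (c₁ * sb) * u⁻¹ := by
    calc _ ≤ K * (1 / (c₁ * u ^ 200 / 2)) * (u ^ 27 / sb) * (2 * π) := by
          have := hexp (c₁ * u ^ 200 / 2) (by positivity)
          gcongr
      _ = 4 * K * π / (c₁ * sb) * (u ^ 173)⁻¹ := by field_simp; ring
      _ ≤ _ := by
        have := hup 173 (by norm_num)
        gcongr
  unfold stairErr
  rw [hβ, hδ, hw, div_eq_mul_inv _ u]
  linarith

/-- The kernel at finite size is an arc integral up to an error that is controlled by the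
constants of `NearSaddle`. -/
theorem exists_norm_corrKernel_sub_le {r₁ R c₀ L ε ε₀ X₀ Y₀ : ℝ} (κ : ℕ) (l l' : ℤ) (hr₁ : 0 < r₁)
    (hR : 0 < R) (hc₀ : 0 < c₀) (hL : 0 ≤ L) (hε : 0 < ε) (hε₀ : 0 < ε₀) (hX₀ : 0 < X₀) :
    ∃ A ν₀ : ℝ, ∀ (n k : ℕ) (x : Fin n → ℝ) (y : Fin k → ℝ), (∀ i, 0 < x i) → (∀ j, 0 ≤ y j) →
      ∀ (Γ : Contours x y) (q : ℤ) (a : ℝ → ℝ) (ξ₀ : ℝ) (S : Finset (Fin n ⊕ Fin k)) (Z : ℝ),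
      NearSaddle (sites x y) (k - q) a ξ₀ S Z r₁ R c₀ L ε ε₀ κ →
      (∀ i, sites x y i ≤ 0 ∨ X₀ ≤ sites x y i) →
      (∀ i, 0 ≤ sites x y i ∨ |sites x y i| ≤ Y₀) →
      ν₀ ≤ card (Fin n ⊕ Fin k) →
      ‖corrKernel x y Γ (q + l) (q + l') - (2 * (π : ℂ) * I)⁻¹ *
        arcInt (expPull fun z => z ^ (l' - l - 1)) ξ₀ (arccos (a ξ₀))‖ ≤
      A / (card (Fin n ⊕ Fin k) : ℝ) ^ (1 / 200 : ℝ) := by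
  set dr := decayRate r₁ R c₀ ε₀ with hdr
  have hdr0 : 0 < dr := by rw [hdr]; unfold decayRate; positivity
  set ρ := min (1 / 2) (dr / 12) with hρ
  have hρ0 : 0 < ρ := by rw [hρ]; positivity
  -- the length of the staircase
  obtain ⟨B, hB1, hBε, hBin, hBout⟩ : ∃ B : ℝ, 1 ≤ B ∧ ε₀ / 2 ≤ B ∧
      R * exp (-B) ≤ ρ * X₀ ∧ Y₀ ≤ ρ * (r₁ * exp B) := by
    have e1 : ∀ᶠ B in atTop, R * exp (-B) ≤ ρ * X₀ := by
      have : Tendsto (fun B => R * exp (-B)) atTop (𝓝 (R * 0)) :=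
        (Real.tendsto_exp_neg_atTop_nhds_zero).const_mul R
      rw [mul_zero] at this
      exact this.eventually_le_const (by positivity)
    have e2 : ∀ᶠ B in atTop, Y₀ ≤ ρ * (r₁ * exp B) := by
      have : Tendsto (fun B => ρ * (r₁ * exp B)) atTop atTop :=
        (Real.tendsto_exp_atTop.const_mul_atTop hr₁).const_mul_atTop hρ0
      exact this.eventually_ge_atTop _
    obtain ⟨B, h⟩ := ((eventually_ge_atTop 1).and ((eventually_ge_atTop (ε₀ / 2)).and
      (e1.and e2))).exists
    exact ⟨B, h⟩
  set T := |log r₁| + |log R| + B + 2 with hT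
  set b := sqrt (sqrt (r₁ ^ 2 * c₀)) with hb
  have hb0 : 0 < b := sqrt_pos.2 (sqrt_pos.2 (by positivity))
  have hb4 : (b ^ 2) ^ 2 = r₁ ^ 2 * c₀ := by
    rw [hb, sq_sqrt (sqrt_nonneg _), sq_sqrt (by positivity)]
  set C₁ := R * (2 * (1 + 2 * R / ε) ^ 2 / ε ^ 2 * R) * 8 + κ * (R / (2 * r₁)) +
    κ * (R ^ 2 / r₁ ^ 2) with hC₁
  have hC₁0 : 0 ≤ C₁ := by positivity
  have hK0 : 0 ≤ kernelConst l l' T := by unfold kernelConst; positivity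
  obtain ⟨A, hA⟩ := exists_stairErr_le (K := kernelConst l l' T) (T := T) (L := L) (C₁ := C₁)
    (b := b) (c₁ := dr / 2) (B := B) hK0 hL hb0 (by positivity) hB1
  obtain ⟨u₀, hu₀1, hu₀ε, hu₀d, hu₀C⟩ : ∃ u₀ : ℝ, 1 ≤ u₀ ∧ 16 / ε₀ ≤ u₀ ∧ 2 / dr ≤ u₀ ∧
      2 * C₁ / dr ≤ u₀ := by
    have hpos1 : 0 ≤ 16 / ε₀ := by positivity
    have hpos2 : 0 ≤ 2 / dr := by positivity
    have hpos3 : 0 ≤ 2 * C₁ / dr := by positivity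
    exact ⟨1 + 16 / ε₀ + 2 / dr + 2 * C₁ / dr, by linarith, by linarith, by linarith, by linarith⟩
  refine ⟨2 * A, u₀ ^ 200, fun n k x y hx hy Γ q a ξ₀ S Z h hX hY hν => ?_⟩
  set ν : ℝ := (card (Fin n ⊕ Fin k) : ℝ) with hνdef
  have hν0 : 0 < ν := h.card_pos
  set u := ν ^ (1 / 200 : ℝ) with hu
  have hu200 : u ^ 200 = ν := by
    rw [hu, ← Real.rpow_natCast, ← Real.rpow_mul hν0.le]; norm_num
  have huu₀ : u₀ ≤ u := by
    by_contra hcon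
    push Not at hcon
    have hup : 0 ≤ u := Real.rpow_nonneg hν0.le _
    have := pow_lt_pow_left₀ hcon hup (n := 200) (by norm_num)
    rw [hu200] at this
    exact absurd hν (not_le.2 this)
  have hu1 : 1 ≤ u := hu₀1.trans huu₀
  have hu0 : 0 < u := by linarith
  have hpow : ∀ e : ℕ, 1 ≤ e → u ≤ u ^ e := fun e he => le_self_pow₀ hu1 (by omega)
  set m := ⌈u ^ 10⌉₊ with hm
  set N := ⌈B * u ^ 104⌉₊ with hN
  have hm1 : u ^ 10 ≤ m := Nat.le_ceil _
  have hp10 : (1 : ℝ) ≤ u ^ 10 := one_le_pow₀ hu1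
  have hp104 : (1 : ℝ) ≤ u ^ 104 := one_le_pow₀ hu1
  have hm2 : (m : ℝ) ≤ 2 * u ^ 10 := by
    have := Nat.ceil_lt_add_one (a := u ^ 10) (by positivity)
    rw [← hm] at this
    linarith
  have hm0 : 0 < m := Nat.ceil_pos.2 (by positivity)
  have hN1 : B * u ^ 104 ≤ N := Nat.le_ceil _
  have hN1' : (N : ℝ) < B * u ^ 104 + 1 := Nat.ceil_lt_add_one (by positivity)
  have hBu : 1 ≤ B * u ^ 104 := by nlinarith
  have hN2 : (N : ℝ) ≤ 2 * B * u ^ 104 := by linarith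
  have hN0 : 0 < N := Nat.ceil_pos.2 (by positivity)
  set δ := (u ^ 104)⁻¹ with hδ
  have hδ0 : 0 < δ := by positivity
  have hδ1 : δ ≤ 1 := inv_le_one_of_one_le₀ hp104
  have hΔ2 : m * δ ≤ 2 * (u ^ 94)⁻¹ := by
    calc m * (u ^ 104)⁻¹ ≤ (2 * u ^ 10) * (u ^ 104)⁻¹ := by gcongr
      _ = _ := by field_simp
  have hξR := h.mem ξ₀ (by simpa using hε₀.le)
  have hξ1 : log r₁ ≤ ξ₀ := (Real.log_le_iff_le_exp hr₁).2 hξR.1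
  have hξ2 : ξ₀ ≤ log R := (Real.le_log_iff_exp_le hR).2 hξR.2
  have hξabs : |ξ₀| ≤ |log r₁| + |log R| := by
    rw [abs_le]
    constructor
    · linarith [neg_abs_le (log r₁), abs_nonneg (log R)]
    · linarith [le_abs_self (log R), abs_nonneg (log r₁)]
  have hNδ1 : B ≤ N * δ := by
    calc B = B * u ^ 104 * δ := by rw [hδ]; field_simp
      _ ≤ _ := by gcongr
  have hNδ2 : N * δ ≤ B + δ := by
    calc N * δ ≤ (B * u ^ 104 + 1) * δ := by gcongr
      _ = B + δ := by rw [hδ]; field_simp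
  have hCle : cellConst r₁ R ε κ ν δ (m * δ) ≤ C₁ := by
    have hR2 := h.R_pos
    have g1 : ν * (m * δ) ^ 3 ≤ 8 := by
      calc ν * (m * δ) ^ 3 ≤ ν * (2 * (u ^ 94)⁻¹) ^ 3 := by gcongr
        _ = 8 * (u ^ 82)⁻¹ := by rw [← hu200]; field_simp; norm_num
        _ ≤ 8 * 1 := by
          gcongr
          exact inv_le_one_of_one_le₀ (one_le_pow₀ hu1)
        _ = 8 := by norm_num
    have g2 : ν * δ ^ 2 ≤ 1 := by
      calc ν * δ ^ 2 = (u ^ 8)⁻¹ := by rw [← hu200, hδ]; field_simp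
        _ ≤ 1 := inv_le_one_of_one_le₀ (one_le_pow₀ hu1)
    unfold cellConst
    rw [hC₁]
    have e1 : R * (ν * (2 * (1 + 2 * R / ε) ^ 2 / ε ^ 2 * (R * (m * δ)))) * (m * δ) ^ 2 =
      R * (2 * (1 + 2 * R / ε) ^ 2 / ε ^ 2 * R) * (ν * (m * δ) ^ 3) := by ring
    have e2 : κ * (R * ν / (2 * r₁)) * δ ^ 2 = κ * (R / (2 * r₁)) * (ν * δ ^ 2) := by ring
    rw [e1, e2]
    have g3 : κ * (R / (2 * r₁)) * (ν * δ ^ 2) ≤ κ * (R / (2 * r₁)) * 1 := by gcongr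
    have g4 : R * (2 * (1 + 2 * R / ε) ^ 2 / ε ^ 2 * R) * (ν * (m * δ) ^ 3) ≤
      R * (2 * (1 + 2 * R / ε) ^ 2 / ε ^ 2 * R) * 8 := by gcongr
    linarith
  have hν_u : u ≤ ν := by rw [← hu200]; exact hpow 200 (by norm_num)
  have hmain := norm_corrKernel_sub_le hx hy Γ h l l' (δ := δ) (β := b * u ^ 50) (T := T) (ρ := ρ)
    (X₀ := X₀) (Y₀ := Y₀) (m := m) (N := N) hδ0 hm0
    (by
      refine hΔ2.trans ?_
      have h1 : 16 / ε₀ ≤ u ^ 94 := by linarith [hpow 94 (by norm_num)]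
      have h2 : (u ^ 94)⁻¹ ≤ (16 / ε₀)⁻¹ := by gcongr
      rw [inv_div] at h2
      linarith)
    (by
      calc ν * δ ^ 2 = (u ^ 8)⁻¹ := by rw [← hu200, hδ]; field_simp
        _ ≤ (2 / dr)⁻¹ := by
          gcongr
          linarith [hpow 8 (by norm_num)]
        _ = dr / 2 := inv_div _ _)
    (by
      refine hCle.trans ?_
      have h1 : 2 * C₁ / dr ≤ ν := by linarith
      rw [div_le_iff₀ hdr0] at h1
      linarith)
    (by positivity)
    (by
      have e1 : ((b * u ^ 50) ^ 2) ^ 2 = r₁ ^ 2 * (c₀ * ν) := by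
        rw [← hu200, ← mul_assoc, ← hb4]; ring
      rw [e1]
      refine mul_le_mul (pow_le_pow_left₀ hr₁.le hξR.1 2) (h.curv.trans ?_) (by positivity)
        (by positivity)
      refine sum_le_sum fun i _ => ?_
      have := exp_pos ξ₀
      have := hξR.2
      gcongr)
    (by rw [hT]; linarith)
    (by linarith) hρ0.le (min_le_left _ _)
    (by
      have := min_le_right (1 / 2) (dr / 12)
      rw [← hρ] at this
      linarith)
    hX₀ hX hY
    (by
      refine le_trans ?_ hBin
      rw [sub_eq_add_neg, exp_add]
      gcongr
      · exact hξR.2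
      · linarith)
    (by
      refine hBout.trans ?_
      rw [exp_add]
      gcongr
      · exact hξR.1
      · linarith)
  refine hmain.trans ?_
  have hAA := hA u _ m N hu1 hCle hm1 hm2 hN0 hN2
  rw [hu200] at hAA
  rw [mul_div_assoc]
  linarith

theorem arcInt_zpow (l l' : ℤ) (ξ θ : ℝ) :
    (2 * (π : ℂ) * I)⁻¹ * arcInt (expPull fun z => z ^ (l' - l - 1)) ξ θ =
      ((exp ((l' - l) * ξ) * discreteSine (θ / π) l l' : ℝ) : ℂ) := by
  have hpi : (π : ℂ) ≠ 0 := ofReal_ne_zero.2 Real.pi_ne_zero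
  have hfun : ∀ y : ℝ, expPull (fun z => z ^ (l' - l - 1)) (ξ + y * I) * I =
      I * Complex.exp ((l' - l) * ξ) * Complex.exp (((l' - l) * I) * y) := by
    intro y
    unfold expPull
    rw [← zpow_add_one₀ (exp_ne_zero _), sub_add_cancel, ← Complex.exp_int_mul, mul_assoc,
      ← Complex.exp_add, mul_comm]
    congr 2
    push_cast
    ring
  unfold arcInt
  simp only [hfun]
  rw [intervalIntegral.integral_const_mul]
  unfold discreteSine
  split_ifs with h
  · subst h
    simp
    field_simp
    linear_combination (-2 * (θ : ℂ)) * I_sq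
  · have hne : ((l' : ℂ) - l) ≠ 0 := by
      rw [sub_ne_zero]; exact_mod_cast (Ne.symm h)
    have hne' : ((l' : ℂ) - l) * I ≠ 0 := mul_ne_zero hne Complex.I_ne_zero
    have hne'' : ((l : ℂ) - l') ≠ 0 := by
      rw [sub_ne_zero]; exact_mod_cast h
    rw [integral_exp_mul_complex hne']
    have hsin : Complex.exp (((l' - l) * I) * θ) -
        Complex.exp (((l' - l) * I) * (-θ : ℝ)) =
        2 * I * Complex.sin ((l' - l) * θ) := by
      rw [Complex.sin]
      rw [show ((l' - l : ℂ) * I) * θ = (l' - l) * θ * I by ring,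
        show ((l' - l : ℂ) * I) * (-θ : ℝ) = -((l' - l) * θ) * I by push_cast; ring]
      linear_combination (Complex.exp ((l' - l) * θ * I) -
        Complex.exp (-((l' - l) * θ) * I)) * I_sq
    rw [hsin]
    have e : π * (θ / π) * ((l : ℝ) - l') = -((l' - l) * θ) := by
      field_simp; ring
    rw [e, Real.sin_neg]
    push_cast
    have e2 : ((l : ℂ) - l') = -((l' : ℂ) - l) := by ring
    rw [e2]
    field_simp

theorem mem_partition_or_exists_mem_Ioo {N : ℕ} {s : Fin (N + 1) → ℝ} (h0 : s 0 = 0)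
    (h1 : s (Fin.last N) = 1) {u : ℝ} (hu : u ∈ Icc (0 : ℝ) 1) :
    (∃ i, s i = u) ∨ ∃ i : Fin N, u ∈ Ioo (s i.castSucc) (s i.succ) := by
  classical
  by_cases hmem : ∃ i, s i = u
  · exact Or.inl hmem
  push Not at hmem
  right
  set S : Finset (Fin (N + 1)) := Finset.univ.filter fun i => s i < u with hS
  have hne : S.Nonempty := ⟨0, by
    rw [hS, mem_filter]
    exact ⟨Finset.mem_univ _, lt_of_le_of_ne (by rw [h0]; exact hu.1) (hmem 0)⟩⟩
  set i := S.max' hne with hi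
  have hiS : s i < u := (mem_filter.1 (S.max'_mem hne)).2
  have hil : i ≠ Fin.last N := by
    intro h
    rw [h, h1] at hiS
    exact absurd hu.2 (not_le.2 hiS)
  obtain ⟨j, hj⟩ := Fin.exists_castSucc_eq.2 hil
  refine ⟨j, by rw [hj]; exact hiS, ?_⟩
  by_contra hcon
  push Not at hcon
  have : j.succ ∈ S := by
    rw [hS, mem_filter]
    exact ⟨Finset.mem_univ _, lt_of_le_of_ne hcon (hmem _)⟩
  have := S.le_max' _ this
  rw [← hi, ← hj] at this
  exact absurd this (not_le.2 Fin.castSucc_lt_succ)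

/-- The points of discontinuity of a piecewise `C¹` function, and its boundedness. -/
theorem PiecewiseC1.exists_finset {f : ℝ → ℝ} (hf : PiecewiseC1 f) :
    ∃ (E : Finset ℝ) (M : ℝ), (∀ s ∈ Icc (0 : ℝ) 1, s ∉ E → ContinuousAt f s) ∧
      ∀ s ∈ Icc (0 : ℝ) 1, |f s| ≤ M := by
  obtain ⟨N, s, hs, h0, h1, hφ⟩ := hf
  choose φ hφC hφE using hφ
  classical
  have hcover := fun u hu => mem_partition_or_exists_mem_Ioo h0 h1 (u := u) hu
  have hbdd : ∀ i, ∃ M, ∀ u ∈ Icc (s i.castSucc) (s i.succ), |φ i u| ≤ M := by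
    intro i
    obtain ⟨M, hM⟩ := isCompact_Icc.exists_bound_of_continuousOn (hφC i).continuousOn
    exact ⟨M, hM⟩
  choose M hM using hbdd
  refine ⟨Finset.univ.image s, (∑ i, |M i|) + ∑ i, |f (s i)|, fun u hu huE => ?_, fun u hu => ?_⟩
  · rcases hcover u hu with ⟨i, rfl⟩ | ⟨i, hi⟩
    · exact absurd (Finset.mem_image_of_mem _ (Finset.mem_univ i)) huE
    · have h2 : ContinuousAt (φ i) u :=
        (hφC i).continuousOn.continuousAt (Icc_mem_nhds hi.1 hi.2)
      refine h2.congr ?_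
      filter_upwards [Ioo_mem_nhds hi.1 hi.2] with v hv
      exact (hφE i hv).symm
  · have p1 : 0 ≤ ∑ i, |M i| := sum_nonneg fun i _ => abs_nonneg _
    have p2 : 0 ≤ ∑ i, |f (s i)| := sum_nonneg fun i _ => abs_nonneg _
    rcases hcover u hu with ⟨i, rfl⟩ | ⟨i, hi⟩
    · have := single_le_sum (f := fun i => |f (s i)|) (fun i _ => abs_nonneg _)
        (Finset.mem_univ i)
      linarith
    · have := single_le_sum (f := fun i => |M i|) (fun i _ => abs_nonneg _)
        (Finset.mem_univ i)
      rw [hφE i hi]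
      have := hM i u ⟨hi.1.le, hi.2.le⟩
      have := le_abs_self (M i)
      linarith

theorem integral_ceil_div (F : ℝ → ℝ) {n : ℕ} (hn : 0 < n) :
    ∫ s in (0 : ℝ)..1, F (⌈n * s⌉ / n) = (∑ i : Fin n, F (((i : ℝ) + 1) / n)) / n := by
  have hn' : (0 : ℝ) < n := by exact_mod_cast hn
  have hpiece : ∀ i : ℕ, EqOn (fun s : ℝ => F (⌈n * s⌉ / n)) (fun _ => F (((i : ℝ) + 1) / n))
      (Ioc ((i : ℝ) / n) (((i + 1 : ℕ) : ℝ) / n)) := by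
    intro i s hs
    have h1 : (i : ℝ) < n * s := by rw [mul_comm]; exact (div_lt_iff₀ hn').1 hs.1
    have h2 : n * s ≤ ((i + 1 : ℕ) : ℝ) := by rw [mul_comm]; exact (le_div_iff₀ hn').1 hs.2
    have h3 : ⌈n * s⌉ = (i : ℤ) + 1 := by
      rw [Int.ceil_eq_iff]
      push_cast at h2 ⊢
      constructor <;> linarith
    simp only [h3]
    push_cast
    rfl
  have hle : ∀ i : ℕ, (i : ℝ) / n ≤ ((i + 1 : ℕ) : ℝ) / n := fun i => by gcongr; simp
  have hIntegr : ∀ i : ℕ, IntervalIntegrable (fun s : ℝ => F (⌈n * s⌉ / n)) volume ((i : ℝ) / n)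
      (((i + 1 : ℕ) : ℝ) / n) := by
    intro i
    refine (intervalIntegrable_const (c := F (((i : ℝ) + 1) / n))).congr ?_
    rw [uIoc_of_le (hle i)]
    exact (hpiece i).symm
  have hsum := intervalIntegral.sum_integral_adjacent_intervals (n := n)
    (a := fun i : ℕ => (i : ℝ) / n) (fun i _ => hIntegr i)
  simp only [Nat.cast_zero, zero_div, div_self hn'.ne'] at hsum
  rw [← hsum, sum_div, ← Fin.sum_univ_eq_sum_range]
  refine sum_congr rfl fun i _ => ?_
  rw [intervalIntegral.integral_congr_ae (g := fun _ => F (((i : ℝ) + 1) / n))]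
  · rw [intervalIntegral.integral_const]
    push_cast
    rw [smul_eq_mul]
    field_simp
    ring
  · refine Eventually.of_forall fun s hs => ?_
    rw [uIoc_of_le (hle i)] at hs
    exact hpiece i hs

/-- Riemann sums of bounded functions with finitely many points of discontinuity. -/
theorem tendsto_riemann_sum {F : ℝ → ℝ} {E : Finset ℝ} {M : ℝ}
    (hE : ∀ s ∈ Icc (0 : ℝ) 1, s ∉ E → ContinuousAt F s) (hM : ∀ s ∈ Icc (0 : ℝ) 1, |F s| ≤ M) :
    Tendsto (fun n : ℕ => (∑ i : Fin n, F (((i : ℝ) + 1) / n)) / n) atTop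
      (𝓝 (∫ s in (0 : ℝ)..1, F s)) := by
  have hlim : Tendsto (fun n : ℕ => ∫ s in (0 : ℝ)..1, F (⌈n * s⌉ / n)) atTop
      (𝓝 (∫ s in (0 : ℝ)..1, F s)) := by
    refine intervalIntegral.tendsto_integral_filter_of_dominated_convergence (fun _ => M) ?_ ?_
      intervalIntegrable_const ?_
    · refine Eventually.of_forall fun n => Measurable.aestronglyMeasurable ?_
      have h1 : Measurable fun s : ℝ => ⌈(n : ℝ) * s⌉ :=
        Int.measurable_ceil.comp (measurable_const.mul measurable_id)
      exact (measurable_from_top (f := fun z : ℤ => F ((z : ℝ) / n))).comp h1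
    · filter_upwards [eventually_gt_atTop 0] with n hn
      refine Eventually.of_forall fun s hs => ?_
      rw [uIoc_of_le zero_le_one] at hs
      have hn' : (0 : ℝ) < n := by exact_mod_cast hn
      refine hM _ ⟨?_, ?_⟩
      · have : 0 ≤ ⌈(n : ℝ) * s⌉ := Int.ceil_nonneg (mul_nonneg hn'.le hs.1.le)
        have : (0 : ℝ) ≤ ⌈(n : ℝ) * s⌉ := by exact_mod_cast this
        positivity
      · rw [div_le_one hn']
        have : ⌈(n : ℝ) * s⌉ ≤ (n : ℤ) := Int.ceil_le.2 (by
          push_cast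
          calc (n : ℝ) * s ≤ n * 1 := by gcongr; exact hs.2
            _ = n := mul_one _)
        exact_mod_cast this
    · have hae : ∀ᵐ s : ℝ, s ∉ (E : Set ℝ) := by
        rw [ae_iff]
        simp only [not_not]
        exact E.finite_toSet.measure_zero _
      filter_upwards [hae] with s hsE hs
      rw [uIoc_of_le zero_le_one] at hs
      have hc := hE s ⟨hs.1.le, hs.2⟩ (by simpa using hsE)
      have hlim : Tendsto (fun n : ℕ => (⌈(n : ℝ) * s⌉ : ℝ) / n) atTop (𝓝 s) := by
        have h1 := (tendsto_nat_ceil_mul_div_atTop (R := ℝ) hs.1.le).comp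
          (tendsto_natCast_atTop_atTop (R := ℝ))
        refine h1.congr fun n => ?_
        simp only [Function.comp_apply]
        congr 1
        have : (0 : ℝ) ≤ n * s := mul_nonneg (Nat.cast_nonneg n) hs.1.le
        rw [mul_comm s, ← natCast_ceil_eq_intCast_ceil this]
      exact hc.tendsto.comp hlim
  refine hlim.congr' ?_
  filter_upwards [eventually_gt_atTop 0] with n hn
  exact integral_ceil_div F hn

section

/-! The real and imaginary parts of `1 / (1 - v z)` and `v / (z + v)` in terms of `x = Re z` and
`ρ = |z|²`. -/

/-- `v / |1 - v z|²`. -/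
def fSlope (x ρ v : ℝ) : ℝ := v / (1 - 2 * v * x + v ^ 2 * ρ)

/-- `v / |z + v|²`. -/
def gSlope (x ρ v : ℝ) : ℝ := v / (v ^ 2 + 2 * v * x + ρ)

/-- `Re (1 / (1 - v z))`. -/
def fRe (x ρ v : ℝ) : ℝ := (1 - v * x) / (1 - 2 * v * x + v ^ 2 * ρ)

/-- `Re (v / (z + v))`. -/
def gRe (x ρ v : ℝ) : ℝ := v * (v + x) / (v ^ 2 + 2 * v * x + ρ)

theorem fDen_pos {x ρ : ℝ} (h : x ^ 2 < ρ) (v : ℝ) : 0 < 1 - 2 * v * x + v ^ 2 * ρ := by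
  have e : 1 - 2 * v * x + v ^ 2 * ρ = (1 - v * x) ^ 2 + v ^ 2 * (ρ - x ^ 2) := by ring
  rw [e]
  rcases eq_or_ne v 0 with rfl | hv
  · norm_num
  · have : 0 < ρ - x ^ 2 := by linarith
    positivity

theorem gDen_pos {x ρ : ℝ} (h : x ^ 2 < ρ) (v : ℝ) : 0 < v ^ 2 + 2 * v * x + ρ := by
  nlinarith [sq_nonneg (v + x)]

section continuity

variable {x ρ : ℝ} (h : x ^ 2 < ρ)
include h

theorem continuous_fSlope : Continuous (fSlope x ρ) :=
  Continuous.div (by fun_prop) (by fun_prop) fun v => (fDen_pos h v).ne'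

theorem continuous_gSlope : Continuous (gSlope x ρ) :=
  Continuous.div (by fun_prop) (by fun_prop) fun v => (gDen_pos h v).ne'

theorem continuous_fRe : Continuous (fRe x ρ) :=
  Continuous.div (by fun_prop) (by fun_prop) fun v => (fDen_pos h v).ne'

theorem continuous_gRe : Continuous (gRe x ρ) :=
  Continuous.div (by fun_prop) (by fun_prop) fun v => (gDen_pos h v).ne'

end continuity

namespace PiecewiseC1

variable {f : ℝ → ℝ} (hf : PiecewiseC1 f)
include hf

theorem aestronglyMeasurable : AEStronglyMeasurable f (volume.restrict (Icc 0 1)) := by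
  obtain ⟨E, M, hE, -⟩ := hf.exists_finset
  have h1 : ContinuousOn f (Icc 0 1 \ (E : Set ℝ)) := fun s hs =>
    (hE s hs.1 (by simpa using hs.2)).continuousWithinAt
  have h2 := h1.aestronglyMeasurable (μ := volume)
    (measurableSet_Icc.diff E.finite_toSet.measurableSet)
  have h3 : volume.restrict (Icc (0 : ℝ) 1 \ (E : Set ℝ)) = volume.restrict (Icc 0 1) := by
    refine Measure.restrict_congr_set ?_
    exact sdiff_null_ae_eq_self (E.finite_toSet.measure_zero _)
  rwa [h3] at h2

theorem intervalIntegrable_comp {V : Type*} [NormedAddCommGroup V]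
    {Φ : ℝ → V} (hΦ : Continuous Φ) : IntervalIntegrable (fun s => Φ (f s)) volume 0 1 := by
  obtain ⟨E, M, -, hM⟩ := hf.exists_finset
  obtain ⟨C, hC⟩ := (isCompact_Icc (a := -M) (b := M)).exists_bound_of_continuousOn hΦ.continuousOn
  rw [intervalIntegrable_iff_integrableOn_Icc_of_le zero_le_one]
  refine IntegrableOn.of_bound (by simp) (hΦ.comp_aestronglyMeasurable hf.aestronglyMeasurable) C ?_
  filter_upwards [ae_restrict_mem measurableSet_Icc] with s hs
  exact hC _ (abs_le.1 (hM s hs))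

theorem tendsto_sum_specialize {φ : ℝ → ℝ} (hφ : Continuous φ) :
    Tendsto (fun n : ℕ => (∑ i, φ (specialize f n i)) / n) atTop
      (𝓝 (∫ s in (0 : ℝ)..1, φ (f s))) := by
  obtain ⟨E, M, hE, hM⟩ := hf.exists_finset
  obtain ⟨C, hC⟩ := (isCompact_Icc (a := -M) (b := M)).exists_bound_of_continuousOn hφ.continuousOn
  exact tendsto_riemann_sum (F := fun s => φ (f s)) (E := E) (M := C)
    (fun s hs hsE => hφ.continuousAt.comp (hE s hs hsE)) fun s hs => hC _ (abs_le.1 (hM s hs))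

end PiecewiseC1

variable {f g : ℝ → ℝ} {c : ℝ}

theorem specialize_mem {n : ℕ} (i : Fin n) : ((i : ℝ) + 1) / n ∈ Icc (0 : ℝ) 1 := by
  refine ⟨by positivity, div_le_one_of_le₀ ?_ (Nat.cast_nonneg n)⟩
  have : (i : ℕ) + 1 ≤ n := i.2
  exact_mod_cast this

theorem tendsto_sum_sites (hf : PiecewiseC1 f) (hg : PiecewiseC1 g) {n k : ℕ → ℕ}
    (hn : Tendsto n atTop atTop) (hk : Tendsto k atTop atTop)
    (hc : Tendsto (fun j => (k j : ℝ) / (n j : ℝ)) atTop (𝓝 c)) {F φ ψ : ℝ → ℝ}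
    (hφ : Continuous φ) (hψ : Continuous ψ) (hfpos : ∀ s ∈ Icc (0 : ℝ) 1, 0 < f s)
    (hgnonneg : ∀ s ∈ Icc (0 : ℝ) 1, 0 ≤ g s)
    (hFφ : ∀ v, 0 < v → F v⁻¹ = φ v) (hFψ : ∀ v, 0 ≤ v → F (-v) = ψ v) :
    Tendsto (fun j => (∑ i, F (sites (specialize f (n j)) (specialize g (k j)) i)) / n j) atTop
      (𝓝 ((∫ s in (0 : ℝ)..1, φ (f s)) + c * ∫ s in (0 : ℝ)..1, ψ (g s))) := by
  have h1 := (hf.tendsto_sum_specialize hφ).comp hn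
  have h2 := hc.mul ((hg.tendsto_sum_specialize hψ).comp hk)
  refine (h1.add h2).congr' ?_
  filter_upwards [hn.eventually_gt_atTop 0, hk.eventually_gt_atTop 0] with j hnj hkj
  have hn' : (0 : ℝ) < n j := by exact_mod_cast hnj
  have hk' : (0 : ℝ) < k j := by exact_mod_cast hkj
  simp only [Function.comp_apply, Fintype.sum_sum_type, sites, Sum.elim_inl, Sum.elim_inr]
  have h3 : ∀ i : Fin (n j), F (specialize f (n j) i)⁻¹ = φ (specialize f (n j) i) :=
    fun i => hFφ _ (hfpos _ (specialize_mem i))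
  have h4 : ∀ i : Fin (k j), F (-specialize g (k j) i) = ψ (specialize g (k j) i) :=
    fun i => hFψ _ (hgnonneg _ (specialize_mem i))
  simp only [h3, h4]
  field_simp

/-- `|a + b z|²`. -/
def den (a b : ℝ) (z : ℂ) : ℝ := a ^ 2 + 2 * a * b * z.re + b ^ 2 * normSq z

theorem den_eq (a b : ℝ) (z : ℂ) : den a b z = (a + b * z.re) ^ 2 + (b * z.im) ^ 2 := by
  unfold den; rw [normSq_apply]; ring

theorem add_mul_ne_zero {a b : ℝ} {z : ℂ} (hd : den a b z ≠ 0) : (a : ℂ) + b * z ≠ 0 := by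
  intro h0
  have h1 := congrArg Complex.re h0
  have h2 := congrArg Complex.im h0
  simp only [add_re, ofReal_re, mul_re, ofReal_im, zero_mul,
    sub_zero, zero_re, add_im, mul_im, add_zero, zero_add,
    zero_im] at h1 h2
  rw [den_eq, h1, h2] at hd
  norm_num at hd

theorem ofReal_div_add_mul (a b : ℝ) (z : ℂ) (hd : den a b z ≠ 0) :
    (a : ℂ) / (a + b * z) = ((a * (a + b * z.re) / den a b z : ℝ) : ℂ) -
      ((z.im * (a * b / den a b z) : ℝ) : ℂ) * I := by
  rw [div_eq_iff (add_mul_ne_zero hd)]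
  have hz : z = z.re + z.im * I := (re_add_im z).symm
  have hD : ((den a b z : ℝ) : ℂ) = (a + b * z.re) ^ 2 + (b * z.im) ^ 2 := by
    rw [den_eq]; push_cast; ring
  have hdc : ((den a b z : ℝ) : ℂ) ≠ 0 := ofReal_ne_zero.2 hd
  push_cast
  generalize ((den a b z : ℝ) : ℂ) = D at hD hdc
  field_simp
  rw [hD]
  nth_rewrite 5 [hz]
  linear_combination ((b : ℂ) ^ 2 * z.im ^ 2 * a) * I_sq

/-- The critical point equation in real form. -/
theorem criticalPointEq_iff (hf : PiecewiseC1 f) (hg : PiecewiseC1 g) {t : ℝ} {z : ℂ}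
    (hz : z.im ≠ 0) : CriticalPointEq f g c t z ↔
      ((∫ s in (0 : ℝ)..1, fSlope z.re (normSq z) (f s)) -
        c * ∫ s in (0 : ℝ)..1, gSlope z.re (normSq z) (g s)) = 0 ∧
      ((∫ s in (0 : ℝ)..1, fRe z.re (normSq z) (f s)) +
        c * ∫ s in (0 : ℝ)..1, gRe z.re (normSq z) (g s)) = 1 + t := by
  have hlt : z.re ^ 2 < normSq z := by
    rw [normSq_apply]
    have : 0 < z.im * z.im := mul_self_pos.2 hz
    nlinarith
  set x := z.re
  set y := z.im
  set ρ := normSq z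
  have e1 : ∀ v : ℝ, (v : ℂ) * z / (1 - (v : ℂ) * z) =
      ((fRe x ρ v - 1 : ℝ) : ℂ) + ((y * fSlope x ρ v : ℝ) : ℂ) * I := by
    intro v
    have e : den 1 (-v) z = 1 - 2 * v * x + v ^ 2 * ρ := by unfold den; ring
    have hd : den 1 (-v) z ≠ 0 := e ▸ (fDen_pos hlt v).ne'
    have h1 := ofReal_div_add_mul 1 (-v) z hd
    have hne := add_mul_ne_zero hd
    rw [e] at h1
    simp only [Complex.ofReal_one, ofReal_neg, neg_mul, ← sub_eq_add_neg, one_mul] at h1 hne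
    rw [show (v : ℂ) * z / (1 - (v : ℂ) * z) = 1 / (1 - (v : ℂ) * z) - 1 by field_simp; ring, h1]
    unfold fRe fSlope
    push_cast
    ring
  have e2 : ∀ v : ℝ, (v : ℂ) / (z + (v : ℂ)) =
      ((gRe x ρ v : ℝ) : ℂ) + ((-y * gSlope x ρ v : ℝ) : ℂ) * I := by
    intro v
    have e : den v 1 z = v ^ 2 + 2 * v * x + ρ := by unfold den; ring
    have h1 := ofReal_div_add_mul v 1 z (e ▸ (gDen_pos hlt v).ne')
    rw [e] at h1
    rw [Complex.ofReal_one, one_mul] at h1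
    rw [add_comm z, h1]
    unfold gRe gSlope
    push_cast
    ring
  have i1 := hf.intervalIntegrable_comp (continuous_fRe hlt)
  have I1 : (∫ s in (0 : ℝ)..1, (f s : ℂ) * z / (1 - (f s : ℂ) * z)) =
      (((∫ s in (0 : ℝ)..1, fRe x ρ (f s)) - 1 : ℝ) : ℂ) +
        ((y * ∫ s in (0 : ℝ)..1, fSlope x ρ (f s) : ℝ) : ℂ) * I := by
    simp only [e1]
    rw [intervalIntegral.integral_add
      (hf.intervalIntegrable_comp (Φ := fun v => ((fRe x ρ v - 1 : ℝ) : ℂ))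
        (continuous_ofReal.comp ((continuous_fRe hlt).sub continuous_const)))
      (hf.intervalIntegrable_comp (Φ := fun v => ((y * fSlope x ρ v : ℝ) : ℂ) * I)
        ((continuous_ofReal.comp ((continuous_fSlope hlt).const_mul y)).mul
          continuous_const)), intervalIntegral.integral_mul_const,
      intervalIntegral.integral_ofReal, intervalIntegral.integral_ofReal,
      intervalIntegral.integral_sub i1 intervalIntegrable_const,
      intervalIntegral.integral_const_mul]
    simp
  have I2 : (∫ s in (0 : ℝ)..1, (g s : ℂ) / (z + (g s : ℂ))) =
      ((∫ s in (0 : ℝ)..1, gRe x ρ (g s) : ℝ) : ℂ) +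
        ((-y * ∫ s in (0 : ℝ)..1, gSlope x ρ (g s) : ℝ) : ℂ) * I := by
    simp only [e2]
    rw [intervalIntegral.integral_add
      (hg.intervalIntegrable_comp (Φ := fun v => ((gRe x ρ v : ℝ) : ℂ))
        (continuous_ofReal.comp (continuous_gRe hlt)))
      (hg.intervalIntegrable_comp (Φ := fun v => ((-y * gSlope x ρ v : ℝ) : ℂ) * I)
        ((continuous_ofReal.comp ((continuous_gSlope hlt).const_mul (-y))).mul
          continuous_const)), intervalIntegral.integral_mul_const,
      intervalIntegral.integral_ofReal, intervalIntegral.integral_ofReal,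
      intervalIntegral.integral_const_mul]
  unfold CriticalPointEq
  rw [I1, I2, Complex.ext_iff]
  simp only [sub_re, add_re, ofReal_re, mul_re, I_re,
    ofReal_im, I_im, sub_im, add_im, mul_im,
    zero_re, zero_im]
  constructor
  · rintro ⟨h1, h2⟩
    constructor
    · have : y * ((∫ s in (0 : ℝ)..1, fSlope x ρ (f s)) -
          c * ∫ s in (0 : ℝ)..1, gSlope x ρ (g s)) = 0 := by linarith
      exact (mul_eq_zero.1 this).resolve_left hz
    · linarith
  · rintro ⟨h1, h2⟩
    constructor
    · linarith
    · linear_combination y * h1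

end

section

section finite

variable {ι : Type*} [Fintype ι]

theorem IsArcMin.abs_sub_le {X : ι → ℝ} {α : ℝ} {a : ℝ → ℝ} (h : IsArcMin X α a) (ξ : ℝ) {b : ℝ}
    (hb : |b| ≤ α) :
    2 * exp ξ * (∑ i, X i ^ 2 / (|X i| + exp ξ) ^ 4) * |a ξ - b| ≤
      |sumSlope X (exp ξ) b| := by
  have ha := h.abs_lt_one ξ
  have hb1 := hb.trans_lt h.lt_one
  have hv := h.var ξ b (_root_.abs_le.1 hb)
  have hE := exp_pos ξ
  set S := 2 * exp ξ * (∑ i, X i ^ 2 / (|X i| + exp ξ) ^ 4) with hS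
  have hS0 : 0 ≤ S := mul_nonneg (by positivity) (sum_sq_div_nonneg X _)
  rcases lt_trichotomy (a ξ) b with hab | hab | hab
  · have h1 := sumSlope_sub_ge X hE hb1 ha hab.le
    rw [abs_of_neg (by linarith)]
    have h2 : 0 ≤ sumSlope X (exp ξ) (a ξ) := nonneg_of_mul_nonneg_left hv (by linarith)
    refine le_trans ?_ (le_abs_self _)
    linarith
  · rw [hab]; simp
  · have h1 := sumSlope_sub_ge X hE ha hb1 hab.le
    rw [abs_of_pos (by linarith)]
    have h2 : sumSlope X (exp ξ) (a ξ) ≤ 0 := by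
      by_contra hcon
      push Not at hcon
      have : sumSlope X (exp ξ) (a ξ) * (b - a ξ) < 0 := mul_neg_of_pos_of_neg hcon (by linarith)
      linarith
    refine le_trans ?_ (neg_le_abs _)
    linarith

theorem sqDist_ge_mul {X r a : ℝ} (hr : 0 ≤ r) : (1 - |a|) * (X ^ 2 + r ^ 2) ≤ sqDist X r a := by
  unfold sqDist
  have h1 : 2 * X * r * a ≤ 2 * |X| * r * |a| := by
    have := le_abs_self (2 * X * r * a)
    rwa [abs_mul, abs_mul, abs_mul, abs_of_nonneg hr, abs_two] at this
  have h2 : 2 * |X| * r ≤ X ^ 2 + r ^ 2 := by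
    rw [← sq_abs X]; nlinarith [sq_nonneg (|X| - r)]
  have h3 := mul_le_mul_of_nonneg_right h2 (abs_nonneg a)
  linarith

theorem abs_sumRe_sub_le (X : ι → ℝ) {r a b : ℝ} (hr : 0 < r) (ha : |a| < 1) (hb : |b| < 1) :
    |sumRe X r a - sumRe X r b| ≤
      card ι * (|a - b| / (2 * ((1 - |a|) * (1 - |b|)))) := by
  unfold sumRe
  rw [← sum_sub_distrib]
  refine (Finset.abs_sum_le_sum_abs _ _).trans ?_
  rw [← nsmul_eq_mul, ← card_univ]
  refine Finset.sum_le_card_nsmul _ _ _ fun i _ => ?_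
  have p1 := sqDist_pos (X := X i) hr ha
  have p2 := sqDist_pos (X := X i) hr hb
  have q1 := sqDist_ge_mul (X := X i) (a := a) hr.le
  have q2 := sqDist_ge_mul (X := X i) (a := b) hr.le
  have ha' : 0 < 1 - |a| := by linarith
  have hb' : 0 < 1 - |b| := by linarith
  have hW : 0 < X i ^ 2 + r ^ 2 := by positivity
  set W := X i ^ 2 + r ^ 2 with hWdef
  have e : X i * (X i - r * a) / sqDist (X i) r a - X i * (X i - r * b) / sqDist (X i) r b =
      ((X i ^ 2 - r ^ 2) * (X i * r)) * (a - b) / (sqDist (X i) r a * sqDist (X i) r b) := by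
    rw [div_sub_div _ _ p1.ne' p2.ne']
    congr 1
    unfold sqDist
    ring
  rw [e, abs_div, abs_mul, abs_of_pos (mul_pos p1 p2)]
  have h1 : |(X i ^ 2 - r ^ 2) * (X i * r)| ≤ W * (W / 2) := by
    rw [abs_mul]
    have h2 : |X i ^ 2 - r ^ 2| ≤ W := by
      rw [abs_le]; constructor <;> nlinarith [sq_nonneg (X i), sq_nonneg r]
    have h3 : |X i * r| ≤ W / 2 := by
      rw [abs_le]; constructor <;> nlinarith [sq_nonneg (X i + r), sq_nonneg (X i - r)]
    gcongr
  calc |(X i ^ 2 - r ^ 2) * (X i * r)| * |a - b| / (sqDist (X i) r a * sqDist (X i) r b) ≤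
      W * (W / 2) * |a - b| / (((1 - |a|) * W) * ((1 - |b|) * W)) := by gcongr
    _ = _ := by field_simp

theorem continuousOn_sumRe_curve (X : ι → ℝ) {a : ℝ → ℝ} {s : Set ℝ} (ha : ∀ ξ, |a ξ| < 1)
    (hc : ContinuousOn a s) : ContinuousOn (fun ξ => sumRe X (exp ξ) (a ξ)) s := by
  unfold sumRe
  refine continuousOn_finsetSum _ fun i _ => ?_
  have he : ContinuousOn exp s := Real.continuous_exp.continuousOn
  refine ContinuousOn.div (continuousOn_const.mul (continuousOn_const.sub (he.mul hc))) ?_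
    fun ξ _ => (sqDist_pos (exp_pos ξ) (ha ξ)).ne'
  unfold sqDist
  exact (continuousOn_const.sub ((continuousOn_const.mul he).mul hc)).add (he.pow 2)

end finite

/-- A pair of functions as in the theorem, and sequences of sizes. -/
structure Admissible (f g : ℝ → ℝ) (c : ℝ) (n k : ℕ → ℕ) : Prop where
  hf : PiecewiseC1 f
  hg : PiecewiseC1 g
  f_pos : ∀ s ∈ Icc (0 : ℝ) 1, 0 < f s
  g_nonneg : ∀ s ∈ Icc (0 : ℝ) 1, 0 ≤ g s
  c_nonneg : 0 ≤ c
  hn : Tendsto n atTop atTop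
  hk : Tendsto k atTop atTop
  hc : Tendsto (fun j => (k j : ℝ) / (n j : ℝ)) atTop (𝓝 c)

/-- The configuration of singularities at size `(n, k)`. -/
def points (f g : ℝ → ℝ) (n k : ℕ) : Fin n ⊕ Fin k → ℝ := sites (specialize f n) (specialize g k)

namespace Admissible

variable {f g : ℝ → ℝ} {c : ℝ} {n k : ℕ → ℕ} (h : Admissible f g c n k)
include h

theorem tendsto_card : Tendsto (fun j => (card (Fin (n j) ⊕ Fin (k j)) : ℝ) / n j) atTop
    (𝓝 (1 + c)) := by
  refine (h.hc.const_add 1).congr' ?_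
  filter_upwards [h.hn.eventually_gt_atTop 0] with j hj
  have : (0 : ℝ) < n j := by exact_mod_cast hj
  rw [card_sum, card_fin, card_fin]
  push_cast
  field_simp

theorem exists_curv {R : ℝ} (hR : 0 < R) : ∃ c₀ > 0, ∀ᶠ j in atTop,
    c₀ * card (Fin (n j) ⊕ Fin (k j)) ≤
      ∑ i, (max (points f g (n j) (k j) i) 0) ^ 2 / (|points f g (n j) (k j) i| + R) ^ 4 := by
  have hcont : Continuous fun v : ℝ => v ^ 2 / (1 + R * |v|) ^ 4 :=
    Continuous.div (by fun_prop) (by fun_prop) fun v => by positivity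
  have hlim := tendsto_sum_sites h.hf h.hg h.hn h.hk h.hc (ψ := fun _ => 0)
    (F := fun X => (max X 0) ^ 2 / (|X| + R) ^ 4) hcont continuous_const h.f_pos h.g_nonneg
    (fun v hv => by
      have := inv_pos.2 hv
      rw [max_eq_left this.le, abs_of_pos this, abs_of_pos hv]
      field_simp) (fun v hv => by simp [hv])
  have hpos : 0 < ∫ s in (0 : ℝ)..1, f s ^ 2 / (1 + R * |f s|) ^ 4 := by
    refine intervalIntegral.intervalIntegral_pos_of_pos_on (h.hf.intervalIntegrable_comp hcont)
      (fun s hs => ?_) zero_lt_one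
    have := h.f_pos s ⟨hs.1.le, hs.2.le⟩
    positivity
  simp only [intervalIntegral.integral_zero, mul_zero, add_zero] at hlim
  set I := ∫ s in (0 : ℝ)..1, f s ^ 2 / (1 + R * |f s|) ^ 4 with hI
  have hc := h.c_nonneg
  refine ⟨I / (2 * (1 + c)), by positivity, ?_⟩
  have h1 := h.tendsto_card.const_mul (I / (2 * (1 + c)))
  have h2 := h1.eventually_lt hlim (by
    have : I / (2 * (1 + c)) * (1 + c) = I / 2 := by field_simp
    rw [this]; linarith)
  filter_upwards [h2, h.hn.eventually_gt_atTop 0] with j hj hnj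
  have : (0 : ℝ) < n j := by exact_mod_cast hnj
  rw [← mul_div_assoc] at hj
  exact ((div_lt_div_iff_of_pos_right this).1 hj).le

omit h in
theorem curv_of_max {ι : Type*} [Fintype ι] {X : ι → ℝ} {R : ℝ} (hR : 0 < R) :
    ∑ i, (max (X i) 0) ^ 2 / (|X i| + R) ^ 4 ≤ ∑ i, X i ^ 2 / (|X i| + R) ^ 4 := by
  refine sum_le_sum fun i _ => ?_
  have : (max (X i) 0) ^ 2 ≤ X i ^ 2 := by
    rcases le_total (X i) 0 with h | h
    · rw [max_eq_right h]; simpa using sq_nonneg (X i)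
    · rw [max_eq_left h]
  gcongr

theorem exists_lower : ∃ X₀ > 0, ∀ n k i, points f g n k i ≤ 0 ∨ X₀ ≤ points f g n k i := by
  obtain ⟨E, M, -, hM⟩ := h.hf.exists_finset
  have hM0 : 0 < M := (h.f_pos 0 (by simp)).trans_le ((le_abs_self _).trans (hM 0 (by simp)))
  refine ⟨M⁻¹, inv_pos.2 hM0, fun n k i => ?_⟩
  rcases i with i | j
  · right
    have h1 := h.f_pos _ (specialize_mem i)
    have h2 := (le_abs_self _).trans (hM _ (specialize_mem i))
    simp only [points, sites, Sum.elim_inl, specialize]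
    gcongr
  · left
    have h1 := h.g_nonneg _ (specialize_mem j)
    simp only [points, sites, Sum.elim_inr, specialize]
    linarith

theorem exists_upper : ∃ Y₀, ∀ n k i, 0 ≤ points f g n k i ∨ |points f g n k i| ≤ Y₀ := by
  obtain ⟨E, M, -, hM⟩ := h.hg.exists_finset
  refine ⟨M, fun n k i => ?_⟩
  rcases i with i | j
  · left
    have h1 := h.f_pos _ (specialize_mem i)
    simp only [points, sites, Sum.elim_inl, specialize]
    positivity
  · right
    simp only [points, sites, Sum.elim_inr, specialize, abs_neg]
    exact hM _ (specialize_mem j)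

/-- At the modulus of a nonreal critical point, the minimiser and the value of `sumRe` are close to
their limits. -/
theorem eventually_near_critical {t : ℝ} {z : ℂ} (hz : z.im ≠ 0) (hcrit : CriticalPointEq f g c t z)
    {η : ℝ} (hη : 0 < η) :
    ∀ᶠ j in atTop, ∀ a, IsArcMin (points f g (n j) (k j))
        (1 - 1 / card (Fin (n j) ⊕ Fin (k j))) a →
      |a (log ‖z‖) - z.re / ‖z‖| ≤ η ∧
      |sumRe (points f g (n j) (k j)) ‖z‖ (a (log ‖z‖)) - n j * (1 + t)| ≤ η * n j := by
  have hz0 : z ≠ 0 := fun h0 => hz (by rw [h0]; rfl)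
  set r := ‖z‖ with hr
  have hr0 : 0 < r := norm_pos_iff.2 hz0
  set b := z.re / r with hb
  have hrb : r * b = z.re := by rw [hb]; field_simp
  have hrr : r ^ 2 = normSq z := by rw [hr, sq_norm]
  have hlt : z.re ^ 2 < normSq z := by
    rw [normSq_apply]
    have : 0 < z.im * z.im := mul_self_pos.2 hz
    nlinarith
  have hb1 : |b| < 1 := by
    rw [← sq_lt_one_iff_abs_lt_one, hb, div_pow, hrr, div_lt_one (by rw [← hrr]; positivity)]
    exact hlt
  have hexp : exp (log r) = r := exp_log hr0
  have hsq : ∀ X, sqDist X r b = X ^ 2 - 2 * X * z.re + normSq z := by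
    intro X; unfold sqDist; rw [← hrb, ← hrr]; ring
  obtain ⟨e1, e2⟩ := (criticalPointEq_iff h.hf h.hg hz).1 hcrit
  have hslope := tendsto_sum_sites h.hf h.hg h.hn h.hk h.hc
    (F := fun X => X / sqDist X r b) (φ := fSlope z.re (normSq z))
    (ψ := fun v => -gSlope z.re (normSq z) v)
    (continuous_fSlope hlt) (continuous_gSlope hlt).neg h.f_pos h.g_nonneg
    (fun v hv => by
      have := (fDen_pos hlt v).ne'
      rw [hsq]; unfold fSlope
      have e : (v⁻¹ ^ 2 - 2 * v⁻¹ * z.re + normSq z) =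
          (1 - 2 * v * z.re + v ^ 2 * normSq z) / v ^ 2 := by field_simp
      rw [e]; field_simp)
    (fun v _ => by
      have e : ((-v) ^ 2 - 2 * -v * z.re + normSq z) =
          (v ^ 2 + 2 * v * z.re + normSq z) := by ring
      rw [hsq, e]; unfold gSlope; ring)
  have hre := tendsto_sum_sites h.hf h.hg h.hn h.hk h.hc
    (F := fun X => X * (X - r * b) / sqDist X r b) (φ := fRe z.re (normSq z))
    (ψ := gRe z.re (normSq z))
    (continuous_fRe hlt) (continuous_gRe hlt) h.f_pos h.g_nonneg
    (fun v hv => by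
      have := (fDen_pos hlt v).ne'
      rw [hsq, hrb]; unfold fRe
      have e : (v⁻¹ ^ 2 - 2 * v⁻¹ * z.re + normSq z) =
          (1 - 2 * v * z.re + v ^ 2 * normSq z) / v ^ 2 := by field_simp
      rw [e]; field_simp)
    (fun v _ => by
      have e : ((-v) ^ 2 - 2 * -v * z.re + normSq z) =
          (v ^ 2 + 2 * v * z.re + normSq z) := by ring
      rw [hsq, hrb, e]; unfold gRe; ring)
  rw [intervalIntegral.integral_neg, mul_neg, ← sub_eq_add_neg, e1] at hslope
  rw [e2] at hre
  obtain ⟨c₀, hc₀, hcurv⟩ := h.exists_curv hr0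
  have hc := h.c_nonneg
  set B := 1 - |b| with hB
  have hB0 : 0 < B := by rw [hB]; linarith
  -- the tolerance for the minimiser
  set η' := min η (min (B / 2) (η * B ^ 2 / (2 * (2 + c)))) with hη'
  have hη'0 : 0 < η' := by rw [hη']; positivity
  have hη'1 : η' ≤ η := min_le_left _ _
  have hη'2 : η' ≤ B / 2 := (min_le_right _ _).trans (min_le_left _ _)
  have hη'3 : η' ≤ η * B ^ 2 / (2 * (2 + c)) := (min_le_right _ _).trans (min_le_right _ _)
  have ev1 := (hslope.abs).eventually_lt_const (u := 2 * r * c₀ * η') (by rw [abs_zero]; positivity)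
  have ev2 := (Metric.tendsto_nhds.1 hre) (η / 2) (by positivity)
  have ev3 := h.tendsto_card.eventually_lt_const (u := 2 + c) (by linarith)
  have hcardtop : Tendsto (fun j => (card (Fin (n j) ⊕ Fin (k j)) : ℝ)) atTop atTop := by
    refine tendsto_atTop_mono (fun j => ?_) (tendsto_natCast_atTop_atTop.comp h.hn)
    simp [card_sum]
  have ev4 := (tendsto_inv_atTop_zero.comp hcardtop).eventually_lt_const (u := B) hB0
  filter_upwards [ev1, ev2, ev3, ev4, hcurv, h.hn.eventually_gt_atTop 0] with j h1 h2 h3 h4 h5 h6 a ha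
  have hn0 : (0 : ℝ) < n j := by exact_mod_cast h6
  set X := points f g (n j) (k j) with hX
  set ν : ℝ := (card (Fin (n j) ⊕ Fin (k j)) : ℝ) with hν
  have hνn : n j ≤ ν := by rw [hν]; simp [card_sum]
  have hbα : |b| ≤ 1 - 1 / ν := by
    simp only [Function.comp_apply, ← one_div] at h4
    linarith
  have hclose := ha.abs_sub_le (log r) hbα
  rw [hexp] at hclose
  have hS : c₀ * n j ≤ ∑ i, X i ^ 2 / (|X i| + r) ^ 4 :=
    le_trans (by gcongr) (h5.trans (curv_of_max hr0))
  have hsl : |sumSlope X r b| < 2 * r * c₀ * η' * n j := by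
    rw [abs_div, abs_of_pos hn0, div_lt_iff₀ hn0] at h1
    exact h1
  have hab : |a (log r) - b| ≤ η' := by
    have h7 : 2 * r * (c₀ * n j) * |a (log r) - b| ≤ 2 * r * (c₀ * n j) * η' := by
      calc 2 * r * (c₀ * n j) * |a (log r) - b| ≤
          2 * r * (∑ i, X i ^ 2 / (|X i| + r) ^ 4) * |a (log r) - b| := by gcongr
        _ ≤ |sumSlope X r b| := hclose
        _ ≤ _ := by linarith
    exact le_of_mul_le_mul_left h7 (by positivity)
  refine ⟨hab.trans hη'1, ?_⟩
  have ha1 := ha.abs_lt_one (log r)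
  have h8 := abs_sumRe_sub_le X hr0 ha1 hb1
  have h9 : B / 2 ≤ 1 - |a (log r)| := by
    have := abs_sub_abs_le_abs_sub (a (log r)) b
    rw [hB] at hη'2 ⊢
    linarith
  have h10 : |sumRe X r (a (log r)) - sumRe X r b| ≤ η / 2 * n j := by
    refine h8.trans ?_
    have hν2 : ν ≤ (2 + c) * n j := by
      rw [div_lt_iff₀ hn0] at h3
      exact h3.le
    calc ν * (|a (log r) - b| / (2 * ((1 - |a (log r)|) * (1 - |b|)))) ≤
        ((2 + c) * n j) * ((η * B ^ 2 / (2 * (2 + c))) / (2 * ((B / 2) * B))) := by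
          gcongr
          exact hab.trans hη'3
      _ = _ := by field_simp
  have h11 : |sumRe X r b - n j * (1 + t)| ≤ η / 2 * n j := by
    rw [dist_eq] at h2
    have : sumRe X r b - n j * (1 + t) = (sumRe X r b / n j - (1 + t)) * n j := by field_simp
    rw [this, abs_mul, abs_of_pos hn0]
    gcongr
    exact h2.le
  calc _ = |(sumRe X r (a (log r)) - sumRe X r b) + (sumRe X r b - n j * (1 + t))| := by
        ring_nf
    _ ≤ _ := abs_add_le _ _
    _ ≤ η * n j := by linarith

end Admissible

end

section

theorem exists_lipschitz_const {R r₁ X₀ c₀ : ℝ} (hR : 0 < R) (hr₁ : 0 < r₁) (hX₀ : 0 < X₀)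
    (hc₀ : 0 < c₀) : ∃ L > 0, 2 + 2 * (R / X₀) ≤ L * r₁ ∧ 2 * R ≤ r₁ * (r₁ * L - 1) ∧
      16 * R < r₁ ^ 4 * c₀ * L := by
  refine ⟨(2 + 2 * (R / X₀)) / r₁ + (2 * R / r₁ + 1) / r₁ + 17 * R / (r₁ ^ 4 * c₀), by positivity,
    ?_, ?_, ?_⟩
  · have : 0 ≤ ((2 * R / r₁ + 1) / r₁ + 17 * R / (r₁ ^ 4 * c₀)) * r₁ := by positivity
    have e : (2 + 2 * (R / X₀)) / r₁ * r₁ = 2 + 2 * (R / X₀) := by field_simp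
    linarith
  · have : 0 ≤ r₁ * (r₁ * ((2 + 2 * (R / X₀)) / r₁ + 17 * R / (r₁ ^ 4 * c₀))) := by positivity
    have e : r₁ * (r₁ * ((2 * R / r₁ + 1) / r₁) - 1) = 2 * R := by field_simp; ring
    linarith
  · have : 0 ≤ r₁ ^ 4 * c₀ * ((2 + 2 * (R / X₀)) / r₁ + (2 * R / r₁ + 1) / r₁) := by positivity
    have e : r₁ ^ 4 * c₀ * (17 * R / (r₁ ^ 4 * c₀)) = 17 * R := by field_simp
    linarith

theorem exp_mem_of_abs_sub_log_le {ρ ξ : ℝ} (hρ : 0 < ρ) (h : |ξ - log ρ| ≤ 1 / 2) :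
    ρ / 4 ≤ exp ξ ∧ exp ξ ≤ 4 * ρ := by
  have hq : exp (1 / 2) ≤ 4 := by
    have h1 : exp (1 / 2) ≤ exp 1 := exp_le_exp.2 (by norm_num)
    have := Real.exp_one_lt_d9
    linarith
  have e : exp ξ = ρ * exp (ξ - log ρ) := by
    rw [exp_sub, exp_log hρ]; field_simp
  obtain ⟨h1, h2⟩ := abs_le.1 h
  rw [e]
  constructor
  · have h3 : 1 / 4 ≤ exp (ξ - log ρ) := by
      calc (1 : ℝ) / 4 ≤ 1 / exp (1 / 2) := one_div_le_one_div_of_le (exp_pos _) hq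
        _ = exp (-(1 / 2)) := by rw [exp_neg, one_div (exp (1 / 2))]
        _ ≤ _ := exp_le_exp.2 h1
    have := mul_le_mul_of_nonneg_left h3 hρ.le
    linarith
  · have h3 : exp (ξ - log ρ) ≤ 4 := (exp_le_exp.2 h2).trans hq
    have := mul_le_mul_of_nonneg_left h3 hρ.le
    linarith

theorem tendsto_add_floor_div {n : ℕ → ℕ} (hn : Tendsto n atTop atTop) (t : ℝ) :
    Tendsto (fun j => ((n j : ℝ) + ⌊(n j : ℝ) * t⌋) / n j) atTop (𝓝 (1 + t)) := by
  have h1 : Tendsto (fun x : ℝ => (⌊x * t⌋ : ℝ) / x) atTop (𝓝 t) := by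
    have h0 : Tendsto (fun x : ℝ => t - 1 / x) atTop (𝓝 t) := by
      simpa using (tendsto_inv_atTop_zero (𝕜 := ℝ)).const_sub t
    refine tendsto_of_tendsto_of_tendsto_of_le_of_le' h0 tendsto_const_nhds ?_ ?_
    · filter_upwards [eventually_gt_atTop 0] with x hx
      have := (Int.sub_one_lt_floor (x * t)).le
      rw [le_div_iff₀ hx]
      have e : (t - 1 / x) * x = x * t - 1 := by field_simp
      linarith
    · filter_upwards [eventually_gt_atTop 0] with x hx
      have := Int.floor_le (x * t)
      rw [div_le_iff₀ hx]
      linarith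
  have h2 := (h1.comp (tendsto_natCast_atTop_atTop.comp hn)).const_add 1
  refine h2.congr' ?_
  filter_upwards [hn.eventually_gt_atTop 0] with j hj
  have : (0 : ℝ) < n j := by exact_mod_cast hj
  simp only [Function.comp_apply]
  field_simp

namespace Admissible

variable {f g : ℝ → ℝ} {c : ℝ} {n k : ℕ → ℕ} (h : Admissible f g c n k)
include h

/-- Uniform Lipschitz continuity of the minimisers near a given modulus. -/
theorem exists_lipschitz {ρ : ℝ} (hρ : 0 < ρ) : ∃ L > 0, ∀ᶠ j in atTop, ∀ a,
    IsArcMin (points f g (n j) (k j)) (1 - 1 / card (Fin (n j) ⊕ Fin (k j))) a →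
    ∀ ξ ξ', |ξ - log ρ| ≤ 1 / 2 → |ξ' - log ρ| ≤ 1 / 2 →
      |a ξ - a ξ'| ≤ L * |ξ - ξ'| := by
  obtain ⟨c₀, hc₀, hcurv⟩ := h.exists_curv (R := 4 * ρ) (by positivity)
  obtain ⟨X₀, hX₀, hX⟩ := h.exists_lower
  obtain ⟨L, hL, hL1, hL2, hL3⟩ := exists_lipschitz_const (R := 4 * ρ) (r₁ := ρ / 4) (X₀ := X₀)
    (c₀ := c₀) (by positivity) (by positivity) hX₀ hc₀
  refine ⟨L * (4 * ρ), by positivity, ?_⟩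
  filter_upwards [hcurv, h.hn.eventually_gt_atTop 0] with j hj hnj a ha ξ ξ' hξ hξ'
  have : Nonempty (Fin (n j) ⊕ Fin (k j)) := ⟨Sum.inl ⟨0, hnj⟩⟩
  obtain ⟨m1, m2⟩ := exp_mem_of_abs_sub_log_le hρ hξ
  obtain ⟨m1', m2'⟩ := exp_mem_of_abs_sub_log_le hρ hξ'
  have h1 := ha.lipschitz (by positivity) hX₀ (hX _ _) hj hL1 hL2 hL3 m1 m2 m1' m2'
  have h2 := exp_sub_exp_le m2 m2'
  calc |a ξ - a ξ'| ≤ L * |exp ξ - exp ξ'| := h1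
    _ ≤ L * (4 * ρ * |ξ - ξ'|) := by gcongr
    _ = _ := by ring

/-- Saddle points exist near limits of nonreal critical points. -/
theorem eventually_exists_saddle {t : ℝ} {ζ : ℂ} (hζ : ζ ≠ 0)
    (happrox : ∀ ε > 0, ∃ (z : ℂ) (t' : ℝ), z.im ≠ 0 ∧ CriticalPointEq f g c t' z ∧
      ‖z - ζ‖ < ε ∧ |t' - t| < ε) {ε : ℝ} (hε : 0 < ε) :
    ∀ᶠ j in atTop, ∀ a, IsArcMin (points f g (n j) (k j))
        (1 - 1 / card (Fin (n j) ⊕ Fin (k j))) a →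
      ∃ ξ, |ξ - log ‖ζ‖| ≤ ε ∧ |a ξ - ζ.re / ‖ζ‖| ≤ ε ∧
        sumRe (points f g (n j) (k j)) (exp ξ) (a ξ) = n j + ⌊(n j : ℝ) * t⌋ := by
  set ρ := ‖ζ‖ with hρdef
  have hρ : 0 < ρ := norm_pos_iff.2 hζ
  obtain ⟨L, hL, hlip⟩ := h.exists_lipschitz hρ
  obtain ⟨c₀, hc₀, hcurv⟩ := h.exists_curv (R := 4 * ρ) (by positivity)
  set δ := min (1 / 4) (min (ε / 2) (ε / (4 * L))) with hδ
  have hδ0 : 0 < δ := by rw [hδ]; positivity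
  have hδ1 : δ ≤ 1 / 4 := min_le_left _ _
  have hδ2 : δ ≤ ε / 2 := (min_le_right _ _).trans (min_le_left _ _)
  have hδ3 : δ ≤ ε / (4 * L) := (min_le_right _ _).trans (min_le_right _ _)
  set γ := c₀ * (ρ / 4 * δ) ^ 3 / (2 * (4 * ρ)) / 4 with hγ
  have hγ0 : 0 < γ := by positivity
  have c1 : ContinuousAt (fun z : ℂ => log ‖z‖) ζ :=
    ContinuousAt.log (by fun_prop) hρ.ne'
  have c2 : ContinuousAt (fun z : ℂ => z.re / ‖z‖) ζ :=
    ContinuousAt.div (continuous_re.continuousAt) (by fun_prop) hρ.ne'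
  obtain ⟨ε₁, hε₁, h1⟩ := continuousAt_iff.1 c1 δ hδ0
  obtain ⟨ε₂, hε₂, h2⟩ := continuousAt_iff.1 c2 (ε / 4) (by positivity)
  obtain ⟨z, t', hz, hcrit, hzζ, htt⟩ := happrox (min γ (min ε₁ ε₂)) (by positivity)
  have hz1 := h1 (x := z) (by
    rw [dist_eq_norm]; exact hzζ.trans_le ((min_le_right _ _).trans (min_le_left _ _)))
  have hz2 := h2 (x := z) (by
    rw [dist_eq_norm]; exact hzζ.trans_le ((min_le_right _ _).trans (min_le_right _ _)))
  rw [dist_eq, ← hρdef] at hz1 hz2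
  have htt' : |t' - t| < γ := htt.trans_le (min_le_left _ _)
  have hz0 : z ≠ 0 := fun h0 => hz (by rw [h0]; rfl)
  have hr0 : 0 < ‖z‖ := norm_pos_iff.2 hz0
  set ξ₁ := log ‖z‖ with hξ₁
  have ev1 := h.eventually_near_critical hz hcrit (η := min γ (ε / 4)) (by positivity)
  have ev2 := (Metric.tendsto_nhds.1 (tendsto_add_floor_div h.hn t)) γ hγ0
  filter_upwards [ev1, ev2, hlip, hcurv, h.hn.eventually_gt_atTop 0] with j hj1 hj2 hj3 hj4 hnj a ha
  have hn0 : (0 : ℝ) < n j := by exact_mod_cast hnj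
  obtain ⟨k1, k2⟩ := hj1 a ha
  set X := points f g (n j) (k j) with hX
  set Q : ℝ := n j + ⌊(n j : ℝ) * t⌋ with hQ
  have hnν : (n j : ℝ) ≤ card (Fin (n j) ⊕ Fin (k j)) := by simp [card_sum]
  have hexp : exp ξ₁ = ‖z‖ := exp_log hr0
  rw [← hξ₁] at k1 k2
  rw [← hexp] at k2
  have hnear : ∀ ξ, |ξ - ξ₁| ≤ δ → |ξ - log ρ| ≤ 2 * δ := by
    intro ξ hξ
    have := abs_add_le (ξ - ξ₁) (ξ₁ - log ρ)
    rw [sub_add_sub_cancel] at this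
    linarith
  have hQ1 : |Q - n j * (1 + t)| ≤ γ * n j := by
    rw [dist_eq] at hj2
    have : Q - n j * (1 + t) = (Q / n j - (1 + t)) * n j := by field_simp
    rw [this, abs_mul, abs_of_pos hn0]
    gcongr
  have hT : |sumRe X (exp ξ₁) (a ξ₁) - Q| ≤ 3 * γ * n j := by
    have b1 : |sumRe X (exp ξ₁) (a ξ₁) - n j * (1 + t')| ≤ γ * n j :=
      k2.trans (mul_le_mul_of_nonneg_right (min_le_left _ _) hn0.le)
    have b2 : |n j * (1 + t') - n j * (1 + t)| ≤ γ * n j := by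
      rw [← mul_sub, abs_mul, abs_of_pos hn0, add_sub_add_left_eq_sub, mul_comm]
      gcongr
    rw [abs_le] at b1 b2 hQ1 ⊢
    constructor <;> linarith [b1.1, b1.2, b2.1, b2.2, hQ1.1, hQ1.2]
  have hgap : ∀ p q, q = p + δ → |p - log ρ| ≤ 1 / 2 → |q - log ρ| ≤ 1 / 2 →
      4 * γ * n j ≤ sumRe X (exp p) (a p) - sumRe X (exp q) (a q) := by
    intro p q hpq hp hq
    obtain ⟨m1, m2⟩ := exp_mem_of_abs_sub_log_le hρ hp
    obtain ⟨m1', m2'⟩ := exp_mem_of_abs_sub_log_le hρ hq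
    have h3 := ha.sumRe_sub_ge (ξ := q) (ξ' := p) (by linarith) m2'
      (hj4.trans (curv_of_max (by positivity)))
    refine le_trans ?_ h3
    have h4 : ρ / 4 * δ ≤ exp q - exp p := by
      have e : exp q = exp p * exp δ := by rw [← exp_add, hpq]
      have := add_one_le_exp δ
      have h5 := mul_le_mul_of_nonneg_left this (exp_pos p).le
      have h6 := mul_le_mul_of_nonneg_right m1 hδ0.le
      rw [e]; linarith
    have h5 : (ρ / 4 * δ) ^ 3 ≤ (exp q - exp p) ^ 3 := pow_le_pow_left₀ (by positivity) h4 3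
    calc 4 * γ * n j = c₀ * n j * (ρ / 4 * δ) ^ 3 / (2 * (4 * ρ)) := by rw [hγ]; ring
      _ ≤ _ := by gcongr
  have m0 : |ξ₁ - log ρ| ≤ 1 / 2 := by linarith
  have mp : |ξ₁ + δ - log ρ| ≤ 1 / 2 := by
    have := hnear (ξ₁ + δ) (by rw [add_sub_cancel_left, abs_of_pos hδ0]); linarith
  have mm : |ξ₁ - δ - log ρ| ≤ 1 / 2 := by
    have := hnear (ξ₁ - δ) (by rw [sub_sub_cancel_left, abs_neg, abs_of_pos hδ0]); linarith
  have g1 := hgap ξ₁ (ξ₁ + δ) rfl m0 mp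
  have g2 := hgap (ξ₁ - δ) ξ₁ (by ring) mm m0
  have hγn : 0 < γ * n j := by positivity
  have hT' := abs_le.1 hT
  have hac : ContinuousOn a (Icc (ξ₁ - δ) (ξ₁ + δ)) := by
    have hl : LipschitzOnWith (Real.toNNReal L) a (Icc (ξ₁ - δ) (ξ₁ + δ)) := by
      refine LipschitzOnWith.of_dist_le_mul fun u hu v hv => ?_
      rw [dist_eq, dist_eq, Real.coe_toNNReal _ hL.le]
      have hu' := hnear u (abs_le.2 ⟨by linarith [hu.1], by linarith [hu.2]⟩)
      have hv' := hnear v (abs_le.2 ⟨by linarith [hv.1], by linarith [hv.2]⟩)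
      exact hj3 a ha u v (by linarith) (by linarith)
    exact hl.continuousOn
  have hTc := continuousOn_sumRe_curve X ha.abs_lt_one hac
  have hivt := intermediate_value_Icc' (by linarith : ξ₁ - δ ≤ ξ₁ + δ) hTc
  obtain ⟨ξ, hξ, hξQ⟩ := hivt (show Q ∈ Icc _ _ from ⟨by linarith, by linarith⟩)
  have hξ1 : |ξ - ξ₁| ≤ δ := abs_le.2 ⟨by linarith [hξ.1], by linarith [hξ.2]⟩
  have hξ2 := hnear ξ hξ1
  refine ⟨ξ, by linarith, ?_, hξQ⟩
  have l1 := hj3 a ha ξ ξ₁ (by linarith) m0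
  have l2 : L * |ξ - ξ₁| ≤ ε / 4 := by
    calc L * |ξ - ξ₁| ≤ L * (ε / (4 * L)) := by gcongr; linarith
      _ = ε / 4 := by field_simp
  have l3 : |a ξ₁ - z.re / ‖z‖| ≤ ε / 4 := k1.trans (min_le_right _ _)
  have e1 : a ξ - ζ.re / ρ = (a ξ - a ξ₁) + ((a ξ₁ - z.re / ‖z‖) + (z.re / ‖z‖ - ζ.re / ρ)) := by
    ring
  rw [e1]
  have t1 := abs_add_le (a ξ - a ξ₁) ((a ξ₁ - z.re / ‖z‖) + (z.re / ‖z‖ - ζ.re / ρ))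
  have t2 := abs_add_le (a ξ₁ - z.re / ‖z‖) (z.re / ‖z‖ - ζ.re / ρ)
  linarith

end Admissible

end

/-- The singularities stay away from `ζ` for all but finitely many arguments. -/
def IsSeparated (f g : ℝ → ℝ) (ζ : ℂ) : Prop :=
  ∃ (E : Finset ℝ) (ε : ℝ), 0 < ε ∧ ∀ s ∈ Icc (0 : ℝ) 1, s ∉ E →
    ε ≤ ‖(((f s)⁻¹ : ℝ) : ℂ) - ζ‖ ∧ ε ≤ ‖((-g s : ℝ) : ℂ) - ζ‖

theorem exists_pos_le_norm_sub (V : Finset ℝ) (ζ : ℂ) :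
    ∃ ε > 0, ∀ v ∈ V, (v : ℂ) ≠ ζ → ε ≤ ‖(v : ℂ) - ζ‖ := by
  classical
  induction V using Finset.induction_on with
  | empty => exact ⟨1, one_pos, by simp⟩
  | insert u V _ ih =>
    obtain ⟨ε, hε, h⟩ := ih
    by_cases hu : (u : ℂ) = ζ
    · refine ⟨ε, hε, fun v hv hne => ?_⟩
      rcases Finset.mem_insert.1 hv with rfl | hv
      · exact absurd hu hne
      · exact h v hv hne
    · have hpos : 0 < ‖(u : ℂ) - ζ‖ := norm_pos_iff.2 (sub_ne_zero.2 hu)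
      refine ⟨min ε ‖(u : ℂ) - ζ‖, lt_min hε hpos, fun v hv hne => ?_⟩
      rcases Finset.mem_insert.1 hv with rfl | hv
      · exact min_le_right _ _
      · exact (min_le_left _ _).trans (h v hv hne)

theorem specialize_injective {n : ℕ} : Function.Injective fun i : Fin n => ((i : ℝ) + 1) / n := by
  intro i j hij
  have hn : (0 : ℝ) < n := by
    have := i.2
    exact_mod_cast (by omega : 0 < n)
  simp only at hij
  rw [div_left_inj' hn.ne'] at hij
  have : (i : ℝ) = j := by linarith
  exact Fin.ext (by exact_mod_cast this)

theorem IsSeparated.points {f g : ℝ → ℝ} {ζ : ℂ} (h : IsSeparated f g ζ) :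
    ∃ (ε : ℝ) (κ : ℕ), 0 < ε ∧ ∀ n k : ℕ, ∃ A : Finset (Fin n ⊕ Fin k), A.card ≤ κ ∧
      (∀ i ∈ A, (points f g n k i : ℂ) = ζ) ∧
      ∀ i ∉ A, ε ≤ ‖(points f g n k i : ℂ) - ζ‖ := by
  classical
  obtain ⟨E, ε, hε, hE⟩ := h
  obtain ⟨ε₁, hε₁, h1⟩ := exists_pos_le_norm_sub
    (E.image (fun s => (f s)⁻¹) ∪ E.image (fun s => -g s)) ζ
  refine ⟨min ε ε₁, E.card + E.card, by positivity, fun n k => ?_⟩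
  refine ⟨Finset.univ.filter fun i => (SkewHowe.points f g n k i : ℂ) = ζ, ?_,
    fun i hi => (mem_filter.1 hi).2, fun i hi => ?_⟩
  · rw [← Finset.card_disjSum]
    refine Finset.card_le_card_of_injOn (Sum.map (fun i : Fin n => ((i : ℝ) + 1) / n)
      (fun j : Fin k => ((j : ℝ) + 1) / k)) (fun i hi => ?_)
      (Function.Injective.injOn (specialize_injective.sumMap specialize_injective))
    have hi' := (mem_filter.1 hi).2
    rcases i with i | j
    · simp only [Sum.map_inl, SetLike.mem_coe, Finset.inl_mem_disjSum]
      by_contra hcon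
      have := (hE _ (specialize_mem i) hcon).1
      simp only [SkewHowe.points, sites, Sum.elim_inl, specialize] at hi'
      rw [hi', sub_self, norm_zero] at this
      linarith
    · simp only [Sum.map_inr, SetLike.mem_coe, Finset.inr_mem_disjSum]
      by_contra hcon
      have := (hE _ (specialize_mem j) hcon).2
      simp only [SkewHowe.points, sites, Sum.elim_inr, specialize] at hi'
      rw [hi', sub_self, norm_zero] at this
      linarith
  · have hne : (SkewHowe.points f g n k i : ℂ) ≠ ζ := fun h0 =>
      hi (mem_filter.2 ⟨Finset.mem_univ _, h0⟩)
    rcases i with i | j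
    · by_cases hs : ((i : ℝ) + 1) / n ∈ E
      · exact (min_le_right _ _).trans (h1 _ (Finset.mem_union_left _
          (Finset.mem_image_of_mem (fun s => (f s)⁻¹) hs)) hne)
      · exact (min_le_left _ _).trans (hE _ (specialize_mem i) hs).1
    · by_cases hs : ((j : ℝ) + 1) / k ∈ E
      · exact (min_le_right _ _).trans (h1 _ (Finset.mem_union_right _
          (Finset.mem_image_of_mem (fun s => -g s) hs)) hne)
      · exact (min_le_left _ _).trans (hE _ (specialize_mem j) hs).2

/-- The point `e^u (b + i √(1 - b²))`. -/
def polarPoint (u b : ℝ) : ℂ := exp u * (b + sqrt (1 - b ^ 2) * I)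

theorem sqDist_eq_norm_sq (X u : ℝ) {b : ℝ} (hb : |b| ≤ 1) :
    sqDist X (exp u) b = ‖(X : ℂ) - polarPoint u b‖ ^ 2 := by
  have h1 : 0 ≤ 1 - b ^ 2 := by
    have := sq_le_one_iff_abs_le_one b |>.2 hb; linarith
  have h2 := sq_sqrt h1
  have hre : ((X : ℂ) - polarPoint u b).re = X - exp u * b := by
    simp [polarPoint, -ofReal_exp]
  have him : ((X : ℂ) - polarPoint u b).im = -(exp u * sqrt (1 - b ^ 2)) := by
    simp [polarPoint, -ofReal_exp]
  rw [sq_norm, normSq_apply, hre, him]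
  unfold sqDist
  linear_combination (-(exp u) ^ 2) * h2

theorem polarPoint_log {ζ : ℂ} (hζ : ζ ≠ 0) (him : 0 ≤ ζ.im) :
    polarPoint (log ‖ζ‖) (ζ.re / ‖ζ‖) = ζ := by
  have hρ : 0 < ‖ζ‖ := norm_pos_iff.2 hζ
  have e1 : sqrt (1 - (ζ.re / ‖ζ‖) ^ 2) = ζ.im / ‖ζ‖ := by
    have h1 : 1 - (ζ.re / ‖ζ‖) ^ 2 = (ζ.im / ‖ζ‖) ^ 2 := by
      have := sq_norm ζ
      rw [normSq_apply] at this
      field_simp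
      linarith
    rw [h1, sqrt_sq (by positivity)]
  apply Complex.ext
  · simp only [polarPoint, exp_log hρ, e1]
    simp
    field_simp
  · simp only [polarPoint, exp_log hρ, e1]
    simp
    field_simp

theorem continuous_polarPoint : Continuous fun p : ℝ × ℝ => polarPoint p.1 p.2 := by
  unfold polarPoint
  fun_prop

theorem exists_sign_nbhd (x ρ : ℝ) (hρ : 0 < ρ) : ∃ η > 0, ∀ b, |b - x / ρ| ≤ η → 0 ≤ b * x := by
  rcases eq_or_ne x 0 with rfl | hx
  · exact ⟨1, one_pos, fun b _ => by simp⟩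
  · have hx' : 0 < |x| := abs_pos.2 hx
    refine ⟨|x| / ρ, by positivity, fun b hb => ?_⟩
    have h1 : |(b - x / ρ) * x| ≤ |x| / ρ * |x| := by rw [abs_mul]; gcongr
    have h2 := (abs_le.1 h1).1
    have e : |x| / ρ * |x| = x ^ 2 / ρ := by rw [← sq_abs]; ring
    have e2 : (b - x / ρ) * x = b * x - x ^ 2 / ρ := by ring
    rw [e, e2] at h2
    linarith

theorem continuous_discreteSine (l l' : ℤ) : Continuous fun ρ => discreteSine ρ l l' := by
  unfold discreteSine
  split_ifs <;> fun_prop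

/-- Uniform control near saddle points. -/
theorem Admissible.exists_nearSaddle {f g : ℝ → ℝ} {c : ℝ} {n k : ℕ → ℕ}
    (h : Admissible f g c n k) {t : ℝ} {ζ : ℂ} (hζ : ζ ≠ 0) (him : 0 ≤ ζ.im)
    (happrox : ∀ ε > 0, ∃ (z : ℂ) (t' : ℝ), z.im ≠ 0 ∧ CriticalPointEq f g c t' z ∧
      ‖z - ζ‖ < ε ∧ |t' - t| < ε) (hsep : IsSeparated f g ζ) :
    ∃ (r₁ R c₀ L ε ε₀ : ℝ) (κ : ℕ), 0 < r₁ ∧ 0 < R ∧ 0 < c₀ ∧ 0 ≤ L ∧ 0 < ε ∧ 0 < ε₀ ∧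
      ∀ ε₁ > 0, ∀ᶠ j in atTop, ∃ (a : ℝ → ℝ) (ξ₀ : ℝ) (A : Finset (Fin (n j) ⊕ Fin (k j))) (Z : ℝ),
        NearSaddle (points f g (n j) (k j)) (k j - ⌊(n j : ℝ) * t⌋) a ξ₀ A Z r₁ R c₀ L ε ε₀ κ ∧
        |ξ₀ - log ‖ζ‖| ≤ ε₁ ∧ |a ξ₀ - ζ.re / ‖ζ‖| ≤ ε₁ := by
  set ρ := ‖ζ‖ with hρdef
  have hρ : 0 < ρ := norm_pos_iff.2 hζ
  obtain ⟨ε, κ, hε, hA⟩ := hsep.points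
  obtain ⟨c₀, hc₀, hcurv⟩ := h.exists_curv (R := 4 * ρ) (by positivity)
  obtain ⟨L, hL, hlip⟩ := h.exists_lipschitz hρ
  obtain ⟨η₁, hη₁, hsign⟩ := exists_sign_nbhd ζ.re ρ hρ
  obtain ⟨η₂, hη₂, hcont⟩ := continuousAt_iff.1
    (continuous_polarPoint.continuousAt (x := (log ρ, ζ.re / ρ))) (ε / 2) (by positivity)
  simp only [hρdef, polarPoint_log hζ him] at hcont
  rw [← hρdef] at hcont
  set η := min η₁ (η₂ / 2) with hη
  have hη0 : 0 < η := by positivity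
  set ε₀ := min (1 / 4) (min (η / (2 * L)) (η₂ / 4)) with hε₀
  have hε₀0 : 0 < ε₀ := by positivity
  have hε₀1 : ε₀ ≤ 1 / 4 := min_le_left _ _
  have hε₀2 : ε₀ ≤ η / (2 * L) := (min_le_right _ _).trans (min_le_left _ _)
  have hε₀3 : ε₀ ≤ η₂ / 4 := (min_le_right _ _).trans (min_le_right _ _)
  refine ⟨ρ / 4, 4 * ρ, c₀, L, ε / 2, ε₀, κ, by positivity, by positivity, hc₀, hL.le, by positivity,
    hε₀0, fun ε₁ hε₁ => ?_⟩
  have ev := h.eventually_exists_saddle hζ happrox (ε := min ε₁ (min ε₀ (η / 2))) (by positivity)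
  filter_upwards [ev, hlip, hcurv, h.hn.eventually_gt_atTop 0] with j hj1 hj2 hj3 hnj
  have hcard : 1 ≤ card (Fin (n j) ⊕ Fin (k j)) := by
    rw [card_sum, card_fin]; omega
  have hcard' : (1 : ℝ) ≤ card (Fin (n j) ⊕ Fin (k j)) := by exact_mod_cast hcard
  obtain ⟨a, ha⟩ := exists_isArcMin (points f g (n j) (k j))
    (α := 1 - 1 / card (Fin (n j) ⊕ Fin (k j)))
    (by rw [sub_nonneg, div_le_one (by linarith)]; exact hcard')
    (by
      have : 0 < 1 / (card (Fin (n j) ⊕ Fin (k j)) : ℝ) := by positivity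
      linarith)
  obtain ⟨ξ₀, hξ₀, haξ₀, hsad⟩ := hj1 a ha
  obtain ⟨A, hAcard, hAeq, hAfar⟩ := hA (n j) (k j)
  have b1 : |ξ₀ - log ρ| ≤ ε₀ := hξ₀.trans ((min_le_right _ _).trans (min_le_left _ _))
  have b2 : |a ξ₀ - ζ.re / ρ| ≤ η / 2 := haξ₀.trans ((min_le_right _ _).trans (min_le_right _ _))
  have hnear : ∀ ξ, |ξ - ξ₀| ≤ ε₀ → |ξ - log ρ| ≤ 2 * ε₀ := by
    intro ξ hξ
    have := abs_add_le (ξ - ξ₀) (ξ₀ - log ρ)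
    rw [sub_add_sub_cancel] at this
    linarith
  have hanear : ∀ ξ, |ξ - ξ₀| ≤ ε₀ → |a ξ - ζ.re / ρ| ≤ η := by
    intro ξ hξ
    have l1 := hj2 a ha ξ ξ₀ (by linarith [hnear ξ hξ]) (by linarith)
    have l2 : L * |ξ - ξ₀| ≤ η / 2 := by
      calc L * |ξ - ξ₀| ≤ L * (η / (2 * L)) := by gcongr; linarith
        _ = η / 2 := by field_simp
    have := abs_add_le (a ξ - a ξ₀) (a ξ₀ - ζ.re / ρ)
    rw [sub_add_sub_cancel] at this
    linarith
  refine ⟨a, ξ₀, A, ζ.re, ?_, hξ₀.trans (min_le_left _ _), haξ₀.trans (min_le_left _ _)⟩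
  exact
    { arc := ha
      saddle := by
        rw [hsad, card_sum, card_fin, card_fin]; push_cast; ring
      r₁_pos := by positivity
      c₀_pos := hc₀
      ε_pos := by positivity
      ε₀_pos := hε₀0
      mem := fun ξ hξ => exp_mem_of_abs_sub_log_le hρ (by linarith [hnear ξ hξ])
      lip := fun ξ ξ' hξ hξ' => hj2 a ha ξ ξ' (by linarith [hnear ξ hξ]) (by linarith [hnear ξ' hξ'])
      curv := hj3.trans (curv_of_max (by positivity))
      far := fun u v hu hv i hi => by
        rw [sqDist_eq_norm_sq _ _ (ha.abs_lt_one v).le]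
        have h1 := hcont (x := (u, a v)) (by
          rw [Prod.dist_eq, max_lt_iff, dist_eq, dist_eq]
          constructor
          · have := hnear u hu
            simp only
            linarith
          · have := hanear v hv
            have : η ≤ η₂ / 2 := min_le_right _ _
            simp only
            linarith)
        rw [dist_eq_norm] at h1
        have h2 := hAfar i hi
        have h3 := norm_sub_le_norm_sub_add_norm_sub (points f g (n j) (k j) i : ℂ)
          (polarPoint u (a v)) ζ
        gcongr
        linarith
      atom := fun i hi => by
        have := congrArg Complex.re (hAeq i hi)
        simpa using this
      atom_card := hAcard
      atom_sign := fun ξ hξ => hsign _ ((hanear ξ hξ).trans (min_le_left _ _))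
      atom_mem := fun ⟨i, hi⟩ => by
        have h1 := hAeq i hi
        have h2 : |ζ.re| = ρ := by
          rw [hρdef, ← h1, ofReal_re, norm_real, norm_eq_abs]
        rw [h2]
        constructor <;> linarith }

/-- Convergence of the correlation kernel. -/
theorem kernelConverges_of_approx {f g : ℝ → ℝ} {c t : ℝ} {ζ : ℂ} (hf : PiecewiseC1 f)
    (hg : PiecewiseC1 g) (hfpos : ∀ s ∈ Icc (0 : ℝ) 1, 0 < f s)
    (hgnonneg : ∀ s ∈ Icc (0 : ℝ) 1, 0 ≤ g s) (hc : 0 ≤ c) (hζ : ζ ≠ 0) (him : 0 ≤ ζ.im)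
    (happrox : ∀ ε > 0, ∃ (z : ℂ) (t' : ℝ), z.im ≠ 0 ∧ CriticalPointEq f g c t' z ∧
      ‖z - ζ‖ < ε ∧ |t' - t| < ε) (hsep : IsSeparated f g ζ) : KernelConverges f g c t ζ := by
  intro n k hn hk hkn Γ l l'
  have h : Admissible f g c n k := ⟨hf, hg, hfpos, hgnonneg, hc, hn, hk, hkn⟩
  have hρ : 0 < ‖ζ‖ := norm_pos_iff.2 hζ
  obtain ⟨X₀, hX₀, hX⟩ := h.exists_lower
  obtain ⟨Y₀, hY⟩ := h.exists_upper
  obtain ⟨r₁, R, c₀, L, ε, ε₀, κ, hr₁, hR, hc₀, hL, hε, hε₀, hns⟩ :=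
    h.exists_nearSaddle hζ him happrox hsep
  obtain ⟨A, ν₀, hker⟩ := exists_norm_corrKernel_sub_le (r₁ := r₁) (R := R) (c₀ := c₀) (L := L)
    (ε := ε) (ε₀ := ε₀) (X₀ := X₀) (Y₀ := Y₀) κ l l' hr₁ hR hc₀ hL hε hε₀ hX₀
  set w : ℝ := ‖ζ‖ ^ (l - l') with hw
  have hw0 : 0 < w := zpow_pos hρ _
  -- the main term
  set Ψ : ℝ × ℝ → ℝ := fun p => w * (exp ((l' - l) * p.1) *
    discreteSine (arccos p.2 / π) l l') with hΨ
  have hΨc : Continuous Ψ := by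
    refine continuous_const.mul (Continuous.mul (by fun_prop) ?_)
    exact (continuous_discreteSine l l').comp
      ((Real.continuous_arccos.comp continuous_snd).div_const _)
  have hΨ0 : Ψ (log ‖ζ‖, ζ.re / ‖ζ‖) = discreteSine (ζ.arg / π) l l' := by
    simp only [hΨ]
    rw [Complex.arg_of_im_nonneg_of_ne_zero him hζ, ← mul_assoc]
    have : w * exp ((l' - l) * log ‖ζ‖) = 1 := by
      rw [mul_comm ((l' : ℝ) - l), exp_mul, exp_log hρ, hw]
      rw [show ((l' : ℝ) - l) = ((l' - l : ℤ) : ℝ) by push_cast; rfl, rpow_intCast,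
        ← zpow_add₀ hρ.ne']
      simp
    rw [this, one_mul]
  rw [Metric.tendsto_nhds]
  intro e he
  obtain ⟨ε₁, hε₁, hcont⟩ := continuousAt_iff.1
    (hΨc.continuousAt (x := (log ‖ζ‖, ζ.re / ‖ζ‖))) (e / 2) (by positivity)
  have hcardtop : Tendsto (fun j => (card (Fin (n j) ⊕ Fin (k j)) : ℝ)) atTop atTop := by
    refine tendsto_atTop_mono (fun j => ?_) (tendsto_natCast_atTop_atTop.comp h.hn)
    simp [card_sum]
  have herr : Tendsto (fun j => w * (A / (card (Fin (n j) ⊕ Fin (k j)) : ℝ) ^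
      (1 / 200 : ℝ))) atTop (𝓝 0) := by
    have h1 := ((tendsto_rpow_atTop (y := 1 / 200) (by norm_num)).comp hcardtop).const_div_atTop A
    simpa using h1.const_mul w
  filter_upwards [hns (ε₁ / 2) (by positivity), hcardtop.eventually_ge_atTop ν₀,
    herr.eventually_lt_const (u := e / 2) (by positivity)] with j ⟨a, ξ₀, S, Z, hN, d1, d2⟩ hν hlt
  have hK := hker (n j) (k j) (specialize f (n j)) (specialize g (k j))
    (fun i => hfpos _ (specialize_mem i)) (fun i => hgnonneg _ (specialize_mem i)) (Γ j)
    ⌊(n j : ℝ) * t⌋ a ξ₀ S Z hN (hX _ _) (hY _ _) hν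
  rw [arcInt_zpow] at hK
  have hmain := hcont (x := (ξ₀, a ξ₀)) (by
    rw [Prod.dist_eq, max_lt_iff, dist_eq, dist_eq]
    constructor
    · simp only; linarith
    · simp only; linarith)
  rw [hΨ0, dist_eq] at hmain
  rw [dist_eq_norm]
  set C := corrKernel (specialize f (n j)) (specialize g (k j)) (Γ j) (⌊(n j : ℝ) * t⌋ + l)
    (⌊(n j : ℝ) * t⌋ + l') with hC
  set m := exp ((l' - l) * ξ₀) * discreteSine (arccos (a ξ₀) / π) l l' with hm
  have e1 : (w : ℂ) * C - (discreteSine (ζ.arg / π) l l' : ℂ) =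
      (w : ℂ) * (C - (m : ℂ)) + ((w * m - discreteSine (ζ.arg / π) l l' : ℝ) : ℂ) := by
    push_cast; ring
  rw [e1]
  have n1 : ‖(w : ℂ) * (C - (m : ℂ))‖ < e / 2 := by
    rw [norm_mul, norm_real, norm_eq_abs, abs_of_pos hw0]
    refine lt_of_le_of_lt ?_ hlt
    gcongr
  have n2 : ‖((w * m - discreteSine (ζ.arg / π) l l' : ℝ) : ℂ)‖ < e / 2 := by
    rw [norm_real, norm_eq_abs]
    exact hmain
  linarith [norm_add_le ((w : ℂ) * (C - (m : ℂ)))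
    ((w * m - discreteSine (ζ.arg / π) l l' : ℝ) : ℂ)]

section

/-! ### Pencils of linear forms

The critical point equation has the form `∫ a / (a + b z) dν = T` for a family of real linear
forms `a + b z`; the substitution `z ↦ -1 / z` replaces `(a, b)` by `(b, -a)`. -/

theorem den_nonneg (a b : ℝ) (z : ℂ) : 0 ≤ den a b z := by rw [den_eq]; positivity

theorem continuous_den (a b : ℝ) : Continuous (den a b) := by
  unfold den
  exact ((continuous_const.add (continuous_const.mul continuous_re)).add
    (continuous_const.mul continuous_normSq))

variable {Ω : Type*} [MeasurableSpace Ω]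

/-- A bounded family of nonzero linear forms `a + b z` in which `b` is small compared with `a`
where `a b` is negative, and `a` is small compared with `b` where `a b` is positive. -/
structure IsPencil (ν : Measure Ω) (a b : Ω → ℝ) (M : ℝ) : Prop where
  measA : AEStronglyMeasurable a ν
  measB : AEStronglyMeasurable b ν
  boundA : ∀ᵐ ω ∂ν, |a ω| ≤ M
  boundB : ∀ᵐ ω ∂ν, |b ω| ≤ M
  one_le : ∀ᵐ ω ∂ν, 1 ≤ a ω ^ 2 + b ω ^ 2
  le_sqA : ∀ᵐ ω ∂ν, |a ω * b ω| ≤ a ω * b ω + M * a ω ^ 2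
  le_sqB : ∀ᵐ ω ∂ν, |a ω * b ω| ≤ -(a ω * b ω) + M * b ω ^ 2
  not_ae : ¬ ∀ᵐ ω ∂ν, a ω * b ω = 0

/-- The forms `a + b z` are bounded away from `0`, except for those with `a b = 0`. -/
def IsApart (ν : Measure Ω) (a b : Ω → ℝ) (z : ℂ) : Prop :=
  ∃ δ > 0, ∀ᵐ ω ∂ν, a ω * b ω = 0 ∨ δ ≤ den (a ω) (b ω) z

/-- The point `z` of the closed upper half-plane satisfies `∫ a / (a + b z) dν = T` and
`∫ a b / |a + b z|² dν = 0`. -/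
structure IsCrit (ν : Measure Ω) (a b : Ω → ℝ) (T : ℝ) (z : ℂ) : Prop where
  im_nonneg : 0 ≤ z.im
  apart : IsApart ν a b z
  slope : ∫ ω, a ω * b ω / den (a ω) (b ω) z ∂ν = 0
  value : ∫ ω, a ω * (a ω + b ω * z.re) / den (a ω) (b ω) z ∂ν = T

variable {ν : Measure Ω} {a b : Ω → ℝ} {M T : ℝ} {z w : ℂ}

theorem IsPencil.swap (h : IsPencil ν a b M) : IsPencil ν b (fun ω => -a ω) M where
  measA := h.measB
  measB := h.measA.neg
  boundA := h.boundB
  boundB := by simpa using h.boundA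
  one_le := by
    filter_upwards [h.one_le] with ω h1
    nlinarith
  le_sqA := by
    filter_upwards [h.le_sqB] with ω h1
    rw [mul_neg, abs_neg, mul_comm]; linarith
  le_sqB := by
    filter_upwards [h.le_sqA] with ω h1
    rw [mul_neg, abs_neg, neg_neg, neg_sq, mul_comm]; linarith
  not_ae := by
    intro h1
    refine h.not_ae ?_
    filter_upwards [h1] with ω h2
    linarith [mul_comm (a ω) (b ω)]

theorem IsPencil.aemeasurable_den (h : IsPencil ν a b M) (z : ℂ) :
    AEMeasurable (fun ω => den (a ω) (b ω) z) ν := by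
  have h1 := h.measA.aemeasurable
  have h2 := h.measB.aemeasurable
  unfold den
  fun_prop

theorem IsPencil.aestronglyMeasurable_slope (h : IsPencil ν a b M) (z : ℂ) :
    AEStronglyMeasurable (fun ω => a ω * b ω / den (a ω) (b ω) z) ν :=
  ((h.measA.aemeasurable.mul h.measB.aemeasurable).div (h.aemeasurable_den z)).aestronglyMeasurable

theorem IsPencil.aestronglyMeasurable_value (h : IsPencil ν a b M) (z : ℂ) (x : ℝ) :
    AEStronglyMeasurable (fun ω => a ω * (a ω + b ω * x) / den (a ω) (b ω) z) ν :=
  ((h.measA.aemeasurable.mul (h.measA.aemeasurable.add (h.measB.aemeasurable.mul_const x))).div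
    (h.aemeasurable_den z)).aestronglyMeasurable

/-- `a (a + b x) / |a + b z|²` does not depend on `z` if `a b = 0`. -/
theorem value_of_mul_eq_zero {a b : ℝ} (hab : a * b = 0) (x : ℝ) (z : ℂ) :
    a * (a + b * x) / den a b z = a ^ 2 / a ^ 2 := by
  rcases mul_eq_zero.1 hab with h | h
  · simp [h]
  · subst h; simp [den, sq]

theorem abs_value_le {a b M δ x : ℝ} {z : ℂ} (ha : |a| ≤ M) (hb : |b| ≤ M) (hδ : 0 < δ)
    (h : a * b = 0 ∨ δ ≤ den a b z) :
    |a * (a + b * x) / den a b z| ≤ 1 + M * (M + M * |x|) / δ := by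
  have hM : 0 ≤ M := (abs_nonneg a).trans ha
  have hp : 0 ≤ M * (M + M * |x|) / δ := by positivity
  rcases h with h | h
  · rw [value_of_mul_eq_zero h, abs_of_nonneg (by positivity)]
    linarith [div_self_le_one (a ^ 2)]
  · rw [abs_div, abs_of_nonneg (den_nonneg _ _ _), abs_mul]
    have h1 : |a + b * x| ≤ M + M * |x| := (abs_add_le _ _).trans (by rw [abs_mul]; gcongr)
    have : |a| * |a + b * x| / den a b z ≤ M * (M + M * |x|) / δ := by gcongr
    linarith

theorem abs_slope_le {a b M δ : ℝ} {z : ℂ} (ha : |a| ≤ M) (hb : |b| ≤ M) (hδ : 0 < δ)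
    (h : a * b = 0 ∨ δ ≤ den a b z) : |a * b / den a b z| ≤ M * M / δ := by
  have hM : 0 ≤ M := (abs_nonneg a).trans ha
  rcases h with h | h
  · rw [h, zero_div, abs_zero]; positivity
  · rw [abs_div, abs_of_nonneg (den_nonneg _ _ _), abs_mul]
    gcongr

theorem IsPencil.integral_pos (h : IsPencil ν a b M) {F : Ω → ℝ} (hF : Integrable F ν)
    (h0 : ∀ᵐ ω ∂ν, 0 ≤ F ω) (hpos : ∀ᵐ ω ∂ν, a ω * b ω ≠ 0 → F ω ≠ 0) : 0 < ∫ ω, F ω ∂ν := by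
  refine lt_of_le_of_ne (integral_nonneg_of_ae h0) fun h1 => h.not_ae ?_
  have h2 := (integral_eq_zero_iff_of_nonneg_ae h0 hF).1 h1.symm
  filter_upwards [h2, hpos] with ω h3 h4
  by_contra h5
  exact h4 h5 h3

variable [IsFiniteMeasure ν]

theorem IsPencil.integrable_slope (h : IsPencil ν a b M) (hz : IsApart ν a b z) :
    Integrable (fun ω => a ω * b ω / den (a ω) (b ω) z) ν := by
  obtain ⟨δ, hδ, hz⟩ := hz
  refine Integrable.of_bound (h.aestronglyMeasurable_slope z) (M * M / δ) ?_
  filter_upwards [hz, h.boundA, h.boundB] with ω h1 h2 h3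
  exact abs_slope_le h2 h3 hδ h1

theorem IsPencil.integrable_value (h : IsPencil ν a b M) (hz : IsApart ν a b z) (x : ℝ) :
    Integrable (fun ω => a ω * (a ω + b ω * x) / den (a ω) (b ω) z) ν := by
  obtain ⟨δ, hδ, hz⟩ := hz
  refine Integrable.of_bound (h.aestronglyMeasurable_value z x) (1 + M * (M + M * |x|) / δ) ?_
  filter_upwards [hz, h.boundA, h.boundB] with ω h1 h2 h3
  exact abs_value_le h2 h3 hδ h1

theorem IsPencil.integrable_sq (h : IsPencil ν a b M) (hz : IsApart ν a b z) :
    Integrable (fun ω => a ω ^ 2 / den (a ω) (b ω) z) ν := by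
  refine (h.integrable_value hz 0).congr (ae_of_all _ fun ω => ?_)
  simp only [mul_zero, add_zero, sq]

theorem IsCrit.integral_sq (h : IsPencil ν a b M) (hz : IsCrit ν a b T z) :
    ∫ ω, a ω ^ 2 / den (a ω) (b ω) z ∂ν = T := by
  have h1 : ∀ ω, a ω * (a ω + b ω * z.re) / den (a ω) (b ω) z =
      a ω ^ 2 / den (a ω) (b ω) z + z.re * (a ω * b ω / den (a ω) (b ω) z) := fun ω => by ring
  have h2 := hz.value
  simp only [h1] at h2
  rwa [integral_add (h.integrable_sq hz.apart) ((h.integrable_slope hz.apart).const_mul _),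
    integral_const_mul, hz.slope, mul_zero, add_zero] at h2

theorem IsCrit.pos (h : IsPencil ν a b M) (hz : IsCrit ν a b T z) : 0 < T := by
  rw [← hz.integral_sq h]
  refine h.integral_pos (h.integrable_sq hz.apart)
    (ae_of_all _ fun ω => div_nonneg (sq_nonneg _) (den_nonneg _ _ _)) ?_
  obtain ⟨δ, hδ, h1⟩ := hz.apart
  filter_upwards [h1] with ω h2 h3
  exact (div_pos (sq_pos_iff.2 (left_ne_zero_of_mul h3)) (hδ.trans_le (h2.resolve_left h3))).ne'

/-- `T < ν Ω` at a critical point `z ≠ 0`, and `T ≤ ν Ω` at `z = 0`. -/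
theorem IsCrit.le_measure (h : IsPencil ν a b M) (hz : IsCrit ν a b T z) :
    T ≤ ν.real univ ∧ (z ≠ 0 → T < ν.real univ) := by
  have hi := (h.integrable_sq hz.apart).add ((h.integrable_slope hz.apart).const_mul (2 * z.re))
  have hi2 := (integrable_const (μ := ν) (1 : ℝ)).sub hi
  have e : ∫ ω, (1 - (a ω ^ 2 / den (a ω) (b ω) z +
      2 * z.re * (a ω * b ω / den (a ω) (b ω) z))) ∂ν = ν.real univ - T := by
    refine (integral_sub (integrable_const (μ := ν) (1 : ℝ)) hi).trans ?_
    rw [integral_const, smul_eq_mul, mul_one]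
    congr 1
    refine (integral_add (h.integrable_sq hz.apart)
      ((h.integrable_slope hz.apart).const_mul (2 * z.re))).trans ?_
    rw [integral_const_mul, hz.slope, hz.integral_sq h, mul_zero, add_zero]
  have key : ∀ ω, den (a ω) (b ω) z ≠ 0 → (1 - (a ω ^ 2 / den (a ω) (b ω) z +
      2 * z.re * (a ω * b ω / den (a ω) (b ω) z))) =
      b ω ^ 2 * normSq z / den (a ω) (b ω) z := by
    intro ω h0
    field_simp
    unfold den
    ring
  have hnn : ∀ ω, 0 ≤ (1 - (a ω ^ 2 / den (a ω) (b ω) z +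
      2 * z.re * (a ω * b ω / den (a ω) (b ω) z))) := by
    intro ω
    by_cases h0 : den (a ω) (b ω) z = 0
    · simp [h0]
    · rw [key ω h0]
      exact div_nonneg (mul_nonneg (sq_nonneg _) (Complex.normSq_nonneg z)) (den_nonneg _ _ _)
  refine ⟨?_, fun h0 => ?_⟩
  · have := integral_nonneg_of_ae (μ := ν) (ae_of_all _ hnn)
    rw [e] at this
    linarith
  · have : 0 < ν.real univ - T := by
      rw [← e]
      refine h.integral_pos hi2 (ae_of_all _ hnn) ?_
      obtain ⟨δ, hδ, h1⟩ := hz.apart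
      filter_upwards [h1] with ω h2 h3
      have hd := hδ.trans_le (h2.resolve_left h3)
      rw [key ω hd.ne']
      exact div_ne_zero (mul_ne_zero (pow_ne_zero _ (right_ne_zero_of_mul h3))
        (normSq_eq_zero.not.2 h0)) hd.ne'
    linarith

theorem IsCrit.unique (h : IsPencil ν a b M) (hz : IsCrit ν a b T z) (hw : IsCrit ν a b T w) :
    z = w := by
  set E : ℝ := 4 * (normSq w * z.re ^ 2 + normSq z * w.re ^ 2) -
    4 * (normSq z + normSq w) * (z.re * w.re) +
    (normSq z - normSq w) ^ 2 with hE
  have hEe : E = normSq (z - w) * normSq (z - (starRingEnd ℂ) w) := by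
    rw [hE]
    simp only [normSq_apply, sub_re, sub_im, conj_re,
      conj_im]
    ring
  have iz := h.integrable_slope hz.apart
  have iw := h.integrable_slope hw.apart
  have jz := h.integrable_sq hz.apart
  have jw := h.integrable_sq hw.apart
  have key : ∀ᵐ ω ∂ν, E * ((a ω * b ω / den (a ω) (b ω) z) * (a ω * b ω / den (a ω) (b ω) w)) =
      (a ω ^ 2 / den (a ω) (b ω) w - a ω ^ 2 / den (a ω) (b ω) z) *
          (normSq z - normSq w) +
        (a ω * b ω / den (a ω) (b ω) w) * (2 * normSq w * z.re - 2 * w.re * normSq w)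
        + (a ω * b ω / den (a ω) (b ω) z) *
          (2 * normSq z * w.re - 2 * z.re * normSq z) := by
    obtain ⟨δ, hδ, h1⟩ := hz.apart
    obtain ⟨δ', hδ', h1'⟩ := hw.apart
    filter_upwards [h1, h1'] with ω h2 h2'
    by_cases h3 : a ω * b ω = 0
    · have e1 : a ω ^ 2 / den (a ω) (b ω) z = a ω ^ 2 / a ω ^ 2 := by
        simpa [sq] using value_of_mul_eq_zero h3 0 z
      have e2 : a ω ^ 2 / den (a ω) (b ω) w = a ω ^ 2 / a ω ^ 2 := by
        simpa [sq] using value_of_mul_eq_zero h3 0 w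
      rw [h3, e1, e2]
      ring
    · have d1 := (hδ.trans_le (h2.resolve_left h3)).ne'
      have d2 := (hδ'.trans_le (h2'.resolve_left h3)).ne'
      field_simp
      rw [hE]
      unfold den
      ring
  have hIntegr : ∫ ω, E * ((a ω * b ω / den (a ω) (b ω) z) * (a ω * b ω / den (a ω) (b ω) w)) ∂ν
      = 0 := by
    have k1 : Integrable (fun ω => (a ω ^ 2 / den (a ω) (b ω) w - a ω ^ 2 / den (a ω) (b ω) z) *
        (normSq z - normSq w)) ν := (jw.sub jz).mul_const _
    have k2 : Integrable (fun ω => (a ω ^ 2 / den (a ω) (b ω) w - a ω ^ 2 / den (a ω) (b ω) z) *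
        (normSq z - normSq w) + (a ω * b ω / den (a ω) (b ω) w) *
        (2 * normSq w * z.re - 2 * w.re * normSq w)) ν := k1.add (iw.mul_const _)
    rw [integral_congr_ae key, integral_add k2 (iz.mul_const _), integral_add k1 (iw.mul_const _),
      integral_mul_const, integral_mul_const, integral_mul_const, hz.slope, hw.slope,
      integral_sub jw jz, hz.integral_sq h, hw.integral_sq h]
    ring
  rw [integral_const_mul] at hIntegr
  have hposint : 0 < ∫ ω, (a ω * b ω / den (a ω) (b ω) z) * (a ω * b ω / den (a ω) (b ω) w) ∂ν := by
    refine h.integral_pos ?_ (ae_of_all _ fun ω => ?_) ?_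
    · obtain ⟨δ, hδ, h1⟩ := hz.apart
      refine iw.bdd_mul (c := M * M / δ) (h.aestronglyMeasurable_slope z) ?_
      filter_upwards [h1, h.boundA, h.boundB] with ω h1 h2 h3
      exact abs_slope_le h2 h3 hδ h1
    · rw [div_mul_div_comm]
      exact div_nonneg (mul_self_nonneg _) (mul_nonneg (den_nonneg _ _ _) (den_nonneg _ _ _))
    · obtain ⟨δ, hδ, h1⟩ := hz.apart
      obtain ⟨δ', hδ', h1'⟩ := hw.apart
      filter_upwards [h1, h1'] with ω h2 h2' h3
      exact mul_ne_zero (div_ne_zero h3 (hδ.trans_le (h2.resolve_left h3)).ne')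
        (div_ne_zero h3 (hδ'.trans_le (h2'.resolve_left h3)).ne')
  have hE0 := (mul_eq_zero.1 hIntegr).resolve_right hposint.ne'
  rw [hEe, mul_eq_zero, normSq_eq_zero, normSq_eq_zero, sub_eq_zero, sub_eq_zero]
    at hE0
  rcases hE0 with h0 | h0
  · exact h0
  · have h1 := congrArg Complex.im h0
    rw [conj_im] at h1
    have h2 : w.im = 0 := by linarith [hz.im_nonneg, hw.im_nonneg]
    rw [h0]
    exact Complex.conj_eq_iff_im.2 h2

end

section

theorem eventually_half_le_den (M : ℝ) {δ : ℝ} (hδ : 0 < δ) (z : ℂ) :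
    ∀ᶠ w in 𝓝 z, ∀ a b : ℝ, |a| ≤ M → |b| ≤ M → δ ≤ den a b z → δ / 2 ≤ den a b w := by
  have hc : Continuous fun w : ℂ => 2 * M ^ 2 * |w.re - z.re| +
      M ^ 2 * |normSq w - normSq z| :=
    (continuous_const.mul (continuous_re.sub continuous_const).abs).add
      (continuous_const.mul (continuous_normSq.sub continuous_const).abs)
  have h0 := hc.tendsto z
  simp only [sub_self, abs_zero, mul_zero, add_zero] at h0
  filter_upwards [h0.eventually_lt_const (half_pos hδ)] with w hw a b ha hb h
  have hM : 0 ≤ M := (abs_nonneg a).trans ha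
  have e : den a b w = den a b z + (2 * (a * b) * (w.re - z.re) +
      b ^ 2 * (normSq w - normSq z)) := by unfold den; ring
  have h1 : |2 * (a * b) * (w.re - z.re)| ≤ 2 * M ^ 2 * |w.re - z.re| := by
    rw [abs_mul, abs_mul, abs_mul, abs_two, sq]
    gcongr
  have h2 : |b ^ 2 * (normSq w - normSq z)| ≤
      M ^ 2 * |normSq w - normSq z| := by
    rw [abs_mul, abs_pow]
    gcongr
  linarith [neg_le_of_abs_le h1, neg_le_of_abs_le h2]

theorem exists_le_den_of_im_ne_zero {z : ℂ} (hz : z.im ≠ 0) :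
    ∃ δ > 0, ∀ a b : ℝ, 1 ≤ a ^ 2 + b ^ 2 → δ ≤ den a b z := by
  refine ⟨z.im ^ 2 / (2 * z.im ^ 2 + 2 * z.re ^ 2 + 1), by positivity, fun a b h => ?_⟩
  rw [div_le_iff₀ (by positivity), den_eq]
  have h1 : z.im ^ 2 ≤ z.im ^ 2 * (a ^ 2 + b ^ 2) := le_mul_of_one_le_right (sq_nonneg _) h
  have h2 : z.im ^ 2 * a ^ 2 ≤ 2 * z.im ^ 2 * (a + b * z.re) ^ 2 + 2 * z.re ^ 2 * (b * z.im) ^ 2 := by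
    have : 0 ≤ z.im ^ 2 * (a + b * z.re + b * z.re) ^ 2 := by positivity
    nlinarith
  nlinarith [mul_nonneg (sq_nonneg z.re) (sq_nonneg (a + b * z.re)),
    mul_nonneg (sq_nonneg z.im) (sq_nonneg (b * z.im)), sq_nonneg (a + b * z.re)]

variable {Ω : Type*} [MeasurableSpace Ω] {ν : Measure Ω} {a b : Ω → ℝ} {M T : ℝ} {z : ℂ}

theorem IsPencil.isApart_of_im_ne_zero (h : IsPencil ν a b M) (hz : z.im ≠ 0) :
    IsApart ν a b z := by
  obtain ⟨δ, hδ, h1⟩ := exists_le_den_of_im_ne_zero hz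
  refine ⟨δ, hδ, ?_⟩
  filter_upwards [h.one_le] with ω h2
  exact Or.inr (h1 _ _ h2)

variable [IsFiniteMeasure ν]

theorem IsCrit.of_tendsto_of_isApart (h : IsPencil ν a b M) {u : ℕ → ℂ} {S : ℕ → ℝ}
    (hu : ∀ n, IsCrit ν a b (S n) (u n)) (huz : Tendsto u atTop (𝓝 z))
    (hS : Tendsto S atTop (𝓝 T)) (hz : IsApart ν a b z) : IsCrit ν a b T z := by
  have him : 0 ≤ z.im := ge_of_tendsto' ((continuous_im.tendsto z).comp huz)
    fun n => (hu n).im_nonneg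
  obtain ⟨δ, hδ, hd⟩ := hz
  have hev : ∀ᶠ n in atTop, ∀ᵐ ω ∂ν, a ω * b ω = 0 ∨ δ / 2 ≤ den (a ω) (b ω) (u n) := by
    filter_upwards [huz.eventually (eventually_half_le_den M hδ z)] with n hn
    filter_upwards [hd, h.boundA, h.boundB] with ω h1 h2 h3
    exact h1.imp_right (hn _ _ h2 h3)
  have hden : ∀ ω, Tendsto (fun n => den (a ω) (b ω) (u n)) atTop (𝓝 (den (a ω) (b ω) z)) :=
    fun ω => ((continuous_den _ _).tendsto z).comp huz
  have hre : Tendsto (fun n => (u n).re) atTop (𝓝 z.re) :=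
    (continuous_re.tendsto z).comp huz
  have hslope : Tendsto (fun n => ∫ ω, a ω * b ω / den (a ω) (b ω) (u n) ∂ν) atTop
      (𝓝 (∫ ω, a ω * b ω / den (a ω) (b ω) z ∂ν)) := by
    refine tendsto_integral_filter_of_dominated_convergence (fun _ => M * M / (δ / 2))
      (Eventually.of_forall fun n => h.aestronglyMeasurable_slope _) ?_ (integrable_const _) ?_
    · filter_upwards [hev] with n hn
      filter_upwards [hn, h.boundA, h.boundB] with ω h1 h2 h3
      exact abs_slope_le h2 h3 (half_pos hδ) h1
    · filter_upwards [hd] with ω h1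
      rcases h1 with h1 | h1
      · simp [h1]
      · exact tendsto_const_nhds.div (hden ω) (hδ.trans_le h1).ne'
  have hvalue : Tendsto (fun n => ∫ ω, a ω * (a ω + b ω * (u n).re) / den (a ω) (b ω) (u n) ∂ν)
      atTop (𝓝 (∫ ω, a ω * (a ω + b ω * z.re) / den (a ω) (b ω) z ∂ν)) := by
    refine tendsto_integral_filter_of_dominated_convergence
      (fun _ => 1 + M * (M + M * (|z.re| + 1)) / (δ / 2))
      (Eventually.of_forall fun n => h.aestronglyMeasurable_value _ _) ?_ (integrable_const _) ?_
    · filter_upwards [hev, hre.abs.eventually_le_const (lt_add_one _)] with n hn hx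
      filter_upwards [hn, h.boundA, h.boundB] with ω h1 h2 h3
      have hM : 0 ≤ M := (abs_nonneg _).trans h2
      refine (abs_value_le h2 h3 (half_pos hδ) h1).trans ?_
      gcongr
    · filter_upwards [hd] with ω h1
      rcases h1 with h1 | h1
      · simp only [value_of_mul_eq_zero h1]
        exact tendsto_const_nhds
      · exact (tendsto_const_nhds.mul (tendsto_const_nhds.add (hre.const_mul _))).div (hden ω)
          (hδ.trans_le h1).ne'
  refine ⟨him, ⟨δ, hδ, hd⟩, tendsto_nhds_unique hslope ?_, tendsto_nhds_unique hvalue ?_⟩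
  · simp only [(hu _).slope]
    exact tendsto_const_nhds
  · simpa only [(hu _).value] using hS

/-- Fatou's lemma for the slope integral at a limit of critical points. -/
theorem IsCrit.integrable_slope_of_tendsto (h : IsPencil ν a b M) {u : ℕ → ℂ} {S : ℕ → ℝ}
    (hu : ∀ n, IsCrit ν a b (S n) (u n)) (huz : Tendsto u atTop (𝓝 z)) :
    (∀ᵐ ω ∂ν, a ω * b ω = 0 ∨ den (a ω) (b ω) z ≠ 0) ∧
      Integrable (fun ω => a ω * b ω / den (a ω) (b ω) z) ν := by
  have hM : 0 ≤ M := by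
    by_contra hM
    refine h.not_ae ?_
    filter_upwards [h.boundA] with ω h1
    linarith [abs_nonneg (a ω)]
  set H : ℂ → Ω → ENNReal := fun w ω =>
    ENNReal.ofReal |a ω * b ω| * (ENNReal.ofReal (den (a ω) (b ω) w))⁻¹ with hH
  have hmeas : ∀ w, AEMeasurable (H w) ν := fun w =>
    ((h.measA.aemeasurable.mul h.measB.aemeasurable).abs.ennreal_ofReal).mul
      (h.aemeasurable_den w).ennreal_ofReal.inv
  have hlim : ∀ ω, Tendsto (fun n => H (u n) ω) atTop (𝓝 (H z ω)) := fun ω =>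
    ENNReal.Tendsto.const_mul ((continuous_inv.tendsto _).comp
      ((ENNReal.continuous_ofReal.tendsto _).comp (((continuous_den _ _).tendsto z).comp huz)))
      (Or.inr ENNReal.ofReal_ne_top)
  have hHeq : ∀ w ω, (a ω * b ω = 0 ∨ den (a ω) (b ω) w ≠ 0) →
      H w ω = ENNReal.ofReal (|a ω * b ω| / den (a ω) (b ω) w) := by
    intro w ω h1
    rcases h1 with h1 | h1
    · simp only [hH, h1, abs_zero, ENNReal.ofReal_zero, zero_mul, zero_div]
    · have hp : 0 < den (a ω) (b ω) w := lt_of_le_of_ne (den_nonneg _ _ _) h1.symm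
      rw [ENNReal.ofReal_div_of_pos hp, ENNReal.div_eq_inv_mul, mul_comm]
  have hbound : ∀ n, ∫⁻ ω, H (u n) ω ∂ν ≤ ENNReal.ofReal (M * ν.real univ) := by
    intro n
    have hi : Integrable (fun ω => a ω * b ω / den (a ω) (b ω) (u n) +
        M * (a ω ^ 2 / den (a ω) (b ω) (u n))) ν :=
      (h.integrable_slope (hu n).apart).add ((h.integrable_sq (hu n).apart).const_mul M)
    calc ∫⁻ ω, H (u n) ω ∂ν ≤ ∫⁻ ω, ENNReal.ofReal (a ω * b ω / den (a ω) (b ω) (u n) +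
          M * (a ω ^ 2 / den (a ω) (b ω) (u n))) ∂ν := by
          obtain ⟨δ, hδ, h1⟩ := (hu n).apart
          refine lintegral_mono_ae ?_
          filter_upwards [h1, h.le_sqA] with ω h2 h3
          rw [hHeq _ _ (h2.imp_right fun h4 => (hδ.trans_le h4).ne')]
          refine ENNReal.ofReal_le_ofReal ?_
          rw [mul_div_assoc', ← add_div]
          exact div_le_div_of_nonneg_right h3 (den_nonneg _ _ _)
      _ = ENNReal.ofReal (M * S n) := by
          rw [← ofReal_integral_eq_lintegral_ofReal hi, integral_add
            (h.integrable_slope (hu n).apart) ((h.integrable_sq (hu n).apart).const_mul M),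
            integral_const_mul, (hu n).slope, (hu n).integral_sq h, zero_add]
          obtain ⟨δ, hδ, h1⟩ := (hu n).apart
          filter_upwards [h.le_sqA] with ω h3
          rw [mul_div_assoc', ← add_div]
          exact div_nonneg ((abs_nonneg _).trans h3) (den_nonneg _ _ _)
      _ ≤ _ := ENNReal.ofReal_le_ofReal (mul_le_mul_of_nonneg_left ((hu n).le_measure h).1 hM)
  have hfin : ∫⁻ ω, H z ω ∂ν ≠ ⊤ := by
    have h1 := lintegral_liminf_le' (μ := ν) (u := atTop) fun n => hmeas (u n)
    simp only [(hlim _).liminf_eq] at h1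
    refine ((h1.trans (liminf_le_of_le ⟨0, by simp⟩ fun c hc => ?_)).trans_lt
      (ENNReal.ofReal_lt_top (r := M * ν.real univ))).ne
    obtain ⟨n, hn⟩ := hc.exists
    exact hn.trans (hbound n)
  have hne : ∀ᵐ ω ∂ν, a ω * b ω = 0 ∨ den (a ω) (b ω) z ≠ 0 := by
    filter_upwards [ae_lt_top' (hmeas z) hfin] with ω h1
    by_contra! h2
    have h3 : ENNReal.ofReal |a ω * b ω| ≠ 0 := by simpa using h2.1
    simp only [hH, h2.2, ENNReal.ofReal_zero, ENNReal.inv_zero, ENNReal.mul_top h3, lt_irrefl] at h1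
  refine ⟨hne, h.aestronglyMeasurable_slope z, ?_⟩
  rw [hasFiniteIntegral_iff_enorm]
  refine lt_of_eq_of_lt (lintegral_congr_ae ?_) (lt_top_iff_ne_top.2 hfin)
  filter_upwards [hne] with ω h1
  rw [hHeq _ _ h1, Real.enorm_eq_ofReal_abs, abs_div, abs_of_nonneg (den_nonneg _ _ _)]

theorem den_swap (a b : ℝ) (hz : z ≠ 0) :
    den b (-a) (-z⁻¹) = den a b z / normSq z := by
  have h0 : normSq z ≠ 0 := normSq_eq_zero.not.2 hz
  unfold den
  rw [neg_re, inv_re, Complex.normSq_neg, Complex.normSq_inv]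
  field_simp
  ring

theorem IsCrit.swap (h : IsPencil ν a b M) (hz : IsCrit ν a b T z) (h0 : z ≠ 0) :
    IsCrit ν b (fun ω => -a ω) (ν.real univ - T) (-z⁻¹) := by
  have hn : 0 < normSq z := Complex.normSq_pos.2 h0
  obtain ⟨δ, hδ, h1⟩ := hz.apart
  refine ⟨?_, ⟨δ / normSq z, div_pos hδ hn, ?_⟩, ?_, ?_⟩
  · rw [Complex.neg_im, Complex.inv_im, neg_div, neg_neg]
    exact div_nonneg hz.im_nonneg hn.le
  · filter_upwards [h1] with ω h2
    rw [den_swap _ _ h0, mul_neg, neg_eq_zero, mul_comm (b ω)]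
    exact h2.imp_right fun h3 => div_le_div_of_nonneg_right h3 hn.le
  · have e : ∀ ω, b ω * -a ω / den (b ω) (-a ω) (-z⁻¹) =
        -normSq z * (a ω * b ω / den (a ω) (b ω) z) := fun ω => by
      rw [den_swap _ _ h0, div_div_eq_mul_div]; ring
    simp only [e, integral_const_mul, hz.slope, mul_zero]
  · have e : ∀ᵐ ω ∂ν, b ω * (b ω + -a ω * (-z⁻¹).re) / den (b ω) (-a ω) (-z⁻¹) =
        1 - a ω * (a ω + b ω * z.re) / den (a ω) (b ω) z := by
      filter_upwards [h1, h.one_le] with ω h2 h3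
      have hd : den (a ω) (b ω) z ≠ 0 := by
        rcases h2 with h2 | h2
        · rcases mul_eq_zero.1 h2 with h4 | h4
          · rw [h4] at h3 ⊢
            have : b ω ≠ 0 := by rintro h5; rw [h5] at h3; norm_num at h3
            simp [den, this, h0]
          · rw [h4] at h3 ⊢
            have : a ω ≠ 0 := by rintro h5; rw [h5] at h3; norm_num at h3
            simp [den, this]
        · exact (hδ.trans_le h2).ne'
      rw [den_swap _ _ h0, neg_re, inv_re]
      field_simp
      unfold den
      ring
    rw [integral_congr_ae e, integral_sub (integrable_const _)
      (h.integrable_value hz.apart _), hz.value]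
    simp

end

section

variable {Ω : Type*} [MeasurableSpace Ω] {ν : Measure Ω} {a b : Ω → ℝ} {M T : ℝ} {z : ℂ}

/-- Critical points in the closed upper half-plane together with `∞`. -/
def IsRoot (ν : Measure Ω) (a b : Ω → ℝ) (T : ℝ) (p : OnePoint ℂ) : Prop :=
  p.elim (IsCrit ν b (fun ω => -a ω) (ν.real univ - T) 0) (IsCrit ν a b T)

/-- At real points and at `∞`, integrability of the slope forces the linear forms to stay away
from `0`. -/
structure IsRegular (ν : Measure Ω) (a b : Ω → ℝ) : Prop where
  real : ∀ x : ℝ, (∀ᵐ ω ∂ν, a ω * b ω = 0 ∨ den (a ω) (b ω) x ≠ 0) →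
    Integrable (fun ω => a ω * b ω / den (a ω) (b ω) x) ν → IsApart ν a b x
  infty : (∀ᵐ ω ∂ν, b ω * -a ω = 0 ∨ den (b ω) (-a ω) 0 ≠ 0) →
    Integrable (fun ω => b ω * -a ω / den (b ω) (-a ω) 0) ν → IsApart ν b (fun ω => -a ω) 0

variable [IsFiniteMeasure ν]

theorem not_isRoot_infty (h : IsPencil ν a b M) (hz : IsCrit ν a b T z) :
    ¬ IsRoot ν a b T OnePoint.infty := by
  intro hi
  change IsCrit ν b (fun ω => -a ω) (ν.real univ - T) 0 at hi
  by_cases h0 : z = 0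
  · subst h0
    have h1 := hz.integral_sq h
    have h2 := hi.integral_sq h.swap
    have i1 := h.integrable_sq hz.apart
    have i2 := h.swap.integrable_sq hi.apart
    have h3 : 0 < ∫ ω, (a ω ^ 2 / den (a ω) (b ω) 0 + b ω ^ 2 / den (b ω) (-a ω) 0 - 1) ∂ν := by
      refine h.integral_pos ((i1.add i2).sub (integrable_const _)) ?_ ?_
      · filter_upwards [h.one_le] with ω h3
        by_cases ha : a ω = 0
        · have : b ω ≠ 0 := by rintro h5; rw [h5, ha] at h3; norm_num at h3
          simp [den, ha, this]
        · simp only [den, zero_re, map_zero, mul_zero, add_zero, neg_sq]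
          rw [div_self (pow_ne_zero 2 ha)]
          have : 0 ≤ b ω ^ 2 / b ω ^ 2 := by positivity
          linarith
      · refine ae_of_all _ fun ω h3 => ?_
        simp [den, left_ne_zero_of_mul h3, right_ne_zero_of_mul h3]
    have i3 : Integrable (fun ω => a ω ^ 2 / den (a ω) (b ω) 0 + b ω ^ 2 / den (b ω) (-a ω) 0) ν :=
      i1.add i2
    rw [integral_sub i3 (integrable_const _), integral_add i1 i2, h1, h2] at h3
    simp at h3
  · have := (hz.swap h h0).unique h.swap hi
    exact h0 (by simpa using this)

theorem IsRoot.unique (h : IsPencil ν a b M) {p q : OnePoint ℂ} (hp : IsRoot ν a b T p)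
    (hq : IsRoot ν a b T q) : p = q := by
  induction p using OnePoint.rec with
  | infty =>
    induction q using OnePoint.rec with
    | infty => rfl
    | coe w => exact absurd hp (not_isRoot_infty h (z := w) hq)
  | coe z =>
    induction q using OnePoint.rec with
    | infty => exact absurd hq (not_isRoot_infty h (z := z) hp)
    | coe w => exact congrArg _ (IsCrit.unique h (z := z) (w := w) hp hq)

/-- Critical points stay in a compact set. -/
theorem exists_subseq_tendsto_root (h : IsPencil ν a b M) (hreg : IsRegular ν a b)
    {p : ℕ → OnePoint ℂ} {S : ℕ → ℝ} (hp : ∀ n, IsRoot ν a b (S n) (p n))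
    (hS : Tendsto S atTop (𝓝 T)) :
    ∃ q, IsRoot ν a b T q ∧ ∃ φ : ℕ → ℕ, StrictMono φ ∧ Tendsto (p ∘ φ) atTop (𝓝 q) := by
  by_cases hfreq : ∃ᶠ n in atTop, p n = OnePoint.infty
  · obtain ⟨φ, hφ, hφp⟩ := extraction_of_frequently_atTop hfreq
    have hc : ∀ n, IsCrit ν b (fun ω => -a ω) (ν.real univ - S (φ n)) 0 := fun n => by
      have := hp (φ n)
      rwa [hφp n] at this
    refine ⟨OnePoint.infty, ?_, φ, hφ, ?_⟩
    · exact IsCrit.of_tendsto_of_isApart h.swap hc tendsto_const_nhds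
        (tendsto_const_nhds.sub (hS.comp hφ.tendsto_atTop)) (hc 0).apart
    · exact tendsto_const_nhds.congr fun n => (hφp n).symm
  obtain ⟨N, hN⟩ := eventually_atTop.1 (not_frequently.1 hfreq)
  have hz : ∀ n, ∃ z : ℂ, (z : OnePoint ℂ) = p (n + N) := fun n =>
    OnePoint.ne_infty_iff_exists.1 (hN _ (Nat.le_add_left _ _))
  choose z hz using hz
  have hcz : ∀ n, IsCrit ν a b (S (n + N)) (z n) := fun n => by
    have := hp (n + N)
    rwa [← hz n] at this
  have hSN : Tendsto (fun n => S (n + N)) atTop (𝓝 T) := hS.comp (tendsto_add_atTop_nat N)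
  suffices H : ∃ q, IsRoot ν a b T q ∧ ∃ φ : ℕ → ℕ, StrictMono φ ∧
      Tendsto (fun n => (z (φ n) : OnePoint ℂ)) atTop (𝓝 q) by
    obtain ⟨q, hq, φ, hφ, hφq⟩ := H
    exact ⟨q, hq, fun n => φ n + N, hφ.add_const N, hφq.congr fun n => hz (φ n)⟩
  by_cases hb : ∃ R, ∃ᶠ n in atTop, ‖z n‖ ≤ R
  · obtain ⟨R, hR⟩ := hb
    obtain ⟨ζ, -, φ, hφ, hφζ⟩ := tendsto_subseq_of_frequently_bounded
      (Metric.isBounded_closedBall (x := (0 : ℂ)) (r := R)) (x := z)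
      (hR.mono fun n hn => by simpa using hn)
    refine ⟨ζ, ?_, φ, hφ, (OnePoint.continuous_coe.tendsto ζ).comp hφζ⟩
    have hcφ : ∀ n, IsCrit ν a b (S (φ n + N)) ((z ∘ φ) n) := fun n => hcz (φ n)
    refine IsCrit.of_tendsto_of_isApart h hcφ hφζ (hSN.comp hφ.tendsto_atTop) ?_
    by_cases him : ζ.im = 0
    · have e : ζ = (ζ.re : ℂ) := Complex.ext rfl (by simp [him])
      rw [e] at hφζ ⊢
      obtain ⟨h1, h2⟩ := IsCrit.integrable_slope_of_tendsto h hcφ hφζ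
      exact hreg.real _ h1 h2
    · exact h.isApart_of_im_ne_zero him
  · push Not at hb
    have hnorm : Tendsto (fun n => ‖z n‖) atTop atTop :=
      tendsto_atTop.2 fun R => (hb R).mono fun n hn => hn.le
    obtain ⟨N', hN'⟩ := eventually_atTop.1 (hb 0)
    have hcob : Tendsto z atTop (Bornology.cobounded ℂ) := tendsto_norm_atTop_iff_cobounded.1 hnorm
    refine ⟨OnePoint.infty, ?_, id, strictMono_id, ?_⟩
    · have hc : ∀ n, IsCrit ν b (fun ω => -a ω) (ν.real univ - S (n + N' + N)) (-(z (n + N'))⁻¹) :=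
        fun n => (hcz _).swap h (norm_pos_iff.1 (hN' _ (Nat.le_add_left _ _)))
      have hlim : Tendsto (fun n => -(z (n + N'))⁻¹) atTop (𝓝 0) := by
        have := ((tendsto_inv₀_cobounded.comp hcob).comp (tendsto_add_atTop_nat N')).neg
        simpa using this
      obtain ⟨h1, h2⟩ := IsCrit.integrable_slope_of_tendsto h.swap hc hlim
      exact IsCrit.of_tendsto_of_isApart h.swap hc hlim
        (tendsto_const_nhds.sub (hSN.comp (tendsto_add_atTop_nat N'))) (hreg.infty h1 h2)
    · refine OnePoint.tendsto_coe_infty.comp ?_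
      rwa [coclosedCompact_eq_cocompact, ← Metric.cobounded_eq_cocompact]

theorem isClosed_setOf_exists_root (h : IsPencil ν a b M) (hreg : IsRegular ν a b) :
    IsClosed {T | ∃ p, IsRoot ν a b T p} := by
  refine IsSeqClosed.isClosed fun S T hS hST => ?_
  choose p hp using hS
  obtain ⟨q, hq, -⟩ := exists_subseq_tendsto_root h hreg hp hST
  exact ⟨q, hq⟩

theorem continuousOn_root (h : IsPencil ν a b M) (hreg : IsRegular ν a b) {p : ℝ → OnePoint ℂ}
    {A : Set ℝ} (hp : ∀ T ∈ A, IsRoot ν a b T (p T)) : ContinuousOn p A := by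
  intro T hT
  refine tendsto_of_subseq_tendsto fun S hS => ?_
  obtain ⟨hS1, hS2⟩ := tendsto_nhdsWithin_iff.1 hS
  obtain ⟨N, hN⟩ := eventually_atTop.1 hS2
  obtain ⟨q, hq, φ, hφ, hφq⟩ := exists_subseq_tendsto_root h hreg
    (p := fun n => p (S (n + N))) (S := fun n => S (n + N)) (T := T)
    (fun n => hp _ (hN _ (Nat.le_add_left _ _))) (hS1.comp (tendsto_add_atTop_nat N))
  rw [hq.unique h (hp T hT)] at hφq
  exact ⟨fun n => φ n + N, hφq⟩

end

section

variable {Ω : Type*} [MeasurableSpace Ω] {ν : Measure Ω} {a b : Ω → ℝ} {M T : ℝ} {z : ℂ}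
  [IsFiniteMeasure ν]

theorem isCrit_iff_integral_eq (h : IsPencil ν a b M) (hz : 0 < z.im) :
    IsCrit ν a b T z ↔ ∫ ω, (a ω : ℂ) / (a ω + b ω * z) ∂ν = T := by
  have hap := h.isApart_of_im_ne_zero hz.ne'
  have e : ∀ᵐ ω ∂ν, (a ω : ℂ) / (a ω + b ω * z) =
      ((a ω * (a ω + b ω * z.re) / den (a ω) (b ω) z : ℝ) : ℂ) -
      ((z.im * (a ω * b ω / den (a ω) (b ω) z) : ℝ) : ℂ) * I := by
    obtain ⟨δ, hδ, h1⟩ := exists_le_den_of_im_ne_zero hz.ne'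
    filter_upwards [h.one_le] with ω h2
    exact ofReal_div_add_mul _ _ _ (hδ.trans_le (h1 _ _ h2)).ne'
  have i1 := h.integrable_value hap z.re
  have i2 := (h.integrable_slope hap).const_mul z.im
  rw [integral_congr_ae e, integral_sub i1.ofReal (i2.ofReal.mul_const _), integral_mul_const,
    integral_complex_ofReal, integral_complex_ofReal, integral_const_mul, Complex.ext_iff]
  simp only [sub_re, ofReal_re, mul_re, I_re, mul_zero,
    ofReal_im, I_im, mul_one, sub_self, sub_zero, sub_im, mul_im,
    add_zero, zero_sub, neg_eq_zero, mul_eq_zero]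
  exact ⟨fun h1 => ⟨h1.value, Or.inr h1.slope⟩,
    fun h1 => ⟨hz.le, hap, h1.2.resolve_left hz.ne', h1.1⟩⟩

theorem IsPencil.differentiableAt_integral (h : IsPencil ν a b M) (hz : 0 < z.im) :
    DifferentiableAt ℂ (fun w => ∫ ω, (a ω : ℂ) / (a ω + b ω * w) ∂ν) z := by
  obtain ⟨δ, hδ, h1⟩ := exists_le_den_of_im_ne_zero hz.ne'
  have hmA : AEMeasurable (fun ω => (a ω : ℂ)) ν := h.measA.aemeasurable.complex_ofReal
  have hmB : AEMeasurable (fun ω => (b ω : ℂ)) ν := h.measB.aemeasurable.complex_ofReal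
  have hsq : ∀ (a b : ℝ) (w : ℂ), ‖(a : ℂ) + b * w‖ ^ 2 = den a b w := by
    intro a b w
    rw [sq_norm, den_eq, normSq_apply]
    simp [sq]
  have hd : ∀ᵐ ω ∂ν, ∀ w ∈ {w | ∀ a b : ℝ, |a| ≤ M → |b| ≤ M → δ ≤ den a b z → δ / 2 ≤ den a b w},
      δ / 2 ≤ den (a ω) (b ω) w := by
    filter_upwards [h.one_le, h.boundA, h.boundB] with ω h2 h3 h4 w hw
    exact hw _ _ h3 h4 (h1 _ _ h2)
  have hne : ∀ (a b : ℝ) (w : ℂ), δ / 2 ≤ den a b w → (a : ℂ) + b * w ≠ 0 := by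
    intro a b w h2 h3
    rw [← hsq, h3] at h2
    norm_num at h2
    linarith
  refine (hasDerivAt_integral_of_dominated_loc_of_deriv_le (bound := fun _ => M * M / (δ / 2))
    (F := fun w ω => (a ω : ℂ) / (a ω + b ω * w))
    (F' := fun w ω => -((a ω : ℂ) * b ω) / (a ω + b ω * w) ^ 2)
    (eventually_half_le_den M hδ z) (Eventually.of_forall fun w => ?_) ?_ ?_ ?_
    (integrable_const _) ?_).2.differentiableAt
  · exact (hmA.div (hmA.add (hmB.mul_const w))).aestronglyMeasurable
  · refine Integrable.of_bound (hmA.div (hmA.add (hmB.mul_const z))).aestronglyMeasurable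
      (M / sqrt δ) ?_
    filter_upwards [h.one_le, h.boundA] with ω h2 h3
    have hM : 0 ≤ M := (abs_nonneg _).trans h3
    rw [norm_div, norm_real, norm_eq_abs]
    have hδ' : 0 < sqrt δ := sqrt_pos.2 hδ
    gcongr
    refine Real.sqrt_le_iff.2 ⟨norm_nonneg _, ?_⟩
    exact (h1 _ _ h2).trans_eq (hsq _ _ _).symm
  · exact ((hmA.mul hmB).neg.div ((hmA.add (hmB.mul_const z)).pow_const 2)).aestronglyMeasurable
  · filter_upwards [hd, h.boundA, h.boundB] with ω h2 h3 h4 w hw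
    rw [norm_div, norm_neg, norm_pow, hsq, norm_mul, norm_real, norm_real]
    have := abs_slope_le h3 h4 (half_pos hδ) (Or.inr (h2 w hw))
    rwa [abs_div, abs_mul, abs_of_nonneg (den_nonneg _ _ _)] at this
  · filter_upwards [hd] with ω h2 w hw
    have h3 := hne _ _ _ (h2 w hw)
    have h4 : HasDerivAt (fun w : ℂ => (a ω : ℂ) + b ω * w) (b ω) w := by
      simpa using ((hasDerivAt_id w).const_mul (b ω : ℂ)).const_add (a ω : ℂ)
    exact ((hasDerivAt_const w (a ω : ℂ)).fun_div h4 h3).congr_deriv (by simp)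

theorem isOpen_setOf_exists_crit (h : IsPencil ν a b M) :
    IsOpen {T | ∃ z : ℂ, 0 < z.im ∧ IsCrit ν a b T z} := by
  rw [isOpen_iff_mem_nhds]
  rintro T ⟨z, hz, hc⟩
  set G : ℂ → ℂ := fun w => ∫ ω, (a ω : ℂ) / (a ω + b ω * w) ∂ν with hG
  have hopen : IsOpen {w : ℂ | 0 < w.im} := isOpen_lt continuous_const continuous_im
  have hGz : G z = T := (isCrit_iff_integral_eq h hz).1 hc
  have han : AnalyticAt ℂ G z := by
    refine DifferentiableOn.analyticAt (s := {w : ℂ | 0 < w.im}) (fun w hw => ?_)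
      (hopen.mem_nhds hz)
    exact (h.differentiableAt_integral hw).differentiableWithinAt
  rcases han.eventually_constant_or_nhds_le_map_nhds with h1 | h1
  · exfalso
    have h2 : ∀ᶠ w in 𝓝 z, w = z := by
      filter_upwards [h1, hopen.mem_nhds hz] with w hw hw'
      exact ((isCrit_iff_integral_eq h hw').2 (hw.trans hGz)).unique h hc
    have h3 : ({z} : Set ℂ) ∈ 𝓝 z := h2
    rw [← mem_interior_iff_mem_nhds, interior_singleton] at h3
    exact h3
  · rw [hGz] at h1
    have h2 : G '' {w : ℂ | 0 < w.im} ∈ 𝓝 (T : ℂ) := h1 (image_mem_map (hopen.mem_nhds hz))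
    filter_upwards [continuous_ofReal.continuousAt.preimage_mem_nhds h2] with S hS
    obtain ⟨w, hw, hwS⟩ := hS
    exact ⟨w, hw, (isCrit_iff_integral_eq h hw).2 hwS⟩

end

section

/-- A `C¹` function with integrable reciprocal has no isolated zeros. -/
theorem eq_zero_or_ne_zero_of_integrableOn_inv {φ : ℝ → ℝ} {p q : ℝ}
    (hφ : ContDiffOn ℝ 1 φ (Icc p q)) (hi : IntegrableOn (fun s => (φ s)⁻¹) (Icc p q)) :
    (∀ s ∈ Icc p q, φ s = 0) ∨ ∀ s ∈ Icc p q, φ s ≠ 0 := by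
  by_contra! hcon
  obtain ⟨⟨v, hv, hv0⟩, ⟨s, hs, hs0⟩⟩ := hcon
  obtain ⟨K, hK⟩ := hφ.exists_lipschitzOnWith one_ne_zero (convex_Icc p q) isCompact_Icc
  have hZ : IsCompact (Icc p q ∩ φ ⁻¹' {0}) := isCompact_Icc.of_isClosed_subset
    (hφ.continuousOn.preimage_isClosed_of_isClosed isClosed_Icc isClosed_singleton) inter_subset_left
  obtain ⟨u, hu, hmin⟩ := hZ.exists_infDist_eq_dist ⟨s, hs, hs0⟩ v
  have hu0 : φ u = 0 := hu.2
  have huv : u ≠ v := by rintro rfl; exact hv0 hu0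
  have hsub : uIcc u v ⊆ Icc p q := uIcc_subset_Icc hu.1 hv
  have hne : ∀ x ∈ uIcc u v, x ≠ u → φ x ≠ 0 := by
    intro x hx hxu h0
    have h1 : dist v u ≤ dist v x := hmin ▸ Metric.infDist_le_dist_of_mem ⟨hsub hx, h0⟩
    rw [dist_eq, dist_eq] at h1
    rcases le_total u v with h2 | h2
    · rw [uIcc_of_le h2] at hx
      rw [abs_of_nonneg (by linarith), abs_of_nonneg (by linarith [hx.2])] at h1
      exact hxu (le_antisymm (by linarith) hx.1)
    · rw [uIcc_of_ge h2] at hx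
      rw [abs_of_nonpos (by linarith), abs_of_nonpos (by linarith [hx.1])] at h1
      exact hxu (le_antisymm hx.2 (by linarith))
  have h1 : IntervalIntegrable (fun x => (x - u)⁻¹) volume u v := by
    have h2 : IntervalIntegrable (fun x => (K : ℝ) * ‖(φ x)⁻¹‖) volume u v :=
      (((intervalIntegrable_iff' (by simp)).2 (hi.mono_set hsub)).norm).const_mul _
    refine h2.mono_fun' (by fun_prop) ?_
    filter_upwards [ae_restrict_mem measurableSet_uIoc] with x hx
    have hx' := uIoc_subset_uIcc hx
    rcases eq_or_ne x u with rfl | hxu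
    · simp only [sub_self, inv_zero, norm_zero]; positivity
    · have h3 := hK.dist_le_mul x (hsub hx') u hu.1
      rw [hu0, dist_eq, dist_eq, sub_zero] at h3
      have h4 : 0 < |φ x| := abs_pos.2 (hne x hx' hxu)
      have h5 : 0 < |x - u| := abs_pos.2 (sub_ne_zero.2 hxu)
      rw [norm_inv, norm_inv, norm_eq_abs, norm_eq_abs, ← div_eq_mul_inv,
        inv_eq_one_div, div_le_div_iff₀ h5 h4]
      linarith
  rw [intervalIntegrable_sub_inv_iff] at h1
  rcases h1 with h1 | h1
  · exact huv h1
  · exact h1 left_mem_uIcc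

namespace PiecewiseC1

variable {f : ℝ → ℝ}

theorem affine (hf : PiecewiseC1 f) (p q : ℝ) : PiecewiseC1 fun s => p + q * f s := by
  obtain ⟨N, s, hs, h0, h1, hφ⟩ := hf
  refine ⟨N, s, hs, h0, h1, fun i => ?_⟩
  obtain ⟨φ, hφC, hφE⟩ := hφ i
  exact ⟨fun s => p + q * φ s, contDiffOn_const.add (contDiffOn_const.mul hφC),
    fun x hx => by simp only [hφE hx]⟩

/-- If the reciprocal of a piecewise `C¹` function is integrable, then the function vanishes
on an interval or is bounded away from `0`, up to finitely many points. -/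
theorem eq_zero_or_le_abs (hf : PiecewiseC1 f)
    (hi : IntegrableOn (fun s => (f s)⁻¹) (Icc 0 1)) :
    ∃ (E : Finset ℝ) (δ : ℝ), 0 < δ ∧ ∀ u ∈ Icc (0 : ℝ) 1, u ∉ E →
      (f u = 0 ∧ ∃ p q : ℝ, p < q ∧ Ioo p q ⊆ Icc 0 1 ∧ ∀ x ∈ Ioo p q, f x = 0) ∨ δ ≤ |f u| := by
  obtain ⟨N, s, hs, h0, h1, hφ⟩ := hf
  choose φ hφC hφE using hφ
  classical
  have hsub : ∀ i : Fin N, Icc (s i.castSucc) (s i.succ) ⊆ Icc 0 1 := fun i =>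
    Icc_subset_Icc (h0 ▸ hs.monotone (Fin.zero_le _)) (h1 ▸ hs.monotone (Fin.le_last _))
  have key : ∀ i, ∃ δ > 0, (∀ x ∈ Icc (s i.castSucc) (s i.succ), φ i x = 0) ∨
      ∀ x ∈ Icc (s i.castSucc) (s i.succ), δ ≤ |φ i x| := by
    intro i
    have h2 : IntegrableOn (fun s => (φ i s)⁻¹) (Icc (s i.castSucc) (s i.succ)) := by
      rw [integrableOn_Icc_iff_integrableOn_Ioo]
      refine ((hi.mono_set (hsub i)).mono_set Ioo_subset_Icc_self).congr_fun
        (fun x hx => ?_) measurableSet_Ioo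
      simp only [hφE i hx]
    rcases eq_zero_or_ne_zero_of_integrableOn_inv (hφC i) h2 with h3 | h3
    · exact ⟨1, one_pos, Or.inl h3⟩
    · obtain ⟨x₀, hx₀, hmin⟩ := isCompact_Icc.exists_isMinOn
        (nonempty_Icc.2 (hs.monotone (Fin.castSucc_le_succ i))) (hφC i).continuousOn.abs
      exact ⟨|φ i x₀|, abs_pos.2 (h3 x₀ hx₀), Or.inr fun x hx => hmin hx⟩
  choose δ hδ hkey using key
  have : Nonempty (Fin N) := by
    rcases N with _ | N
    · exact absurd (h0.symm.trans h1) zero_ne_one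
    · exact ⟨0⟩
  obtain ⟨i₀, hle⟩ := Finite.exists_min δ
  refine ⟨Finset.univ.image s, δ i₀, hδ i₀, fun u hu huE => ?_⟩
  rcases mem_partition_or_exists_mem_Ioo h0 h1 hu with ⟨i, rfl⟩ | ⟨i, hui⟩
  · exact absurd (Finset.mem_image_of_mem _ (Finset.mem_univ i)) huE
  · rcases hkey i with h2 | h2
    · refine Or.inl ⟨by rw [hφE i hui, h2 u (Ioo_subset_Icc_self hui)], _, _,
        hs Fin.castSucc_lt_succ, Ioo_subset_Icc_self.trans (hsub i), fun x hx => ?_⟩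
      rw [hφE i hx, h2 x (Ioo_subset_Icc_self hx)]
    · refine Or.inr ?_
      rw [hφE i hui]
      exact (hle i).trans (h2 u (Ioo_subset_Icc_self hui))

theorem le_abs_of_ae_ne (hf : PiecewiseC1 f) (hi : IntegrableOn (fun s => (f s)⁻¹) (Icc 0 1))
    (hne : ∀ᵐ s ∂volume.restrict (Icc (0 : ℝ) 1), f s ≠ 0) :
    ∃ (E : Finset ℝ) (δ : ℝ), 0 < δ ∧ ∀ u ∈ Icc (0 : ℝ) 1, u ∉ E → δ ≤ |f u| := by
  obtain ⟨E, δ, hδ, h⟩ := hf.eq_zero_or_le_abs hi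
  refine ⟨E, δ, hδ, fun u hu huE => (h u hu huE).resolve_left ?_⟩
  rintro ⟨-, p, q, hpq, hsub, h0⟩
  have h1 : ∀ᵐ s ∂volume.restrict (Ioo p q), False := by
    filter_upwards [ae_restrict_of_ae_restrict_of_subset hsub hne, ae_restrict_mem measurableSet_Ioo]
      with s h2 h3
    exact h2 (h0 s h3)
  rw [eventually_false_iff_eq_bot, ae_eq_bot, Measure.restrict_eq_zero, Real.volume_Ioo,
    ENNReal.ofReal_eq_zero] at h1
  linarith

end PiecewiseC1

theorem ae_of_forall_notMem {E : Finset ℝ} {P : ℝ → Prop}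
    (h : ∀ u ∈ Icc (0 : ℝ) 1, u ∉ E → P u) : ∀ᵐ u ∂volume.restrict (Icc (0 : ℝ) 1), P u := by
  filter_upwards [ae_restrict_mem measurableSet_Icc,
    ae_restrict_of_ae (E.finite_toSet.countable.ae_notMem volume)] with u h1 h2
  exact h u h1 h2

variable {f g : ℝ → ℝ} {w : ℝ}

/-- If `f / (1 - f w)²` is integrable, then `1 - f w` is bounded away from `0`. -/
theorem exists_le_abs_one_sub (hf : PiecewiseC1 f) (hne : ∀ᵐ s ∂volume.restrict (Icc (0 : ℝ) 1), 1 - f s * w ≠ 0)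
    (hi : IntegrableOn (fun s => f s / (1 - f s * w) ^ 2) (Icc 0 1)) :
    ∃ (E : Finset ℝ) (δ : ℝ), 0 < δ ∧ ∀ s ∈ Icc (0 : ℝ) 1, s ∉ E → δ ≤ |1 - f s * w| := by
  have h1 : PiecewiseC1 fun s => 1 - f s * w := by
    convert hf.affine 1 (-w) using 2
    ring
  refine h1.le_abs_of_ae_ne ?_ hne
  refine Integrable.mono' (((integrable_const (2 : ℝ)).add (hi.norm.const_mul |w|)))
    (h1.aestronglyMeasurable.aemeasurable.inv.aestronglyMeasurable) (hne.mono fun s h2 => ?_)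
  simp only [Pi.add_apply, norm_inv, norm_div, norm_pow, norm_eq_abs]
  have h3 : 0 < |1 - f s * w| := abs_pos.2 h2
  set y := |1 - f s * w| with hy
  rw [inv_eq_one_div, mul_div_assoc', add_div' _ _ _ (by positivity), div_le_div_iff₀ h3 (by positivity)]
  have h4 : 1 ≤ y + |w| * |f s| := by
    rw [← abs_mul, mul_comm w]
    calc (1 : ℝ) = |(1 - f s * w) + f s * w| := by rw [sub_add_cancel, abs_one]
      _ ≤ _ := abs_add_le _ _
  nlinarith [mul_nonneg h3.le (sq_nonneg (y - 1)), mul_le_mul_of_nonneg_left h4 h3.le, sq_nonneg (y - 1 / 2)]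

theorem exists_le_abs_add (hg : PiecewiseC1 g) (hw : w ≠ 0)
    (hne : ∀ᵐ s ∂volume.restrict (Icc (0 : ℝ) 1), w + g s ≠ 0)
    (hi : IntegrableOn (fun s => g s / (w + g s) ^ 2) (Icc 0 1)) :
    ∃ (E : Finset ℝ) (δ : ℝ), 0 < δ ∧ ∀ s ∈ Icc (0 : ℝ) 1, s ∉ E → δ ≤ |w + g s| := by
  have h1 : PiecewiseC1 fun s => w + g s := by simpa using hg.affine w 1
  refine h1.le_abs_of_ae_ne ?_ hne
  refine Integrable.mono' (((integrable_const (2 / |w|)).add (hi.norm.const_mul 1)))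
    (h1.aestronglyMeasurable.aemeasurable.inv.aestronglyMeasurable) (hne.mono fun s h2 => ?_)
  simp only [Pi.add_apply, norm_inv, norm_div, norm_pow, norm_eq_abs, one_mul]
  have h3 : 0 < |w + g s| := abs_pos.2 h2
  have hw' : 0 < |w| := abs_pos.2 hw
  have h4 : |w| ≤ |w + g s| + |g s| := by
    calc |w| = |(w + g s) - g s| := by rw [add_sub_cancel_right]
      _ ≤ _ := abs_sub _ _
  set y := |w + g s| with hy
  have hg0 := abs_nonneg (g s)
  rcases le_total (|w| / 2) y with h5 | h5
  · have : y⁻¹ ≤ 2 / |w| := by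
      rw [inv_le_comm₀ h3 (by positivity), inv_div]
      exact h5
    have h6 : 0 ≤ |g s| / y ^ 2 := by positivity
    linarith
  · have : y⁻¹ ≤ |g s| / y ^ 2 := by
      rw [inv_eq_one_div, div_le_div_iff₀ h3 (by positivity)]
      nlinarith
    have h6 : 0 ≤ 2 / |w| := by positivity
    linarith

end

section

/-- The measure `ds` on the first copy of `[0, 1]` plus `c ds` on the second one. -/
def pencilMeasure (c : ℝ) : Measure (ℝ ⊕ ℝ) :=
  Measure.map Sum.inl (volume.restrict (Icc 0 1)) +
    ENNReal.ofReal c • Measure.map Sum.inr (volume.restrict (Icc 0 1))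

/-- The constant coefficients of the linear forms `1 - f z` and `g + z`. -/
def coeffA (g : ℝ → ℝ) : ℝ ⊕ ℝ → ℝ := Sum.elim (fun _ => 1) g

/-- The leading coefficients of the linear forms `1 - f z` and `g + z`. -/
def coeffB (f : ℝ → ℝ) : ℝ ⊕ ℝ → ℝ := Sum.elim (fun s => -f s) fun _ => 1

theorem measurableEmbedding_inl : MeasurableEmbedding (Sum.inl : ℝ → ℝ ⊕ ℝ) :=
  ⟨Sum.inl_injective, measurable_inl, fun _ hs => measurableSet_inl_image.2 hs⟩

theorem measurableEmbedding_inr : MeasurableEmbedding (Sum.inr : ℝ → ℝ ⊕ ℝ) :=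
  ⟨Sum.inr_injective, measurable_inr, fun _ hs => measurableSet_inr_image.2 hs⟩

instance (c : ℝ) : IsFiniteMeasure (pencilMeasure c) := by
  unfold pencilMeasure
  have : IsFiniteMeasure (ENNReal.ofReal c •
      Measure.map (Sum.inr : ℝ → ℝ ⊕ ℝ) (volume.restrict (Icc 0 1))) :=
    Measure.smul_finite _ ENNReal.ofReal_ne_top
  infer_instance

variable {c : ℝ} {f g : ℝ → ℝ} {t : ℝ} {z : ℂ}

theorem ae_pencilMeasure_iff (hc : 0 < c) {P : ℝ ⊕ ℝ → Prop} : (∀ᵐ ω ∂pencilMeasure c, P ω) ↔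
    (∀ᵐ s ∂volume.restrict (Icc (0 : ℝ) 1), P (Sum.inl s)) ∧
      ∀ᵐ s ∂volume.restrict (Icc (0 : ℝ) 1), P (Sum.inr s) := by
  rw [pencilMeasure, ae_add_measure_iff, Measure.ae_ennreal_smul_measure_iff
    (ENNReal.ofReal_pos.2 hc).ne', measurableEmbedding_inl.ae_map_iff,
    measurableEmbedding_inr.ae_map_iff]

theorem integrable_pencilMeasure_iff (hc : 0 < c) {F : ℝ ⊕ ℝ → ℝ} :
    Integrable F (pencilMeasure c) ↔ IntegrableOn (fun s => F (Sum.inl s)) (Icc 0 1) ∧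
      IntegrableOn (fun s => F (Sum.inr s)) (Icc 0 1) := by
  rw [pencilMeasure, integrable_add_measure, integrable_smul_measure
    (ENNReal.ofReal_pos.2 hc).ne' ENNReal.ofReal_ne_top, measurableEmbedding_inl.integrable_map_iff,
    measurableEmbedding_inr.integrable_map_iff]
  rfl

theorem integral_pencilMeasure (hc : 0 < c) {F : ℝ ⊕ ℝ → ℝ} (hF : Integrable F (pencilMeasure c)) :
    ∫ ω, F ω ∂pencilMeasure c =
      (∫ s in (0 : ℝ)..1, F (Sum.inl s)) + c * ∫ s in (0 : ℝ)..1, F (Sum.inr s) := by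
  have h := hF
  rw [pencilMeasure, integrable_add_measure] at h
  rw [pencilMeasure, integral_add_measure h.1 h.2, integral_smul_measure,
    measurableEmbedding_inl.integral_map, measurableEmbedding_inr.integral_map,
    ENNReal.toReal_ofReal hc.le, smul_eq_mul, intervalIntegral.integral_of_le zero_le_one,
    intervalIntegral.integral_of_le zero_le_one, integral_Icc_eq_integral_Ioc,
    integral_Icc_eq_integral_Ioc]

theorem pencilMeasure_real_univ (hc : 0 < c) : (pencilMeasure c).real univ = 1 + c := by
  have h := integral_pencilMeasure hc (integrable_const (μ := pencilMeasure c) (1 : ℝ))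
  simpa using h

section

variable (hf : PiecewiseC1 f) (hg : PiecewiseC1 g) (hfpos : ∀ s ∈ Icc (0 : ℝ) 1, 0 < f s)
  (hc : 0 < c)
include hf hg hfpos hc

theorem exists_isPencil (hgnonneg : ∀ s ∈ Icc (0 : ℝ) 1, 0 ≤ g s) :
    ∃ M, IsPencil (pencilMeasure c) (coeffA g) (coeffB f) M := by
  obtain ⟨-, M₁, -, hM₁⟩ := hf.exists_finset
  obtain ⟨-, M₂, -, hM₂⟩ := hg.exists_finset
  have hae : ∀ {P : ℝ ⊕ ℝ → Prop}, (∀ s ∈ Icc (0 : ℝ) 1, 0 < f s → |f s| ≤ M₁ → P (Sum.inl s)) →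
      (∀ s ∈ Icc (0 : ℝ) 1, 0 ≤ g s → |g s| ≤ M₂ → P (Sum.inr s)) →
      ∀ᵐ ω ∂pencilMeasure c, P ω := fun h1 h2 => (ae_pencilMeasure_iff hc).2
    ⟨(ae_restrict_mem measurableSet_Icc).mono fun s hs => h1 s hs (hfpos s hs) (hM₁ s hs),
      (ae_restrict_mem measurableSet_Icc).mono fun s hs => h2 s hs (hgnonneg s hs) (hM₂ s hs)⟩
  have hmeas : ∀ {u v : ℝ → ℝ}, AEStronglyMeasurable u (volume.restrict (Icc 0 1)) →
      AEStronglyMeasurable v (volume.restrict (Icc 0 1)) →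
      AEStronglyMeasurable (Sum.elim u v) (pencilMeasure c) := fun {u v} hu hv =>
    ((measurableEmbedding_inl.aestronglyMeasurable_map_iff (g := Sum.elim u v)).2 hu).add_measure
      (((measurableEmbedding_inr.aestronglyMeasurable_map_iff (g := Sum.elim u v)).2 hv).smul_measure _)
  have hM₁0 : 0 ≤ M₁ := (abs_nonneg _).trans (hM₁ 0 (by simp))
  have hM₂0 : 0 ≤ M₂ := (abs_nonneg _).trans (hM₂ 0 (by simp))
  refine ⟨1 + 2 * M₁ + 2 * M₂, hmeas aestronglyMeasurable_const hg.aestronglyMeasurable,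
    hmeas hf.aestronglyMeasurable.neg aestronglyMeasurable_const, hae ?_ ?_, hae ?_ ?_, hae ?_ ?_,
    hae ?_ ?_, hae ?_ ?_, fun h => ?_⟩
  any_goals
    intro s hs h1 h2
    simp only [coeffA, coeffB, Sum.elim_inl, Sum.elim_inr, abs_neg, abs_one, one_mul, mul_one,
      one_pow, neg_sq, neg_neg]
    rw [abs_of_nonneg (by linarith)] at h2
    try rw [abs_of_nonneg (by linarith)]
    nlinarith [sq_nonneg (f s), sq_nonneg (g s)]
  have h1 := ((ae_pencilMeasure_iff hc).1 h).1
  have h2 : ∀ᵐ s ∂volume.restrict (Icc (0 : ℝ) 1), False := by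
    filter_upwards [h1, ae_restrict_mem measurableSet_Icc] with s h2 h3
    simp only [coeffA, coeffB, Sum.elim_inl, one_mul, neg_eq_zero] at h2
    exact (hfpos s h3).ne' h2
  rw [eventually_false_iff_eq_bot, ae_eq_bot, Measure.restrict_eq_zero, volume_Icc] at h2
  simp at h2

theorem isRegular_pencil : IsRegular (pencilMeasure c) (coeffA g) (coeffB f) where
  real x h1 h2 := by
    rw [ae_pencilMeasure_iff hc] at h1
    rw [integrable_pencilMeasure_iff hc] at h2
    simp only [coeffA, coeffB, Sum.elim_inl, Sum.elim_inr, mul_one, one_mul, neg_eq_zero] at h1 h2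
    have e1 : ∀ s, den 1 (-f s) x = (1 - f s * x) ^ 2 := fun s => by rw [den_eq]; simp; ring
    have e2 : ∀ s, den (g s) 1 x = (x + g s) ^ 2 := fun s => by rw [den_eq]; simp; ring
    simp only [e1, e2] at h1 h2
    have h3 : IntegrableOn (fun s => f s / (1 - f s * x) ^ 2) (Icc 0 1) := by
      simpa [neg_div] using h2.1.neg
    obtain ⟨E, δ, hδ, hE⟩ := exists_le_abs_one_sub hf (by
      filter_upwards [h1.1, ae_restrict_mem measurableSet_Icc] with s h4 h5
      exact ne_of_apply_ne (· ^ 2) (by simpa using h4.resolve_left (hfpos s h5).ne')) h3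
    have hg' : ∃ (E : Finset ℝ) (δ : ℝ), 0 < δ ∧ ∀ s ∈ Icc (0 : ℝ) 1, s ∉ E →
        g s = 0 ∨ δ ≤ |x + g s| := by
      rcases eq_or_ne x 0 with rfl | hx
      · have h4 : IntegrableOn (fun s => (g s)⁻¹) (Icc 0 1) := by
          refine h2.2.congr_fun (fun s _ => ?_) measurableSet_Icc
          simp [sq, div_self_mul_self']
        obtain ⟨E, δ, hδ, hE⟩ := hg.eq_zero_or_le_abs h4
        exact ⟨E, δ, hδ, fun s hs hsE => (hE s hs hsE).imp And.left (by simp)⟩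
      · obtain ⟨E, δ, hδ, hE⟩ := exists_le_abs_add hg hx (by
          filter_upwards [h1.2] with s h4
          rcases h4 with h4 | h4
          · rw [h4]; simpa using hx
          · exact ne_of_apply_ne (· ^ 2) (by simpa using h4)) h2.2
        exact ⟨E, δ, hδ, fun s hs hsE => Or.inr (hE s hs hsE)⟩
    obtain ⟨E', δ', hδ', hE'⟩ := hg'
    refine ⟨min (δ ^ 2) (δ' ^ 2), lt_min (by positivity) (by positivity),
      (ae_pencilMeasure_iff hc).2 ⟨ae_of_forall_notMem (E := E) fun s hs hsE => Or.inr ?_,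
        ae_of_forall_notMem (E := E') fun s hs hsE => (hE' s hs hsE).imp (fun h => ?_) fun h => ?_⟩⟩
    · simp only [coeffA, coeffB, Sum.elim_inl, e1]
      refine (min_le_left _ _).trans ?_
      rw [← sq_abs (1 - f s * x)]
      exact pow_le_pow_left₀ hδ.le (hE s hs hsE) 2
    · simp [coeffA, h]
    · simp only [coeffA, coeffB, Sum.elim_inr, e2]
      refine (min_le_right _ _).trans ?_
      rw [← sq_abs (x + g s)]
      exact pow_le_pow_left₀ hδ'.le h 2
  infty h1 h2 := by
    rw [integrable_pencilMeasure_iff hc] at h2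
    have h3 : IntegrableOn (fun s => (f s)⁻¹) (Icc 0 1) := by
      refine h2.1.congr_fun (fun s hs => ?_) measurableSet_Icc
      have := (hfpos s hs).ne'
      simp only [coeffA, coeffB, Sum.elim_inl, den, zero_re, map_zero]
      field_simp
      ring
    obtain ⟨E, δ, hδ, hE⟩ := hf.eq_zero_or_le_abs h3
    refine ⟨min (δ ^ 2) 1, lt_min (by positivity) one_pos,
      (ae_pencilMeasure_iff hc).2 ⟨ae_of_forall_notMem (E := E) fun s hs hsE => Or.inr ?_,
        ae_of_all _ fun s => Or.inr ?_⟩⟩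
    · have h4 := (hE s hs hsE).resolve_left fun h => (hfpos s hs).ne' h.1
      simp only [coeffA, coeffB, Sum.elim_inl, den, zero_re, map_zero, mul_zero, add_zero,
        neg_sq]
      refine (min_le_left _ _).trans ?_
      rw [← sq_abs (f s)]
      exact pow_le_pow_left₀ hδ.le h4 2
    · simp [coeffA, coeffB, den]

end

end

section

variable {c : ℝ} {f g : ℝ → ℝ} {t w : ℝ} {z : ℂ}

theorem den_one_neg_ofReal (v w : ℝ) : den 1 (-v) w = (1 - v * w) ^ 2 := by
  rw [den_eq]; simp; ring

theorem den_one_right_ofReal (v w : ℝ) : den v 1 w = (w + v) ^ 2 := by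
  rw [den_eq]; simp; ring

theorem integral_congr_ae_Icc {F G : ℝ → ℝ}
    (h : ∀ᵐ s ∂volume.restrict (Icc (0 : ℝ) 1), F s = G s) :
    ∫ s in (0 : ℝ)..1, F s = ∫ s in (0 : ℝ)..1, G s := by
  rw [intervalIntegral.integral_of_le zero_le_one, intervalIntegral.integral_of_le zero_le_one]
  exact integral_congr_ae (ae_restrict_of_ae_restrict_of_subset Ioc_subset_Icc_self h)

section

variable (hf : PiecewiseC1 f) (hg : PiecewiseC1 g) (hfpos : ∀ s ∈ Icc (0 : ℝ) 1, 0 < f s)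
  (hgnonneg : ∀ s ∈ Icc (0 : ℝ) 1, 0 ≤ g s) (hc : 0 < c)
include hf hg hfpos hgnonneg hc

theorem integral_slope_pencil (hz : IsApart (pencilMeasure c) (coeffA g) (coeffB f) z) :
    ∫ ω, coeffA g ω * coeffB f ω / den (coeffA g ω) (coeffB f ω) z ∂pencilMeasure c =
      -((∫ s in (0 : ℝ)..1, f s / den 1 (-f s) z) - c * ∫ s in (0 : ℝ)..1, g s / den (g s) 1 z) := by
  obtain ⟨M, h⟩ := exists_isPencil hf hg hfpos hc hgnonneg
  rw [integral_pencilMeasure hc (h.integrable_slope hz)]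
  simp only [coeffA, coeffB, Sum.elim_inl, Sum.elim_inr, one_mul, mul_one, neg_div,
    intervalIntegral.integral_neg]
  ring

theorem isCrit_iff_criticalPointEq (hz : 0 < z.im) :
    IsCrit (pencilMeasure c) (coeffA g) (coeffB f) (1 + t) z ↔ CriticalPointEq f g c t z := by
  obtain ⟨M, h⟩ := exists_isPencil hf hg hfpos hc hgnonneg
  have hap := h.isApart_of_im_ne_zero hz.ne'
  have h1 := integral_slope_pencil hf hg hfpos hgnonneg hc hap
  have h2 := integral_pencilMeasure hc (h.integrable_value hap z.re)
  have e1 : ∀ v, den 1 (-v) z = 1 - 2 * v * z.re + v ^ 2 * normSq z := fun v => by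
    unfold den; ring
  have e2 : ∀ v, den v 1 z = v ^ 2 + 2 * v * z.re + normSq z := fun v => by
    unfold den; ring
  simp only [coeffA, coeffB, Sum.elim_inl, Sum.elim_inr, one_mul, e1, e2, neg_mul,
    ← sub_eq_add_neg] at h1 h2
  rw [criticalPointEq_iff hf hg hz.ne']
  unfold fSlope gSlope fRe gRe
  rw [← neg_eq_zero, ← h1, ← h2]
  exact ⟨fun h3 => ⟨h3.slope, h3.value⟩, fun h3 => ⟨hz.le, hap, h3.1, h3.2⟩⟩

theorem one_add_criticalValue (hw : IsApart (pencilMeasure c) (coeffA g) (coeffB f) w) :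
    ∫ ω, coeffA g ω * (coeffA g ω + coeffB f ω * (w : ℂ).re) / den (coeffA g ω) (coeffB f ω) w
      ∂pencilMeasure c = 1 + criticalValue f g c w := by
  obtain ⟨M, h⟩ := exists_isPencil hf hg hfpos hc hgnonneg
  have hi := h.integrable_value hw (w : ℂ).re
  have hi1 := ((integrable_pencilMeasure_iff hc).1 hi).1
  rw [integral_pencilMeasure hc hi]
  simp only [coeffA, coeffB, Sum.elim_inl, Sum.elim_inr, one_mul, den_one_neg_ofReal,
    den_one_right_ofReal, ofReal_re] at hi1 ⊢
  change _ = 1 + ((∫ s in (0 : ℝ)..1, f s * w / (1 - f s * w)) +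
    c * ∫ s in (0 : ℝ)..1, g s / (w + g s))
  have e1 : ∫ s in (0 : ℝ)..1, f s * w / (1 - f s * w) =
      ∫ s in (0 : ℝ)..1, ((1 + -f s * w) / (1 - f s * w) ^ 2 - 1) := by
    refine integral_congr_ae_Icc ?_
    obtain ⟨δ, hδ, hd⟩ := hw
    filter_upwards [((ae_pencilMeasure_iff hc).1 hd).1, ae_restrict_mem measurableSet_Icc]
      with s h1 h2
    simp only [coeffA, coeffB, Sum.elim_inl, one_mul, den_one_neg_ofReal, neg_eq_zero] at h1
    have h3 : 1 - f s * w ≠ 0 := ne_of_apply_ne (· ^ 2)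
      (by simpa using (hδ.trans_le (h1.resolve_left (hfpos s h2).ne')).ne')
    field_simp
    ring
  have e2 : ∀ s, g s * (g s + w) / (w + g s) ^ 2 = g s / (w + g s) := fun s => by
    by_cases h0 : w + g s = 0
    · simp [h0]
    · rw [sq, add_comm (g s) w, mul_div_mul_right _ _ h0]
  rw [e1, intervalIntegral.integral_sub
    ((intervalIntegrable_iff_integrableOn_Icc_of_le zero_le_one).2 hi1) intervalIntegrable_const]
  simp only [e2, intervalIntegral.integral_const, sub_zero, one_smul]
  ring

theorem isCrit_iff_isRealDoubleRoot :
    IsCrit (pencilMeasure c) (coeffA g) (coeffB f) (1 + t) w ↔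
      IsRealDoubleRoot f g c w ∧ criticalValue f g c w = t := by
  obtain ⟨M, h⟩ := exists_isPencil hf hg hfpos hc hgnonneg
  have hs : IsApart (pencilMeasure c) (coeffA g) (coeffB f) w → _ :=
    integral_slope_pencil hf hg hfpos hgnonneg hc (z := w)
  simp only [den_one_neg_ofReal, den_one_right_ofReal] at hs
  constructor
  · intro hw
    obtain ⟨δ, hδ, hd⟩ := hw.apart
    have hi := (integrable_pencilMeasure_iff hc).1 (h.integrable_slope hw.apart)
    have hd' := (ae_pencilMeasure_iff hc).1 hd
    simp only [coeffA, coeffB, Sum.elim_inl, Sum.elim_inr, one_mul, mul_one, den_one_neg_ofReal,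
      den_one_right_ofReal, neg_eq_zero] at hi hd'
    refine ⟨⟨?_, by simpa [neg_div] using hi.1.neg, hi.2, ?_⟩, ?_⟩
    · filter_upwards [hd'.1, hd'.2, ae_restrict_mem measurableSet_Icc] with s h1 h2 h3
      refine ⟨ne_of_apply_ne (· ^ 2)
        (by simpa using (hδ.trans_le (h1.resolve_left (hfpos s h3).ne')).ne'),
        h2.imp_right fun h4 => ne_of_apply_ne (· ^ 2) (by simpa using (hδ.trans_le h4).ne')⟩
    · rw [← neg_eq_zero, ← hs hw.apart]
      exact hw.slope
    · have := one_add_criticalValue hf hg hfpos hgnonneg hc hw.apart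
      rw [hw.value] at this
      linarith
  · rintro ⟨⟨hne, hi1, hi2, heq⟩, hval⟩
    have hap : IsApart (pencilMeasure c) (coeffA g) (coeffB f) w := by
      refine (isRegular_pencil hf hg hfpos hc).real w ((ae_pencilMeasure_iff hc).2 ⟨?_, ?_⟩)
        ((integrable_pencilMeasure_iff hc).2 ⟨?_, ?_⟩)
      · filter_upwards [hne] with s h1
        refine Or.inr ?_
        simp only [coeffA, coeffB, Sum.elim_inl, den_one_neg_ofReal]
        exact pow_ne_zero 2 h1.1
      · filter_upwards [hne] with s h1
        simp only [coeffA, coeffB, Sum.elim_inr, den_one_right_ofReal, mul_one]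
        exact h1.2.imp_right (pow_ne_zero 2)
      · simpa [coeffA, coeffB, den_one_neg_ofReal, neg_div] using hi1.neg
      · simpa [coeffA, coeffB, den_one_right_ofReal] using hi2
    refine ⟨by simp, hap, ?_, ?_⟩
    · rw [hs hap, heq, neg_zero]
    · rw [one_add_criticalValue hf hg hfpos hgnonneg hc hap, hval]

theorem isRoot_infty_iff : IsRoot (pencilMeasure c) (coeffA g) (coeffB f) (1 + t) OnePoint.infty ↔
    IsInftyDoubleRoot f g c ∧ -1 = t := by
  obtain ⟨M, h⟩ := exists_isPencil hf hg hfpos hc hgnonneg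
  change IsCrit _ _ _ _ _ ↔ _
  have hslope : ∀ ω, coeffB f ω * -coeffA g ω / den (coeffB f ω) (-coeffA g ω) 0 =
      Sum.elim (fun s => (f s)⁻¹) (fun s => -g s) ω := by
    rintro (s | s)
    · by_cases h0 : f s = 0
      · simp [coeffA, coeffB, h0]
      · simp only [coeffA, coeffB, Sum.elim_inl, den, zero_re, map_zero]
        field_simp
        ring
    · simp [coeffA, coeffB, den]
  have hvalue : ∫ ω, coeffB f ω * (coeffB f ω + -coeffA g ω * (0 : ℂ).re) /
      den (coeffB f ω) (-coeffA g ω) 0 ∂pencilMeasure c = 1 + c := by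
    rw [← pencilMeasure_real_univ hc]
    have : ∀ᵐ ω ∂pencilMeasure c, coeffB f ω * (coeffB f ω + -coeffA g ω * (0 : ℂ).re) /
        den (coeffB f ω) (-coeffA g ω) 0 = 1 := by
      refine (ae_pencilMeasure_iff hc).2 ⟨?_, ae_of_all _ fun s => by simp [coeffB, den]⟩
      filter_upwards [ae_restrict_mem measurableSet_Icc] with s hs
      have := (hfpos s hs).ne'
      simp [coeffB, den, sq, this]
    rw [integral_congr_ae this]
    simp
  have hIntegr : Integrable (Sum.elim (fun s => (f s)⁻¹) fun s => -g s) (pencilMeasure c) →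
      ∫ ω, coeffB f ω * -coeffA g ω / den (coeffB f ω) (-coeffA g ω) 0 ∂pencilMeasure c =
        (∫ s in (0 : ℝ)..1, (f s)⁻¹) - c * ∫ s in (0 : ℝ)..1, g s := by
    intro hi
    simp only [hslope]
    rw [integral_pencilMeasure hc hi]
    simp only [Sum.elim_inl, Sum.elim_inr, intervalIntegral.integral_neg]
    ring
  constructor
  · intro hw
    have hi := h.swap.integrable_slope hw.apart
    simp only [hslope] at hi
    refine ⟨⟨((integrable_pencilMeasure_iff hc).1 hi).1, ?_⟩, ?_⟩
    · rw [← hIntegr hi]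
      exact hw.slope
    · have := hw.value
      rw [hvalue, pencilMeasure_real_univ hc] at this
      linarith
  · rintro ⟨⟨hi1, heq⟩, rfl⟩
    have hi2 : IntegrableOn g (Icc 0 1) := (intervalIntegrable_iff_integrableOn_Icc_of_le
      zero_le_one).1 (hg.intervalIntegrable_comp continuous_id)
    have hi : Integrable (Sum.elim (fun s => (f s)⁻¹) fun s => -g s) (pencilMeasure c) :=
      (integrable_pencilMeasure_iff hc).2 ⟨hi1, hi2.neg⟩
    refine ⟨by simp, (isRegular_pencil hf hg hfpos hc).infty ?_ ?_, ?_, ?_⟩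
    · refine (ae_pencilMeasure_iff hc).2 ⟨?_, ae_of_all _ fun s => by simp [coeffB, den]⟩
      filter_upwards [ae_restrict_mem measurableSet_Icc] with s hs
      exact Or.inr (by simp [coeffB, den, (hfpos s hs).ne'])
    · simpa only [hslope] using hi
    · rw [hIntegr hi, heq]
    · rw [hvalue, pencilMeasure_real_univ hc]
      ring

theorem isRoot_map_iff (w : OnePoint ℝ) :
    IsRoot (pencilMeasure c) (coeffA g) (coeffB f) (1 + t) (w.map fun u : ℝ => (u : ℂ)) ↔
      IsDoubleRoot f g c w ∧ criticalValue f g c w = t := by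
  induction w using OnePoint.rec with
  | infty => exact isRoot_infty_iff hf hg hfpos hgnonneg hc
  | coe w => exact isCrit_iff_isRealDoubleRoot hf hg hfpos hgnonneg hc

end

theorem isSeparated_of_im_ne_zero (hz : z.im ≠ 0) : IsSeparated f g z := by
  refine ⟨∅, |z.im|, abs_pos.2 hz, fun s hs _ => ⟨?_, ?_⟩⟩
  all_goals
    refine le_trans ?_ (Complex.abs_im_le_norm _)
    rw [sub_im, ofReal_im, zero_sub, abs_neg]

theorem IsRealDoubleRoot.isSeparated (hf : PiecewiseC1 f) (hg : PiecewiseC1 g)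
    (hfpos : ∀ s ∈ Icc (0 : ℝ) 1, 0 < f s) (hw : IsRealDoubleRoot f g c w) (h0 : w ≠ 0) :
    IsSeparated f g (w : ℂ) := by
  obtain ⟨hne, hi1, hi2, -⟩ := hw
  obtain ⟨E, δ, hδ, hE⟩ := exists_le_abs_one_sub hf (hne.mono fun s h => h.1) hi1
  obtain ⟨E', δ', hδ', hE'⟩ := exists_le_abs_add hg h0 (hne.mono fun s h => by
    rcases h.2 with h1 | h1
    · rw [h1]; simpa using h0
    · exact h1) hi2
  obtain ⟨-, M, -, hM⟩ := hf.exists_finset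
  have hM0 : 0 < M := (abs_pos.2 (hfpos 0 (by simp)).ne').trans_le (hM 0 (by simp))
  classical
  refine ⟨E ∪ E', min (δ / M) δ', lt_min (by positivity) hδ', fun s hs hsE => ?_⟩
  rw [Finset.mem_union, not_or] at hsE
  rw [← ofReal_sub, ← ofReal_sub, norm_real, norm_real,
    norm_eq_abs, norm_eq_abs]
  have hfs := hfpos s hs
  constructor
  · refine (min_le_left _ _).trans ?_
    have e : (f s)⁻¹ - w = (1 - f s * w) / f s := by field_simp
    rw [e, abs_div]
    have h1 := hE s hs hsE.1
    have h2 := hM s hs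
    have h3 : 0 < |f s| := abs_pos.2 hfs.ne'
    gcongr
  · refine (min_le_right _ _).trans ?_
    rw [show -g s - w = -(w + g s) by ring, abs_neg]
    exact hE' s hs hsE.2

end

section

variable {c : ℝ} {f g : ℝ → ℝ} {t : ℝ} {z : ℂ}

theorem criticalPointEq_conj_iff (hf : PiecewiseC1 f) (hg : PiecewiseC1 g) (hz : z.im ≠ 0) :
    CriticalPointEq f g c t ((starRingEnd ℂ) z) ↔ CriticalPointEq f g c t z := by
  rw [criticalPointEq_iff hf hg hz, criticalPointEq_iff hf hg (by simpa using hz),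
    conj_re, Complex.normSq_conj]

theorem hasOnlyRealRoots_zero (hf : PiecewiseC1 f) (hg : PiecewiseC1 g)
    (hfpos : ∀ s ∈ Icc (0 : ℝ) 1, 0 < f s) : HasOnlyRealRoots f g 0 t := by
  intro z hz
  by_contra him
  have h1 := ((criticalPointEq_iff hf hg him).1 hz).1
  have hlt : z.re ^ 2 < normSq z := by
    rw [normSq_apply]
    nlinarith [mul_self_pos.2 him]
  rw [zero_mul, sub_zero] at h1
  refine h1.not_gt (intervalIntegral.intervalIntegral_pos_of_pos_on
    (hf.intervalIntegrable_comp (continuous_fSlope hlt)) (fun s hs => ?_) zero_lt_one)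
  exact div_pos (hfpos s (Ioo_subset_Icc_self hs)) (fDen_pos hlt _)

theorem not_isDoubleRoot_zero (hfpos : ∀ s ∈ Icc (0 : ℝ) 1, 0 < f s) (w : OnePoint ℝ) :
    ¬ IsDoubleRoot f g 0 w := by
  have key : ∀ {F : ℝ → ℝ}, IntegrableOn F (Icc 0 1) →
      (∀ᵐ s ∂volume.restrict (Icc (0 : ℝ) 1), 0 < F s) → (∫ s in (0 : ℝ)..1, F s) ≠ 0 := by
    intro F hi hpos h0
    rw [intervalIntegral.integral_of_le zero_le_one, ← integral_Icc_eq_integral_Ioc,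
      integral_eq_zero_iff_of_nonneg_ae (hpos.mono fun s h => h.le) hi] at h0
    have h2 : ∀ᵐ s ∂volume.restrict (Icc (0 : ℝ) 1), False := by
      filter_upwards [h0, hpos] with s h1 h2
      exact h2.ne' h1
    rw [eventually_false_iff_eq_bot, ae_eq_bot, Measure.restrict_eq_zero, volume_Icc] at h2
    simp at h2
  induction w using OnePoint.rec with
  | infty =>
    rintro ⟨hi, h0⟩
    rw [zero_mul, sub_zero] at h0
    refine key hi ?_ h0
    filter_upwards [ae_restrict_mem measurableSet_Icc] with s hs
    exact inv_pos.2 (hfpos s hs)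
  | coe w =>
    rintro ⟨hne, hi, -, h0⟩
    rw [zero_mul, sub_zero] at h0
    refine key hi ?_ h0
    filter_upwards [ae_restrict_mem measurableSet_Icc, hne] with s hs h1
    exact div_pos (hfpos s hs) (by have := h1.1; positivity)

section

variable (hf : PiecewiseC1 f) (hg : PiecewiseC1 g) (hfpos : ∀ s ∈ Icc (0 : ℝ) 1, 0 < f s)
  (hgnonneg : ∀ s ∈ Icc (0 : ℝ) 1, 0 ≤ g s) (hc : 0 < c)
include hf hg hfpos hgnonneg hc

/-- A root of the critical point equation lies in the open upper half-plane, or it is a double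
root in `ℝ ⊔ {∞}`. -/
theorem IsRoot.im_pos_or_isDoubleRoot {p : OnePoint ℂ}
    (hp : IsRoot (pencilMeasure c) (coeffA g) (coeffB f) (1 + t) p) :
    (∃ z : ℂ, p = z ∧ 0 < z.im ∧ IsCrit (pencilMeasure c) (coeffA g) (coeffB f) (1 + t) z) ∨
      ∃ w : OnePoint ℝ, p = w.map (fun u : ℝ => (u : ℂ)) ∧ IsDoubleRoot f g c w ∧
        criticalValue f g c w = t := by
  induction p using OnePoint.rec with
  | infty =>
    exact Or.inr ⟨OnePoint.infty, rfl, (isRoot_map_iff hf hg hfpos hgnonneg hc OnePoint.infty).1 hp⟩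
  | coe z =>
    have hz : IsCrit (pencilMeasure c) (coeffA g) (coeffB f) (1 + t) z := hp
    rcases hz.im_nonneg.eq_or_lt with h | h
    · have e : z = (z.re : ℂ) := Complex.ext rfl (by simp [← h])
      have e' : (z : OnePoint ℂ) = (z.re : OnePoint ℝ).map (fun u : ℝ => (u : ℂ)) :=
        congrArg OnePoint.some e
      refine Or.inr ⟨_, e', (isRoot_map_iff hf hg hfpos hgnonneg hc z.re).1 ?_⟩
      rwa [← e']
    · exact Or.inl ⟨z, rfl, h, hz⟩

theorem IsDoubleRoot.criticalValue_mem {w : OnePoint ℝ} (hw : IsDoubleRoot f g c w) :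
    criticalValue f g c w ∈ Icc (-1) c := by
  obtain ⟨M, h⟩ := exists_isPencil hf hg hfpos hc hgnonneg
  have h1 := (isRoot_map_iff hf hg hfpos hgnonneg hc w).2 ⟨hw, rfl⟩
  induction w using OnePoint.rec with
  | infty => exact ⟨le_rfl, by change (-1 : ℝ) ≤ c; linarith⟩
  | coe w =>
    have h2 : IsCrit (pencilMeasure c) (coeffA g) (coeffB f)
      (1 + criticalValue f g c (w : OnePoint ℝ)) w := h1
    have h3 := h2.pos h
    have h4 := (h2.le_measure h).1
    rw [pencilMeasure_real_univ hc] at h4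
    exact ⟨by linarith, by linarith⟩

theorem hasConjugatePair_iff : HasConjugatePair f g c t ↔
    ∃ z : ℂ, 0 < z.im ∧ IsCrit (pencilMeasure c) (coeffA g) (coeffB f) (1 + t) z := by
  obtain ⟨M, h⟩ := exists_isPencil hf hg hfpos hc hgnonneg
  have hiff : ∀ {z : ℂ}, 0 < z.im → _ := fun {z} hz =>
    isCrit_iff_criticalPointEq hf hg hfpos hgnonneg hc (t := t) hz
  constructor
  · rintro ⟨z, hz, h1⟩
    exact ⟨z, hz, (hiff hz).2 ((h1 z hz.ne').2 (Or.inl rfl))⟩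
  · rintro ⟨z, hz, h1⟩
    refine ⟨z, hz, fun w hw => ⟨fun h2 => ?_, ?_⟩⟩
    · rcases lt_or_gt_of_ne hw with h3 | h3
      · have h4 : 0 < ((starRingEnd ℂ) w).im := by simpa using h3
        right
        rw [← ((hiff h4).2 ((criticalPointEq_conj_iff hf hg hw).2 h2)).unique h h1,
          Complex.conj_conj]
      · exact Or.inl (((hiff h3).2 h2).unique h h1)
    · rintro (rfl | rfl)
      · exact (hiff hz).1 h1
      · exact (criticalPointEq_conj_iff hf hg hz.ne').2 ((hiff hz).1 h1)

theorem hasOnlyRealRoots_of_not_hasConjugatePair (h : ¬ HasConjugatePair f g c t) :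
    HasOnlyRealRoots f g c t := by
  intro z hz
  by_contra him
  rw [hasConjugatePair_iff hf hg hfpos hgnonneg hc] at h
  rcases lt_or_gt_of_ne him with h1 | h1
  · have h2 : 0 < ((starRingEnd ℂ) z).im := by simpa using h1
    exact h ⟨_, h2, (isCrit_iff_criticalPointEq hf hg hfpos hgnonneg hc h2).2
      ((criticalPointEq_conj_iff hf hg him).2 hz)⟩
  · exact h ⟨z, h1, (isCrit_iff_criticalPointEq hf hg hfpos hgnonneg hc h1).2 hz⟩

/-- On an interval that contains no critical value of a double root, the number of nonreal roots
is constant. -/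
theorem hasConjugatePair_or_hasOnlyRealRoots {α β : ℝ}
    (hαβ : ∀ w, IsDoubleRoot f g c w → criticalValue f g c w ∉ Ioo α β) :
    (∀ t ∈ Ioo α β, HasConjugatePair f g c t) ∨ ∀ t ∈ Ioo α β, HasOnlyRealRoots f g c t := by
  obtain ⟨M, h⟩ := exists_isPencil hf hg hfpos hc hgnonneg
  by_cases hne : (Ioo α β ∩ {t | HasConjugatePair f g c t}).Nonempty
  · left
    have e : {t | HasConjugatePair f g c t} = (fun t : ℝ => 1 + t) ⁻¹'
        {T | ∃ z : ℂ, 0 < z.im ∧ IsCrit (pencilMeasure c) (coeffA g) (coeffB f) T z} :=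
      Set.ext fun t => hasConjugatePair_iff hf hg hfpos hgnonneg hc
    have hopen : IsOpen {t | HasConjugatePair f g c t} := by
      rw [e]
      exact (isOpen_setOf_exists_crit h).preimage (by fun_prop)
    suffices H : Ioo α β ⊆ {t | HasConjugatePair f g c t} from fun t ht => H ht
    refine isPreconnected_Ioo.subset_of_closure_inter_subset hopen hne ?_
    rintro t ⟨ht, htI⟩
    have hcl : IsClosed ((fun t : ℝ => 1 + t) ⁻¹'
        {T | ∃ p, IsRoot (pencilMeasure c) (coeffA g) (coeffB f) T p}) :=
      (isClosed_setOf_exists_root h (isRegular_pencil hf hg hfpos hc)).preimage (by fun_prop)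
    have hsub : {t | HasConjugatePair f g c t} ⊆ (fun t : ℝ => 1 + t) ⁻¹'
        {T | ∃ p, IsRoot (pencilMeasure c) (coeffA g) (coeffB f) T p} := by
      intro t ht
      obtain ⟨z, -, hz⟩ := (hasConjugatePair_iff hf hg hfpos hgnonneg hc).1 ht
      exact ⟨(z : OnePoint ℂ), hz⟩
    obtain ⟨p, hp⟩ := closure_minimal hsub hcl ht
    rcases IsRoot.im_pos_or_isDoubleRoot hf hg hfpos hgnonneg hc hp with
      ⟨z, -, hz, hcz⟩ | ⟨w, -, hw, hwt⟩
    · exact (hasConjugatePair_iff hf hg hfpos hgnonneg hc).2 ⟨z, hz, hcz⟩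
    · exact absurd (hwt ▸ htI) (hαβ w hw)
  · right
    intro t ht
    exact hasOnlyRealRoots_of_not_hasConjugatePair hf hg hfpos hgnonneg hc fun h1 => hne ⟨t, ht, h1⟩

/-- The nonreal root extends continuously to the endpoints of a support interval. -/
theorem exists_root_extension {α β : ℝ} (hαβ : α < β)
    (hpair : ∀ t ∈ Ioo α β, HasConjugatePair f g c t) :
    ∃ z₁ : ℝ → OnePoint ℂ, ContinuousOn z₁ (Icc α β) ∧
      (∀ t ∈ Icc α β, IsRoot (pencilMeasure c) (coeffA g) (coeffB f) (1 + t) (z₁ t)) ∧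
      ∀ t ∈ Ioo α β, ∃ ζ : ℂ, z₁ t = (ζ : OnePoint ℂ) ∧ 0 < ζ.im ∧ CriticalPointEq f g c t ζ := by
  obtain ⟨M, h⟩ := exists_isPencil hf hg hfpos hc hgnonneg
  have hreg := isRegular_pencil hf hg hfpos hc
  have hcrit : ∀ t ∈ Ioo α β, ∃ z : ℂ, 0 < z.im ∧
      IsCrit (pencilMeasure c) (coeffA g) (coeffB f) (1 + t) z := fun t ht =>
    (hasConjugatePair_iff hf hg hfpos hgnonneg hc).1 (hpair t ht)
  have hex : ∀ t ∈ Icc α β, ∃ p, IsRoot (pencilMeasure c) (coeffA g) (coeffB f) (1 + t) p := by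
    have hcl : IsClosed ((fun t : ℝ => 1 + t) ⁻¹'
        {T | ∃ p, IsRoot (pencilMeasure c) (coeffA g) (coeffB f) T p}) :=
      (isClosed_setOf_exists_root h hreg).preimage (by fun_prop)
    rw [← closure_Ioo hαβ.ne]
    refine closure_minimal (fun t ht => ?_) hcl
    obtain ⟨z, -, hz⟩ := hcrit t ht
    exact ⟨(z : OnePoint ℂ), hz⟩
  classical
  set P : ℝ → OnePoint ℂ := fun T =>
    if hT : ∃ p, IsRoot (pencilMeasure c) (coeffA g) (coeffB f) T p then hT.choose
    else OnePoint.infty with hP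
  have hProot : ∀ T, (∃ p, IsRoot (pencilMeasure c) (coeffA g) (coeffB f) T p) →
      IsRoot (pencilMeasure c) (coeffA g) (coeffB f) T (P T) := fun T hT => by
    simp only [hP, dif_pos hT]
    exact hT.choose_spec
  refine ⟨fun t => P (1 + t), ?_, fun t ht => hProot _ (hex t ht), fun t ht => ?_⟩
  · exact (continuousOn_root h hreg
      (A := {T | ∃ p, IsRoot (pencilMeasure c) (coeffA g) (coeffB f) T p}) hProot).comp
      (by fun_prop) hex
  · obtain ⟨z, hz, hcz⟩ := hcrit t ht
    have hr : IsRoot (pencilMeasure c) (coeffA g) (coeffB f) (1 + t) (z : OnePoint ℂ) := hcz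
    exact ⟨z, (hProot _ ⟨_, hr⟩).unique h hr, hz,
      (isCrit_iff_criticalPointEq hf hg hfpos hgnonneg hc hz).1 hcz⟩

/-- At `t = -1` and at `t = c` all roots are double roots in `ℝ ⊔ {∞}`. -/
theorem IsRoot.isDoubleRoot_of_extreme {p : OnePoint ℂ} (ht : t = -1 ∨ t = c)
    (hp : IsRoot (pencilMeasure c) (coeffA g) (coeffB f) (1 + t) p) :
    ∃ w : OnePoint ℝ, p = w.map (fun u : ℝ => (u : ℂ)) ∧ IsDoubleRoot f g c w ∧
      criticalValue f g c w = t := by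
  obtain ⟨M, h⟩ := exists_isPencil hf hg hfpos hc hgnonneg
  rcases IsRoot.im_pos_or_isDoubleRoot hf hg hfpos hgnonneg hc hp with ⟨z, -, hz, hcz⟩ | hw
  · exfalso
    have h1 := hcz.pos h
    have h2 := (hcz.le_measure h).2 (by rintro rfl; simp at hz)
    rw [pencilMeasure_real_univ hc] at h2
    rcases ht with rfl | rfl
    · linarith
    · linarith
  · exact hw

theorem kernelConverges_of_root_extension {α β : ℝ} (hαβ : α < β) {z₁ : ℝ → OnePoint ℂ}
    (hcont : ContinuousOn z₁ (Icc α β))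
    (hroot : ∀ t ∈ Icc α β, IsRoot (pencilMeasure c) (coeffA g) (coeffB f) (1 + t) (z₁ t))
    (hIntegr : ∀ t ∈ Ioo α β, ∃ ζ : ℂ, z₁ t = (ζ : OnePoint ℂ) ∧ 0 < ζ.im ∧ CriticalPointEq f g c t ζ)
    (ht : t ∈ Icc α β) {ζ : ℂ} (hζ : z₁ t = (ζ : OnePoint ℂ)) (h0 : ζ ≠ 0) :
    KernelConverges f g c t ζ := by
  have hcζ : IsCrit (pencilMeasure c) (coeffA g) (coeffB f) (1 + t) ζ := by
    have := hroot t ht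
    rwa [hζ] at this
  refine kernelConverges_of_approx hf hg hfpos hgnonneg hc.le h0 hcζ.im_nonneg ?_ ?_
  · intro ε hε
    have hopen : IsOpen ((↑) '' ball ζ ε : Set (OnePoint ℂ)) :=
      OnePoint.isOpenEmbedding_coe.isOpenMap _ Metric.isOpen_ball
    have h1 : ∀ᶠ t' in 𝓝[Ioo α β] t, z₁ t' ∈ ((↑) '' ball ζ ε : Set (OnePoint ℂ)) := by
      refine ((hcont t ht).mono Ioo_subset_Icc_self).eventually (hopen.mem_nhds ?_)
      rw [hζ]
      exact ⟨ζ, Metric.mem_ball_self hε, rfl⟩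
    have h2 : ∀ᶠ t' in 𝓝[Ioo α β] t, |t' - t| < ε :=
      eventually_nhdsWithin_of_eventually_nhds (Metric.ball_mem_nhds t hε)
    have : (𝓝[Ioo α β] t).NeBot := by
      rw [← mem_closure_iff_nhdsWithin_neBot, closure_Ioo hαβ.ne]
      exact ht
    obtain ⟨t', ⟨z, hz, hzt⟩, h4, h5⟩ := (h1.and (h2.and self_mem_nhdsWithin)).exists
    obtain ⟨z', hz', him, hcp⟩ := hIntegr t' h5
    have e : z = z' := OnePoint.coe_injective (hzt.trans hz')
    subst e
    exact ⟨z, t', him.ne', hcp, mem_ball_iff_norm.1 hz, h4⟩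
  · rcases hcζ.im_nonneg.eq_or_lt with h | h
    · have e : ζ = (ζ.re : ℂ) := Complex.ext rfl (by simp [← h])
      have h1 : IsRealDoubleRoot f g c ζ.re := ((isCrit_iff_isRealDoubleRoot hf hg hfpos hgnonneg hc
        (w := ζ.re) (t := t)).1 (e ▸ hcζ)).1
      rw [e]
      exact h1.isSeparated hf hg hfpos fun h2 => h0 (by rw [e, h2, Complex.ofReal_zero])
    · exact isSeparated_of_im_ne_zero h.ne'

end

end

end

end SkewHowe

theorem theorem1p2
    (f g : ℝ → ℝ) (hf : SkewHowe.PiecewiseC1 f) (hg : SkewHowe.PiecewiseC1 g)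
    (hfpos : ∀ s ∈ Set.Icc (0 : ℝ) 1, 0 < f s) (hgnonneg : ∀ s ∈ Set.Icc (0 : ℝ) 1, 0 ≤ g s)
    (c : ℝ) (hc : 0 ≤ c)
    -- the roots `z⁽¹⁾, …, z⁽ᵐ⁾`, labelled so that their critical values are in increasing order
    (m : ℕ) (zr : Fin m → OnePoint ℝ)
    (hzr : ∀ w : OnePoint ℝ, SkewHowe.IsDoubleRoot f g c w ↔ ∃ i, zr i = w)
    (hmono : Monotone fun i => SkewHowe.criticalValue f g c (zr i))
    -- the numbers `t⁽⁰⁾ = -1, t⁽¹⁾, …, t⁽ᵐ⁾, t⁽ᵐ⁺¹⁾ = c`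
    (τ : Fin (m + 2) → ℝ) (hτ0 : τ 0 = -1) (hτlast : τ (Fin.last (m + 1)) = c)
    (hτ : ∀ i : Fin m, τ i.succ.castSucc = SkewHowe.criticalValue f g c (zr i)) :
    Monotone τ ∧
    ∀ a : Fin (m + 1),
      ((∀ t ∈ Set.Ioo (τ a.castSucc) (τ a.succ), SkewHowe.HasConjugatePair f g c t) ∨
        (∀ t ∈ Set.Ioo (τ a.castSucc) (τ a.succ), SkewHowe.HasOnlyRealRoots f g c t)) ∧
      -- support intervals
      (τ a.castSucc < τ a.succ →
        (∀ t ∈ Set.Ioo (τ a.castSucc) (τ a.succ), SkewHowe.HasConjugatePair f g c t) →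
        -- the root `z₁(t)`, extended continuously to the closed interval
        ∃ z₁ : ℝ → OnePoint ℂ,
          ContinuousOn z₁ (Set.Icc (τ a.castSucc) (τ a.succ)) ∧
          (∀ t ∈ Set.Ioo (τ a.castSucc) (τ a.succ), ∃ ζ : ℂ,
            z₁ t = (ζ : OnePoint ℂ) ∧ 0 < ζ.im ∧ SkewHowe.CriticalPointEq f g c t ζ) ∧
          (∀ t : ℝ, t = τ a.castSucc ∨ t = τ a.succ → ∃ i : Fin m,
            z₁ t = (zr i).map (fun u : ℝ => (u : ℂ)) ∧
              SkewHowe.criticalValue f g c (zr i) = t) ∧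
          ∀ t ∈ Set.Icc (τ a.castSucc) (τ a.succ), ∀ ζ : ℂ,
            z₁ t = (ζ : OnePoint ℂ) → ζ ≠ 0 → SkewHowe.KernelConverges f g c t ζ) := by
  have hroot : ∀ i, SkewHowe.IsDoubleRoot f g c (zr i) := fun i => (hzr _).2 ⟨i, rfl⟩
  have hleft : ∀ a : Fin (m + 1), τ a.castSucc = -1 ∨ ∃ j : Fin m, a = j.succ ∧
      τ a.castSucc = SkewHowe.criticalValue f g c (zr j) := by
    intro a
    rcases Fin.eq_zero_or_eq_succ a with rfl | ⟨j, rfl⟩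
    · exact Or.inl hτ0
    · exact Or.inr ⟨j, rfl, hτ j⟩
  have hright : ∀ a : Fin (m + 1), τ a.succ = c ∨ ∃ j : Fin m, a = j.castSucc ∧
      τ a.succ = SkewHowe.criticalValue f g c (zr j) := by
    intro a
    rcases Fin.eq_castSucc_or_eq_last a with ⟨j, rfl⟩ | rfl
    · refine Or.inr ⟨j, rfl, ?_⟩
      rw [← Fin.castSucc_succ, hτ j]
    · exact Or.inl (by rw [Fin.succ_last, hτlast])
  have hrange : ∀ i, SkewHowe.criticalValue f g c (zr i) ∈ Set.Icc (-1) c := by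
    intro i
    rcases hc.eq_or_lt with rfl | hc
    · exact absurd (hroot i) (SkewHowe.not_isDoubleRoot_zero hfpos _)
    · exact SkewHowe.IsDoubleRoot.criticalValue_mem hf hg hfpos hgnonneg hc (hroot i)
  have hτmono : Monotone τ := by
    rw [Fin.monotone_iff_le_succ]
    intro a
    rcases hleft a with h1 | ⟨j, rfl, h1⟩ <;> rcases hright _ with h2 | ⟨j', h3, h2⟩
    · rw [h1, h2]; linarith
    · rw [h1, h2]; exact (hrange j').1
    · rw [h1, h2]; exact (hrange j).2
    · rw [h1, h2]
      refine hmono ?_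
      have := congrArg Fin.val h3
      simp only [Fin.val_succ, Fin.val_castSucc] at this
      exact Fin.le_def.2 (by omega)
  refine ⟨hτmono, fun a => ⟨?_, fun hlt hpair => ?_⟩⟩
  · rcases hc.eq_or_lt with rfl | hc
    · exact Or.inr fun t _ => SkewHowe.hasOnlyRealRoots_zero hf hg hfpos
    refine SkewHowe.hasConjugatePair_or_hasOnlyRealRoots hf hg hfpos hgnonneg hc ?_
    rintro w hw ⟨h1, h2⟩
    obtain ⟨i, rfl⟩ := (hzr w).1 hw
    rw [← hτ i] at h1 h2
    have h3 := hτmono.reflect_lt h1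
    have h4 := hτmono.reflect_lt h2
    simp only [Fin.lt_def, Fin.val_succ, Fin.val_castSucc] at h3 h4
    omega
  · rcases hc.eq_or_lt with rfl | hc
    · exfalso
      obtain ⟨t, ht⟩ := Set.nonempty_Ioo.2 hlt
      obtain ⟨z, hz, h1⟩ := hpair t ht
      exact hz.ne' (SkewHowe.hasOnlyRealRoots_zero hf hg hfpos z ((h1 z hz.ne').2 (Or.inl rfl)))
    obtain ⟨z₁, hcont, hz₁, hIntegr⟩ :=
      SkewHowe.exists_root_extension hf hg hfpos hgnonneg hc hlt hpair
    refine ⟨z₁, hcont, hIntegr, fun t ht => ?_, fun t ht ζ hζ h0 =>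
      SkewHowe.kernelConverges_of_root_extension hf hg hfpos hgnonneg hc hlt hcont hz₁ hIntegr ht hζ h0⟩
    have hmem : t ∈ Set.Icc (τ a.castSucc) (τ a.succ) := by
      rcases ht with rfl | rfl
      · exact Set.left_mem_Icc.2 hlt.le
      · exact Set.right_mem_Icc.2 hlt.le
    have hcases : (t = -1 ∨ t = c) ∨ ∃ j, SkewHowe.criticalValue f g c (zr j) = t := by
      rcases ht with rfl | rfl
      · rcases hleft a with h1 | ⟨j, -, h1⟩
        · exact Or.inl (Or.inl h1)
        · exact Or.inr ⟨j, h1.symm⟩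
      · rcases hright a with h1 | ⟨j, -, h1⟩
        · exact Or.inl (Or.inr h1)
        · exact Or.inr ⟨j, h1.symm⟩
    rcases hcases with h1 | ⟨j, h1⟩
    · obtain ⟨w, hw, hwd, hwt⟩ := SkewHowe.IsRoot.isDoubleRoot_of_extreme hf hg hfpos hgnonneg hc h1
        (hz₁ t hmem)
      obtain ⟨i, rfl⟩ := (hzr w).1 hwd
      exact ⟨i, hw, hwt⟩
    · obtain ⟨M, hM⟩ := SkewHowe.exists_isPencil hf hg hfpos hc hgnonneg
      exact ⟨j, (hz₁ t hmem).unique hM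
        ((SkewHowe.isRoot_map_iff hf hg hfpos hgnonneg hc _).2 ⟨hroot j, h1⟩), h1⟩
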